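/- All manifolds are smooth, Hausdorff, second countable and without boundary. Let $m,k\ge 0$, let $(W,\Omega)$ be a symplectic manifold of dimension $2(m+k+1)$, let $M$ be a manifold of dimension $2(m+k)+1$ and let $e:M\to W$ be a smooth embedding (a hypersurface). Let $N$ be a compact manifold of dimension $2m+1$ and $f:N\to M$ a smooth embedding (so of codimension $2k$). Let $\widetilde\omega$ be a Hamiltonian structure on $N$, i.e. a closed two-form of maximal rank (its kernel is a line at every point), for which there is a one-form $\lambda$ on $N$ with $\lambda\wedge\widetilde\omega^{m}$ nowhere zero (equivalently, $N$ is orientable). Assume that $f(N)$ has a trivial tubular neighbourhood on which the induced form splits: for some $\delta>0$, with $D^{2k}_\delta\subset\mathbb R^{2k}$ the open ball of radius $\delta$ with coordinates $(x_1,\dots,x_k,y_1,\dots,y_k)$, there is a diffeomorphism $\Psi$ of $N\times D^{2k}_\delta$ onto an open subset $U\subset M$ with $\Psi(p,0)=f(p)$ for all $p\in N$ and $$\Psi^*e^*\Omega=\widetilde\omega+\sum_{i=1}^k dx_i\wedge dy_i .$$ Then in every neighbourhood of $e$ in the strong (Whitney) $C^1$ topology there is a smooth embedding $e_1:M\to W$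 such that $(e_1\circ f)^*\Omega=\widetilde\omega$ and $e_1(f(N))$ is a normally hyperbolic invariant submanifold of the characteristic foliation of $e_1(M)$. Here, identifying $M$ with $e_1(M)$, the characteristic foliation is the foliation of $M$ tangent to the line field $\ker e_1^*\Omega$. That $f(N)$ is a normally hyperbolic invariant submanifold of it means that there is a smooth complete vector field $X$ on $M$ with values in $\ker e_1^*\Omega$, spanning $\ker e_1^*\Omega$ at every point of some neighbourhood of $f(N)$, with flow $\varphi_t$, such that $\varphi_t(f(N))\subset f(N)$ for all $t$ and there is a continuous splitting $TM|_{f(N)}=T f(N)\oplus E^+\oplus E^-$, invariant under $D\varphi_t$, with the following property: for every Riemannian metric on $M$ there are constants $\rho_0>0$, $\rho_+>\rho_0$, $\rho_->\rho_0$ and $C>0$ with - $\|D\varphi_t v\|\le Ce^{\rho_0|t|}\|v\|$ for all $t\in\mathbb R$ and $v\in T f(N)$; - $\|D\varphi_t v\|\ge C^{-1}e^{\rho_+t}\|v\|$ for all $t\ge 0$ and $v\in E^+$; - $\|D\varphi_t v\|\le Ce^{-\rho_-t}\|v\|$ for all $t\ge 0$ and $v\in E^-$. -/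

import Mathlib

open Set Filter Topology Manifold Bundle
open scoped ContDiff

/-! ### Differential forms on manifolds -/

section Forms

variable {E H : Type*} [NormedAddCommGroup E] [NormedSpace ℝ E] [TopologicalSpace H]
  {E' H' : Type*} [NormedAddCommGroup E'] [NormedSpace ℝ E'] [TopologicalSpace H']

/-- A (not necessarily continuous) differential form of degree `r` on a manifold. -/
abbrev DiffForm (I : ModelWithCorners ℝ E H) (M : Type*) [TopologicalSpace M]
    [ChartedSpace H M] (r : ℕ) : Type _ :=
  ∀ x : M, (TangentSpace I x) [⋀^Fin r]→L[ℝ] ℝ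

/-- The pullback `f^* σ`. -/
noncomputable def DiffForm.pullback (I : ModelWithCorners ℝ E H) (J : ModelWithCorners ℝ E' H')
    {M : Type*} [TopologicalSpace M] [ChartedSpace H M]
    {M' : Type*} [TopologicalSpace M'] [ChartedSpace H' M'] {r : ℕ}
    (f : M → M') (σ : DiffForm J M' r) : DiffForm I M r :=
  fun x => (σ (f x)).compContinuousLinearMap (mfderiv I J f x)

/-- The kernel of a two-form at a point: all `v` with `σ(v, ·) = 0`. -/
def DiffForm.ker {I : ModelWithCorners ℝ E H} {M : Type*} [TopologicalSpace M]
    [ChartedSpace H M] (σ : DiffForm I M 2) (x : M) : Submodule ℝ (TangentSpace I x) where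
  carrier := {v | ∀ w : TangentSpace I x, σ x ![v, w] = 0}
  zero_mem' := fun w => (σ x).map_coord_zero (m := ![0, w]) 0 rfl
  add_mem' := by
    intro a b ha hb w
    have h := (σ x).map_update_add ![a, w] 0 a b
    have h1 : ∀ c : TangentSpace I x, Function.update ![a, w] 0 c = ![c, w] := by
      intro c; ext i; fin_cases i <;> rfl
    rw [h1, h1, h1] at h
    rw [h, ha w, hb w, add_zero]
  smul_mem' := by
    intro c a ha w
    have h := (σ x).map_update_smul ![a, w] 0 c a
    have h1 : ∀ c : TangentSpace I x, Function.update ![a, w] 0 c = ![c, w] := by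
      intro c; ext i; fin_cases i <;> rfl
    rw [h1, h1] at h
    rw [h, ha w, smul_zero]

variable {M : Type*} [TopologicalSpace M] [ChartedSpace E M]

/-- The coordinate expression of a form in the chart `φ`; it is meaningful on `φ.target`. -/
noncomputable def DiffForm.inChart {r : ℕ} (σ : DiffForm 𝓘(ℝ, E) M r)
    (φ : OpenPartialHomeomorph M E) : E → E [⋀^Fin r]→L[ℝ] ℝ :=
  DiffForm.pullback 𝓘(ℝ, E) 𝓘(ℝ, E) φ.symm σ

/-- A form is smooth if it is so in every chart of the smooth structure. -/
def DiffForm.IsSmooth {r : ℕ} (σ : DiffForm 𝓘(ℝ, E) M r) : Prop :=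
  ∀ φ ∈ IsManifold.maximalAtlas 𝓘(ℝ, E) ∞ M, ContDiffOn ℝ ∞ (σ.inChart φ) φ.target

/-- `dσ = 0`. -/
def DiffForm.IsClosed {r : ℕ} (σ : DiffForm 𝓘(ℝ, E) M r) : Prop :=
  ∀ φ ∈ IsManifold.maximalAtlas 𝓘(ℝ, E) ∞ M, ∀ y ∈ φ.target, extDeriv (σ.inChart φ) y = 0

/-- A symplectic form: smooth, closed and nondegenerate. -/
structure DiffForm.IsSymplectic (Ω : DiffForm 𝓘(ℝ, E) M 2) : Prop where
  smooth : Ω.IsSmooth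
  closed : Ω.IsClosed
  nondegenerate : ∀ x, Ω.ker x = ⊥

/-- A Hamiltonian structure on an odd-dimensional manifold: a smooth closed two-form of
maximal rank, i.e. whose kernel is a line at every point. -/
structure DiffForm.IsHamiltonian (σ : DiffForm 𝓘(ℝ, E) M 2) : Prop where
  smooth : σ.IsSmooth
  closed : σ.IsClosed
  maximal_rank : ∀ x, Module.finrank ℝ (σ.ker x) = 1

/-- `σ` can be framed: there is a smooth one-form `μ` that does not vanish on the nonzero vectors
of the kernel of `σ`. In dimension `2m + 1`, for `σ` of maximal rank, this says that the form
`μ ∧ σ^m` is nowhere zero. Such a `μ` exists if and only if the manifold is orientable. -/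
def DiffForm.HasFraming (σ : DiffForm 𝓘(ℝ, E) M 2) : Prop :=
  ∃ μ : DiffForm 𝓘(ℝ, E) M 1, μ.IsSmooth ∧ ∀ x, ∀ v ∈ σ.ker x, v ≠ 0 → μ x ![v] ≠ 0

/-- The wedge product of two linear forms, `(a ∧ b)(v, w) = a v * b w - a w * b v`. -/
noncomputable def wedgeTwo (a b : E →L[ℝ] ℝ) : E [⋀^Fin 2]→L[ℝ] ℝ :=
  ContinuousMultilinearMap.alternatization
    ((ContinuousMultilinearMap.mkPiAlgebra ℝ (Fin 2) ℝ).compContinuousLinearMap ![a, b])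

theorem wedgeTwo_apply (a b : E →L[ℝ] ℝ) (v w : E) :
    wedgeTwo a b ![v, w] = a v * b w - a w * b v := by
  have h : (Finset.univ : Finset (Equiv.Perm (Fin 2))) = {1, Equiv.swap 0 1} := by decide
  rw [wedgeTwo, ContinuousMultilinearMap.alternatization_apply_apply, h,
    Finset.sum_pair (by decide)]
  simp [Fin.prod_univ_two]
  ring

/-- The two-form `∑ i, dx_i ∧ dy_i` on `ℝ^{2k}`; the coordinate `x_i` has index `Sum.inl i`
and `y_i` has index `Sum.inr i`. -/
noncomputable def stdForm (k : ℕ) :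
    DiffForm 𝓘(ℝ, EuclideanSpace ℝ (Fin k ⊕ Fin k)) (EuclideanSpace ℝ (Fin k ⊕ Fin k)) 2 :=
  fun _ => ∑ i : Fin k, wedgeTwo (E := EuclideanSpace ℝ (Fin k ⊕ Fin k))
    (EuclideanSpace.proj (Sum.inl i)) (EuclideanSpace.proj (Sum.inr i))

end Forms

/-! ### Neighbourhoods in the strong (Whitney) `C^1` topology -/

section C1

variable {E : Type*} [NormedAddCommGroup E] [NormedSpace ℝ E]
  {E' : Type*} [NormedAddCommGroup E'] [NormedSpace ℝ E']
  {M : Type*} [TopologicalSpace M] [ChartedSpace E M]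
  {W : Type*} [TopologicalSpace W] [ChartedSpace E' W]

/-- The data of a basic neighbourhood of `e : M → W` in the strong `C^1` topology: a locally
finite sequence of compact sets `K i`, each in a chart of `M` and mapped by `e` into a chart
of `W`, with tolerances `ε i`. (A locally finite family of nonempty sets in a second countable
manifold is countable, and `K i = ∅` is allowed.) -/
structure C1NhdData (e : M → W) where
  φ : ℕ → OpenPartialHomeomorph M E
  ψ : ℕ → OpenPartialHomeomorph W E'
  K : ℕ → Set M
  ε : ℕ → ℝ
  φ_mem : ∀ i, φ i ∈ IsManifold.maximalAtlas 𝓘(ℝ, E) ∞ M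
  ψ_mem : ∀ i, ψ i ∈ IsManifold.maximalAtlas 𝓘(ℝ, E') ∞ W
  isCompact_K : ∀ i, IsCompact (K i)
  locallyFinite_K : LocallyFinite K
  K_subset : ∀ i, K i ⊆ (φ i).source
  mapsTo : ∀ i, MapsTo e (K i) (ψ i).source
  ε_pos : ∀ i, 0 < ε i

/-- `g` lies in the basic neighbourhood given by `D`: on each `K i`, in the charts, values and
first derivatives of `g` and `e` differ by less than `ε i`. -/
def C1NhdData.Mem {e : M → W} (D : C1NhdData (E := E) (E' := E') e) (g : M → W) : Prop :=
  ∀ i, MapsTo g (D.K i) (D.ψ i).source ∧ ∀ x ∈ D.K i,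
    ‖D.ψ i (g x) - D.ψ i (e x)‖ < D.ε i ∧
    ‖fderiv ℝ (D.ψ i ∘ g ∘ (D.φ i).symm) (D.φ i x) -
      fderiv ℝ (D.ψ i ∘ e ∘ (D.φ i).symm) (D.φ i x)‖ < D.ε i

end C1

/-! ### Normal hyperbolicity -/

section NormallyHyperbolic

variable {E : Type*} [NormedAddCommGroup E] [NormedSpace ℝ E]
  {E' : Type*} [NormedAddCommGroup E'] [NormedSpace ℝ E']
  {M : Type*} [TopologicalSpace M] [ChartedSpace E M] [IsManifold 𝓘(ℝ, E) ∞ M]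
  {N : Type*} [TopologicalSpace N] [ChartedSpace E' N]

/-- `φ` is the global smooth flow of the vector field `X`. -/
structure IsGlobalFlow (X : ∀ x : M, TangentSpace 𝓘(ℝ, E) x) (φ : ℝ → M → M) : Prop where
  smooth : ContMDiff (𝓘(ℝ, ℝ).prod 𝓘(ℝ, E)) 𝓘(ℝ, E) ∞ (fun q : ℝ × M => φ q.1 q.2)
  map_zero : ∀ x, φ 0 x = x
  integral : ∀ x, IsMIntegralCurve (I := 𝓘(ℝ, E)) (fun t => φ t x) X

/-- A family of subspaces of the tangent spaces is a continuous subbundle of `TM` over the subset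
`S`: near every point of `S` it is spanned by a continuous linearly independent frame. -/
def IsContinuousSubbundleOn (F : ∀ x : M, Submodule ℝ (TangentSpace 𝓘(ℝ, E) x))
    (S : Set M) : Prop :=
  ∀ x₀ ∈ S, ∃ U ∈ 𝓝 x₀, ∃ (r : ℕ) (s : Fin r → ∀ x : M, TangentSpace 𝓘(ℝ, E) x),
    (∀ i, ContinuousOn (fun x => (⟨x, s i x⟩ : TangentBundle 𝓘(ℝ, E) M)) (U ∩ S)) ∧
    ∀ x ∈ U ∩ S, LinearIndependent ℝ (fun i => s i x) ∧
      Submodule.span ℝ (range fun i => s i x) = F x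

/-- The norm of a tangent vector for a Riemannian metric. -/
noncomputable def metricNorm
    (g : ContinuousRiemannianMetric E (fun x : M => TangentSpace 𝓘(ℝ, E) x))
    {x : M} (v : TangentSpace 𝓘(ℝ, E) x) : ℝ :=
  Real.sqrt (g.inner x v v)

/-- The image of the embedding `f : N → M` is a normally hyperbolic invariant submanifold of the
vector field `X` on `M` with flow `φ`. On a compact submanifold the estimates do not depend on
the Riemannian metric up to the value of `C`, and they are required here for all metrics. -/
def IsNormallyHyperbolic (X : ∀ x : M, TangentSpace 𝓘(ℝ, E) x) (f : N → M) : Prop :=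
  ∃ φ : ℝ → M → M, IsGlobalFlow X φ ∧
    (∀ t, MapsTo (φ t) (range f) (range f)) ∧
    ∃ Ep Em : ∀ x : M, Submodule ℝ (TangentSpace 𝓘(ℝ, E) x),
      IsContinuousSubbundleOn Ep (range f) ∧ IsContinuousSubbundleOn Em (range f) ∧
      -- `T_{f p} M = T_p N ⊕ E⁺ ⊕ E⁻`
      (∀ p : N, Disjoint (Ep (f p)) (Em (f p)) ∧
        IsCompl (mfderiv 𝓘(ℝ, E') 𝓘(ℝ, E) f p).range (Ep (f p) ⊔ Em (f p))) ∧
      -- invariance of the splitting; that of `TN` follows from the invariance of `N`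
      (∀ x ∈ range f, ∀ t : ℝ,
        (Ep x).map (mfderiv 𝓘(ℝ, E) 𝓘(ℝ, E) (φ t) x).toLinearMap = Ep (φ t x) ∧
        (Em x).map (mfderiv 𝓘(ℝ, E) 𝓘(ℝ, E) (φ t) x).toLinearMap = Em (φ t x)) ∧
      ∀ g : ContinuousRiemannianMetric E (fun x : M => TangentSpace 𝓘(ℝ, E) x),
        ∃ ρ₀ ρp ρm C : ℝ, 0 < ρ₀ ∧ ρ₀ < ρp ∧ ρ₀ < ρm ∧ 0 < C ∧
          (∀ p : N, ∀ t : ℝ, ∀ v ∈ (mfderiv 𝓘(ℝ, E') 𝓘(ℝ, E) f p).range,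
            metricNorm g (mfderiv 𝓘(ℝ, E) 𝓘(ℝ, E) (φ t) (f p) v) ≤
              C * Real.exp (ρ₀ * |t|) * metricNorm g (x := f p) v) ∧
          (∀ x ∈ range f, ∀ t : ℝ, 0 ≤ t → ∀ v ∈ Ep x,
            C⁻¹ * Real.exp (ρp * t) * metricNorm g v ≤
              metricNorm g (mfderiv 𝓘(ℝ, E) 𝓘(ℝ, E) (φ t) x v)) ∧
          (∀ x ∈ range f, ∀ t : ℝ, 0 ≤ t → ∀ v ∈ Em x,
            metricNorm g (mfderiv 𝓘(ℝ, E) 𝓘(ℝ, E) (φ t) x v) ≤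
              C * Real.exp (-(ρm * t)) * metricNorm g v)

/-- The image of `f` is a normally hyperbolic invariant submanifold of the characteristic foliation
of the two-form `σ`, whose tangent lines are the kernels of `σ`: it is so for some smooth complete
vector field that is tangent to the foliation and spans it on a neighbourhood of the submanifold.
(Away from the submanifold zeros are allowed, since the foliation need not be orientable.) -/
def IsNormallyHyperbolicForCharFoliation (σ : DiffForm 𝓘(ℝ, E) M 2) (f : N → M) : Prop :=
  ∃ X : ∀ x : M, TangentSpace 𝓘(ℝ, E) x,
    ContMDiff 𝓘(ℝ, E) (𝓘(ℝ, E).prod 𝓘(ℝ, E)) ∞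
      (fun x => (⟨x, X x⟩ : TangentBundle 𝓘(ℝ, E) M)) ∧
    (∀ x, X x ∈ σ.ker x) ∧
    (∃ V : Set M, IsOpen V ∧ range f ⊆ V ∧
      ∀ x ∈ V, X x ≠ 0 ∧ Submodule.span ℝ {X x} = σ.ker x) ∧
    IsNormallyHyperbolic (E' := E') X f

end NormallyHyperbolic

/-! The hypersurface is pushed along the flow `θ` of a vector field `V` on `W`, transverse to it
along `N`, for the time `h(z)`. Here `z = (x, y)` are the normal coordinates of the tube, and `h` is
supported in a small ball and equals `A ∑ x_i y_i` near `z = 0`. Since `h` and `dh` vanish at `z =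
0`, nothing changes along `N` to first order: `e₁ ∘ f = e ∘ f`, and the characteristic lines at the
points of `N` are still the kernel lines of `σ`. The linearisation of the characteristic foliation
normal to `N`, however, sees the Hessian of `h`, and a Hessian is not controlled by `C^1` size: `r²
h₁(z / r)` has the same Hessian at `0` as `h₁`, while its values are `O(r²)` and its derivative is
`O(r)`. So `A` may be prescribed in advance, however small the `C^1` neighbourhood
(`exists_small_saddle`).

The effect of the Hessian is computed in the flow-out coordinates `(u, z, t) ↦ θ_t(e(Ψ(u, z)))`,
with `u` in a chart of `N`. There `Ω` becomes a two-form `B` that is `σ + ∑ dx_i ∧ dy_i` on vectors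
tangent to the slice `t = 0`, and the perturbed hypersurface is the graph `t = h(z)`. The framing of
`σ` gives a nowhere zero kernel field on `N`, and nondegeneracy of `Ω` gives a field `V` pairing
positively with it; `R` is the kernel field of `σ` with `Ω(V, R) = 1`
(`SplitTube.exists_transverseFlow`). Let `X` be the kernel field on the graph, normalised by the
one-form `Ω(V, ·)` of `N` pulled back to the tube, and let `(D₁, D₂)` be its derivative at a point
of `N` in a normal direction `ζ`. Differentiating the equation `B(X, v + dh(v) ∂_t) = 0` gives
`σ(D₁, a') + ω(D₂, ζ') = d²h(ζ, ζ')` for all `a'`, `ζ'`, where `ω = ∑ dx_i ∧ dy_i`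
(`fderiv_kernel_field_of_graph`). Hence `D₁` lies in the kernel of `σ`; the normalisation forces it
to vanish; and `D₂` obeys the Hamiltonian equations of `A ∑ x_i y_i`, which are `x' = A x`, `y' = -A
y`.

Thus along `N` the linearised flow of `X` is that of `R` in the tangential directions and `e^{At} ⊕
e^{-At}` in the normal ones. By compactness the flow of `R` stretches by at most a constant times
`e^{ρ|t|}`, with `ρ` depending on `N` and `R` but not on `h`; the choice `A = ρ + 1` gives normal
hyperbolicity (`isNormallyHyperbolic_of_linear`). The field `X` is defined only near `N` and is cut
off to make it complete. It remains to see that small perturbations are embeddings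
(`SplitTube.exists_forall_isEmbedding_perturb`) and lie in the given neighbourhood of `e`
(`SplitTube.exists_forall_mem_perturb`). Smooth global flows of compactly supported fields come from
the inverse function theorem, applied to the integral equation on a space of curves
(`eventually_contDiffAt_of_local_flow`, `exists_isGlobalFlow_of_isCompact`). -/

set_option synthInstance.maxHeartbeats 200000
set_option linter.unusedSectionVars false

/-! ### Smooth dependence of solutions of ODEs on the initial value -/

section SmoothODE


universe u

set_option maxHeartbeats 1000000 in
/-- Pointwise application of a continuous family of linear maps to a continuous map. -/
noncomputable def ContinuousMap.clmApply (K : Type*) [TopologicalSpace K] [CompactSpace K]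
    (E F : Type*) [NormedAddCommGroup E] [NormedSpace ℝ E]
    [NormedAddCommGroup F] [NormedSpace ℝ F] :
    C(K, E →L[ℝ] F) →L[ℝ] C(K, E) →L[ℝ] C(K, F) :=
  LinearMap.mkContinuous₂
    (LinearMap.mk₂ ℝ (fun (A : C(K, E →L[ℝ] F)) (α : C(K, E)) => (⟨fun s => A s (α s), by fun_prop⟩ : C(K, F)))
      (by intros; ext; simp) (by intros; ext; simp) (by intros; ext; simp) (by intros; ext; simp))
    1 (by
      intro A α
      rw [ContinuousMap.norm_le _ (by positivity)]
      intro s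
      rw [one_mul]
      exact ((A s).le_opNorm _).trans
        (mul_le_mul (A.norm_coe_le_norm s) (α.norm_coe_le_norm s) (norm_nonneg _)
          ((norm_nonneg (A s)).trans (A.norm_coe_le_norm s))))

theorem ContinuousMap.clmApply_apply {K : Type*} [TopologicalSpace K] [CompactSpace K]
    {E F : Type*} [NormedAddCommGroup E] [NormedSpace ℝ E]
    [NormedAddCommGroup F] [NormedSpace ℝ F] (A : C(K, E →L[ℝ] F)) (α : C(K, E)) (s : K) :
    ContinuousMap.clmApply K E F A α s = A s (α s) := rfl

/-- The derivative `X'` is uniformly continuous near the compact image of `α`. So there is one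
radius `d` on which the mean value inequality bounds the remainder by `c ‖β s‖`, for all `s` at
once. -/
theorem ContinuousMap.hasFDerivAt_comp_left {K : Type*} [TopologicalSpace K] [CompactSpace K]
    {E F : Type*} [NormedAddCommGroup E] [NormedSpace ℝ E]
    [NormedAddCommGroup F] [NormedSpace ℝ F] (X : C(E, F)) (X' : C(E, E →L[ℝ] F))
    (hX : ∀ x, HasFDerivAt X (X' x) x) (α : C(K, E)) :
    HasFDerivAt (fun β : C(K, E) => X.comp β)
      (ContinuousMap.clmApply K E F (X'.comp α)) α := by
  rw [hasFDerivAt_iff_isLittleO_nhds_zero, Asymptotics.isLittleO_iff]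
  intro c hc
  have hcomp : IsCompact (range α) := isCompact_range α.continuous
  have hu := hcomp.uniformContinuousAt_of_continuousAt (f := X')
    (fun x _ => X'.continuous.continuousAt) (Metric.dist_mem_uniformity hc)
  obtain ⟨d, hd, hd'⟩ := Metric.mem_uniformity_dist.1 hu
  filter_upwards [Metric.ball_mem_nhds (0 : C(K, E)) hd] with β hβ
  rw [ContinuousMap.norm_le _ (by positivity)]
  intro s
  have hβs : ‖β s‖ ≤ ‖β‖ := β.norm_coe_le_norm s
  have hβd : ‖β‖ < d := by simpa using hβ
  have key := (convex_ball (α s) d).norm_image_sub_le_of_norm_hasFDerivWithin_le'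
    (f := X) (f' := X') (φ := X' (α s)) (C := c)
    (fun x _ => (hX x).hasFDerivWithinAt) (fun x hx => by
      have := hd' (a := α s) (b := x) (by rwa [dist_comm]) (mem_range_self s)
      rw [← dist_eq_norm, dist_comm]
      exact (mem_ofPred_eq ▸ this).le)
    (Metric.mem_ball_self hd) (y := α s + β s) (by simpa using hβs.trans_lt hβd)
  simp only [ContinuousMap.sub_apply, ContinuousMap.comp_apply, ContinuousMap.add_apply,
    ContinuousMap.clmApply_apply]
  simp only [add_sub_cancel_left] at key
  exact key.trans (mul_le_mul_of_nonneg_left hβs hc.le)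

/-- Composition with a smooth map is a smooth operation on continuous maps. -/
theorem ContinuousMap.contDiff_comp_left {K : Type u} [TopologicalSpace K] [CompactSpace K]
    {E : Type u} [NormedAddCommGroup E] [NormedSpace ℝ E] (n : ℕ) :
    ∀ {F : Type u} [NormedAddCommGroup F] [NormedSpace ℝ F] (X : C(E, F)),
      ContDiff ℝ n X → ContDiff ℝ n (fun β : C(K, E) => X.comp β) := by
  induction n with
  | zero =>
    intro F _ _ X hX
    rw [Nat.cast_zero, contDiff_zero]
    exact X.continuous_postcomp
  | succ n ih =>
    intro F _ _ X hX
    have h1 := hX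
    rw [Nat.cast_add, Nat.cast_one, contDiff_succ_iff_hasFDerivAt] at h1
    obtain ⟨D, hD, hd⟩ := h1
    rw [Nat.cast_add, Nat.cast_one, contDiff_succ_iff_hasFDerivAt]
    refine ⟨fun α => ContinuousMap.clmApply K E F ((⟨D, hD.continuous⟩ : C(E, E →L[ℝ] F)).comp α),
      ?_, fun α => ContinuousMap.hasFDerivAt_comp_left X ⟨D, hD.continuous⟩ hd α⟩
    -- The derivative is composition with `D`, which takes values in `E →L[ℝ] F`, followed by a
    -- bounded linear map. This is why the induction runs over all targets `F`.
    exact (ContinuousMap.clmApply K E F).contDiff.comp (ih ⟨D, hD.continuous⟩ hD)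

/-- The primitive vanishing at `0` of a continuous map on the unit interval. -/
noncomputable def ContinuousMap.primitive (E : Type*) [NormedAddCommGroup E] [NormedSpace ℝ E]
    [CompleteSpace E] : C(unitInterval, E) →L[ℝ] C(unitInterval, E) :=
  LinearMap.mkContinuous
    { toFun := fun α => ⟨fun τ => ∫ s in (0 : ℝ)..τ, α (projIcc 0 1 zero_le_one s), by
        have h : Continuous fun s : ℝ => α (projIcc 0 1 zero_le_one s) :=
          α.continuous.comp continuous_projIcc
        exact (intervalIntegral.continuous_primitive
          (fun a b => h.intervalIntegrable a b) 0).comp continuous_subtype_val⟩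
      map_add' := by
        intro α β
        ext τ
        exact intervalIntegral.integral_add
          ((α.continuous.comp continuous_projIcc).intervalIntegrable _ _)
          ((β.continuous.comp continuous_projIcc).intervalIntegrable _ _)
      map_smul' := by
        intro c α
        ext τ
        exact intervalIntegral.integral_smul _ _ } 1 (by
      intro α
      rw [ContinuousMap.norm_le _ (by positivity)]
      intro τ
      have := intervalIntegral.norm_integral_le_of_norm_le_const (a := (0 : ℝ)) (b := (τ : ℝ))
        (f := fun s => α (projIcc 0 1 zero_le_one s)) (C := ‖α‖)
        (fun s _ => α.norm_coe_le_norm _)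
      refine this.trans ?_
      rw [sub_zero, abs_of_nonneg τ.2.1, one_mul]
      exact mul_le_of_le_one_right (norm_nonneg _) τ.2.2)

theorem ContinuousMap.primitive_apply {E : Type*} [NormedAddCommGroup E] [NormedSpace ℝ E]
    [CompleteSpace E] (α : C(unitInterval, E)) (τ : unitInterval) :
    ContinuousMap.primitive E α τ = ∫ s in (0 : ℝ)..τ, α (projIcc 0 1 zero_le_one s) := rfl

/-- The space of continuous curves on the unit interval. -/
abbrev UnitCurve (E : Type*) [TopologicalSpace E] : Type _ := C(unitInterval, E)

variable {E : Type} [NormedAddCommGroup E] [NormedSpace ℝ E] [CompleteSpace E]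

/-- A local flow of a smooth vector field, continuous in all variables, is smooth for small times. -/
theorem eventually_contDiffAt_of_local_flow {X : E → E} (hX : ContDiff ℝ ∞ X) {Φ : E × ℝ → E}
    {x₀ : E} {r ε : ℝ} (hr : 0 < r) (hε : 0 < ε)
    (h0 : ∀ x ∈ Metric.ball x₀ r, Φ (x, 0) = x)
    (hd : ∀ x ∈ Metric.ball x₀ r, ∀ t ∈ Ioo (-ε) ε,
      HasDerivAt (fun t => Φ (x, t)) (X (Φ (x, t))) t)
    (hc : ContinuousOn Φ (Metric.ball x₀ r ×ˢ Ioo (-ε) ε)) :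
    ∀ᶠ q in 𝓝 ((x₀, 0) : E × ℝ), ContDiffAt ℝ ∞ Φ q := by
  let Xc : C(E, E) := ⟨X, hX.continuous⟩
  let cst : E →L[ℝ] (UnitCurve E) := ContinuousLinearMap.const ℝ unitInterval
  let N : (UnitCurve E) → (UnitCurve E) := fun α => Xc.comp α
  have hN : ContDiff ℝ ∞ N := contDiff_infty.2 fun n =>
    ContinuousMap.contDiff_comp_left n Xc (contDiff_infty.1 hX n)
  -- With time rescaled to the unit interval, the trajectory `τ ↦ Φ (x, t τ)` is a solution `α` of
  -- `α = x + t ∫ X(α)`. Carrying `x` and `t` along as components turns this implicit equation into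
  -- one for an invertible map.
  let 𝒢 : E × ℝ × (UnitCurve E) → E × ℝ × (UnitCurve E) := fun p =>
    (p.1, p.2.1, p.2.2 - cst p.1 - p.2.1 • ContinuousMap.primitive E (N p.2.2))
  have h𝒢 : ContDiff ℝ ∞ 𝒢 := by fun_prop
  let p₀ : E × ℝ × (UnitCurve E) := (x₀, 0, cst x₀)
  let c₀ : (UnitCurve E) := ContinuousMap.primitive E (N (cst x₀))
  -- At `p₀` the factor `t` is zero, so the integral term contributes only `t • c₀` to the
  -- derivative. The derivative is therefore triangular and its inverse is explicit.
  let T : (E × ℝ × (UnitCurve E)) ≃L[ℝ] (E × ℝ × (UnitCurve E)) := ContinuousLinearEquiv.equivOfInverse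
    ((ContinuousLinearMap.fst ℝ E (ℝ × (UnitCurve E))).prod
      (((ContinuousLinearMap.fst ℝ ℝ (UnitCurve E)).comp (ContinuousLinearMap.snd ℝ E (ℝ × (UnitCurve E)))).prod
      ((ContinuousLinearMap.snd ℝ ℝ (UnitCurve E)).comp (ContinuousLinearMap.snd ℝ E (ℝ × (UnitCurve E)))
        - cst.comp (ContinuousLinearMap.fst ℝ E (ℝ × (UnitCurve E)))
        - (((ContinuousLinearMap.fst ℝ ℝ (UnitCurve E)).comp
            (ContinuousLinearMap.snd ℝ E (ℝ × (UnitCurve E)))).smulRight c₀))))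
    ((ContinuousLinearMap.fst ℝ E (ℝ × (UnitCurve E))).prod
      (((ContinuousLinearMap.fst ℝ ℝ (UnitCurve E)).comp (ContinuousLinearMap.snd ℝ E (ℝ × (UnitCurve E)))).prod
      ((ContinuousLinearMap.snd ℝ ℝ (UnitCurve E)).comp (ContinuousLinearMap.snd ℝ E (ℝ × (UnitCurve E)))
        + cst.comp (ContinuousLinearMap.fst ℝ E (ℝ × (UnitCurve E)))
        + (((ContinuousLinearMap.fst ℝ ℝ (UnitCurve E)).comp
            (ContinuousLinearMap.snd ℝ E (ℝ × (UnitCurve E)))).smulRight c₀))))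
    (by rintro ⟨x, t, α⟩; simp; abel) (by rintro ⟨x, t, α⟩; simp; abel)
  have hT : HasFDerivAt 𝒢 (T : (E × ℝ × (UnitCurve E)) →L[ℝ] (E × ℝ × (UnitCurve E))) p₀ := by
    have h1 : HasFDerivAt (fun p : E × ℝ × (UnitCurve E) => p.1) (ContinuousLinearMap.fst ℝ E (ℝ × (UnitCurve E))) p₀ :=
      hasFDerivAt_fst
    have h2 : HasFDerivAt (fun p : E × ℝ × (UnitCurve E) => p.2.1)
      ((ContinuousLinearMap.fst ℝ ℝ (UnitCurve E)).comp (ContinuousLinearMap.snd ℝ E (ℝ × (UnitCurve E)))) p₀ :=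
      ((ContinuousLinearMap.fst ℝ ℝ (UnitCurve E)).comp (ContinuousLinearMap.snd ℝ E (ℝ × (UnitCurve E)))).hasFDerivAt
    have h3 : HasFDerivAt (fun p : E × ℝ × (UnitCurve E) => p.2.2)
      ((ContinuousLinearMap.snd ℝ ℝ (UnitCurve E)).comp (ContinuousLinearMap.snd ℝ E (ℝ × (UnitCurve E)))) p₀ :=
      ((ContinuousLinearMap.snd ℝ ℝ (UnitCurve E)).comp (ContinuousLinearMap.snd ℝ E (ℝ × (UnitCurve E)))).hasFDerivAt
    have hS : DifferentiableAt ℝ (fun p : E × ℝ × (UnitCurve E) => ContinuousMap.primitive E (N p.2.2)) p₀ := by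
      have : ContDiff ℝ ∞ (fun p : E × ℝ × (UnitCurve E) => ContinuousMap.primitive E (N p.2.2)) := by fun_prop
      exact (this.differentiable (by simp)) p₀
    have h4 := h2.smul hS.hasFDerivAt
    have h5 := h1.prodMk (h2.prodMk ((h3.sub (cst.hasFDerivAt.comp p₀ h1)).sub h4))
    refine h5.congr_fderiv ?_
    refine ContinuousLinearMap.ext ?_
    rintro ⟨x, t, α⟩
    simp [T, p₀, c₀, ContinuousLinearEquiv.equivOfInverse]
  have hne : (∞ : WithTop ℕ∞) ≠ 0 := by simp
  let Θ := h𝒢.contDiffAt.toOpenPartialHomeomorph 𝒢 (n := ∞) hT hne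
  have hΘ : ∀ p, Θ p = 𝒢 p := fun p => rfl
  have hp₀ : p₀ ∈ Θ.source := h𝒢.contDiffAt.mem_toOpenPartialHomeomorph_source hT hne
  have h𝒢0 : 𝒢 p₀ = (x₀, 0, 0) := by simp [𝒢, p₀]
  -- the inverse of `𝒢` is smooth near `(x₀, 0, 0)`
  have hinv : ∀ᶠ p in 𝓝 p₀, ∃ T' : (E × ℝ × (UnitCurve E)) ≃L[ℝ] (E × ℝ × (UnitCurve E)), HasFDerivAt 𝒢
      (T' : (E × ℝ × (UnitCurve E)) →L[ℝ] (E × ℝ × (UnitCurve E))) p := by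
    have hcont : ContinuousAt (fderiv ℝ 𝒢) p₀ :=
      (h𝒢.continuous_fderiv (by simp)).continuousAt
    have := hcont.eventually (hT.fderiv ▸ ContinuousLinearEquiv.nhds T)
    filter_upwards [this] with p hp
    obtain ⟨T', hT'⟩ := hp
    exact ⟨T', hT' ▸ (h𝒢.differentiable (by simp) p).hasFDerivAt⟩
  have hsymm : ∀ᶠ y in 𝓝 ((x₀, 0, 0) : E × ℝ × (UnitCurve E)), ContDiffAt ℝ ∞ Θ.symm y := by
    have ht : ((x₀, 0, 0) : E × ℝ × (UnitCurve E)) ∈ Θ.target := by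
      rw [← h𝒢0, ← hΘ]; exact Θ.map_source hp₀
    have hc : Tendsto Θ.symm (𝓝 (x₀, 0, 0)) (𝓝 p₀) := by
      have := (Θ.continuousAt_symm (Θ.map_source hp₀)).tendsto
      rwa [Θ.left_inv hp₀, hΘ, h𝒢0] at this
    filter_upwards [hc.eventually hinv, Θ.open_target.mem_nhds ht] with y ⟨T', hT'⟩ hy
    exact Θ.contDiffAt_symm hy hT' h𝒢.contDiffAt
  -- the trajectories solve the integral equation
  have hsol : ∀ᶠ q in 𝓝 ((x₀, 0) : E × ℝ), Φ q = (Θ.symm (q.1, q.2, 0)).2.2 1 := by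
    obtain ⟨η, hη, hηs⟩ := Metric.isOpen_iff.1 Θ.open_source p₀ hp₀
    have hcat : ContinuousAt Φ (x₀, 0) := hc.continuousAt
      (prod_mem_nhds (Metric.ball_mem_nhds x₀ hr) (Ioo_mem_nhds (by linarith) hε))
    have hx₀ : Φ (x₀, 0) = x₀ := h0 _ (Metric.mem_ball_self hr)
    -- Half of `η`, because the pointwise strict inequality becomes a weak one for the supremum
    -- norm.
    obtain ⟨ρ, hρ, hρ'⟩ := Metric.continuousAt_iff.1 hcat (η / 2) (by linarith)
    rw [hx₀] at hρ'
    let m := min (min ρ η) (min r ε)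
    have hm : 0 < m := lt_min (lt_min hρ hη) (lt_min hr hε)
    filter_upwards [Metric.ball_mem_nhds ((x₀, 0) : E × ℝ) hm] with ⟨x, t⟩ hq
    rw [Metric.mem_ball, Prod.dist_eq, max_lt_iff] at hq
    obtain ⟨hx, ht⟩ := hq
    simp only [m, lt_min_iff, dist_zero_right, Real.norm_eq_abs] at hx ht
    have hxr : x ∈ Metric.ball x₀ r := hx.2.1
    have hts : ∀ s ∈ Icc (0 : ℝ) 1, |t * s| ≤ |t| := fun s hs => by
      rw [abs_mul, abs_of_nonneg hs.1]
      exact mul_le_of_le_one_right (abs_nonneg _) hs.2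
    have hte : ∀ s ∈ Icc (0 : ℝ) 1, t * s ∈ Ioo (-ε) ε := fun s hs =>
      abs_lt.1 ((hts s hs).trans_lt ht.2.2)
    let β : (UnitCurve E) := ⟨fun τ => Φ (x, t * τ), by
      refine hc.comp_continuous (f := fun τ : unitInterval => (x, t * (τ : ℝ))) (by fun_prop) ?_
      exact fun τ => ⟨hxr, hte τ τ.2⟩⟩
    have hβs : (x, t, β) ∈ Θ.source := by
      apply hηs
      rw [Metric.mem_ball, Prod.dist_eq, Prod.dist_eq]
      refine max_lt hx.1.2 (max_lt (by simpa [p₀] using ht.1.2) ?_)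
      refine lt_of_le_of_lt ?_ (half_lt_self hη)
      rw [ContinuousMap.dist_le (by positivity)]
      intro τ
      have : dist (x, t * (τ : ℝ)) (x₀, 0) < ρ := by
        rw [Prod.dist_eq]
        refine max_lt hx.1.1 ?_
        rw [dist_zero_right]
        exact (hts τ τ.2).trans_lt ht.1.1
      exact (hρ' this).le
    have hβ𝒢 : Θ (x, t, β) = (x, t, 0) := by
      rw [hΘ]
      refine Prod.ext rfl (Prod.ext rfl ?_)
      ext τ
      -- Integrating the differential equation along `s ↦ Φ (x, t s)` is exactly the vanishing of
      -- the last component of `𝒢`.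
      have hFTC := intervalIntegral.integral_eq_sub_of_hasDerivAt (a := (0 : ℝ)) (b := τ)
        (f := fun s => Φ (x, t * s)) (f' := fun s => t • X (Φ (x, t * s))) (by
          intro s hs
          rw [uIcc_of_le τ.2.1] at hs
          have := (hd x hxr (t * s) (hte s ⟨hs.1, hs.2.trans τ.2.2⟩)).scomp s
            ((hasDerivAt_id s).const_mul t)
          simpa [Function.comp_def] using this) (by
          apply ContinuousOn.intervalIntegrable
          rw [uIcc_of_le τ.2.1]
          refine continuousOn_const.smul (hX.continuous.comp_continuousOn
            (hc.comp (f := fun s : ℝ => (x, t * s)) (by fun_prop) ?_))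
          exact fun s hs => ⟨hxr, hte s ⟨hs.1, hs.2.trans τ.2.2⟩⟩)
      rw [intervalIntegral.integral_smul, mul_zero, h0 x hxr] at hFTC
      have hint_eq : (∫ s in (0 : ℝ)..τ, N β (projIcc 0 1 zero_le_one s)) =
          ∫ s in (0 : ℝ)..τ, X (Φ (x, t * s)) := by
        apply intervalIntegral.integral_congr
        intro s hs
        rw [uIcc_of_le τ.2.1] at hs
        beta_reduce
        rw [projIcc_of_mem zero_le_one (⟨hs.1, hs.2.trans τ.2.2⟩ : s ∈ Icc (0 : ℝ) 1)]
        rfl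
      have hβτ : β τ = Φ (x, t * τ) := rfl
      simp only [𝒢, ContinuousMap.sub_apply, ContinuousMap.smul_apply,
        ContinuousMap.primitive_apply, hint_eq, hFTC, hβτ, cst]
      simp
    have := Θ.left_inv hβs
    rw [hβ𝒢] at this
    simp only [this]
    simp [β]
  have hmap : Tendsto (fun q : E × ℝ => ((q.1, q.2, 0) : E × ℝ × (UnitCurve E))) (𝓝 (x₀, 0))
      (𝓝 (x₀, 0, 0)) := by
    have : Continuous (fun q : E × ℝ => ((q.1, q.2, 0) : E × ℝ × (UnitCurve E))) := by fun_prop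
    exact this.tendsto (x₀, 0)
  filter_upwards [hmap.eventually hsymm, hsol.eventually_nhds] with q hq1 hq2
  refine ContDiffAt.congr_of_eventuallyEq ?_ hq2
  let ev : (UnitCurve E) →L[ℝ] E := ContinuousMap.evalCLM ℝ (1 : unitInterval)
  have h1 : ContDiffAt ℝ ∞ (fun q : E × ℝ => ((q.1, q.2, 0) : E × ℝ × (UnitCurve E))) q := by fun_prop
  have h2 := hq1.comp q h1
  exact ev.contDiff.contDiffAt.comp q h2.snd.snd

end SmoothODE

/-! ### Smooth flows of compactly supported vector fields -/

section TangentMaps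

variable {E H : Type*} [NormedAddCommGroup E] [NormedSpace ℝ E] [TopologicalSpace H]
  {I : ModelWithCorners ℝ E H} {M : Type*} [TopologicalSpace M] [ChartedSpace H M]
  {E' H' : Type*} [NormedAddCommGroup E'] [NormedSpace ℝ E'] [TopologicalSpace H']
  {I' : ModelWithCorners ℝ E' H'} {M' : Type*} [TopologicalSpace M'] [ChartedSpace H' M']
  {F : Type*} [NormedAddCommGroup F] [NormedSpace ℝ F]

theorem ContMDiffOn.contMDiffOn_tangentMap [IsManifold I ∞ M] [IsManifold I' ∞ M']
    {f : M → M'} {U : Set M} (hU : IsOpen U) (hf : ContMDiffOn I I' ∞ f U) :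
    ContMDiffOn I.tangent I'.tangent ∞ (tangentMap I I' f) (π E (TangentSpace I) ⁻¹' U) := by
  refine (hf.contMDiffOn_tangentMapWithin (m := ∞) (by simp) hU.uniqueMDiffOn).congr ?_
  intro v hv
  simp only [tangentMap, tangentMapWithin]
  rw [mfderivWithin_of_isOpen hU hv]

/-- The derivative of a smooth function along a smooth vector field is smooth. -/
theorem ContMDiffOn.mfderiv_apply_field [IsManifold I ∞ M] {g : M → F} {U : Set M} (hU : IsOpen U)
    (hg : ContMDiffOn I 𝓘(ℝ, F) ∞ g U) {X : ∀ x : M, TangentSpace I x}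
    (hX : ContMDiffOn I I.tangent ∞ (fun x => (⟨x, X x⟩ : TangentBundle I M)) U) :
    ContMDiffOn I 𝓘(ℝ, F) ∞ (fun x => (mfderiv I 𝓘(ℝ, F) g x (X x) : F)) U := by
  have h1 := (hg.contMDiffOn_tangentMap hU).comp hX (fun x hx => hx)
  exact (contMDiff_snd_tangentBundle_modelSpace F 𝓘(ℝ, F)).comp_contMDiffOn h1

end TangentMaps

section LocalFlow

variable {E : Type} [NormedAddCommGroup E] [NormedSpace ℝ E] [FiniteDimensional ℝ E]

/-- A smooth vector field on an open set of a vector space has smooth local flows. -/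
theorem ContDiffOn.exists_smooth_local_flow {X : E → E} {U : Set E} (hU : IsOpen U)
    (hX : ContDiffOn ℝ ∞ X U) {x₀ : E} (hx₀ : x₀ ∈ U) :
    ∃ r > (0 : ℝ), ∃ ε > (0 : ℝ), ∃ Φ : E × ℝ → E,
      ContDiffOn ℝ ∞ Φ (Metric.ball x₀ r ×ˢ Ioo (-ε) ε) ∧
      ∀ x ∈ Metric.ball x₀ r, Φ (x, 0) = x ∧ ∀ t ∈ Ioo (-ε) ε, Φ (x, t) ∈ U ∧
        HasDerivAt (fun t => Φ (x, t)) (X (Φ (x, t))) t := by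
  have : CompleteSpace E := FiniteDimensional.complete ℝ E
  obtain ⟨R, hR, hRU⟩ := Metric.isOpen_iff.1 hU x₀ hx₀
  -- The cut-off extends the field to the whole space but agrees with `X` only on the ball of radius
  -- `R / 4`. The final domain is shrunk until all trajectories stay in that ball.
  let χ : ContDiffBump x₀ := ⟨R / 4, R / 2, by linarith, by linarith⟩
  let Y : E → E := fun x => χ x • X x
  have hY : ContDiff ℝ ∞ Y := by
    rw [contDiff_iff_contDiffAt]
    intro x
    by_cases hx : x ∈ Metric.ball x₀ R
    · exact χ.contDiff.contDiffAt.smul ((hX.mono hRU).contDiffAt (Metric.isOpen_ball.mem_nhds hx))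
    · have hx' : x ∉ Metric.closedBall x₀ (R / 2) := fun h =>
        hx (lt_of_le_of_lt (Metric.mem_closedBall.1 h) (by linarith))
      refine (contDiffAt_const (c := (0 : E))).congr_of_eventuallyEq ?_
      filter_upwards [Metric.isClosed_closedBall.isOpen_compl.mem_nhds hx'] with y hy
      have : χ y = 0 := χ.zero_of_le_dist (le_of_lt (by simpa using hy))
      simp [Y, this]
  have hYX : ∀ x ∈ Metric.ball x₀ (R / 4), Y x = X x := fun x hx => by
    simp [Y, χ.one_of_mem_closedBall (Metric.ball_subset_closedBall hx)]
  obtain ⟨ε, hε, a, r, L, K, hr, hpl⟩ :=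
    IsPicardLindelof.of_contDiffAt_one ((hY.contDiffAt (x := x₀)).of_le (by simp))
  obtain ⟨Φ, hΦ, hΦc⟩ := (hpl 0).exists_forall_mem_closedBall_eq_hasDerivWithinAt_continuousOn
  have hr' : (0 : ℝ) < r := hr
  simp only [zero_sub, zero_add] at hΦ hΦc
  have hd : ∀ x ∈ Metric.ball x₀ (r : ℝ), ∀ t ∈ Ioo (-ε) ε,
      HasDerivAt (fun t => Φ (x, t)) (Y (Φ (x, t))) t := fun x hx t ht =>
    ((hΦ x (Metric.ball_subset_closedBall hx)).2 t (Ioo_subset_Icc_self ht)).hasDerivAt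
      (Icc_mem_nhds ht.1 ht.2)
  have h0 : ∀ x ∈ Metric.ball x₀ (r : ℝ), Φ (x, 0) = x := fun x hx =>
    (hΦ x (Metric.ball_subset_closedBall hx)).1
  have hc : ContinuousOn Φ (Metric.ball x₀ (r : ℝ) ×ˢ Ioo (-ε) ε) :=
    hΦc.mono (prod_mono Metric.ball_subset_closedBall Ioo_subset_Icc_self)
  have hs := eventually_contDiffAt_of_local_flow hY hr' hε h0 hd hc
  have hx₀' : Φ (x₀, 0) = x₀ := h0 _ (Metric.mem_ball_self hr')
  have hn : ∀ᶠ q in 𝓝 ((x₀, 0) : E × ℝ), Φ q ∈ Metric.ball x₀ (R / 4) := by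
    have hcat : ContinuousAt Φ (x₀, 0) := hc.continuousAt
      (prod_mem_nhds (Metric.ball_mem_nhds x₀ hr') (Ioo_mem_nhds (by linarith) hε))
    refine hcat.eventually ?_
    rw [hx₀']
    exact Metric.ball_mem_nhds _ (by linarith)
  obtain ⟨ρ, hρ, hρ'⟩ := Metric.eventually_nhds_iff_ball.1 (hs.and hn)
  have hmem : ∀ x ∈ Metric.ball x₀ (min ρ r), ∀ t ∈ Ioo (-(min ρ ε)) (min ρ ε),
      (x, t) ∈ Metric.ball ((x₀, 0) : E × ℝ) ρ := by
    intro x hx t ht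
    rw [Metric.mem_ball, Prod.dist_eq]
    refine max_lt (lt_of_lt_of_le hx (min_le_left _ _)) ?_
    rw [dist_zero_right]
    exact lt_of_lt_of_le (abs_lt.2 ht) (min_le_left _ _)
  refine ⟨min ρ r, lt_min hρ hr', min ρ ε, lt_min hρ hε, Φ, ?_, ?_⟩
  · rintro ⟨x, t⟩ ⟨hx, ht⟩
    exact (hρ' _ (hmem x hx t ht)).1.contDiffWithinAt
  · intro x hx
    have hxr : x ∈ Metric.ball x₀ (r : ℝ) := Metric.ball_subset_ball (min_le_right _ _) hx
    refine ⟨h0 x hxr, fun t ht => ?_⟩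
    have h4 := (hρ' _ (hmem x hx t ht)).2
    refine ⟨hRU (Metric.ball_subset_ball (by linarith) h4), ?_⟩
    rw [← hYX _ h4]
    exact hd x hxr t ⟨lt_of_le_of_lt (neg_le_neg (min_le_right _ _)) ht.1,
      lt_of_lt_of_le ht.2 (min_le_right _ _)⟩

variable {M : Type*} [TopologicalSpace M] [ChartedSpace E M] [IsManifold 𝓘(ℝ, E) ∞ M]

/-- A smooth vector field on a manifold has smooth local flows. -/
theorem ContMDiff.exists_smooth_local_flow {X : ∀ x : M, TangentSpace 𝓘(ℝ, E) x}
    (hX : ContMDiff 𝓘(ℝ, E) 𝓘(ℝ, E).tangent ∞ (fun x => (⟨x, X x⟩ : TangentBundle 𝓘(ℝ, E) M)))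
    (q₀ : M) :
    ∃ U : Set M, IsOpen U ∧ q₀ ∈ U ∧ ∃ ε > (0 : ℝ), ∃ Φ : ℝ × M → M,
      ContMDiffOn (𝓘(ℝ, ℝ).prod 𝓘(ℝ, E)) 𝓘(ℝ, E) ∞ Φ (Ioo (-ε) ε ×ˢ U) ∧
      ∀ q ∈ U, Φ (0, q) = q ∧ IsMIntegralCurveOn (fun t => Φ (t, q)) X (Ioo (-ε) ε) := by
  let φ := chartAt E q₀
  have hφm : φ ∈ IsManifold.maximalAtlas 𝓘(ℝ, E) ∞ M := IsManifold.chart_mem_maximalAtlas q₀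
  have hφ : ContMDiffOn 𝓘(ℝ, E) 𝓘(ℝ, E) ∞ φ φ.source := contMDiffOn_of_mem_maximalAtlas hφm
  have hφs : ContMDiffOn 𝓘(ℝ, E) 𝓘(ℝ, E) ∞ φ.symm φ.target :=
    contMDiffOn_symm_of_mem_maximalAtlas hφm
  have hφd : φ.MDifferentiable 𝓘(ℝ, E) 𝓘(ℝ, E) :=
    ⟨hφ.mdifferentiableOn (by simp), hφs.mdifferentiableOn (by simp)⟩
  let Y : E → E := fun u => mfderiv 𝓘(ℝ, E) 𝓘(ℝ, E) φ (φ.symm u) (X (φ.symm u))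
  have hY : ContDiffOn ℝ ∞ Y φ.target :=
    ((hφ.mfderiv_apply_field φ.open_source hX.contMDiffOn).comp hφs
      φ.mapsTo_symm).contDiffOn
  obtain ⟨r, hr, ε, hε, Φ, hΦ, hΦ'⟩ := hY.exists_smooth_local_flow φ.open_target
    (φ.map_source (mem_chart_source E q₀))
  have hUo : IsOpen (φ.source ∩ φ ⁻¹' Metric.ball (φ q₀) r) :=
    φ.isOpen_inter_preimage Metric.isOpen_ball
  refine ⟨φ.source ∩ φ ⁻¹' Metric.ball (φ q₀) r, hUo,
    ⟨mem_chart_source E q₀, Metric.mem_ball_self hr⟩, ε, hε,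
    fun p => φ.symm (Φ (φ p.2, p.1)), ?_, ?_⟩
  · refine hφs.comp (t := φ.target) ?_ (fun p hp => ((hΦ' _ hp.2.2).2 _ hp.1).1)
    have h1 : ContMDiffOn (𝓘(ℝ, ℝ).prod 𝓘(ℝ, E)) 𝓘(ℝ, E × ℝ) ∞ (fun p : ℝ × M => (φ p.2, p.1))
        (Ioo (-ε) ε ×ˢ (φ.source ∩ φ ⁻¹' Metric.ball (φ q₀) r)) := by
      refine ContMDiffOn.prodMk_space ?_ contMDiffOn_fst
      exact hφ.comp contMDiffOn_snd (fun p hp => hp.2.1)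
    exact hΦ.contMDiffOn.comp h1 (fun p hp => ⟨hp.2.2, hp.1⟩)
  · rintro q ⟨hq, hqr⟩
    refine ⟨?_, fun t ht => ?_⟩
    · simp only [(hΦ' _ hqr).1, φ.left_inv hq]
    · obtain ⟨hU, hd⟩ := (hΦ' _ hqr).2 t ht
      have h1 : HasMFDerivAt 𝓘(ℝ, ℝ) 𝓘(ℝ, E) (fun t => Φ (φ q, t)) t
          ((1 : ℝ →L[ℝ] ℝ).smulRight (Y (Φ (φ q, t)))) := hd.hasFDerivAt.hasMFDerivAt
      have h2 := (hφd.mdifferentiableAt_symm hU).hasMFDerivAt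
      have h3 := h2.comp t h1
      refine HasMFDerivAt.hasMFDerivWithinAt (h3.congr_mfderiv ?_)
      have h4 : ∀ v : E, mfderiv 𝓘(ℝ, E) 𝓘(ℝ, E) φ.symm (Φ (φ q, t))
          (mfderiv 𝓘(ℝ, E) 𝓘(ℝ, E) φ (φ.symm (Φ (φ q, t))) v) = v := by
        intro v
        have := hφd.symm_comp_deriv (φ.map_target hU)
        rw [φ.right_inv hU] at this
        exact congrArg (fun L => L v) this
      refine ContinuousLinearMap.ext fun a => ?_
      let b : ℝ := a
      change mfderiv 𝓘(ℝ, E) 𝓘(ℝ, E) φ.symm (Φ (φ q, t)) (b • Y (Φ (φ q, t))) =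
        b • X (φ.symm (Φ (φ q, t)))
      exact ((mfderiv 𝓘(ℝ, E) 𝓘(ℝ, E) φ.symm (Φ (φ q, t))).map_smul b (Y (Φ (φ q, t)))).trans
        (congrArg (fun w => b • w) (h4 _))

end LocalFlow

section GlobalFlow

variable {E : Type} [NormedAddCommGroup E] [NormedSpace ℝ E]
  {M : Type*} [TopologicalSpace M] [ChartedSpace E M] [IsManifold 𝓘(ℝ, E) ∞ M] [T2Space M]

theorem isMIntegralCurve_unique {X : ∀ x : M, TangentSpace 𝓘(ℝ, E) x}
    (hX : ContMDiff 𝓘(ℝ, E) 𝓘(ℝ, E).tangent ∞ (fun x => (⟨x, X x⟩ : TangentBundle 𝓘(ℝ, E) M)))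
    {γ γ' : ℝ → M} (hγ : IsMIntegralCurve γ X) (hγ' : IsMIntegralCurve γ' X) {t₀ : ℝ}
    (h : γ t₀ = γ' t₀) : γ = γ' := by
  have : IsManifold 𝓘(ℝ, E) 1 M := IsManifold.of_le (n := ∞) (by simp)
  exact isMIntegralCurve_Ioo_eq_of_contMDiff_boundaryless (hX.of_le (by simp)) hγ hγ' h

/-- As functions of `s`, both sides are integral curves with the same value at `s = 0`. Smoothness
of `φ` is not assumed, because the identity is what propagates smoothness from small times to all
times. -/
theorem IsGlobalFlow.add {X : ∀ x : M, TangentSpace 𝓘(ℝ, E) x}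
    (hX : ContMDiff 𝓘(ℝ, E) 𝓘(ℝ, E).tangent ∞ (fun x => (⟨x, X x⟩ : TangentBundle 𝓘(ℝ, E) M)))
    {φ : ℝ → M → M} (h0 : ∀ x, φ 0 x = x) (hφ : ∀ x, IsMIntegralCurve (fun t => φ t x) X)
    (s t : ℝ) (x : M) : φ (s + t) x = φ s (φ t x) := by
  have h := isMIntegralCurve_unique hX ((hφ x).comp_add t) (hφ (φ t x)) (t₀ := 0)
    (by simp [h0])
  exact congrFun h s

/-- A compactly supported smooth vector field has a global smooth flow. -/
theorem exists_isGlobalFlow_of_isCompact [FiniteDimensional ℝ E]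
    {X : ∀ x : M, TangentSpace 𝓘(ℝ, E) x}
    (hX : ContMDiff 𝓘(ℝ, E) 𝓘(ℝ, E).tangent ∞ (fun x => (⟨x, X x⟩ : TangentBundle 𝓘(ℝ, E) M)))
    {K : Set M} (hK : IsCompact K) (hXK : ∀ x ∉ K, X x = 0) :
    ∃ φ : ℝ → M → M, IsGlobalFlow X φ := by
  have hm1 : IsManifold 𝓘(ℝ, E) 1 M := IsManifold.of_le (n := ∞) (by simp)
  have hX1 : ContMDiff 𝓘(ℝ, E) 𝓘(ℝ, E).tangent 1
    (fun x => (⟨x, X x⟩ : TangentBundle 𝓘(ℝ, E) M)) := hX.of_le (by simp)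
  choose U hUo hUq ε hε Φ hΦ hΦ' using hX.exists_smooth_local_flow
  obtain ⟨s, -, hs⟩ := hK.elim_nhds_subcover U (fun q _ => (hUo q).mem_nhds (hUq q))
  obtain ⟨ε₀, hε₀, hle⟩ : ∃ ε₀ > (0 : ℝ), ∀ q ∈ s, ε₀ ≤ ε q := by
    rcases s.eq_empty_or_nonempty with h | h
    · exact ⟨1, one_pos, by simp [h]⟩
    · exact ⟨s.inf' h ε, (Finset.lt_inf'_iff h).2 fun q _ => hε q, fun q hq =>
        Finset.inf'_le _ hq⟩
  -- Finitely many local flows cover `K`, and off `K` the constant flow serves. So there is one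
  -- lifetime `ε₀` for all initial points, which makes the integral curves extend to all times.
  have hloc : ∀ q : M, ∃ V : Set M, IsOpen V ∧ q ∈ V ∧ ∃ Φ : ℝ × M → M,
      ContMDiffOn (𝓘(ℝ, ℝ).prod 𝓘(ℝ, E)) 𝓘(ℝ, E) ∞ Φ (Ioo (-ε₀) ε₀ ×ˢ V) ∧
      ∀ q ∈ V, Φ (0, q) = q ∧ IsMIntegralCurveOn (fun t => Φ (t, q)) X (Ioo (-ε₀) ε₀) := by
    intro q
    by_cases hq : q ∈ K
    · obtain ⟨q', hq', hqU⟩ := mem_iUnion₂.1 (hs hq)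
      have hsub : Ioo (-ε₀) ε₀ ⊆ Ioo (-(ε q')) (ε q') :=
        Ioo_subset_Ioo (neg_le_neg (hle q' hq')) (hle q' hq')
      exact ⟨U q', hUo q', hqU, Φ q', (hΦ q').mono (prod_mono hsub subset_rfl),
        fun p hp => ⟨(hΦ' q' p hp).1, (hΦ' q' p hp).2.mono hsub⟩⟩
    · refine ⟨Kᶜ, hK.isClosed.isOpen_compl, hq, Prod.snd, contMDiffOn_snd, fun p hp => ⟨rfl, ?_⟩⟩
      intro t _
      refine (hasMFDerivAt_const (I := 𝓘(ℝ, ℝ)) (I' := 𝓘(ℝ, E)) p t).hasMFDerivWithinAt.congr_mfderiv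
        ?_
      simp only [hXK p hp, ContinuousLinearMap.smulRight_zero]
      rfl
  have hex : ∀ q : M, ∃ γ : ℝ → M, γ 0 = q ∧ IsMIntegralCurve γ X := by
    refine exists_isMIntegralCurve_of_isMIntegralCurveOn hX1 hε₀ fun q => ?_
    obtain ⟨V, -, hqV, Φ, -, h⟩ := hloc q
    exact ⟨fun t => Φ (t, q), h q hqV⟩
  choose γ hγ0 hγ using hex
  let φ : ℝ → M → M := fun t q => γ q t
  have hadd : ∀ s t x, φ (s + t) x = φ s (φ t x) := IsGlobalFlow.add hX hγ0 hγ
  have hsm : ∀ t ∈ Ioo (-ε₀) ε₀, ∀ q : M,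
      ContMDiffAt (𝓘(ℝ, ℝ).prod 𝓘(ℝ, E)) 𝓘(ℝ, E) ∞ (fun p : ℝ × M => φ p.1 p.2) (t, q) := by
    intro t ht q
    obtain ⟨V, hV, hqV, Φ, hΦ, h⟩ := hloc q
    have hn : Ioo (-ε₀) ε₀ ×ˢ V ∈ 𝓝 (t, q) := (isOpen_Ioo.prod hV).mem_nhds ⟨ht, hqV⟩
    refine (hΦ.contMDiffAt hn).congr_of_eventuallyEq ?_
    filter_upwards [hn] with p hp
    exact isMIntegralCurveOn_Ioo_eqOn_of_contMDiff_boundaryless (t₀ := 0) (a := -ε₀) (b := ε₀)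
      ⟨by linarith, hε₀⟩ hX1 ((hγ p.2).isMIntegralCurveOn _) (h p.2 hp.2).2
      (by rw [hγ0, (h p.2 hp.2).1]) hp.1
  have hslice : ∀ t ∈ Ioo (-ε₀) ε₀, ContMDiff 𝓘(ℝ, E) 𝓘(ℝ, E) ∞ (φ t) := by
    intro t ht q
    exact (hsm t ht q).comp q (contMDiffAt_const.prodMk contMDiffAt_id)
  -- The map `φ t` is the `n`-th iterate of `φ (t / n)`, and `|t / n| < ε₀`.
  have hall : ∀ t, ContMDiff 𝓘(ℝ, E) 𝓘(ℝ, E) ∞ (φ t) := by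
    intro t
    obtain ⟨n, hn⟩ := exists_nat_gt (|t| / ε₀)
    have hn0 : (0 : ℝ) < n := lt_of_le_of_lt (by positivity) hn
    have hmul : ∀ j : ℕ, ContMDiff 𝓘(ℝ, E) 𝓘(ℝ, E) ∞ (φ (j * (t / n))) := by
      intro j
      induction j with
      | zero =>
        have : φ ((0 : ℕ) * (t / n)) = id := by
          funext q; simp [φ, hγ0]
        rw [this]; exact contMDiff_id
      | succ j ih =>
        have : φ ((j + 1 : ℕ) * (t / n)) = φ (t / n) ∘ φ (j * (t / n)) := by
          funext q
          rw [Function.comp_apply, ← hadd]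
          congr 1
          push_cast; ring
        rw [this]
        refine (hslice _ (abs_lt.1 ?_)).comp ih
        rw [abs_div, abs_of_pos hn0, div_lt_iff₀ hn0]
        rw [div_lt_iff₀ hε₀] at hn
        linarith
    have := hmul n
    rwa [mul_div_cancel₀ _ hn0.ne'] at this
  refine ⟨φ, ⟨?_, hγ0, hγ⟩⟩
  rintro ⟨t₀, q₀⟩
  -- Joint smoothness at `(t₀, q₀)` is joint smoothness at `(0, φ t₀ q₀)`, precomposed with the
  -- smooth map `φ t₀`.
  have heq : (fun p : ℝ × M => φ p.1 p.2) =
      (fun p : ℝ × M => φ p.1 p.2) ∘ (fun p : ℝ × M => (p.1 - t₀, φ t₀ p.2)) := by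
    funext p
    simp only [Function.comp_apply, ← hadd, sub_add_cancel]
  rw [heq]
  refine ContMDiffAt.comp (t₀, q₀)
    (I' := 𝓘(ℝ, ℝ).prod 𝓘(ℝ, E)) (by simpa using hsm 0 ⟨by linarith, hε₀⟩ (φ t₀ q₀)) ?_
  refine ContMDiffAt.prodMk ?_ ?_
  · exact contMDiffAt_fst.sub contMDiffAt_const
  · exact (hall t₀).contMDiffAt.comp _ contMDiffAt_snd

end GlobalFlow


/-! ### Two-forms as bilinear maps, and pullbacks of smooth forms -/

section Bilinear

variable {E : Type*} [NormedAddCommGroup E] [NormedSpace ℝ E]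
  {F : Type*} [NormedAddCommGroup F] [NormedSpace ℝ F]

theorem map_vecCons_two (σ : E [⋀^Fin 2]→L[ℝ] ℝ) (u v : E) :
    ‖σ ![u, v]‖ ≤ ‖σ‖ * ‖u‖ * ‖v‖ := by
  have := σ.le_opNorm ![u, v]
  rwa [Fin.prod_univ_two, ← mul_assoc] at this

theorem update_vecCons_zero (a b c : E) : Function.update ![a, b] 0 c = ![c, b] := by
  ext i; fin_cases i <;> rfl

theorem update_vecCons_one (a b c : E) : Function.update ![a, b] 1 c = ![a, c] := by
  ext i; fin_cases i <;> rfl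

theorem update_vecCons_single (a c : E) : Function.update ![a] 0 c = ![c] := by
  ext i; fin_cases i; rfl

/-- The bilinear map of an alternating form of degree two. -/
noncomputable def bilinOfAlt (σ : E [⋀^Fin 2]→L[ℝ] ℝ) : E →L[ℝ] E →L[ℝ] ℝ :=
  LinearMap.mkContinuous₂
    (LinearMap.mk₂ ℝ (fun u v => σ ![u, v])
      (fun a b w => by simpa [update_vecCons_zero] using σ.map_update_add ![a, w] 0 a b)
      (fun c a w => by simpa [update_vecCons_zero] using σ.map_update_smul ![a, w] 0 c a)
      (fun w a b => by simpa [update_vecCons_one] using σ.map_update_add ![w, a] 1 a b)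
      (fun c w a => by simpa [update_vecCons_one] using σ.map_update_smul ![w, a] 1 c a))
    ‖σ‖ (map_vecCons_two σ)

theorem norm_bilinOfAlt_le (σ : E [⋀^Fin 2]→L[ℝ] ℝ) : ‖bilinOfAlt σ‖ ≤ ‖σ‖ :=
  LinearMap.mkContinuous₂_norm_le _ (norm_nonneg _) _

/-- The passage from alternating forms of degree two to bilinear maps. -/
noncomputable def altBilin (E : Type*) [NormedAddCommGroup E] [NormedSpace ℝ E]
    (σ : E [⋀^Fin 2]→L[ℝ] ℝ) : E →L[ℝ] E →L[ℝ] ℝ := bilinOfAlt σ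

theorem contDiff_altBilin {n : WithTop ℕ∞} : ContDiff ℝ n (altBilin E) := by
  refine IsBoundedLinearMap.contDiff (IsLinearMap.with_bound ⟨?_, ?_⟩ 1 ?_)
  · intro σ τ; ext; rfl
  · intro c σ; ext; rfl
  · intro σ
    rw [one_mul]
    exact norm_bilinOfAlt_le σ

theorem altBilin_apply (σ : E [⋀^Fin 2]→L[ℝ] ℝ) (u v : E) : altBilin E σ u v = σ ![u, v] := rfl

theorem altBilin_self (σ : E [⋀^Fin 2]→L[ℝ] ℝ) (u : E) : altBilin E σ u u = 0 := by
  rw [altBilin_apply]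
  exact σ.map_eq_zero_of_eq ![u, u] (i := 0) (j := 1) rfl (by decide)

theorem altBilin_swap (σ : E [⋀^Fin 2]→L[ℝ] ℝ) (u v : E) :
    altBilin E σ u v = - altBilin E σ v u := by
  have h := altBilin_self σ (u + v)
  simp only [map_add, add_apply, altBilin_self] at h
  linarith

theorem vecCons_map_two (A : F →L[ℝ] E) (u v : F) : (A ∘ ![u, v]) = ![A u, A v] := by
  ext i; fin_cases i <;> rfl

theorem altBilin_comp (σ : E [⋀^Fin 2]→L[ℝ] ℝ) (A : F →L[ℝ] E) (u v : F) :
    altBilin F (σ.compContinuousLinearMap A) u v = altBilin E σ (A u) (A v) := by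
  simp only [altBilin_apply, ContinuousAlternatingMap.compContinuousLinearMap_apply,
    vecCons_map_two]

/-- The linear map of an alternating form of degree one. -/
noncomputable def linOfAlt (σ : E [⋀^Fin 1]→L[ℝ] ℝ) : E →L[ℝ] ℝ :=
  LinearMap.mkContinuous
    { toFun := fun u => σ ![u]
      map_add' := fun a b => by
        simpa [update_vecCons_single] using σ.map_update_add ![a] 0 a b
      map_smul' := fun c a => by
        simpa [update_vecCons_single] using σ.map_update_smul ![a] 0 c a } ‖σ‖ (fun u => by
          have := σ.le_opNorm ![u]
          rwa [Fin.prod_univ_one] at this)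

/-- The passage from alternating forms of degree one to linear maps. -/
noncomputable def altLin (E : Type*) [NormedAddCommGroup E] [NormedSpace ℝ E]
    (σ : E [⋀^Fin 1]→L[ℝ] ℝ) : E →L[ℝ] ℝ := linOfAlt σ

theorem contDiff_altLin {n : WithTop ℕ∞} : ContDiff ℝ n (altLin E) := by
  refine IsBoundedLinearMap.contDiff (IsLinearMap.with_bound ⟨?_, ?_⟩ 1 ?_)
  · intro σ τ; ext; rfl
  · intro c σ; ext; rfl
  · intro σ
    rw [one_mul]
    refine ContinuousLinearMap.opNorm_le_bound _ (norm_nonneg _) fun u => ?_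
    have := σ.le_opNorm ![u]
    rwa [Fin.prod_univ_one] at this

theorem altLin_apply (σ : E [⋀^Fin 1]→L[ℝ] ℝ) (u : E) : altLin E σ u = σ ![u] := rfl

theorem altLin_comp (σ : E [⋀^Fin 1]→L[ℝ] ℝ) (A : F →L[ℝ] E) (u : F) :
    altLin F (σ.compContinuousLinearMap A) u = altLin E σ (A u) := by
  simp only [altLin_apply, ContinuousAlternatingMap.compContinuousLinearMap_apply]
  congr 1
  ext i; fin_cases i; rfl

end Bilinear

section Pullback

variable {E H : Type*} [NormedAddCommGroup E] [NormedSpace ℝ E] [TopologicalSpace H]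
  {E' H' : Type*} [NormedAddCommGroup E'] [NormedSpace ℝ E'] [TopologicalSpace H']
  {E'' H'' : Type*} [NormedAddCommGroup E''] [NormedSpace ℝ E''] [TopologicalSpace H'']
  {I : ModelWithCorners ℝ E H} {J : ModelWithCorners ℝ E' H'} {J' : ModelWithCorners ℝ E'' H''}
  {M : Type*} [TopologicalSpace M] [ChartedSpace H M]
  {M' : Type*} [TopologicalSpace M'] [ChartedSpace H' M']
  {M'' : Type*} [TopologicalSpace M''] [ChartedSpace H'' M''] {r : ℕ}

/-- The value of a form at a point, composed with a linear map into the model space. -/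
noncomputable def DiffForm.compAt (σ : DiffForm J M' r) (y : M') (L : E →L[ℝ] E') :
    E [⋀^Fin r]→L[ℝ] ℝ :=
  ContinuousAlternatingMap.compContinuousLinearMap (σ y : E' [⋀^Fin r]→L[ℝ] ℝ) L

/-- The bilinear form of a two-form at a point. -/
noncomputable def DiffForm.bilin (σ : DiffForm J M' 2) (y : M') : E' →L[ℝ] E' →L[ℝ] ℝ :=
  altBilin E' (σ y)

theorem DiffForm.bilin_self (σ : DiffForm J M' 2) (y : M') (v : E') : σ.bilin y v v = 0 :=
  altBilin_self (E := E') _ v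

theorem DiffForm.bilin_swap (σ : DiffForm J M' 2) (y : M') (v w : E') :
    σ.bilin y v w = - σ.bilin y w v :=
  altBilin_swap (E := E') _ v w

/-- The pullback of a form, as a function with values in the forms on the model space. -/
noncomputable def DiffForm.pull (I : ModelWithCorners ℝ E H) (J : ModelWithCorners ℝ E' H')
    (g : M → M') (σ : DiffForm J M' r) (x : M) : E [⋀^Fin r]→L[ℝ] ℝ :=
  σ.compAt (E := E) (g x) (mfderiv I J g x)

theorem DiffForm.altBilin_pull (g : M → M') (σ : DiffForm J M' 2) (x : M) (u v : E) :
    altBilin E (DiffForm.pull I J g σ x) u v =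
      σ.bilin (g x) (mfderiv I J g x u) (mfderiv I J g x v) :=
  altBilin_comp (E := E') (F := E) (σ (g x)) (mfderiv I J g x) u v

theorem DiffForm.pull_congr {g g' : M → M'} (σ : DiffForm J M' r) {x : M}
    (h : g =ᶠ[𝓝 x] g') : DiffForm.pull I J g σ x = DiffForm.pull I J g' σ x := by
  unfold DiffForm.pull
  rw [h.mfderiv_eq, h.eq_of_nhds]

theorem DiffForm.pull_comp {f : M → M'} {g : M' → M''} (σ : DiffForm J' M'' r) {x : M}
    (hg : MDifferentiableAt J J' g (f x)) (hf : MDifferentiableAt I J f x) :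
    DiffForm.pull I J' (g ∘ f) σ x =
      (DiffForm.pull J J' g σ (f x)).compContinuousLinearMap (mfderiv I J f x : E →L[ℝ] E') := by
  unfold DiffForm.pull
  rw [mfderiv_comp x hg hf]
  rfl

end Pullback

section SmoothForms

variable {E : Type*} [NormedAddCommGroup E] [NormedSpace ℝ E]
  {M : Type*} [TopologicalSpace M] [ChartedSpace E M] [IsManifold 𝓘(ℝ, E) ∞ M]
  {F : Type*} [NormedAddCommGroup F] [NormedSpace ℝ F] [FiniteDimensional ℝ F]

/-- Smoothness of a form is defined through its expressions in charts. Factoring `g` through one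
chart of the target reduces a pullback by any smooth map to such an expression. -/
theorem DiffForm.eventually_pull_eq_inChart {r : ℕ} (σ : DiffForm 𝓘(ℝ, E) M r) {g : F → M}
    {U : Set F} (hU : IsOpen U) (hg : ContMDiffOn 𝓘(ℝ, F) 𝓘(ℝ, E) ∞ g U) {y₀ : F}
    (hy₀ : y₀ ∈ U) :
    ∀ᶠ y in 𝓝 y₀, DiffForm.pull 𝓘(ℝ, F) 𝓘(ℝ, E) g σ y =
      (σ.inChart (chartAt E (g y₀)) (chartAt E (g y₀) (g y))).compContinuousLinearMap
        (fderiv ℝ (chartAt E (g y₀) ∘ g) y) := by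
  set φ := chartAt E (g y₀)
  have hφm : φ ∈ IsManifold.maximalAtlas 𝓘(ℝ, E) ∞ M := IsManifold.chart_mem_maximalAtlas _
  have hV : IsOpen (U ∩ g ⁻¹' φ.source) := hg.continuousOn.isOpen_inter_preimage hU φ.open_source
  filter_upwards [hV.mem_nhds ⟨hy₀, mem_chart_source E (g y₀)⟩] with y hy
  have h1 : g =ᶠ[𝓝 y] φ.symm ∘ (φ ∘ g) := by
    filter_upwards [hV.mem_nhds hy] with z hz
    simp [φ.left_inv hz.2]
  have hgy : ContMDiffAt 𝓘(ℝ, F) 𝓘(ℝ, E) ∞ g y := hg.contMDiffAt (hU.mem_nhds hy.1)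
  have hφg : ContMDiffAt 𝓘(ℝ, F) 𝓘(ℝ, E) ∞ (φ ∘ g) y :=
    (contMDiffAt_of_mem_maximalAtlas hφm hy.2).comp y hgy
  rw [DiffForm.pull_congr σ h1, DiffForm.pull_comp (f := φ ∘ g) (g := φ.symm) σ
    ((contMDiffAt_symm_of_mem_maximalAtlas hφm (φ.map_source hy.2)).mdifferentiableAt (by simp))
    (hφg.mdifferentiableAt (by simp)), mfderiv_eq_fderiv]
  rfl

theorem contDiffOn_chart_comp {g : F → M}
    {U : Set F} (hU : IsOpen U) (hg : ContMDiffOn 𝓘(ℝ, F) 𝓘(ℝ, E) ∞ g U) {y₀ : F}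
    (hy₀ : y₀ ∈ U) : ContDiffAt ℝ ∞ (chartAt E (g y₀) ∘ g) y₀ := by
  have hφm : chartAt E (g y₀) ∈ IsManifold.maximalAtlas 𝓘(ℝ, E) ∞ M :=
    IsManifold.chart_mem_maximalAtlas _
  exact ((contMDiffAt_of_mem_maximalAtlas hφm (mem_chart_source E (g y₀))).comp y₀
    (hg.contMDiffAt (hU.mem_nhds hy₀))).contDiffAt

/-- Evaluation on a basis identifies the linear maps out of the finite-dimensional space `F` with a
finite power of `G`. -/
theorem contDiffAt_clm_of_forall_apply {Y G : Type*} [NormedAddCommGroup Y] [NormedSpace ℝ Y]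
    [NormedAddCommGroup G] [NormedSpace ℝ G] {A : Y → F →L[ℝ] G} {y : Y}
    (h : ∀ v, ContDiffAt ℝ ∞ (fun z => A z v) y) : ContDiffAt ℝ ∞ A y := by
  let d := Module.finrank ℝ F
  have hd : d = Module.finrank ℝ (Fin d → ℝ) := (Module.finrank_fin_fun ℝ).symm
  let e₁ := ContinuousLinearEquiv.ofFinrankEq hd
  let e₂ := (e₁.arrowCongr (1 : G ≃L[ℝ] G)).trans (ContinuousLinearEquiv.piRing (Fin d))
  rw [← Function.id_comp A, ← e₂.symm_comp_self]
  exact e₂.symm.contDiff.contDiffAt.comp y (contDiffAt_pi.mpr fun i => h _)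

/-- The pullback of a smooth two-form by a smooth map from a vector space is smooth. -/
theorem DiffForm.IsSmooth.contDiffOn_altBilin_pull {σ : DiffForm 𝓘(ℝ, E) M 2}
    (hσ : σ.IsSmooth) {g : F → M} {U : Set F} (hU : IsOpen U)
    (hg : ContMDiffOn 𝓘(ℝ, F) 𝓘(ℝ, E) ∞ g U) :
    ContDiffOn ℝ ∞ (fun y => altBilin F (DiffForm.pull 𝓘(ℝ, F) 𝓘(ℝ, E) g σ y)) U := by
  intro y₀ hy₀
  refine ContDiffAt.contDiffWithinAt ?_
  set φ := chartAt E (g y₀)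
  have hφm : φ ∈ IsManifold.maximalAtlas 𝓘(ℝ, E) ∞ M := IsManifold.chart_mem_maximalAtlas _
  have hφg : ContDiffAt ℝ ∞ (φ ∘ g) y₀ := contDiffOn_chart_comp hU hg hy₀
  have hd : ContDiffAt ℝ ∞ (fderiv ℝ (φ ∘ g)) y₀ := hφg.fderiv_right (by simp)
  have hs : ContDiffAt ℝ ∞ (σ.inChart φ) (φ (g y₀)) :=
    (hσ φ hφm).contDiffAt (φ.open_target.mem_nhds (φ.map_source (mem_chart_source E (g y₀))))
  have hb : ContDiffAt ℝ ∞ (fun y => altBilin E (σ.inChart φ (φ (g y)))) y₀ :=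
    contDiff_altBilin.contDiffAt.comp y₀ (hs.comp y₀ hφg)
  have key : ContDiffAt ℝ ∞ (fun y => (ContinuousLinearMap.bilinearComp
      (altBilin E (σ.inChart φ (φ (g y)))) (fderiv ℝ (φ ∘ g) y) (fderiv ℝ (φ ∘ g) y))) y₀ := by
    refine contDiffAt_clm_of_forall_apply fun u => contDiffAt_clm_of_forall_apply fun v => ?_
    exact (hb.clm_apply (hd.clm_apply contDiffAt_const)).clm_apply (hd.clm_apply contDiffAt_const)
  refine key.congr_of_eventuallyEq ?_
  filter_upwards [σ.eventually_pull_eq_inChart hU hg hy₀] with y hy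
  ext u v
  rw [hy]
  exact altBilin_comp _ _ _ _

/-- The pullback of a smooth one-form by a smooth map from a vector space is smooth. -/
theorem DiffForm.IsSmooth.contDiffOn_altLin_pull {σ : DiffForm 𝓘(ℝ, E) M 1}
    (hσ : σ.IsSmooth) {g : F → M} {U : Set F} (hU : IsOpen U)
    (hg : ContMDiffOn 𝓘(ℝ, F) 𝓘(ℝ, E) ∞ g U) :
    ContDiffOn ℝ ∞ (fun y => altLin F (DiffForm.pull 𝓘(ℝ, F) 𝓘(ℝ, E) g σ y)) U := by
  intro y₀ hy₀
  refine ContDiffAt.contDiffWithinAt ?_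
  set φ := chartAt E (g y₀)
  have hφm : φ ∈ IsManifold.maximalAtlas 𝓘(ℝ, E) ∞ M := IsManifold.chart_mem_maximalAtlas _
  have hφg : ContDiffAt ℝ ∞ (φ ∘ g) y₀ := contDiffOn_chart_comp hU hg hy₀
  have hd : ContDiffAt ℝ ∞ (fderiv ℝ (φ ∘ g)) y₀ := hφg.fderiv_right (by simp)
  have hs : ContDiffAt ℝ ∞ (σ.inChart φ) (φ (g y₀)) :=
    (hσ φ hφm).contDiffAt (φ.open_target.mem_nhds (φ.map_source (mem_chart_source E (g y₀))))
  have hb : ContDiffAt ℝ ∞ (fun y => altLin E (σ.inChart φ (φ (g y)))) y₀ :=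
    contDiff_altLin.contDiffAt.comp y₀ (hs.comp y₀ hφg)
  refine (hb.clm_comp hd).congr_of_eventuallyEq ?_
  filter_upwards [σ.eventually_pull_eq_inChart hU hg hy₀] with y hy
  ext u
  rw [hy]
  exact altLin_comp _ _ _

end SmoothForms

/-! ### The kernel of a two-form of corank one -/

section Kernel

variable {F : Type*} [NormedAddCommGroup F] [NormedSpace ℝ F] [FiniteDimensional ℝ F]

/-- An alternating bilinear form on an odd-dimensional space is degenerate. -/
theorem exists_ne_zero_of_odd_finrank (hF : Odd (Module.finrank ℝ F)) (B : F →L[ℝ] F →L[ℝ] ℝ)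
    (hB : ∀ u, B u u = 0) : ∃ v ≠ 0, B v = 0 := by
  let b := Module.finBasis ℝ F
  let A : Matrix (Fin (Module.finrank ℝ F)) (Fin (Module.finrank ℝ F)) ℝ :=
    Matrix.of fun i j => B (b i) (b j)
  have hanti : ∀ u v, B u v = - B v u := by
    intro u v
    have := hB (u + v)
    simp only [map_add, add_apply, hB] at this
    linarith
  have hA : A.transpose = -A := by
    ext i j
    simp only [A, Matrix.transpose_apply, Matrix.of_apply, Matrix.neg_apply]
    exact hanti _ _
  -- In odd size `n`, antisymmetry gives `det A = det Aᵀ = (-1)^n det A = - det A`.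
  have hdet : A.det = 0 := by
    have h1 := A.det_transpose
    rw [hA, Matrix.det_neg, Fintype.card_fin, hF.neg_one_pow] at h1
    linarith
  obtain ⟨w, hw, hw'⟩ := Matrix.exists_vecMul_eq_zero_iff.2 hdet
  refine ⟨∑ i, w i • b i, ?_, ?_⟩
  · intro h
    apply hw
    funext i
    exact Fintype.linearIndependent_iff.1 b.linearIndependent w h i
  · have hb : (B (∑ i, w i • b i)).toLinearMap = 0 := by
      apply b.ext
      intro j
      have := congrFun hw' j
      simp only [Matrix.vecMul, dotProduct, A, Matrix.of_apply, Pi.zero_apply] at this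
      simpa [map_sum, sum_apply] using this
    ext v
    exact congrArg (fun L : F →ₗ[ℝ] ℝ => L v) hb

/-- The operator `v ↦ B(v, ·) + ν(v) ν`, invertible if `B` has corank one and `ν` does not vanish
on the kernel of `B`. -/
noncomputable def framedMap (B : F →L[ℝ] F →L[ℝ] ℝ) (ν : F →L[ℝ] ℝ) : F →L[ℝ] F →L[ℝ] ℝ :=
  B + ν.smulRight ν

theorem framedMap_apply (B : F →L[ℝ] F →L[ℝ] ℝ) (ν : F →L[ℝ] ℝ) (v w : F) :
    framedMap B ν v w = B v w + ν v * ν w := rfl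

/-- Evaluating the image of `v` on `v` itself kills `B(v, v)` and leaves the square `ν(v)²`. -/
theorem framedMap_injective (B : F →L[ℝ] F →L[ℝ] ℝ) (hB : ∀ u, B u u = 0) (ν : F →L[ℝ] ℝ)
    (h : ∀ v, B v = 0 → ν v = 0 → v = 0) : Function.Injective (framedMap B ν) := by
  rw [injective_iff_map_eq_zero]
  intro v hv
  have h1 : framedMap B ν v v = 0 := by rw [hv]; rfl
  rw [framedMap_apply, hB, zero_add] at h1
  have h2 : ν v = 0 := mul_self_eq_zero.1 h1
  refine h v ?_ h2
  ext w
  have h3 : framedMap B ν v w = 0 := by rw [hv]; rfl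
  rw [framedMap_apply, h2, zero_mul, add_zero] at h3
  simpa using h3

/-- An injective `framedMap` as an equivalence. -/
noncomputable def framedEquiv (B : F →L[ℝ] F →L[ℝ] ℝ) (ν : F →L[ℝ] ℝ)
    (h : Function.Injective (framedMap B ν)) : F ≃L[ℝ] (F →L[ℝ] ℝ) :=
  (LinearEquiv.ofInjectiveOfFinrankEq (framedMap B ν).toLinearMap h
    (by
      rw [← LinearMap.toContinuousLinearMap.finrank_eq, Module.finrank_linearMap_self])).toContinuousLinearEquiv

theorem framedEquiv_coe (B : F →L[ℝ] F →L[ℝ] ℝ) (ν : F →L[ℝ] ℝ)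
    (h : Function.Injective (framedMap B ν)) :
    (framedEquiv B ν h : F →L[ℝ] (F →L[ℝ] ℝ)) = framedMap B ν := by
  ext; rfl

theorem exists_kernel_vector (B : F →L[ℝ] F →L[ℝ] ℝ) (ν : F →L[ℝ] ℝ)
    (h : Function.Injective (framedMap B ν)) (hne : ∃ v ≠ 0, B v = 0) :
    ∃ v, B v = 0 ∧ ν v = 1 := by
  obtain ⟨v, hv, hBv⟩ := hne
  have hν : ν v ≠ 0 := by
    intro h0
    apply hv
    apply h
    ext w
    simp [framedMap_apply, hBv, h0]
  refine ⟨(ν v)⁻¹ • v, by rw [map_smul, hBv, smul_zero], ?_⟩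
  rw [map_smul, smul_eq_mul, inv_mul_cancel₀ hν]

/-- The framed map sends the normalised kernel vector to `ν`. This expresses the kernel vector by
inversion, from which its smooth dependence on `B` and `ν` can be read off. -/
theorem kernel_vector_eq_inverse (B : F →L[ℝ] F →L[ℝ] ℝ) (ν : F →L[ℝ] ℝ)
    (h : Function.Injective (framedMap B ν)) {v : F} (hv : B v = 0) (hν : ν v = 1) :
    v = ContinuousLinearMap.inverse (framedMap B ν) ν := by
  rw [← framedEquiv_coe B ν h, ContinuousLinearMap.inverse_equiv]
  refine ((framedEquiv B ν h).symm_apply_eq.2 ?_).symm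
  ext w
  change ν w = framedMap B ν v w
  rw [framedMap_apply, hv, hν, one_mul]
  simp

/-- Both sides have the image `ν(w) ν` under the framed map. So invertibility of that map already
forces the kernel of `B` to be at most a line. -/
theorem kernel_eq_span (B : F →L[ℝ] F →L[ℝ] ℝ) (ν : F →L[ℝ] ℝ)
    (h : Function.Injective (framedMap B ν)) {v : F} (hv : B v = 0) (hν : ν v = 1) {w : F}
    (hw : B w = 0) : w = ν w • v := by
  apply h
  ext u
  simp [framedMap_apply, hv, hw, hν]

/-- The normalised kernel vector depends smoothly on the forms. -/
theorem contDiffAt_kernel_vector {Y : Type*} [NormedAddCommGroup Y] [NormedSpace ℝ Y]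
    {B : Y → F →L[ℝ] F →L[ℝ] ℝ} {ν : Y → F →L[ℝ] ℝ} {y₀ : Y} (hB : ContDiffAt ℝ ∞ B y₀)
    (hν : ContDiffAt ℝ ∞ ν y₀) (h : Function.Injective (framedMap (B y₀) (ν y₀))) :
    ContDiffAt ℝ ∞ (fun y => ContinuousLinearMap.inverse (framedMap (B y) (ν y)) (ν y)) y₀ := by
  have : CompleteSpace F := FiniteDimensional.complete ℝ F
  have h1 : ContDiffAt ℝ ∞ (fun y => framedMap (B y) (ν y)) y₀ :=
    hB.add (hν.smulRight hν)
  have h2 : ContDiffAt ℝ ∞ ContinuousLinearMap.inverse (framedMap (B y₀) (ν y₀)) := by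
    rw [← framedEquiv_coe _ _ h]
    exact contDiffAt_map_inverse _
  exact (h2.comp y₀ h1).clm_apply hν

theorem eventually_injective_framedMap {Y : Type*} [TopologicalSpace Y]
    {B : Y → F →L[ℝ] F →L[ℝ] ℝ} {ν : Y → F →L[ℝ] ℝ} {y₀ : Y} (hB : ContinuousAt B y₀)
    (hν : ContinuousAt ν y₀) (h : Function.Injective (framedMap (B y₀) (ν y₀))) :
    ∀ᶠ y in 𝓝 y₀, Function.Injective (framedMap (B y) (ν y)) := by
  have : CompleteSpace F := FiniteDimensional.complete ℝ F
  have h1 : ContinuousAt (fun y => framedMap (B y) (ν y)) y₀ := by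
    have hc : ContDiff ℝ 0
        (fun q : (F →L[ℝ] F →L[ℝ] ℝ) × (F →L[ℝ] ℝ) => framedMap q.1 q.2) :=
      contDiff_fst.add (contDiff_snd.smulRight contDiff_snd)
    exact hc.continuous.continuousAt.comp (f := fun y => (B y, ν y)) (hB.prodMk hν)
  have h2 := h1.eventually ((framedEquiv_coe _ _ h) ▸ ContinuousLinearEquiv.nhds (framedEquiv _ _ h))
  filter_upwards [h2] with y hy
  obtain ⟨T, hT⟩ := hy
  rw [← hT]
  exact T.injective

end Kernel


/-! ### Immersions and embeddings -/

section InverseFunction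

variable {E : Type*} [NormedAddCommGroup E] [NormedSpace ℝ E] [CompleteSpace E]
  {F : Type*} [NormedAddCommGroup F] [NormedSpace ℝ F]

/-- The inverse function theorem, with smoothness of the local inverse on its whole domain. -/
theorem ContDiffOn.exists_smooth_openPartialHomeomorph {G : E → F} {U : Set E} (hU : IsOpen U)
    (hG : ContDiffOn ℝ ∞ G U) {a : E} (ha : a ∈ U) {T₀ : E ≃L[ℝ] F}
    (hT₀ : HasFDerivAt G (T₀ : E →L[ℝ] F) a) :
    ∃ T : OpenPartialHomeomorph E F, a ∈ T.source ∧ T.source ⊆ U ∧ (∀ x, T x = G x) ∧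
      ContDiffOn ℝ ∞ T T.source ∧ ContDiffOn ℝ ∞ T.symm T.target := by
  have hGa : ContDiffAt ℝ ∞ G a := hG.contDiffAt (hU.mem_nhds ha)
  let T₁ := hGa.toOpenPartialHomeomorph G hT₀ (by simp)
  have hT₁ : ∀ x, T₁ x = G x := fun x => by
    rw [hGa.toOpenPartialHomeomorph_coe hT₀ (by simp)]
  -- The local inverse is smooth at the image of every point where the derivative is invertible.
  -- That is an open condition, so the domain is restricted to it.
  let V : Set E := U ∩ fderiv ℝ G ⁻¹' range ((↑) : (E ≃L[ℝ] F) → E →L[ℝ] F)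
  have hV : IsOpen V :=
    (hG.continuousOn_fderiv_of_isOpen hU (by simp)).isOpen_inter_preimage hU
      ContinuousLinearEquiv.isOpen
  have haV : a ∈ V := ⟨ha, T₀, hT₀.fderiv.symm⟩
  let T := T₁.restrOpen V hV
  have hTs : T.source = T₁.source ∩ V := rfl
  have hT : ∀ x, T x = G x := hT₁
  refine ⟨T, ⟨hGa.mem_toOpenPartialHomeomorph_source hT₀ (by simp), haV⟩, fun x hx => hx.2.1, hT,
    ?_, ?_⟩
  · exact (hG.mono fun x hx => hx.2.1).congr fun x _ => hT x
  · intro y hy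
    have hx := T.map_target hy
    obtain ⟨T', hT'⟩ := hx.2.2
    have hGx : ContDiffAt ℝ ∞ G (T.symm y) := hG.contDiffAt (hU.mem_nhds hx.2.1)
    have hTG : (T : E → F) = G := funext hT
    refine (T.contDiffAt_symm (f₀' := T') hy ?_ ?_).contDiffWithinAt
    · rw [hTG, hT']
      exact (hGx.differentiableAt (by simp)).hasFDerivAt
    · rw [hTG]; exact hGx

end InverseFunction

section Immersion

variable {E : Type*} [NormedAddCommGroup E] [NormedSpace ℝ E] [FiniteDimensional ℝ E]
  {E' : Type*} [NormedAddCommGroup E'] [NormedSpace ℝ E'] [FiniteDimensional ℝ E']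
  {F : Type*} [NormedAddCommGroup F] [NormedSpace ℝ F] [FiniteDimensional ℝ F]

/-- An injective linear map extends to an isomorphism from a product. -/
theorem exists_coprod_equiv (A : E →L[ℝ] E') (hA : Function.Injective A)
    (hF : Module.finrank ℝ E + Module.finrank ℝ F = Module.finrank ℝ E') :
    ∃ (j : F →L[ℝ] E') (T : (E × F) ≃L[ℝ] E'), (T : (E × F) →L[ℝ] E') = A.coprod j := by
  obtain ⟨Q, hQ⟩ := Submodule.exists_isCompl (LinearMap.range A.toLinearMap)
  have h1 : Module.finrank ℝ (LinearMap.range A.toLinearMap) = Module.finrank ℝ E :=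
    LinearMap.finrank_range_of_inj hA
  have h2 := Submodule.finrank_add_eq_of_isCompl hQ
  have h3 : Module.finrank ℝ F = Module.finrank ℝ Q := by omega
  let q : F ≃L[ℝ] Q := ContinuousLinearEquiv.ofFinrankEq h3
  let j : F →L[ℝ] E' := Q.subtypeL.comp (q : F →L[ℝ] Q)
  have hinj : Function.Injective (A.coprod j) := by
    rw [injective_iff_map_eq_zero]
    rintro ⟨u, t⟩ h
    have h4 : A u + (q t : E') = 0 := h
    have h5 : A u ∈ LinearMap.range A.toLinearMap ⊓ Q := by
      refine ⟨⟨u, rfl⟩, ?_⟩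
      rw [eq_neg_of_add_eq_zero_left h4]
      exact Q.neg_mem (q t).2
    rw [hQ.inf_eq_bot, Submodule.mem_bot] at h5
    rw [h5, zero_add] at h4
    have h6 : u = 0 := hA (by rw [h5, map_zero])
    have h7 : t = 0 := q.injective (by rw [map_zero]; exact Subtype.ext h4)
    rw [h6, h7]; rfl
  refine ⟨j, (LinearEquiv.ofInjectiveOfFinrankEq (A.coprod j).toLinearMap hinj
    (by rw [Module.finrank_prod, hF])).toContinuousLinearEquiv, ?_⟩
  ext x <;> rfl

variable {W : Type*} [TopologicalSpace W] [ChartedSpace E' W] [IsManifold 𝓘(ℝ, E') ∞ W]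
  {M : Type*} [TopologicalSpace M] [ChartedSpace E M] [IsManifold 𝓘(ℝ, E) ∞ M]

/-- Composing a chart of the smooth structure with a smooth coordinate change. -/
theorem trans_mem_maximalAtlas {ψ : OpenPartialHomeomorph W E'}
    (hψ : ψ ∈ IsManifold.maximalAtlas 𝓘(ℝ, E') ∞ W) {c : OpenPartialHomeomorph E' E'}
    (hc : ContDiffOn ℝ ∞ c c.source) (hc' : ContDiffOn ℝ ∞ c.symm c.target) :
    ψ.trans c ∈ IsManifold.maximalAtlas 𝓘(ℝ, E') ∞ W := by
  refine OpenPartialHomeomorph.mem_maximalAtlas_of_contMDiffOn (I := 𝓘(ℝ, E')) (n := ∞) (M := W)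
    (ψ.trans c) ?_ ?_
  · exact hc.contMDiffOn.comp ((contMDiffOn_of_mem_maximalAtlas hψ).mono fun x hx => hx.1)
      fun x hx => hx.2
  · exact (contMDiffOn_symm_of_mem_maximalAtlas hψ).comp (hc'.contMDiffOn.mono fun x hx => hx.1)
      fun x hx => hx.2

/-- A smooth map with injective derivative at a point is an immersion there. -/
theorem ContMDiff.isImmersionAtOfComplement
    (hF : Module.finrank ℝ E + Module.finrank ℝ F = Module.finrank ℝ E') {g : M → W}
    (hg : ContMDiff 𝓘(ℝ, E) 𝓘(ℝ, E') ∞ g) {x : M}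
    (hx : Function.Injective (mfderiv 𝓘(ℝ, E) 𝓘(ℝ, E') g x)) :
    IsImmersionAtOfComplement F 𝓘(ℝ, E) 𝓘(ℝ, E') ∞ g x := by
  have : CompleteSpace E := FiniteDimensional.complete ℝ E
  have : CompleteSpace E' := FiniteDimensional.complete ℝ E'
  have : CompleteSpace F := FiniteDimensional.complete ℝ F
  set φ := chartAt E x
  set ψ := chartAt E' (g x)
  have hφ : φ ∈ IsManifold.maximalAtlas 𝓘(ℝ, E) ∞ M := IsManifold.chart_mem_maximalAtlas _
  have hψ : ψ ∈ IsManifold.maximalAtlas 𝓘(ℝ, E') ∞ W := IsManifold.chart_mem_maximalAtlas _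
  have hxφ : x ∈ φ.source := mem_chart_source E x
  have hxψ : g x ∈ ψ.source := mem_chart_source E' (g x)
  let g' : E → E' := ψ ∘ g ∘ φ.symm
  let U' : Set E := φ.target ∩ φ.symm ⁻¹' (g ⁻¹' ψ.source)
  have hU' : IsOpen U' :=
    φ.isOpen_inter_preimage_symm (ψ.open_source.preimage hg.continuous)
  have hφxU : φ x ∈ U' := ⟨φ.map_source hxφ, by
    simp only [mem_preimage, φ.left_inv hxφ]; exact hxψ⟩
  have hg' : ContDiffOn ℝ ∞ g' U' := by
    refine ContMDiffOn.contDiffOn ?_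
    exact (contMDiffOn_of_mem_maximalAtlas hψ).comp (hg.comp_contMDiffOn
      ((contMDiffOn_symm_of_mem_maximalAtlas hφ).mono fun u hu => hu.1)) fun u hu => hu.2
  let A : E →L[ℝ] E' := fderiv ℝ g' (φ x)
  have hA : Function.Injective A := by
    have h1 : mfderiv 𝓘(ℝ, E) 𝓘(ℝ, E') g' (φ x) = A := mfderiv_eq_fderiv
    have hsm : MDifferentiableAt 𝓘(ℝ, E) 𝓘(ℝ, E) φ.symm (φ x) :=
      (contMDiffAt_symm_of_mem_maximalAtlas hφ (φ.map_source hxφ)).mdifferentiableAt (by simp)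
    have hgm : MDifferentiableAt 𝓘(ℝ, E) 𝓘(ℝ, E') g (φ.symm (φ x)) :=
      hg.mdifferentiable (by simp) _
    have hψm : MDifferentiableAt 𝓘(ℝ, E') 𝓘(ℝ, E') ψ (g (φ.symm (φ x))) := by
      refine (contMDiffAt_of_mem_maximalAtlas hψ ?_).mdifferentiableAt (by simp)
      rw [φ.left_inv hxφ]; exact hxψ
    have h2 : mfderiv 𝓘(ℝ, E) 𝓘(ℝ, E') g' (φ x) =
        (mfderiv 𝓘(ℝ, E') 𝓘(ℝ, E') ψ (g (φ.symm (φ x)))).comp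
          ((mfderiv 𝓘(ℝ, E) 𝓘(ℝ, E') g (φ.symm (φ x))).comp
            (mfderiv 𝓘(ℝ, E) 𝓘(ℝ, E) φ.symm (φ x))) := by
      rw [← mfderiv_comp (φ x) hgm hsm]
      exact mfderiv_comp (φ x) (f := g ∘ φ.symm) hψm (hgm.comp _ hsm)
    have hφd := mdifferentiable_of_mem_atlas (I := 𝓘(ℝ, E)) (chart_mem_atlas E x)
    have hψd := mdifferentiable_of_mem_atlas (I := 𝓘(ℝ, E')) (chart_mem_atlas E' (g x))
    rw [← h1, h2]
    have hgx : g (φ.symm (φ x)) ∈ ψ.source := by rw [φ.left_inv hxφ]; exact hxψ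
    have i1 := hψd.mfderiv_injective hgx
    have i2 : Function.Injective (mfderiv 𝓘(ℝ, E) 𝓘(ℝ, E') g (φ.symm (φ x))) := by
      rw [φ.left_inv hxφ]; exact hx
    have i3 := hφd.symm.mfderiv_injective (φ.map_source hxφ)
    exact i1.comp (i2.comp i3)
  obtain ⟨j, T₀, hT₀⟩ := exists_coprod_equiv (F := F) A hA hF
  -- The map is thickened by a complement `j` of the image of its derivative, so that the inverse
  -- function theorem applies.
  let G : E × F → E' := fun q => g' q.1 + j q.2
  have hGs : ContDiffOn ℝ ∞ G (U' ×ˢ univ) :=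
    (hg'.comp contDiff_fst.contDiffOn fun q hq => hq.1).add
      (j.contDiff.comp contDiff_snd).contDiffOn
  have hGd : HasFDerivAt G (T₀ : (E × F) →L[ℝ] E') (φ x, 0) := by
    rw [hT₀]
    have h1 : HasFDerivAt g' A (φ x) :=
      ((hg'.contDiffAt (hU'.mem_nhds hφxU)).differentiableAt (by simp)).hasFDerivAt
    have h2 := (h1.comp (φ x, (0 : F)) (hasFDerivAt_fst (𝕜 := ℝ))).add
      (j.hasFDerivAt.comp (φ x, (0 : F)) (hasFDerivAt_snd (𝕜 := ℝ)))
    exact h2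
  obtain ⟨T, haT, hTU, hTG, hTs, hTs'⟩ :=
    hGs.exists_smooth_openPartialHomeomorph (hU'.prod isOpen_univ) (a := (φ x, 0))
      ⟨hφxU, mem_univ _⟩ hGd
  -- The inverse of `T` straightens the image of the map to `E × {0}`, and `T₀` brings it back to
  -- the model space `E'`. In these coordinates the map reads `u ↦ T₀ (u, 0)`.
  let c : OpenPartialHomeomorph E' E' := T.symm.trans T₀.toHomeomorph.toOpenPartialHomeomorph
  have hc : ContDiffOn ℝ ∞ c c.source :=
    T₀.contDiff.comp_contDiffOn (hTs'.mono fun y hy => hy.1)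
  have hc' : ContDiffOn ℝ ∞ c.symm c.target :=
    hTs.comp T₀.symm.contDiff.contDiffOn fun y hy => hy.2
  let O : Set E := {u | (u, (0 : F)) ∈ T.source}
  have hO : IsOpen O := T.open_source.preimage (by fun_prop)
  have hGu : ∀ u, G (u, 0) = g' u := fun u => by simp [G]
  refine IsImmersionAtOfComplement.mk_of_continuousAt hg.continuous.continuousAt T₀
    (φ.trans (OpenPartialHomeomorph.ofSet O hO)) (ψ.trans c) ⟨hxφ, haT⟩ ?_ ?_ ?_ ?_
  · refine ⟨hxψ, ?_, mem_univ _⟩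
    have := T.map_source haT
    rw [hTG, hGu] at this
    simpa [g', φ.left_inv hxφ] using this
  · exact trans_mem_maximalAtlas hφ contDiff_id.contDiffOn contDiff_id.contDiffOn
  · exact trans_mem_maximalAtlas hψ hc hc'
  · intro u hu
    have hu' : u ∈ O := by
      simp at hu
      exact hu.1
    have h1 : T.symm (g' u) = (u, 0) := by
      rw [← hGu, ← hTG, T.left_inv hu']
    change T₀ (T.symm (g' u)) = T₀ (u, 0)
    rw [h1]

theorem ContMDiff.isImmersion_of_injective_mfderiv
    (hF : Module.finrank ℝ E + Module.finrank ℝ F = Module.finrank ℝ E') {g : M → W}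
    (hg : ContMDiff 𝓘(ℝ, E) 𝓘(ℝ, E') ∞ g)
    (hx : ∀ x, Function.Injective (mfderiv 𝓘(ℝ, E) 𝓘(ℝ, E') g x)) :
    IsImmersion 𝓘(ℝ, E) 𝓘(ℝ, E') ∞ g :=
  IsImmersionOfComplement.isImmersion (F := F)
    fun x => hg.isImmersionAtOfComplement hF (hx x)

/-- The derivative of an immersion is injective. -/
theorem IsImmersionAtOfComplement.injective_mfderiv {F : Type*} [NormedAddCommGroup F]
    [NormedSpace ℝ F] {g : M → W} {x : M}
    (h : IsImmersionAtOfComplement F 𝓘(ℝ, E) 𝓘(ℝ, E') ∞ g x) :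
    Function.Injective (mfderiv 𝓘(ℝ, E) 𝓘(ℝ, E') g x) := by
  let φ := h.domChart
  let ψ := h.codChart
  have hφ : φ ∈ IsManifold.maximalAtlas 𝓘(ℝ, E) ∞ M := h.domChart_mem_maximalAtlas
  have hψ : ψ ∈ IsManifold.maximalAtlas 𝓘(ℝ, E') ∞ W := h.codChart_mem_maximalAtlas
  have hxφ : x ∈ φ.source := h.mem_domChart_source
  have hxψ : g x ∈ ψ.source := h.mem_codChart_source
  let j : E →L[ℝ] E' := (h.equiv : (E × F) →L[ℝ] E').comp (ContinuousLinearMap.inl ℝ E F)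
  have hj : Function.Injective j :=
    h.equiv.injective.comp fun a b hab => (Prod.ext_iff.1 hab).1
  have heq : ψ ∘ g =ᶠ[𝓝 x] j ∘ φ := by
    filter_upwards [φ.open_source.mem_nhds hxφ] with y hy
    have h0 : φ y ∈ (h.domChart.extend 𝓘(ℝ, E)).target := by
      rw [OpenPartialHomeomorph.extend_target]
      exact ⟨φ.map_source hy, mem_range_self (φ y)⟩
    have h1 := h.writtenInCharts h0
    have h2 : φ.symm (φ y) = y := φ.left_inv hy
    simp only [Function.comp_apply, OpenPartialHomeomorph.extend_coe,
      OpenPartialHomeomorph.extend_coe_symm, modelWithCornersSelf_coe,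
      modelWithCornersSelf_coe_symm, id] at h1
    change ψ (g (φ.symm (φ y))) = _ at h1
    rw [h2] at h1
    exact h1
  have hgm : MDifferentiableAt 𝓘(ℝ, E) 𝓘(ℝ, E') g x := h.contMDiffAt.mdifferentiableAt (by simp)
  have hψm : MDifferentiableAt 𝓘(ℝ, E') 𝓘(ℝ, E') ψ (g x) :=
    (contMDiffAt_of_mem_maximalAtlas hψ hxψ).mdifferentiableAt (by simp)
  have hφm : MDifferentiableAt 𝓘(ℝ, E) 𝓘(ℝ, E) φ x :=
    (contMDiffAt_of_mem_maximalAtlas hφ hxφ).mdifferentiableAt (by simp)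
  have hjm : MDifferentiableAt 𝓘(ℝ, E) 𝓘(ℝ, E') j (φ x) := j.differentiableAt.mdifferentiableAt
  have h3 : (mfderiv 𝓘(ℝ, E') 𝓘(ℝ, E') ψ (g x)).comp (mfderiv 𝓘(ℝ, E) 𝓘(ℝ, E') g x) =
      (mfderiv 𝓘(ℝ, E) 𝓘(ℝ, E') j (φ x)).comp (mfderiv 𝓘(ℝ, E) 𝓘(ℝ, E) φ x) := by
    rw [← mfderiv_comp x hψm hgm, ← mfderiv_comp x hjm hφm]
    exact heq.mfderiv_eq
  have hφd : φ.MDifferentiable 𝓘(ℝ, E) 𝓘(ℝ, E) :=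
    ⟨(contMDiffOn_of_mem_maximalAtlas hφ).mdifferentiableOn (by simp),
      (contMDiffOn_symm_of_mem_maximalAtlas hφ).mdifferentiableOn (by simp)⟩
  have i1 := hφd.mfderiv_injective hxφ
  have hj' : Function.Injective (mfderiv 𝓘(ℝ, E) 𝓘(ℝ, E') j (φ x)) := by
    rw [mfderiv_eq_fderiv, j.fderiv]
    exact hj
  have i2 := hj'.comp i1
  intro a b hab
  apply i2
  have h4 := congrArg (fun L : E →L[ℝ] E' => L a) h3
  have h5 := congrArg (fun L : E →L[ℝ] E' => L b) h3
  refine h4.symm.trans (Eq.trans ?_ h5)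
  exact congrArg (mfderiv 𝓘(ℝ, E') 𝓘(ℝ, E') ψ (g x)) hab

theorem IsImmersion.injective_mfderiv {g : M → W} (h : IsImmersion 𝓘(ℝ, E) 𝓘(ℝ, E') ∞ g) (x : M) :
    Function.Injective (mfderiv 𝓘(ℝ, E) 𝓘(ℝ, E') g x) :=
  IsImmersionAtOfComplement.injective_mfderiv (h.isImmersionOfComplement_complement x)

end Immersion

/-- A perturbation of an embedding, supported in a compact set, is an embedding if it is injective
on a compact neighbourhood of its support and the image of the support stays away from the image of
the complement. -/
theorem Topology.IsEmbedding.of_eqOn_compl {X Y : Type*} [TopologicalSpace X] [TopologicalSpace Y]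
    [T2Space X] [T2Space Y] {e g : X → Y} (he : IsEmbedding e) (hg : Continuous g) {B S : Set X}
    (hB : IsCompact B) (hSB : S ⊆ interior B) (hinj : InjOn g B)
    (heq : ∀ x ∉ S, g x = e x) (hdisj : ∀ x ∈ S, g x ∉ closure (e '' (interior B)ᶜ)) :
    IsEmbedding g := by
  have hginj : Function.Injective g := by
    -- A new coincidence would need one point in the support and one outside it. If the second lies
    -- in the interior of `B`, injectivity on `B` excludes it; otherwise `hdisj` does.
    have key : ∀ x y, x ∈ S → y ∉ S → g x = g y → x = y := by
      intro x y hx hy hxy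
      by_cases hyB : y ∈ interior B
      · exact hinj (interior_subset (hSB hx)) (interior_subset hyB) hxy
      · have hmem : g x ∈ e '' (interior B)ᶜ := ⟨y, hyB, by rw [hxy, heq y hy]⟩
        exact absurd (subset_closure hmem) (hdisj x hx)
    intro x y hxy
    by_cases hx : x ∈ S <;> by_cases hy : y ∈ S
    · exact hinj (interior_subset (hSB hx)) (interior_subset (hSB hy)) hxy
    · exact key x y hx hy hxy
    · exact (key y x hy hx hxy.symm).symm
    · rw [heq x hx, heq y hy] at hxy
      exact he.injective hxy
  refine ⟨isInducing_iff_nhds.2 fun x => le_antisymm hg.continuousAt.tendsto.le_comap ?_, hginj⟩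
  rw [le_iff_ultrafilter]
  intro F hF
  have hgF : Tendsto g F (𝓝 (g x)) := tendsto_iff_comap.2 hF
  -- If the ultrafilter lives on the compact set `B`, it converges there, and injectivity identifies
  -- the limit with `x`. Otherwise it lives where `g = e`: then `x ∈ S` contradicts `hdisj`, and for
  -- `x ∉ S` the embedding `e` gives the convergence.
  rcases F.em (· ∈ B) with hBF | hBF
  · obtain ⟨b, hb, hFb⟩ := hB.ultrafilter_le_nhds F (le_principal_iff.2 hBF)
    have h1 : g b = g x := tendsto_nhds_unique (hg.continuousAt.tendsto.comp hFb) hgF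
    rwa [← hginj h1]
  · have h2 : g =ᶠ[(F : Filter X)] e := by
      filter_upwards [hBF] with y hy
      exact heq y fun h => hy (interior_subset (hSB h))
    have h3 : Tendsto e F (𝓝 (g x)) := hgF.congr' h2
    by_cases hx : x ∈ S
    · refine absurd (mem_closure_of_tendsto h3 ?_) (hdisj x hx)
      filter_upwards [hBF] with y hy
      exact ⟨y, fun h => hy (interior_subset h), rfl⟩
    · rw [heq x hx] at h3
      rw [he.nhds_eq_comap]
      exact h3.le_comap


/-! ### Smooth kernel fields -/

section KernelField

variable {F : Type*} [NormedAddCommGroup F] [NormedSpace ℝ F] [FiniteDimensional ℝ F]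
  {E : Type*} [NormedAddCommGroup E] [NormedSpace ℝ E] [FiniteDimensional ℝ E]

/-- The framed map of the data pulled back by `A` is the framed map of the original data,
precomposed with `A` and followed by the transpose of `A`. Invertibility can therefore be tested in
any parametrization. -/
theorem injective_framedMap_of_comp {A : F →L[ℝ] E} (hA : Function.Bijective A)
    {B : E →L[ℝ] E →L[ℝ] ℝ} {ν : E →L[ℝ] ℝ} {B' : F →L[ℝ] F →L[ℝ] ℝ} {ν' : F →L[ℝ] ℝ}
    (hB : ∀ v w, B' v w = B (A v) (A w)) (hν : ∀ v, ν' v = ν (A v)) :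
    Function.Injective (framedMap B' ν') ↔ Function.Injective (framedMap B ν) := by
  have key : ∀ v w, framedMap B' ν' v w = framedMap B ν (A v) (A w) := fun v w => by
    rw [framedMap_apply, framedMap_apply, hB, hν, hν]
  simp only [injective_iff_map_eq_zero]
  constructor
  · intro h a ha
    obtain ⟨v, rfl⟩ := hA.2 a
    rw [h v (by ext w; rw [key, ha]; rfl), map_zero]
  · intro h v hv
    have : A v = 0 := h _ (by
      ext b
      obtain ⟨w, rfl⟩ := hA.2 b
      rw [← key, hv]; rfl)
    exact hA.1 (by rw [this, map_zero])

/-- The two conditions on a normalised kernel vector are natural under isomorphisms and determine it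
uniquely. -/
theorem kernel_vector_comp {A : F →L[ℝ] E} (hA : Function.Bijective A)
    {B : E →L[ℝ] E →L[ℝ] ℝ} {ν : E →L[ℝ] ℝ} {B' : F →L[ℝ] F →L[ℝ] ℝ} {ν' : F →L[ℝ] ℝ}
    (hB : ∀ v w, B' v w = B (A v) (A w)) (hν : ∀ v, ν' v = ν (A v))
    (hinj : Function.Injective (framedMap B ν)) (hker : ∃ v ≠ 0, B v = 0) :
    ContinuousLinearMap.inverse (framedMap B ν) ν =
      A (ContinuousLinearMap.inverse (framedMap B' ν') ν') := by
  obtain ⟨v, hv, hv1⟩ := exists_kernel_vector B ν hinj hker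
  obtain ⟨w, rfl⟩ := hA.2 v
  rw [← kernel_vector_eq_inverse B ν hinj hv hv1]
  congr 1
  refine kernel_vector_eq_inverse B' ν' ((injective_framedMap_of_comp hA hB hν).2 hinj) ?_ ?_
  · ext z; rw [hB, hv]; rfl
  · rw [hν, hv1]

variable {M : Type*} [TopologicalSpace M] [ChartedSpace E M] [IsManifold 𝓘(ℝ, E) ∞ M]

/-- A smooth parametrization has bijective derivative. -/
theorem bijective_mfderiv_of_smooth {κ : OpenPartialHomeomorph F M}
    (hκ : ContMDiffOn 𝓘(ℝ, F) 𝓘(ℝ, E) ∞ κ κ.source)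
    (hκ' : ContMDiffOn 𝓘(ℝ, E) 𝓘(ℝ, F) ∞ κ.symm κ.target) {w : F} (hw : w ∈ κ.source) :
    Function.Bijective (mfderiv 𝓘(ℝ, F) 𝓘(ℝ, E) κ w : F →L[ℝ] E) := by
  have hd : κ.MDifferentiable 𝓘(ℝ, F) 𝓘(ℝ, E) :=
    ⟨hκ.mdifferentiableOn (by simp), hκ'.mdifferentiableOn (by simp)⟩
  exact hd.mfderiv_bijective hw

/-- The push-forward of a smooth vector field by a smooth parametrization is smooth. -/
theorem contMDiffAt_pushforward {κ : OpenPartialHomeomorph F M}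
    (hκ : ContMDiffOn 𝓘(ℝ, F) 𝓘(ℝ, E) ∞ κ κ.source)
    (hκ' : ContMDiffOn 𝓘(ℝ, E) 𝓘(ℝ, F) ∞ κ.symm κ.target) {w₀ : F} (hw₀ : w₀ ∈ κ.source)
    {v : F → F} (hv : ContDiffAt ℝ ∞ v w₀) {X : ∀ x : M, TangentSpace 𝓘(ℝ, E) x}
    (hX : ∀ᶠ w in 𝓝 w₀, X (κ w) = mfderiv 𝓘(ℝ, F) 𝓘(ℝ, E) κ w (v w)) :
    ContMDiffAt 𝓘(ℝ, E) 𝓘(ℝ, E).tangent ∞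
      (fun x => (⟨x, X x⟩ : TangentBundle 𝓘(ℝ, E) M)) (κ w₀) := by
  have hs : ContMDiffAt 𝓘(ℝ, E) 𝓘(ℝ, F) ∞ κ.symm (κ w₀) :=
    hκ'.contMDiffAt (κ.open_target.mem_nhds (κ.map_source hw₀))
  have hl : κ.symm (κ w₀) = w₀ := κ.left_inv hw₀
  have hsec : ContMDiffAt 𝓘(ℝ, F) 𝓘(ℝ, F).tangent ∞
      (fun w => (⟨w, v w⟩ : TangentBundle 𝓘(ℝ, F) F)) w₀ :=
    contMDiffAt_vectorSpace_iff_contDiffAt.2 hv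
  have h1 : ContMDiffAt 𝓘(ℝ, F).tangent 𝓘(ℝ, E).tangent ∞ (tangentMap 𝓘(ℝ, F) 𝓘(ℝ, E) κ)
      (⟨w₀, v w₀⟩ : TangentBundle 𝓘(ℝ, F) F) :=
    (hκ.contMDiffOn_tangentMap κ.open_source).contMDiffAt
      ((κ.open_source.preimage (FiberBundle.continuous_proj _ _)).mem_nhds hw₀)
  have h2 : ContMDiffAt 𝓘(ℝ, F) 𝓘(ℝ, E).tangent ∞
      (fun w => tangentMap 𝓘(ℝ, F) 𝓘(ℝ, E) κ (⟨w, v w⟩ : TangentBundle 𝓘(ℝ, F) F)) w₀ :=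
    h1.comp w₀ hsec
  rw [← hl] at h2
  have h3 := h2.comp (κ w₀) hs
  refine h3.congr_of_eventuallyEq ?_
  have h4 : ∀ᶠ x in 𝓝 (κ w₀), X (κ (κ.symm x)) =
      mfderiv 𝓘(ℝ, F) 𝓘(ℝ, E) κ (κ.symm x) (v (κ.symm x)) := by
    have := hs.continuousAt.tendsto
    rw [hl] at this
    exact this.eventually hX
  filter_upwards [h4, κ.open_target.mem_nhds (κ.map_source hw₀)] with x hx hxt
  have h5 : κ (κ.symm x) = x := κ.right_inv hxt
  have h6 : (⟨x, X x⟩ : TangentBundle 𝓘(ℝ, E) M) = ⟨κ (κ.symm x), X (κ (κ.symm x))⟩ := by rw [h5]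
  rw [h6, hx]
  rfl

/-- The kernel field of a two-form of corank one, normalised by a one-form, is smooth. -/
theorem contMDiffAt_kernel_field {κ : OpenPartialHomeomorph F M}
    (hκ : ContMDiffOn 𝓘(ℝ, F) 𝓘(ℝ, E) ∞ κ κ.source)
    (hκ' : ContMDiffOn 𝓘(ℝ, E) 𝓘(ℝ, F) ∞ κ.symm κ.target) {w₀ : F} (hw₀ : w₀ ∈ κ.source)
    {β : M → E →L[ℝ] E →L[ℝ] ℝ} {ν : M → E →L[ℝ] ℝ} {B : F → F →L[ℝ] F →L[ℝ] ℝ}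
    {η : F → F →L[ℝ] ℝ} (hB : ContDiffAt ℝ ∞ B w₀) (hη : ContDiffAt ℝ ∞ η w₀)
    (hBβ : ∀ᶠ w in 𝓝 w₀, ∀ v v', B w v v' =
      β (κ w) (mfderiv 𝓘(ℝ, F) 𝓘(ℝ, E) κ w v) (mfderiv 𝓘(ℝ, F) 𝓘(ℝ, E) κ w v'))
    (hην : ∀ᶠ w in 𝓝 w₀, ∀ v, η w v = ν (κ w) (mfderiv 𝓘(ℝ, F) 𝓘(ℝ, E) κ w v))
    (hker : ∀ x, ∃ v ≠ 0, β x v = 0) (hinj : Function.Injective (framedMap (B w₀) (η w₀))) :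
    (∀ᶠ w in 𝓝 w₀, Function.Injective (framedMap (β (κ w)) (ν (κ w))) ∧
      ContinuousLinearMap.inverse (framedMap (β (κ w)) (ν (κ w))) (ν (κ w)) =
        mfderiv 𝓘(ℝ, F) 𝓘(ℝ, E) κ w
          (ContinuousLinearMap.inverse (framedMap (B w) (η w)) (η w))) ∧
    ContMDiffAt 𝓘(ℝ, E) 𝓘(ℝ, E).tangent ∞ (fun x => (⟨x,
      ContinuousLinearMap.inverse (framedMap (β x) (ν x)) (ν x)⟩ : TangentBundle 𝓘(ℝ, E) M))
      (κ w₀) := by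
  have h1 : ∀ᶠ w in 𝓝 w₀, Function.Injective (framedMap (β (κ w)) (ν (κ w))) ∧
      ContinuousLinearMap.inverse (framedMap (β (κ w)) (ν (κ w))) (ν (κ w)) =
        mfderiv 𝓘(ℝ, F) 𝓘(ℝ, E) κ w
          (ContinuousLinearMap.inverse (framedMap (B w) (η w)) (η w)) := by
    filter_upwards [hBβ, hην, κ.open_source.mem_nhds hw₀,
      eventually_injective_framedMap hB.continuousAt hη.continuousAt hinj] with w h1 h2 h3 h4
    have hA := bijective_mfderiv_of_smooth hκ hκ' h3
    have h5 := (injective_framedMap_of_comp (F := F) (E := E) hA h1 h2).1 h4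
    exact ⟨h5, kernel_vector_comp (F := F) (E := E) hA h1 h2 h5 (hker _)⟩
  refine ⟨h1, contMDiffAt_pushforward hκ hκ' hw₀ (contDiffAt_kernel_vector hB hη hinj) ?_⟩
  filter_upwards [h1] with w hw
  exact hw.2

end KernelField

section HamiltonianField

variable {E : Type*} [NormedAddCommGroup E] [NormedSpace ℝ E] [FiniteDimensional ℝ E]
  {M : Type*} [TopologicalSpace M] [ChartedSpace E M]

theorem DiffForm.mem_ker_iff {σ : DiffForm 𝓘(ℝ, E) M 2} {x : M} {v : E} :
    v ∈ (σ.ker x : Submodule ℝ (TangentSpace 𝓘(ℝ, E) x)) ↔ σ.bilin x v = 0 := by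
  constructor
  · intro h
    ext w
    exact h w
  · intro h w
    exact congrArg (fun L : E →L[ℝ] ℝ => L w) h

theorem DiffForm.IsHamiltonian.exists_ne_zero {σ : DiffForm 𝓘(ℝ, E) M 2} (hσ : σ.IsHamiltonian)
    (x : M) : ∃ v : E, v ≠ 0 ∧ σ.bilin x v = 0 := by
  have h := hσ.maximal_rank x
  have h1 : σ.ker x ≠ ⊥ := by
    intro h0
    rw [h0, finrank_bot] at h
    exact zero_ne_one h
  obtain ⟨v, hv, hv0⟩ := Submodule.exists_mem_ne_zero_of_ne_bot h1
  exact ⟨v, hv0, DiffForm.mem_ker_iff.1 hv⟩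

end HamiltonianField


/-! ### Cut-offs and transverse vector fields -/

section CutOff

variable {E : Type*} [NormedAddCommGroup E] [NormedSpace ℝ E] [FiniteDimensional ℝ E]
  {M : Type*} [TopologicalSpace M] [ChartedSpace E M] [IsManifold 𝓘(ℝ, E) ∞ M]

/-- A smooth cut-off function. -/
theorem exists_smooth_cutoff [T2Space M] [SecondCountableTopology M] {K U : Set M}
    (hK : IsCompact K) (hU : IsOpen U) (hKU : K ⊆ U) :
    ∃ (χ : M → ℝ) (L : Set M), ContMDiff 𝓘(ℝ, E) 𝓘(ℝ, ℝ) ∞ χ ∧ IsCompact L ∧ L ⊆ U ∧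
      (∀ x ∉ L, χ x = 0) ∧ ∀ᶠ x in 𝓝ˢ K, χ x = 1 := by
  have : LocallyCompactSpace E := inferInstance
  have : LocallyCompactSpace M := ChartedSpace.locallyCompactSpace E M
  obtain ⟨L, hL, hKL, hLU⟩ := exists_compact_between hK hU hKU
  obtain ⟨χ, h1, h0, -⟩ := exists_contMDiffMap_one_nhds_of_subset_interior (n := ⊤) 𝓘(ℝ, E)
    hK.isClosed hKL
  exact ⟨χ, L, χ.contMDiff, hL, hLU, h0, h1⟩

/-- The field may be arbitrary off `U`: the product is zero on the complement of `L`, which is open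
and together with `U` covers the manifold. -/
theorem contMDiff_smul_of_cutoff [T2Space M] {χ : M → ℝ} {L U : Set M}
    (hχ : ContMDiff 𝓘(ℝ, E) 𝓘(ℝ, ℝ) ∞ χ) (hL : IsCompact L) (hLU : L ⊆ U)
    (h0 : ∀ x ∉ L, χ x = 0) {X : ∀ x : M, TangentSpace 𝓘(ℝ, E) x}
    (hX : ∀ x ∈ U, ContMDiffAt 𝓘(ℝ, E) 𝓘(ℝ, E).tangent ∞
      (fun x => (⟨x, X x⟩ : TangentBundle 𝓘(ℝ, E) M)) x) :
    ContMDiff 𝓘(ℝ, E) 𝓘(ℝ, E).tangent ∞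
      (fun x => (⟨x, χ x • X x⟩ : TangentBundle 𝓘(ℝ, E) M)) := by
  intro x
  by_cases hx : x ∈ L
  · exact ContMDiffAt.smul_section hχ.contMDiffAt (hX x (hLU hx))
  · have hz : ContMDiffAt 𝓘(ℝ, E) 𝓘(ℝ, E).tangent ∞
        (zeroSection E (TangentSpace 𝓘(ℝ, E) : M → Type _)) x :=
      (contMDiff_zeroSection ℝ (TangentSpace 𝓘(ℝ, E) : M → Type _)).contMDiffAt
    refine hz.congr_of_eventuallyEq ?_
    filter_upwards [hL.isClosed.isOpen_compl.mem_nhds hx] with y hy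
    rw [h0 y hy, zero_smul]
    rfl

end CutOff

section Transverse

variable {E : Type*} [NormedAddCommGroup E] [NormedSpace ℝ E] [FiniteDimensional ℝ E]
  {W : Type*} [TopologicalSpace W] [ChartedSpace E W] [IsManifold 𝓘(ℝ, E) ∞ W]
  {F : Type*} [NormedAddCommGroup F] [NormedSpace ℝ F] [FiniteDimensional ℝ F]
  {N : Type*} [TopologicalSpace N] [ChartedSpace F N] [IsManifold 𝓘(ℝ, F) ∞ N]

/-- In the chart `ψ`, pairing a constant vector with the image of a vector. -/
theorem DiffForm.inChart_pair (Ω : DiffForm 𝓘(ℝ, E) W 2) {g : N → W}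
    (hg : ContMDiff 𝓘(ℝ, F) 𝓘(ℝ, E) ∞ g) {ψ : OpenPartialHomeomorph W E}
    (hψ : ψ ∈ IsManifold.maximalAtlas 𝓘(ℝ, E) ∞ W) {p : N} (hp : g p ∈ ψ.source) (v : E) (a : F) :
    Ω.bilin (g p) (mfderiv 𝓘(ℝ, E) 𝓘(ℝ, E) ψ.symm (ψ (g p)) v)
        (mfderiv 𝓘(ℝ, F) 𝓘(ℝ, E) g p a) =
      altBilin E (Ω.inChart ψ (ψ (g p))) v (mfderiv 𝓘(ℝ, F) 𝓘(ℝ, E) (ψ ∘ g) p a) := by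
  have hd : ψ.MDifferentiable 𝓘(ℝ, E) 𝓘(ℝ, E) :=
    ⟨(contMDiffOn_of_mem_maximalAtlas hψ).mdifferentiableOn (by simp),
      (contMDiffOn_symm_of_mem_maximalAtlas hψ).mdifferentiableOn (by simp)⟩
  have hgm : MDifferentiableAt 𝓘(ℝ, F) 𝓘(ℝ, E) g p := hg.mdifferentiable (by simp) _
  have h2 : (mfderiv 𝓘(ℝ, E) 𝓘(ℝ, E) ψ.symm (ψ (g p)) : E →L[ℝ] E)
      (mfderiv 𝓘(ℝ, F) 𝓘(ℝ, E) (ψ ∘ g) p a) = mfderiv 𝓘(ℝ, F) 𝓘(ℝ, E) g p a := by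
    rw [mfderiv_comp p (hd.mdifferentiableAt hp) hgm]
    exact congrArg (fun L : E →L[ℝ] E => L (mfderiv 𝓘(ℝ, F) 𝓘(ℝ, E) g p a)) (hd.symm_comp_deriv hp)
  have h3 : altBilin E (Ω.inChart ψ (ψ (g p))) v (mfderiv 𝓘(ℝ, F) 𝓘(ℝ, E) (ψ ∘ g) p a) =
      Ω.bilin (ψ.symm (ψ (g p))) (mfderiv 𝓘(ℝ, E) 𝓘(ℝ, E) ψ.symm (ψ (g p)) v)
      ((mfderiv 𝓘(ℝ, E) 𝓘(ℝ, E) ψ.symm (ψ (g p)) : E →L[ℝ] E)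
      (mfderiv 𝓘(ℝ, F) 𝓘(ℝ, E) (ψ ∘ g) p a)) :=
    altBilin_comp (E := E) (F := E) (Ω (ψ.symm (ψ (g p)))) _ _ _
  rw [h3, h2, ψ.left_inv hp]

/-- Along a compact submanifold with a nonvanishing vector field there is a compactly supported
field that pairs positively with it. -/
theorem DiffForm.exists_transverse_field [T2Space W] [SecondCountableTopology W] [CompactSpace N]
    (Ω : DiffForm 𝓘(ℝ, E) W 2)
    (hΩ : Ω.IsSmooth) (hΩ' : ∀ x, Ω.ker x = ⊥) {g : N → W} (hg : ContMDiff 𝓘(ℝ, F) 𝓘(ℝ, E) ∞ g)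
    (hge : IsEmbedding g) (hgi : ∀ p, Function.Injective (mfderiv 𝓘(ℝ, F) 𝓘(ℝ, E) g p))
    {R : ∀ p : N, TangentSpace 𝓘(ℝ, F) p}
    (hR : ContMDiff 𝓘(ℝ, F) 𝓘(ℝ, F).tangent ∞ (fun p => (⟨p, R p⟩ : TangentBundle 𝓘(ℝ, F) N)))
    (hR0 : ∀ p, R p ≠ 0) :
    ∃ (V : ∀ x : W, TangentSpace 𝓘(ℝ, E) x) (K : Set W), IsCompact K ∧ (∀ x ∉ K, V x = 0) ∧
      ContMDiff 𝓘(ℝ, E) 𝓘(ℝ, E).tangent ∞ (fun x => (⟨x, V x⟩ : TangentBundle 𝓘(ℝ, E) W)) ∧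
      ∀ p, 0 < Ω.bilin (g p) (V (g p)) (mfderiv 𝓘(ℝ, F) 𝓘(ℝ, E) g p (R p)) := by
  have : LocallyCompactSpace W := ChartedSpace.locallyCompactSpace E W
  let w : N → E := fun p => mfderiv 𝓘(ℝ, F) 𝓘(ℝ, E) g p (R p)
  -- The condition is convex in `v` and is imposed only over the image of `g`. Local solutions can
  -- thus be glued by a partition of unity.
  let t : ∀ x : W, Set (TangentSpace 𝓘(ℝ, E) x) := fun x =>
    {v | ∀ p, g p = x → 0 < Ω.bilin x v (w p)}
  have ht : ∀ x, Convex ℝ (t x) := by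
    intro x v hv v' hv' a b ha hb hab p hp
    have h1 := hv p hp
    have h2 := hv' p hp
    have h3 : ∀ v v' : E, Ω.bilin x (a • v + b • v') (w p) =
        a * Ω.bilin x v (w p) + b * Ω.bilin x v' (w p) := fun v v' => by
      rw [map_add, map_smul, map_smul]; rfl
    refine lt_of_lt_of_eq ?_ (h3 v v').symm
    rcases ha.eq_or_lt with rfl | ha
    · have : b = 1 := by linarith
      subst this
      simpa using h2
    · have := mul_pos ha h1
      have := mul_nonneg hb h2.le
      linarith
  have hloc : ∀ x₀ : W, ∃ U ∈ 𝓝 x₀, ∃ s : (x : W) → TangentSpace 𝓘(ℝ, E) x,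
      ContMDiffOn 𝓘(ℝ, E) (𝓘(ℝ, E).prod 𝓘(ℝ, E)) ∞
        (fun x => (⟨x, s x⟩ : TangentBundle 𝓘(ℝ, E) W)) U ∧ ∀ y ∈ U, s y ∈ t y := by
    intro x₀
    by_cases hx₀ : x₀ ∈ range g
    · obtain ⟨p₀, rfl⟩ := hx₀
      set ψ := chartAt E (g p₀)
      have hψ : ψ ∈ IsManifold.maximalAtlas 𝓘(ℝ, E) ∞ W := IsManifold.chart_mem_maximalAtlas _
      have hpψ : g p₀ ∈ ψ.source := mem_chart_source E (g p₀)
      have hψt : ψ (g p₀) ∈ ψ.target := ψ.map_source hpψ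
      have hw : w p₀ ≠ 0 := fun h => hR0 p₀ (hgi p₀ (h.trans (map_zero _).symm))
      -- If no vector paired positively with `w p₀`, then replacing `v` by `-v` would put `w p₀` in
      -- the kernel of the nondegenerate form.
      obtain ⟨v₁, hv₁⟩ : ∃ v₁ : E, 0 < Ω.bilin (g p₀) v₁ (w p₀) := by
        by_contra! hcon
        apply hw
        have h1 : w p₀ ∈ (Ω.ker (g p₀) : Submodule ℝ (TangentSpace 𝓘(ℝ, E) (g p₀))) := by
          rw [DiffForm.mem_ker_iff]
          ext v
          have h2 := hcon v
          have h3 := hcon (-v)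
          rw [map_neg, neg_apply] at h3
          have h4 := Ω.bilin_swap (g p₀) (w p₀) v
          change Ω.bilin (g p₀) (w p₀) v = 0
          linarith
        rw [hΩ'] at h1
        exact h1
      have hd : ψ.MDifferentiable 𝓘(ℝ, E) 𝓘(ℝ, E) :=
        ⟨(contMDiffOn_of_mem_maximalAtlas hψ).mdifferentiableOn (by simp),
          (contMDiffOn_symm_of_mem_maximalAtlas hψ).mdifferentiableOn (by simp)⟩
      -- The vector `v₁` is extended to a field that is constant in the chart. Its pairing with `w`,
      -- as a function on `N`, is then the continuous function `q`.
      let v₀ : E := mfderiv 𝓘(ℝ, E) 𝓘(ℝ, E) ψ (g p₀) v₁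
      let s : (x : W) → TangentSpace 𝓘(ℝ, E) x := fun x =>
        (mfderiv 𝓘(ℝ, E) 𝓘(ℝ, E) ψ.symm (ψ x) v₀ : E)
      let q : N → ℝ := fun p => altBilin E (Ω.inChart ψ (ψ (g p))) v₀
        (mfderiv 𝓘(ℝ, F) 𝓘(ℝ, E) (ψ ∘ g) p (R p))
      have hO : IsOpen (g ⁻¹' ψ.source) := ψ.open_source.preimage hg.continuous
      have hψg : ContMDiffOn 𝓘(ℝ, F) 𝓘(ℝ, E) ∞ (ψ ∘ g) (g ⁻¹' ψ.source) :=
        (contMDiffOn_of_mem_maximalAtlas hψ).comp hg.contMDiffOn fun p hp => hp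
      have hq : ContinuousAt q p₀ := by
        have c1 : ContinuousAt (fun p => altBilin E (Ω.inChart ψ (ψ (g p)))) p₀ := by
          have h1 := (hΩ ψ hψ).contDiffAt (ψ.open_target.mem_nhds hψt)
          have h2 := (contDiff_altBilin (n := ∞) (E := E)).contDiffAt.comp (ψ (g p₀)) h1
          exact ContinuousAt.comp (f := fun p => ψ (g p)) h2.continuousAt
            (hψg.continuousOn.continuousAt (hO.mem_nhds hpψ))
        have c2 := (hψg.mfderiv_apply_field hO hR.contMDiffOn).continuousOn.continuousAt
          (hO.mem_nhds hpψ)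
        exact (c1.clm_apply continuousAt_const).clm_apply c2
      have hqeq : ∀ p, g p ∈ ψ.source → Ω.bilin (g p) (s (g p)) (w p) = q p := fun p hp =>
        Ω.inChart_pair hg hψ hp v₀ (R p)
      have hs₀ : s (g p₀) = v₁ :=
        congrArg (fun L : E →L[ℝ] E => L v₁) (hd.symm_comp_deriv hpψ)
      have hq₀ : 0 < q p₀ := by
        rw [← hqeq p₀ hpψ, hs₀]
        exact hv₁
      have hev : ∀ᶠ p in 𝓝 p₀, 0 < q p := hq.eventually (lt_mem_nhds hq₀)
      -- Since `g` is an embedding, positivity near `p₀` in `N` holds at all points of `N` whose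
      -- image is close to `g p₀`; no other sheet of the image comes near.
      rw [hge.nhds_eq_comap, eventually_comap] at hev
      refine ⟨_, inter_mem hev (ψ.open_source.mem_nhds hpψ), s, ?_, ?_⟩
      · intro x hx
        refine ContMDiffAt.contMDiffWithinAt ?_
        have h1 := contMDiffAt_pushforward (κ := ψ.symm)
          (contMDiffOn_symm_of_mem_maximalAtlas hψ) (contMDiffOn_of_mem_maximalAtlas hψ)
          (w₀ := ψ x) (ψ.map_source hx.2) (v := fun _ => v₀) contDiffAt_const (X := s) (by
            filter_upwards [ψ.open_target.mem_nhds (ψ.map_source hx.2)] with u hu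
            change (mfderiv 𝓘(ℝ, E) 𝓘(ℝ, E) ψ.symm (ψ (ψ.symm u)) v₀ : E) = _
            rw [ψ.right_inv hu])
        rwa [ψ.left_inv hx.2] at h1
      · intro y hy p hp
        subst hp
        rw [hqeq p hy.2]
        exact hy.1 p rfl
    · refine ⟨(range g)ᶜ, (isCompact_range hg.continuous).isClosed.isOpen_compl.mem_nhds hx₀,
        fun _ => 0, ?_, fun y hy p hp => absurd ⟨p, hp⟩ hy⟩
      exact (contMDiff_zeroSection ℝ (TangentSpace 𝓘(ℝ, E) : W → Type _)).contMDiffOn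
  obtain ⟨s, hs⟩ := exists_contMDiffSection_forall_mem_convex_of_local (n := ⊤) 𝓘(ℝ, E)
    (fun x : W => TangentSpace 𝓘(ℝ, E) x) t ht hloc
  obtain ⟨χ, L, hχ, hL, -, h0, h1⟩ := exists_smooth_cutoff (E := E) (isCompact_range hg.continuous)
    isOpen_univ (subset_univ _)
  refine ⟨fun x => χ x • s x, L, hL, fun x hx => (congrArg (· • s x) (h0 x hx)).trans (zero_smul ℝ _),
    contMDiff_smul_of_cutoff hχ hL (subset_univ _) h0 (fun x _ => s.contMDiff x), fun p => ?_⟩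
  have h2 : χ (g p) = 1 := h1.self_of_nhdsSet _ (mem_range_self p)
  have h3 : χ (g p) • s (g p) = s (g p) := by rw [h2, one_smul]
  change 0 < Ω.bilin (g p) (χ (g p) • s (g p)) (w p)
  rw [h3]
  exact hs (g p) p rfl

end Transverse


/-! ### The linearisation of the characteristic field of a perturbed hypersurface -/

section Linearisation

theorem hasDerivAt_bilin_comp {Y : Type*} [NormedAddCommGroup Y] [NormedSpace ℝ Y]
    {B : Y → Y →L[ℝ] Y →L[ℝ] ℝ} {c ξ η : ℝ → Y} {c' ξ' η' : Y} {s : ℝ}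
    (hB : DifferentiableAt ℝ B (c s)) (hc : HasDerivAt c c' s) (hξ : HasDerivAt ξ ξ' s)
    (hη : HasDerivAt η η' s) :
    HasDerivAt (fun s => B (c s) (ξ s) (η s))
      (fderiv ℝ B (c s) c' (ξ s) (η s) + B (c s) ξ' (η s) + B (c s) (ξ s) η') s := by
  have h1 : HasDerivAt (fun s => B (c s)) (fderiv ℝ B (c s) c') s :=
    HasFDerivAt.comp_hasDerivAt (E := Y →L[ℝ] Y →L[ℝ] ℝ) (l := B) (l' := fderiv ℝ B (c s)) s
      hB.hasFDerivAt hc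
  exact (h1.clm_apply hξ).clm_apply hη

variable {E : Type*} [NormedAddCommGroup E] [NormedSpace ℝ E]
  {Z : Type*} [NormedAddCommGroup Z] [NormedSpace ℝ Z]

/-- Let `B` be a two-form on `E × Z × ℝ` which splits as `σ₀ + τ` along `{u₀} × Z × {0}`, and `X`
the normalised kernel field of its restriction to the graph of a function `h` on `Z` with
derivative `Q`. Then the derivative of `X` in the directions of `Z` at `(u₀, 0)` is given by the
Hamiltonian equations of `h`. -/
theorem fderiv_kernel_field_of_graph {B : E × Z × ℝ → (E × Z × ℝ) →L[ℝ] (E × Z × ℝ) →L[ℝ] ℝ}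
    {u₀ : E} (hB : DifferentiableAt ℝ B (u₀, 0, 0))
    (hBalt : ∀ u v, B (u₀, 0, 0) u v = - B (u₀, 0, 0) v u)
    {σ₀ : E →L[ℝ] E →L[ℝ] ℝ} {τ : Z →L[ℝ] Z →L[ℝ] ℝ}
    (hsplit : ∀ᶠ z in 𝓝 (0 : Z), ∀ (a a' : E) (ζ ζ' : Z),
      B (u₀, z, 0) (a, ζ, 0) (a', ζ', 0) = σ₀ a a' + τ ζ ζ')
    {R : E} (hR : σ₀ R = 0) (hR1 : B (u₀, 0, 0) (0, 0, 1) (R, 0, 0) = 1)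
    {h : Z → ℝ} {Q : Z →L[ℝ] Z →L[ℝ] ℝ} (h0 : h 0 = 0) (hh : ∀ᶠ z in 𝓝 0, HasFDerivAt h (Q z) z)
    {X : E × Z → E × Z} (hX : DifferentiableAt ℝ X (u₀, 0)) (hX0 : X (u₀, 0) = (R, 0))
    (hker : ∀ᶠ z in 𝓝 (0 : Z), ∀ (a' : E) (ζ' : Z),
      B (u₀, z, h z) ((X (u₀, z)).1, (X (u₀, z)).2, Q z (X (u₀, z)).2) (a', ζ', Q z ζ') = 0)
    {ν : E →L[ℝ] ℝ} (hν : ∀ᶠ z in 𝓝 (0 : Z), ν (X (u₀, z)).1 = 1)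
    (hνσ : ∀ a, σ₀ a = 0 → ν a = 0 → a = 0) (ζ : Z) :
    (fderiv ℝ X (u₀, 0) (0, ζ)).1 = 0 ∧
      ∀ ζ', τ (fderiv ℝ X (u₀, 0) (0, ζ)).2 ζ' = Q ζ ζ' := by
  set D := fderiv ℝ X (u₀, 0) (0, ζ)
  have hline : HasDerivAt (fun s : ℝ => s • ζ) ζ 0 := by
    simpa using (hasDerivAt_id (0 : ℝ)).smul_const ζ
  have htend : Tendsto (fun s : ℝ => s • ζ) (𝓝 0) (𝓝 0) := by
    have := hline.continuousAt.tendsto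
    simpa using this
  have hXs : HasDerivAt (fun s : ℝ => X (u₀, s • ζ)) D 0 := by
    have h1 : HasDerivAt (fun s : ℝ => (u₀, s • ζ)) ((0 : E), ζ) 0 :=
      (hasDerivAt_const (0 : ℝ) u₀).prodMk hline
    have h2 : HasFDerivAt X (fderiv ℝ X (u₀, 0)) (u₀, (0 : ℝ) • ζ) := by
      rw [zero_smul]; exact hX.hasFDerivAt
    exact h2.comp_hasDerivAt (0 : ℝ) h1
  have hX1 : HasDerivAt (fun s : ℝ => (X (u₀, s • ζ)).1) D.1 0 :=
    (ContinuousLinearMap.fst ℝ E Z).hasFDerivAt.comp_hasDerivAt (0 : ℝ) hXs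
  have hX2 : HasDerivAt (fun s : ℝ => (X (u₀, s • ζ)).2) D.2 0 :=
    (ContinuousLinearMap.snd ℝ E Z).hasFDerivAt.comp_hasDerivAt (0 : ℝ) hXs
  have hX20 : (X (u₀, (0 : ℝ) • ζ)).2 = 0 := by rw [zero_smul, hX0]
  have hX10 : (X (u₀, (0 : ℝ) • ζ)).1 = R := by rw [zero_smul, hX0]
  -- The normalising form `ν` does not depend on `z`, so the derivative of the normalisation is just
  -- `ν D.1`.
  have hν' : ν D.1 = 0 := by
    have h1 : HasDerivAt (fun s : ℝ => ν (X (u₀, s • ζ)).1) (ν D.1) 0 :=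
      ν.hasFDerivAt.comp_hasDerivAt (0 : ℝ) hX1
    refine h1.unique ((hasDerivAt_const (0 : ℝ) (1 : ℝ)).congr_of_eventuallyEq ?_)
    exact htend.eventually hν
  -- Being linear in `z`, the derivative `Q` vanishes at `0`. So the graph is tangent to the slice
  -- `t = 0` at the base point, and moving along it to first order is moving in that slice.
  have hhs : HasDerivAt (fun s : ℝ => h (s • ζ)) 0 0 := by
    have h1 : HasFDerivAt h (Q 0) ((0 : ℝ) • ζ) := by
      rw [zero_smul]; exact hh.self_of_nhds
    have h2 := h1.comp_hasDerivAt (0 : ℝ) hline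
    rwa [map_zero, zero_apply] at h2
  have hc : HasDerivAt (fun s : ℝ => (u₀, s • ζ, h (s • ζ))) ((0 : E), ζ, (0 : ℝ)) 0 :=
    (hasDerivAt_const (0 : ℝ) u₀).prodMk (hline.prodMk hhs)
  have hc0 : HasDerivAt (fun s : ℝ => (u₀, s • ζ, (0 : ℝ))) ((0 : E), ζ, (0 : ℝ)) 0 :=
    (hasDerivAt_const (0 : ℝ) u₀).prodMk (hline.prodMk (hasDerivAt_const (0 : ℝ) (0 : ℝ)))
  have key : ∀ (a' : E) (ζ' : Z), σ₀ D.1 a' + τ D.2 ζ' = Q ζ ζ' := by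
    intro a' ζ'
    -- On the slice `t = 0` the split form annihilates `(R, 0, 0)` at every `z`, hence so does its
    -- derivative in `z`. The unknown first derivatives of `B` therefore drop out.
    have hT1 : fderiv ℝ B (u₀, 0, 0) (0, ζ, 0) (R, 0, 0) (a', ζ', 0) = 0 := by
      have h1 : HasDerivAt (fun s : ℝ => B (u₀, s • ζ, 0) (R, 0, 0) (a', ζ', 0))
          (fderiv ℝ B (u₀, 0, 0) (0, ζ, 0) (R, 0, 0) (a', ζ', 0)) 0 := by
        have h2 := hasDerivAt_bilin_comp (B := B) (s := 0) (by rw [zero_smul]; exact hB) hc0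
          (hasDerivAt_const (0 : ℝ) ((R, 0, 0) : E × Z × ℝ))
          (hasDerivAt_const (0 : ℝ) ((a', ζ', 0) : E × Z × ℝ))
        rwa [zero_smul, map_zero, map_zero, zero_apply, add_zero, add_zero] at h2
      refine h1.unique ((hasDerivAt_const (0 : ℝ) (0 : ℝ)).congr_of_eventuallyEq ?_)
      filter_upwards [htend.eventually hsplit] with s hs
      rw [hs R a' 0 ζ', hR]
      simp
    have hQ : HasDerivAt (fun s : ℝ => Q (s • ζ)) (Q ζ) 0 :=
      Q.hasFDerivAt.comp_hasDerivAt (0 : ℝ) hline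
    have hξ : HasDerivAt (fun s : ℝ => ((X (u₀, s • ζ)).1, (X (u₀, s • ζ)).2,
        Q (s • ζ) (X (u₀, s • ζ)).2)) (D.1, D.2, (0 : ℝ)) 0 := by
      refine hX1.prodMk (hX2.prodMk ?_)
      have h1 := hQ.clm_apply hX2
      rw [hX20] at h1
      simpa using h1
    have hξ' : HasDerivAt (fun s : ℝ => (a', ζ', Q (s • ζ) ζ')) ((0 : E), (0 : Z), Q ζ ζ') 0 := by
      refine (hasDerivAt_const (0 : ℝ) a').prodMk ((hasDerivAt_const (0 : ℝ) ζ').prodMk ?_)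
      simpa using hQ.clm_apply (hasDerivAt_const (0 : ℝ) ζ')
    -- The kernel equation along `s ↦ (u₀, s ζ, h(s ζ))`, differentiated at `s = 0`. The three terms
    -- come from the base point, from the field, and from the test vector, whose last entry is `Q(s
    -- ζ) ζ'`.
    have hf := hasDerivAt_bilin_comp (B := B) (s := 0) (by rw [zero_smul, h0]; exact hB) hc hξ hξ'
    have hf0 := hf.unique ((hasDerivAt_const (0 : ℝ) (0 : ℝ)).congr_of_eventuallyEq (by
      filter_upwards [htend.eventually hker] with s hs
      exact hs a' ζ'))
    rw [hX10, hX20] at hf0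
    simp only [zero_smul, h0, map_zero, zero_apply] at hf0
    have hsp := hsplit.self_of_nhds D.1 a' D.2 ζ'
    -- Here the Hessian enters: the test vector tilts towards the time direction at the rate `Q ζ
    -- ζ'`, and `R` pairs to `-1` with that direction.
    have hlast : B (u₀, 0, 0) (R, 0, 0) (0, 0, Q ζ ζ') = - Q ζ ζ' := by
      have h1 : ((0, 0, Q ζ ζ') : E × Z × ℝ) = Q ζ ζ' • ((0, 0, 1) : E × Z × ℝ) := by simp
      rw [h1, map_smul, hBalt, hR1]
      simp
    rw [hT1, hsp, hlast] at hf0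
    linarith
  -- Taking `ζ' = 0` puts `D.1` in the kernel of `σ₀`, on which `ν` is injective.
  have hD1 : D.1 = 0 := by
    refine hνσ _ ?_ hν'
    ext a'
    simpa using key a' 0
  refine ⟨hD1, fun ζ' => ?_⟩
  simpa [hD1] using key 0 ζ'

end Linearisation


/-! ### The linearised flow -/

section Calculus

variable {E : Type*} [NormedAddCommGroup E] [NormedSpace ℝ E]
  {H : Type*} [NormedAddCommGroup H] [NormedSpace ℝ H]

/-- Exchange of the derivatives with respect to time and to the parameter. -/
theorem hasDerivAt_fderiv_param {Φ Y : ℝ × E → H} {t₀ : ℝ} {w₀ : E}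
    (hΦ : ContDiffAt ℝ ∞ Φ (t₀, w₀))
    (hY : ∀ᶠ q in 𝓝 (t₀, w₀), HasDerivAt (fun t => Φ (t, q.2)) (Y q) q.1) (v : E) :
    HasDerivAt (fun t => fderiv ℝ (fun w => Φ (t, w)) w₀ v)
      (fderiv ℝ (fun w => Y (t₀, w)) w₀ v) t₀ := by
  have hev : ∀ᶠ q in 𝓝 (t₀, w₀), DifferentiableAt ℝ Φ q := by
    filter_upwards [(hΦ.of_le (m := 1) (by simp)).eventually (by simp)] with q hq
    exact hq.differentiableAt (by simp)
  let D : ℝ × E → (ℝ × E) →L[ℝ] H := fderiv ℝ Φ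
  have hD : ContDiffAt ℝ ∞ D (t₀, w₀) := hΦ.fderiv_right (by simp)
  have hDd : HasFDerivAt D (fderiv ℝ D (t₀, w₀)) (t₀, w₀) :=
    (hD.differentiableAt (by simp)).hasFDerivAt
  -- The two sides of the claim are the mixed values of the second derivative of `Φ` on `(1, 0)` and
  -- `(0, v)`, taken in the two orders.
  have hsymm : IsSymmSndFDerivAt ℝ Φ (t₀, w₀) := hΦ.isSymmSndFDerivAt (by
    rw [minSmoothness_of_isRCLikeNormedField]
    exact WithTop.coe_le_coe.2 (le_top : (2 : ℕ∞) ≤ ⊤))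
  have hslice : ∀ q : ℝ × E, HasFDerivAt (fun w => (q.1, w)) (ContinuousLinearMap.inr ℝ ℝ E) q.2 :=
    fun q => hasFDerivAt_prodMk_right q.1 q.2
  have h1 : ∀ᶠ t in 𝓝 t₀, fderiv ℝ (fun w => Φ (t, w)) w₀ v = D (t, w₀) (0, v) := by
    have ht : Tendsto (fun t : ℝ => (t, w₀)) (𝓝 t₀) (𝓝 (t₀, w₀)) := by
      exact Continuous.tendsto (by fun_prop) t₀
    filter_upwards [ht.eventually hev] with t ht
    have h2 : HasFDerivAt (fun w => Φ (t, w)) ((D (t, w₀)).comp (ContinuousLinearMap.inr ℝ ℝ E))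
        w₀ := HasFDerivAt.comp w₀ (g := Φ) (f := fun w => (t, w)) ht.hasFDerivAt (hslice (t, w₀))
    rw [h2.fderiv]
    rfl
  have h3 : ∀ᶠ w in 𝓝 w₀, Y (t₀, w) = D (t₀, w) (1, 0) := by
    have hw : Tendsto (fun w : E => (t₀, w)) (𝓝 w₀) (𝓝 (t₀, w₀)) :=
      Continuous.tendsto (by fun_prop) w₀
    filter_upwards [hw.eventually hev, hw.eventually hY] with w hw hw'
    have h4 : HasDerivAt (fun t => Φ (t, w)) (D (t₀, w) (1, 0)) t₀ := by
      have h5 : HasDerivAt (fun t : ℝ => (t, w)) ((1 : ℝ), (0 : E)) t₀ :=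
        (hasDerivAt_id t₀).prodMk (hasDerivAt_const t₀ w)
      exact HasFDerivAt.comp_hasDerivAt (l := Φ) t₀ hw.hasFDerivAt h5
    exact hw'.unique h4
  have h6 : HasDerivAt (fun t => D (t, w₀) (0, v)) (fderiv ℝ D (t₀, w₀) (1, 0) (0, v)) t₀ := by
    have h5 : HasDerivAt (fun t : ℝ => (t, w₀)) ((1 : ℝ), (0 : E)) t₀ :=
      (hasDerivAt_id t₀).prodMk (hasDerivAt_const t₀ w₀)
    have h7 : HasDerivAt (fun t => D (t, w₀)) (fderiv ℝ D (t₀, w₀) (1, 0)) t₀ :=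
      HasFDerivAt.comp_hasDerivAt (E := (ℝ × E) →L[ℝ] H) (l := D) (l' := fderiv ℝ D (t₀, w₀)) t₀
        hDd h5
    simpa using h7.clm_apply (hasDerivAt_const t₀ ((0, v) : ℝ × E))
  have h8 : HasFDerivAt (fun w => D (t₀, w) (1, 0))
      (((ContinuousLinearMap.apply ℝ H ((1, 0) : ℝ × E)).comp (fderiv ℝ D (t₀, w₀))).comp
        (ContinuousLinearMap.inr ℝ ℝ E)) w₀ := by
    have h9 : HasFDerivAt (fun q => D q (1, 0))
        ((ContinuousLinearMap.apply ℝ H ((1, 0) : ℝ × E)).comp (fderiv ℝ D (t₀, w₀))) (t₀, w₀) :=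
      (ContinuousLinearMap.apply ℝ H ((1, 0) : ℝ × E)).hasFDerivAt.comp (t₀, w₀) hDd
    exact HasFDerivAt.comp w₀ (g := fun q => D q (1, 0)) (f := fun w => (t₀, w)) h9 (hslice (t₀, w₀))
  have h10 : fderiv ℝ (fun w => Y (t₀, w)) w₀ v = fderiv ℝ D (t₀, w₀) (1, 0) (0, v) := by
    rw [EventuallyEq.fderiv_eq h3, h8.fderiv]
    exact hsymm (0, v) (1, 0)
  rw [h10]
  exact h6.congr_of_eventuallyEq h1

/-- Exponential bound for a differential inequality. -/
theorem norm_le_exp_of_norm_deriv_le {J J' : ℝ → H} {ρ : ℝ} (hJ : ∀ t, HasDerivAt J (J' t) t)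
    (hb : ∀ t, ‖J' t‖ ≤ ρ * ‖J t‖) (t : ℝ) : ‖J t‖ ≤ Real.exp (ρ * |t|) * ‖J 0‖ := by
  have key : ∀ {J J' : ℝ → H}, (∀ t, HasDerivAt J (J' t) t) → (∀ t, ‖J' t‖ ≤ ρ * ‖J t‖) →
      ∀ t, 0 ≤ t → ‖J t‖ ≤ Real.exp (ρ * t) * ‖J 0‖ := by
    intro J J' hJ hb t ht
    have h := norm_le_gronwallBound_of_norm_deriv_right_le (f := J) (f' := J') (δ := ‖J 0‖) (K := ρ)
      (ε := 0) (a := 0) (b := t) (fun s _ => (hJ s).continuousAt.continuousWithinAt)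
      (fun s _ => (hJ s).hasDerivWithinAt) le_rfl (fun s _ => by simpa using hb s) t ⟨ht, le_rfl⟩
    rwa [gronwallBound_ε0, sub_zero, mul_comm] at h
  rcases le_total 0 t with ht | ht
  · rw [abs_of_nonneg ht]
    exact key hJ hb t ht
  · have h1 : ∀ s, HasDerivAt (fun s => J (-s)) (-J' (-s)) s := fun s => by
      have := (hJ (-s)).scomp s (hasDerivAt_neg s)
      rw [neg_smul, one_smul] at this
      exact this
    have h2 := key h1 (fun s => by simpa using hb (-s)) (-t) (by linarith)
    rw [abs_of_nonpos ht]
    simpa using h2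

/-- The scalar linear equation. -/
theorem eq_exp_of_hasDerivAt {q : ℝ → ℝ} {A : ℝ} (hq : ∀ t, HasDerivAt q (A * q t) t) (t : ℝ) :
    q t = Real.exp (A * t) * q 0 := by
  have h1 : ∀ t, HasDerivAt (fun t => Real.exp (-(A * t)) * q t) 0 t := fun t => by
    have h2 : HasDerivAt (fun t => Real.exp (-(A * t))) (Real.exp (-(A * t)) * (-(A * 1))) t :=
      (((hasDerivAt_id t).const_mul A).neg).exp
    exact (h2.mul (hq t)).congr_deriv (by ring)
  have h3 := is_const_of_deriv_eq_zero (fun t => (h1 t).differentiableAt) (fun t => (h1 t).deriv) t 0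
  simp only [mul_zero, neg_zero, Real.exp_zero, one_mul] at h3
  rw [← h3, ← mul_assoc, ← Real.exp_add]
  simp

end Calculus

section LinearisedFlow

variable {E : Type} [NormedAddCommGroup E] [NormedSpace ℝ E] [FiniteDimensional ℝ E]
  {M : Type*} [TopologicalSpace M] [ChartedSpace E M] [IsManifold 𝓘(ℝ, E) ∞ M]
  {H : Type*} [NormedAddCommGroup H] [NormedSpace ℝ H]

theorem IsGlobalFlow.contMDiff_time {X : ∀ x : M, TangentSpace 𝓘(ℝ, E) x} {φ : ℝ → M → M}
    (hφ : IsGlobalFlow X φ) (t : ℝ) : ContMDiff 𝓘(ℝ, E) 𝓘(ℝ, E) ∞ (φ t) :=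
  hφ.smooth.comp (contMDiff_const.prodMk contMDiff_id)

/-- The linearised flow, observed through a function `Γ`. -/
theorem IsGlobalFlow.hasDerivAt_mfderiv {X : ∀ x : M, TangentSpace 𝓘(ℝ, E) x} {φ : ℝ → M → M}
    (hφ : IsGlobalFlow X φ)
    (hX : ContMDiff 𝓘(ℝ, E) 𝓘(ℝ, E).tangent ∞ (fun x => (⟨x, X x⟩ : TangentBundle 𝓘(ℝ, E) M)))
    {Γ : M → H} {U : Set M} (hU : IsOpen U) (hΓ : ContMDiffOn 𝓘(ℝ, E) 𝓘(ℝ, H) ∞ Γ U) {x : M}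
    {t : ℝ} (hx : φ t x ∈ U) (v : E) :
    HasDerivAt (fun t => (mfderiv 𝓘(ℝ, E) 𝓘(ℝ, H) Γ (φ t x)
        (mfderiv 𝓘(ℝ, E) 𝓘(ℝ, E) (φ t) x v) : H))
      (mfderiv 𝓘(ℝ, E) 𝓘(ℝ, H) (fun y => (mfderiv 𝓘(ℝ, E) 𝓘(ℝ, H) Γ y (X y) : H)) (φ t x)
        (mfderiv 𝓘(ℝ, E) 𝓘(ℝ, E) (φ t) x v)) t := by
  set c := chartAt E x
  have hc : c ∈ IsManifold.maximalAtlas 𝓘(ℝ, E) ∞ M := IsManifold.chart_mem_maximalAtlas _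
  have hxc : x ∈ c.source := mem_chart_source E x
  have hcx : c x ∈ c.target := c.map_source hxc
  have hcs : ContMDiffAt 𝓘(ℝ, E) 𝓘(ℝ, E) ∞ c.symm (c x) :=
    contMDiffAt_symm_of_mem_maximalAtlas hc hcx
  have hd : c.MDifferentiable 𝓘(ℝ, E) 𝓘(ℝ, E) :=
    ⟨(contMDiffOn_of_mem_maximalAtlas hc).mdifferentiableOn (by simp),
      (contMDiffOn_symm_of_mem_maximalAtlas hc).mdifferentiableOn (by simp)⟩
  let v' : E := mfderiv 𝓘(ℝ, E) 𝓘(ℝ, E) c x v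
  let y : M → H := fun y => mfderiv 𝓘(ℝ, E) 𝓘(ℝ, H) Γ y (X y)
  have hy : ContMDiffOn 𝓘(ℝ, E) 𝓘(ℝ, H) ∞ y U := hΓ.mfderiv_apply_field hU hX.contMDiffOn
  -- A chart is used only for the initial point, and the trajectory may leave it. The target needs
  -- no chart because `Γ` takes values in a vector space, so the computation is one of Euclidean
  -- calculus.
  let T : ℝ × E → M := fun q => φ q.1 (c.symm q.2)
  have hlx : c.symm (c x) = x := c.left_inv hxc
  have hT : ∀ q : ℝ × E, q.2 ∈ c.target → ContMDiffAt 𝓘(ℝ, ℝ × E) 𝓘(ℝ, E) ∞ T q := by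
    intro q hq
    have h1 : ContMDiffAt 𝓘(ℝ, ℝ × E) 𝓘(ℝ, E) ∞ (fun q : ℝ × E => c.symm q.2) q :=
      (contMDiffAt_symm_of_mem_maximalAtlas hc hq).comp q contDiff_snd.contMDiff.contMDiffAt
    have h2 : ContMDiffAt 𝓘(ℝ, ℝ × E) 𝓘(ℝ, ℝ) ∞ (fun q : ℝ × E => q.1) q :=
      contDiff_fst.contMDiff.contMDiffAt
    exact (hφ.smooth.contMDiffAt (x := (q.1, c.symm q.2))).comp q (h2.prodMk h1)
  have hTx : T (t, c x) = φ t x := by simp only [T, hlx]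
  have hTU : ∀ᶠ q in 𝓝 (t, c x), T q ∈ U ∧ q.2 ∈ c.target := by
    refine ((hT (t, c x) hcx).continuousAt.eventually ?_).and ?_
    · rw [hTx]; exact hU.mem_nhds hx
    · exact continuous_snd.continuousAt.eventually (c.open_target.mem_nhds hcx)
  have hΦ : ContDiffAt ℝ ∞ (fun q => Γ (T q)) (t, c x) := by
    refine ContMDiffAt.contDiffAt ?_
    refine ContMDiffAt.comp (t, c x) (g := Γ) ?_ (hT (t, c x) hcx)
    rw [hTx]
    exact hΓ.contMDiffAt (hU.mem_nhds hx)
  have hY : ∀ᶠ q in 𝓝 (t, c x), HasDerivAt (fun t => Γ (T (t, q.2))) (y (T q)) q.1 := by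
    filter_upwards [hTU] with q hq
    have h1 := hφ.integral (c.symm q.2) q.1
    have h2 : HasMFDerivAt 𝓘(ℝ, E) 𝓘(ℝ, H) Γ (T q) (mfderiv 𝓘(ℝ, E) 𝓘(ℝ, H) Γ (T q)) :=
      ((hΓ.contMDiffAt (hU.mem_nhds hq.1)).mdifferentiableAt (by simp)).hasMFDerivAt
    have h3 := HasMFDerivAt.comp q.1 (g := Γ) (f := fun t => φ t (c.symm q.2)) h2 h1
    let A : E →L[ℝ] H := mfderiv 𝓘(ℝ, E) 𝓘(ℝ, H) Γ (T q)
    let b : E := X (T q)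
    have h4 : HasFDerivAt (fun t => Γ (T (t, q.2)))
        (A.comp (ContinuousLinearMap.smulRight (1 : ℝ →L[ℝ] ℝ) b)) q.1 :=
      hasMFDerivAt_iff_hasFDerivAt.1 h3
    have h5 : (A.comp (ContinuousLinearMap.smulRight (1 : ℝ →L[ℝ] ℝ) b)) 1 = A b := by simp
    have h6 := h4.hasDerivAt
    rw [h5] at h6
    exact h6
  have hmain := hasDerivAt_fderiv_param hΦ hY v'
  have hslice : ∀ s : ℝ, MDifferentiableAt 𝓘(ℝ, E) 𝓘(ℝ, E) (fun w => T (s, w)) (c x) := fun s =>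
    (((hφ.contMDiff_time s).contMDiffAt).comp (c x) hcs).mdifferentiableAt (by simp)
  have hsd : ∀ s : ℝ, (mfderiv 𝓘(ℝ, E) 𝓘(ℝ, E) (fun w => T (s, w)) (c x) v' : E) =
      mfderiv 𝓘(ℝ, E) 𝓘(ℝ, E) (φ s) x v := by
    intro s
    have h1 : mfderiv 𝓘(ℝ, E) 𝓘(ℝ, E) (φ s ∘ c.symm) (c x) =
        (mfderiv 𝓘(ℝ, E) 𝓘(ℝ, E) (φ s) (c.symm (c x))).comp
          (mfderiv 𝓘(ℝ, E) 𝓘(ℝ, E) c.symm (c x)) :=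
      mfderiv_comp (c x) (((hφ.contMDiff_time s).mdifferentiable (by simp)) _)
        (hcs.mdifferentiableAt (by simp))
    have h2 : (mfderiv 𝓘(ℝ, E) 𝓘(ℝ, E) c.symm (c x) : E →L[ℝ] E) v' = v :=
      congrArg (fun L : E →L[ℝ] E => L v) (hd.symm_comp_deriv hxc)
    have h3 := congrArg (fun L : E →L[ℝ] E => L v') h1
    refine h3.trans ?_
    change (mfderiv 𝓘(ℝ, E) 𝓘(ℝ, E) (φ s) (c.symm (c x)) : E →L[ℝ] E)
      ((mfderiv 𝓘(ℝ, E) 𝓘(ℝ, E) c.symm (c x) : E →L[ℝ] E) v') = _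
    rw [h2, hlx]
  have hchain : ∀ (G : M → H) (s : ℝ), MDifferentiableAt 𝓘(ℝ, E) 𝓘(ℝ, H) G (φ s x) →
      fderiv ℝ (fun w => G (T (s, w))) (c x) v' =
        (mfderiv 𝓘(ℝ, E) 𝓘(ℝ, H) G (φ s x) (mfderiv 𝓘(ℝ, E) 𝓘(ℝ, E) (φ s) x v) : H) := by
    intro G s hG
    have hTs : T (s, c x) = φ s x := by simp only [T, hlx]
    rw [← hTs] at hG
    have h1 := mfderiv_comp (c x) (f := fun w => T (s, w)) hG (hslice s)
    rw [mfderiv_eq_fderiv] at h1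
    have h2 := congrArg (fun L : E →L[ℝ] H => L v') h1
    refine h2.trans ?_
    change (mfderiv 𝓘(ℝ, E) 𝓘(ℝ, H) G (T (s, c x)) : E →L[ℝ] H)
      (mfderiv 𝓘(ℝ, E) 𝓘(ℝ, E) (fun w => T (s, w)) (c x) v' : E) = _
    rw [hsd s, hTs]
  have hev : ∀ᶠ s in 𝓝 t, φ s x ∈ U := by
    have h1 : Continuous fun s => φ s x := hφ.smooth.continuous.comp
      (continuous_id.prodMk continuous_const)
    exact h1.continuousAt.eventually (hU.mem_nhds hx)
  have h5 := hchain y t ((hy.contMDiffAt (hU.mem_nhds hx)).mdifferentiableAt (by simp))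
  rw [h5] at hmain
  refine hmain.congr_of_eventuallyEq ?_
  filter_upwards [hev] with s hs
  exact (hchain Γ s ((hΓ.contMDiffAt (hU.mem_nhds hs)).mdifferentiableAt (by simp))).symm

end LinearisedFlow


/-! ### Comparison of norms along a compact set -/

section ModelDerivative

variable (E : Type*) [NormedAddCommGroup E] [NormedSpace ℝ E]
  (E' : Type*) [NormedAddCommGroup E'] [NormedSpace ℝ E']
  {M' : Type*} [TopologicalSpace M'] [ChartedSpace E' M']
  {M : Type*} [TopologicalSpace M] [ChartedSpace E M]

/-- The derivative of a map between manifolds, as a linear map between the model spaces. -/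
noncomputable def tderiv (f : M → M') (x : M) : E →L[ℝ] E' := mfderiv 𝓘(ℝ, E) 𝓘(ℝ, E') f x

end ModelDerivative

section Norms

/-- By homogeneity it suffices to compare on the unit sphere. There the ratio at `w₀` is bounded by
compactness, and a strict inequality persists for nearby `w`, uniformly on the sphere. -/
theorem eventually_le_of_homogeneous {T : Type*} [TopologicalSpace T] {E : Type*}
    [NormedAddCommGroup E] [NormedSpace ℝ E] [FiniteDimensional ℝ E] {a b : T × E → ℝ} {w₀ : T}
    (ha : ∀ v, ContinuousAt a (w₀, v)) (hb : ∀ v, ContinuousAt b (w₀, v))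
    (hah : ∀ w v (c : ℝ), a (w, c • v) = |c| * a (w, v))
    (hbh : ∀ w v (c : ℝ), b (w, c • v) = |c| * b (w, v)) (hpos : ∀ v ≠ 0, 0 < b (w₀, v)) :
    ∃ C > 0, ∀ᶠ w in 𝓝 w₀, ∀ v, a (w, v) ≤ C * b (w, v) := by
  have hK : IsCompact (Metric.sphere (0 : E) 1) := isCompact_sphere 0 1
  have hne : ∀ v ∈ Metric.sphere (0 : E) 1, v ≠ 0 := fun v hv h => by
    simp [h] at hv
  have hcont : ContinuousOn (fun v => a (w₀, v) / b (w₀, v)) (Metric.sphere (0 : E) 1) := by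
    intro v hv
    have hs : ContinuousAt (fun v : E => (w₀, v)) v := by fun_prop
    exact (((ha v).comp hs).div ((hb v).comp hs) (hpos v (hne v hv)).ne').continuousWithinAt
  obtain ⟨C, hC⟩ := hK.exists_bound_of_continuousOn hcont
  -- Adding one makes the inequality at `w₀` strict, hence stable.
  refine ⟨|C| + 1, by positivity, ?_⟩
  have hev : ∀ v ∈ Metric.sphere (0 : E) 1, ∀ᶠ q in 𝓝 w₀ ×ˢ 𝓝 v,
      a (q.1, q.2) < (|C| + 1) * b (q.1, q.2) := by
    intro v hv
    rw [← nhds_prod_eq]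
    have h1 : a (w₀, v) < (|C| + 1) * b (w₀, v) := by
      have h2 := hC v hv
      have h3 := hpos v (hne v hv)
      rw [Real.norm_eq_abs, abs_div, abs_of_pos h3, div_le_iff₀ h3] at h2
      have h4 := le_abs_self (a (w₀, v))
      have h5 : C * b (w₀, v) ≤ |C| * b (w₀, v) := mul_le_mul_of_nonneg_right (le_abs_self C) h3.le
      linarith
    exact (ha v).eventually_lt (continuousAt_const.mul (hb v)) h1
  have hall := hK.eventually_forall_of_forall_eventually (x₀ := w₀)
    (P := fun w v => a (w, v) < (|C| + 1) * b (w, v)) (fun v hv => by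
      rw [nhds_prod_eq]; exact hev v hv)
  filter_upwards [hall] with w hw v
  by_cases hv : v = 0
  · have h1 := hah w v 0
    have h2 := hbh w v 0
    subst hv
    simp only [smul_zero, abs_zero, zero_mul] at h1 h2
    rw [h1, h2, mul_zero]
  · have hn : 0 < ‖v‖ := norm_pos_iff.2 hv
    have hu : ‖v‖⁻¹ • v ∈ Metric.sphere (0 : E) 1 := by
      simp [norm_smul, hn.ne']
    have h1 := (hw _ hu).le
    rw [hah, hbh, abs_of_pos (inv_pos.2 hn)] at h1
    have h2 := mul_le_mul_of_nonneg_left h1 hn.le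
    rw [← mul_assoc, mul_inv_cancel₀ hn.ne', one_mul] at h2
    calc a (w, v) ≤ _ := h2
      _ = (|C| + 1) * b (w, v) := by field_simp

variable {E : Type*} [NormedAddCommGroup E] [NormedSpace ℝ E] [FiniteDimensional ℝ E]
  {M : Type*} [TopologicalSpace M] [ChartedSpace E M] [IsManifold 𝓘(ℝ, E) ∞ M]
  {H : Type*} [NormedAddCommGroup H] [NormedSpace ℝ H]

theorem metricNorm_smul (g : ContinuousRiemannianMetric E (fun x : M => TangentSpace 𝓘(ℝ, E) x))
    {x : M} (c : ℝ) (v : TangentSpace 𝓘(ℝ, E) x) : metricNorm g (c • v) = |c| * metricNorm g v := by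
  unfold metricNorm
  have h : g.inner x (c • v) (c • v) = c ^ 2 * g.inner x v v := by
    have h1 := (g.inner x (c • v)).map_smul c v
    have h2 := congrArg (fun L : TangentSpace 𝓘(ℝ, E) x →L[ℝ] ℝ => L v) ((g.inner x).map_smul c v)
    refine h1.trans ((congrArg (c • ·) h2).trans ?_)
    change c * (c * g.inner x v v) = _
    ring
  rw [h, Real.sqrt_mul (sq_nonneg c), Real.sqrt_sq_eq_abs]

theorem metricNorm_nonneg (g : ContinuousRiemannianMetric E (fun x : M => TangentSpace 𝓘(ℝ, E) x))
    {x : M} (v : TangentSpace 𝓘(ℝ, E) x) : 0 ≤ metricNorm g v := Real.sqrt_nonneg _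

theorem continuous_metricNorm
    (g : ContinuousRiemannianMetric E (fun x : M => TangentSpace 𝓘(ℝ, E) x)) :
    Continuous (fun q : TangentBundle 𝓘(ℝ, E) M => metricNorm g q.2) := by
  refine Real.continuous_sqrt.comp ?_
  rw [continuous_iff_continuousAt]
  intro q
  have hid : ContinuousAt (fun q : TangentBundle 𝓘(ℝ, E) M =>
      (⟨q.1, q.2⟩ : TangentBundle 𝓘(ℝ, E) M)) q := continuousAt_id
  have hb : ContinuousAt (fun q : TangentBundle 𝓘(ℝ, E) M => q.1) q :=
    (FiberBundle.continuous_proj E (TangentSpace 𝓘(ℝ, E) : M → Type _)).continuousAt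
  have h1 : ContinuousAt (fun q : TangentBundle 𝓘(ℝ, E) M =>
      TotalSpace.mk' ℝ (E := Bundle.Trivial M ℝ) q.1 (g.inner q.1 q.2 q.2)) q :=
    (ContinuousAt.comp (f := fun q : TangentBundle 𝓘(ℝ, E) M => q.1)
      g.continuous.continuousAt hb).clm_bundle_apply₂ (F₁ := E) (F₂ := E) hid hid
  simp only [FiberBundle.continuousAt_totalSpace] at h1
  exact h1.2

/-- Along a compact set, every Riemannian metric is comparable with the norm transported by a map
with injective derivative. -/
theorem exists_metricNorm_comparison
    (g : ContinuousRiemannianMetric E (fun x : M => TangentSpace 𝓘(ℝ, E) x)) {S U : Set M}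
    (hS : IsCompact S) (hU : IsOpen U) (hSU : S ⊆ U) {Γ : M → H}
    (hΓ : ContMDiffOn 𝓘(ℝ, E) 𝓘(ℝ, H) ∞ Γ U)
    (hinj : ∀ x ∈ S, ∀ v, tderiv E H Γ x v = 0 → v = 0) :
    ∃ C > 0, ∀ x ∈ S, ∀ v : TangentSpace 𝓘(ℝ, E) x,
      metricNorm g v ≤ C * ‖tderiv E H Γ x v‖ ∧
      ‖tderiv E H Γ x v‖ ≤ C * metricNorm g v := by
  refine hS.induction_on (p := fun S => ∃ C > 0, ∀ x ∈ S, ∀ v : TangentSpace 𝓘(ℝ, E) x,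
      metricNorm g v ≤ C * ‖tderiv E H Γ x v‖ ∧
      ‖tderiv E H Γ x v‖ ≤ C * metricNorm g v) ?_ ?_ ?_ ?_
  · exact ⟨1, one_pos, fun x hx => absurd hx (notMem_empty x)⟩
  · rintro s t hst ⟨C, hC, h⟩
    exact ⟨C, hC, fun x hx => h x (hst hx)⟩
  · rintro s t ⟨C, hC, h⟩ ⟨C', hC', h'⟩
    refine ⟨max C C', lt_max_of_lt_left hC, ?_⟩
    rintro x (hx | hx) v
    · exact ⟨(h x hx v).1.trans (mul_le_mul_of_nonneg_right (le_max_left _ _) (norm_nonneg _)),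
        (h x hx v).2.trans (mul_le_mul_of_nonneg_right (le_max_left _ _) (metricNorm_nonneg g v))⟩
    · exact ⟨(h' x hx v).1.trans (mul_le_mul_of_nonneg_right (le_max_right _ _) (norm_nonneg _)),
        (h' x hx v).2.trans (mul_le_mul_of_nonneg_right (le_max_right _ _) (metricNorm_nonneg g v))⟩
  · intro x hx
    set c := chartAt E x
    have hc : c ∈ IsManifold.maximalAtlas 𝓘(ℝ, E) ∞ M := IsManifold.chart_mem_maximalAtlas _
    have hxc : x ∈ c.source := mem_chart_source E x
    have hcx : c x ∈ c.target := c.map_source hxc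
    have hlx : c.symm (c x) = x := c.left_inv hxc
    have hd : c.MDifferentiable 𝓘(ℝ, E) 𝓘(ℝ, E) :=
      ⟨(contMDiffOn_of_mem_maximalAtlas hc).mdifferentiableOn (by simp),
        (contMDiffOn_symm_of_mem_maximalAtlas hc).mdifferentiableOn (by simp)⟩
    -- In these coordinates the metric norm `a` and the transported norm `b` are functions on `E ×
    -- E`, homogeneous in the vector. Both are positive over `c x`, so
    -- `eventually_le_of_homogeneous` applies in both directions.
    let T : E × E → TangentBundle 𝓘(ℝ, E) M := fun q =>
      tangentMap 𝓘(ℝ, E) 𝓘(ℝ, E) c.symm (⟨q.1, q.2⟩ : TangentBundle 𝓘(ℝ, E) E)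
    have hT : ∀ v, ContinuousAt T (c x, v) := by
      intro v
      have h1 : Continuous (fun q : E × E => (⟨q.1, q.2⟩ : TangentBundle 𝓘(ℝ, E) E)) :=
        (tangentBundleModelSpaceHomeomorph 𝓘(ℝ, E)).symm.continuous
      have h2 := ((contMDiffOn_symm_of_mem_maximalAtlas hc).contMDiffOn_tangentMap
        c.open_target).continuousOn.continuousAt (x := (⟨c x, v⟩ : TangentBundle 𝓘(ℝ, E) E))
        ((c.open_target.preimage (FiberBundle.continuous_proj _ _)).mem_nhds hcx)
      exact ContinuousAt.comp (f := fun q : E × E => (⟨q.1, q.2⟩ : TangentBundle 𝓘(ℝ, E) E))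
        (x := (c x, v)) h2 h1.continuousAt
    let a : E × E → ℝ := fun q => metricNorm g (T q).2
    let b : E × E → ℝ := fun q => ‖tderiv E H Γ (T q).1 (T q).2‖
    have ha : ∀ v, ContinuousAt a (c x, v) := fun v =>
      ContinuousAt.comp (f := T) (continuous_metricNorm g).continuousAt (hT v)
    have hb : ∀ v, ContinuousAt b (c x, v) := by
      intro v
      have hmem : (T (c x, v)).1 ∈ U := by
        change c.symm (c x) ∈ U
        rw [hlx]; exact hSU hx
      have h2 := (hΓ.contMDiffOn_tangentMap hU).continuousOn.continuousAt (x := T (c x, v))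
        ((hU.preimage (FiberBundle.continuous_proj _ _)).mem_nhds hmem)
      have h3 := ContinuousAt.comp (f := T) h2 (hT v)
      exact (continuous_norm.comp
        (contMDiff_snd_tangentBundle_modelSpace (n := ∞) H 𝓘(ℝ, H)).continuous).continuousAt.comp h3
    have hah : ∀ w v (r : ℝ), a (w, r • v) = |r| * a (w, v) := fun w v r =>
      (congrArg (metricNorm g) ((mfderiv 𝓘(ℝ, E) 𝓘(ℝ, E) c.symm w).map_smul r v)).trans
        (metricNorm_smul g r _)
    have hbh : ∀ w v (r : ℝ), b (w, r • v) = |r| * b (w, v) := fun w v r => by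
      let A : E →L[ℝ] E := mfderiv 𝓘(ℝ, E) 𝓘(ℝ, E) c.symm w
      let A' : E →L[ℝ] H := tderiv E H Γ (c.symm w)
      change ‖A' (A (r • v))‖ = |r| * ‖A' (A v)‖
      rw [map_smul, map_smul, norm_smul, Real.norm_eq_abs]
    have hinjc : ∀ v : E, v ≠ 0 → (T (c x, v)).2 ≠ 0 := fun v hv h =>
      hv (hd.symm.mfderiv_injective hcx (h.trans (map_zero _).symm))
    have hapos : ∀ v ≠ 0, 0 < a (c x, v) := fun v hv =>
      Real.sqrt_pos.2 (g.pos _ _ (hinjc v hv))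
    have hinj' : ∀ y, y ∈ S → ∀ v : TangentSpace 𝓘(ℝ, E) y, v ≠ 0 →
        0 < ‖tderiv E H Γ y v‖ := fun y hy v hv =>
      norm_pos_iff.2 fun h => hv (hinj y hy v h)
    have hbpos : ∀ v ≠ 0, 0 < b (c x, v) := fun v hv =>
      hinj' (c.symm (c x)) (by rw [hlx]; exact hx) _ (hinjc v hv)
    obtain ⟨C, hC, h1⟩ := eventually_le_of_homogeneous ha hb hah hbh hbpos
    obtain ⟨C', hC', h2⟩ := eventually_le_of_homogeneous hb ha hbh hah hapos
    have hcc : ContinuousAt c x := c.continuousAt hxc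
    refine ⟨_, mem_nhdsWithin_of_mem_nhds (inter_mem (c.open_source.mem_nhds hxc)
      (hcc.eventually (h1.and h2))), max C C', lt_max_of_lt_left hC, ?_⟩
    rintro y ⟨hy, h3, h4⟩ v
    let v' : E := mfderiv 𝓘(ℝ, E) 𝓘(ℝ, E) c y v
    have hTy : T (c y, v') = ⟨y, v⟩ := by
      have h5 : (mfderiv 𝓘(ℝ, E) 𝓘(ℝ, E) c.symm (c y) : E →L[ℝ] E) v' = v :=
        congrArg (fun L : E →L[ℝ] E => L v) (hd.symm_comp_deriv hy)
      have h6 : T (c y, v') = ⟨c.symm (c y), (mfderiv 𝓘(ℝ, E) 𝓘(ℝ, E) c.symm (c y) : E →L[ℝ] E) v'⟩ :=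
        rfl
      rw [h6, h5]
      congr 1
      exact c.left_inv hy
    have ha' : a (c y, v') = metricNorm g v := by
      change metricNorm g (T (c y, v')).2 = _
      rw [hTy]
    have hb' : b (c y, v') = ‖tderiv E H Γ y v‖ := by
      change ‖tderiv E H Γ (T (c y, v')).1 (T (c y, v')).2‖ = _
      rw [hTy]
    have h7 := h3 v'
    have h8 := h4 v'
    rw [ha', hb'] at h7 h8
    exact ⟨h7.trans (mul_le_mul_of_nonneg_right (le_max_left _ _) (norm_nonneg _)),
      h8.trans (mul_le_mul_of_nonneg_right (le_max_right _ _) (metricNorm_nonneg g v))⟩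

end Norms


/-! ### A criterion for normal hyperbolicity -/

section Splitting

/-- The subspace of `ℝ^ι` of the vectors supported in `J`. -/
def coordSubmodule {ι : Type*} [Fintype ι] (J : Set ι) : Submodule ℝ (EuclideanSpace ℝ ι) where
  carrier := {ζ | ∀ j ∉ J, ζ j = 0}
  zero_mem' := fun _ _ => rfl
  add_mem' := fun {a b} ha hb j hj => by simp [ha j hj, hb j hj]
  smul_mem' := fun c a ha j hj => by simp [ha j hj]

variable {E : Type*} [NormedAddCommGroup E] [NormedSpace ℝ E]
  {M : Type*} [TopologicalSpace M] [ChartedSpace E M] [IsManifold 𝓘(ℝ, E) ∞ M]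
  {G : Type*} [NormedAddCommGroup G] [NormedSpace ℝ G]
  {ι : Type*} [Fintype ι]

/-- The tangent vectors `v` with `dg(v) = 0` and `dz(v)` supported in `J`. -/
noncomputable def normalSubmodule (g : M → G) (z : M → EuclideanSpace ℝ ι) (J : Set ι) (x : M) :
    Submodule ℝ (TangentSpace 𝓘(ℝ, E) x) :=
  ((tderiv E G g x).toLinearMap.ker ⊓
    (coordSubmodule J).comap (tderiv E (EuclideanSpace ℝ ι) z x).toLinearMap : Submodule ℝ E)

theorem mem_normalSubmodule {g : M → G} {z : M → EuclideanSpace ℝ ι} {J : Set ι} {x : M} {v : E} :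
    v ∈ (normalSubmodule g z J x : Submodule ℝ (TangentSpace 𝓘(ℝ, E) x)) ↔
      tderiv E G g x v = 0 ∧ ∀ j ∉ J, tderiv E (EuclideanSpace ℝ ι) z x v j = 0 := Iff.rfl

/-- The `s i` form a frame dual to `dz` inside the kernel of `dg`. For `v` in the subspace, the
difference of `v` and `∑ dz(v)_j s_j` over the selected indices is killed by both `dg` and `dz`, so
it vanishes. -/
theorem isContinuousSubbundleOn_normalSubmodule [DecidableEq ι] {g : M → G}
    {z : M → EuclideanSpace ℝ ι} {S : Set M}
    (hinj : ∀ x ∈ S, ∀ v : E, tderiv E G g x v = 0 → tderiv E (EuclideanSpace ℝ ι) z x v = 0 → v = 0)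
    (hframe : ∀ x₀ ∈ S, ∃ O ∈ 𝓝 x₀, ∃ s : ι → ∀ x : M, TangentSpace 𝓘(ℝ, E) x,
      (∀ i, ContinuousOn (fun x => (⟨x, s i x⟩ : TangentBundle 𝓘(ℝ, E) M)) O) ∧
      ∀ x ∈ O, x ∈ S → ∀ i, tderiv E G g x (s i x) = 0 ∧
        tderiv E (EuclideanSpace ℝ ι) z x (s i x) = EuclideanSpace.single i 1)
    {r : ℕ} (j : Fin r → ι) (hj : Function.Injective j) :
    IsContinuousSubbundleOn (normalSubmodule (E := E) g z (range j)) S := by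
  intro x₀ hx₀
  obtain ⟨O, hO, s, hs, hsd⟩ := hframe x₀ hx₀
  refine ⟨O, hO, r, fun i => s (j i), fun i => (hs (j i)).mono inter_subset_left, ?_⟩
  rintro x ⟨hxO, hxS⟩
  have hd := hsd x hxO hxS
  let s' : ι → E := fun i => s i x
  let Dg := tderiv E G g x
  let Dz := tderiv E (EuclideanSpace ℝ ι) z x
  have hg : ∀ i, Dg (s' i) = 0 := fun i => (hd i).1
  have hz : ∀ i, Dz (s' i) = EuclideanSpace.single i 1 := fun i => (hd i).2
  have hli : LinearIndependent ℝ (fun i => s' (j i)) := by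
    rw [Fintype.linearIndependent_iff]
    intro c hc i
    have h1 := congrArg (fun ζ : EuclideanSpace ℝ ι => ζ (j i)) (congrArg Dz hc)
    simpa [map_sum, hz, Pi.single_apply, hj.eq_iff] using h1
  refine ⟨hli, ?_⟩
  change Submodule.span ℝ (range fun i => s' (j i)) =
    (Dg.toLinearMap.ker ⊓ (coordSubmodule (range j)).comap Dz.toLinearMap : Submodule ℝ E)
  apply le_antisymm
  · rw [Submodule.span_le]
    rintro _ ⟨i, rfl⟩
    refine ⟨hg (j i), ?_⟩
    intro l hl
    change Dz (s' (j i)) l = 0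
    rw [hz]
    have : l ≠ j i := fun h => hl ⟨i, h.symm⟩
    simp [this]
  · rintro v ⟨hv1, hv2⟩
    have hv1' : Dg v = 0 := hv1
    have hv2' : ∀ l ∉ range j, Dz v l = 0 := hv2
    have h2 : v - ∑ i, Dz v (j i) • s' (j i) = 0 := by
      refine hinj x hxS _ ?_ ?_
      · change Dg _ = 0
        simp [map_sub, map_sum, hg, hv1']
      · change Dz _ = 0
        ext l
        by_cases hl : l ∈ range j
        · obtain ⟨i, rfl⟩ := hl
          simp [map_sub, map_sum, hz, Pi.single_apply, hj.eq_iff]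
        · have h3 : ∀ i, l ≠ j i := fun i h => hl ⟨i, h.symm⟩
          simp [map_sub, map_sum, hz, h3, hv2' l hl]
    rw [sub_eq_zero.1 h2]
    exact Submodule.sum_mem _ fun i _ => Submodule.smul_mem _ _ (Submodule.subset_span ⟨i, rfl⟩)

end Splitting

section Flow

variable {E : Type} [NormedAddCommGroup E] [NormedSpace ℝ E] [FiniteDimensional ℝ E]
  {M : Type*} [TopologicalSpace M] [ChartedSpace E M] [IsManifold 𝓘(ℝ, E) ∞ M]
  {H : Type*} [NormedAddCommGroup H] [NormedSpace ℝ H]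
  {X : ∀ x : M, TangentSpace 𝓘(ℝ, E) x} {φ : ℝ → M → M}

theorem IsGlobalFlow.hasDerivAt_tderiv (hφ : IsGlobalFlow X φ)
    (hX : ContMDiff 𝓘(ℝ, E) 𝓘(ℝ, E).tangent ∞ (fun x => (⟨x, X x⟩ : TangentBundle 𝓘(ℝ, E) M)))
    {Γ : M → H} {U : Set M} (hU : IsOpen U) (hΓ : ContMDiffOn 𝓘(ℝ, E) 𝓘(ℝ, H) ∞ Γ U) {x : M}
    {t : ℝ} (hx : φ t x ∈ U) (v : E) :
    HasDerivAt (fun t => tderiv E H Γ (φ t x) (tderiv E E (φ t) x v))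
      (tderiv E H (fun y => tderiv E H Γ y (X y)) (φ t x) (tderiv E E (φ t) x v)) t :=
  hφ.hasDerivAt_mfderiv hX hU hΓ hx v

theorem IsGlobalFlow.tderiv_zero (hφ : IsGlobalFlow X φ) (x : M) (v : E) :
    tderiv E E (φ 0) x v = v := by
  have h : φ 0 = id := funext hφ.map_zero
  unfold tderiv
  rw [h, mfderiv_id]
  rfl

theorem IsGlobalFlow.tderiv_neg_apply [T2Space M] (hφ : IsGlobalFlow X φ)
    (hX : ContMDiff 𝓘(ℝ, E) 𝓘(ℝ, E).tangent ∞ (fun x => (⟨x, X x⟩ : TangentBundle 𝓘(ℝ, E) M)))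
    (t : ℝ) (x : M) (v : E) : φ (-t) (φ t x) = x ∧
      tderiv E E (φ t) x (tderiv E E (φ (-t)) (φ t x) v) = v := by
  have hback : φ (-t) (φ t x) = x := by
    rw [← IsGlobalFlow.add hX hφ.map_zero hφ.integral, neg_add_cancel, hφ.map_zero]
  refine ⟨hback, ?_⟩
  have hcomp : φ t ∘ φ (-t) = id := by
    funext y
    rw [Function.comp_apply, ← IsGlobalFlow.add hX hφ.map_zero hφ.integral, add_neg_cancel, hφ.map_zero, id]
  have h1 : mfderiv 𝓘(ℝ, E) 𝓘(ℝ, E) (φ t ∘ φ (-t)) (φ t x) =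
      (mfderiv 𝓘(ℝ, E) 𝓘(ℝ, E) (φ t) (φ (-t) (φ t x))).comp
        (mfderiv 𝓘(ℝ, E) 𝓘(ℝ, E) (φ (-t)) (φ t x)) :=
    mfderiv_comp _ ((hφ.contMDiff_time t).mdifferentiable (by simp) _)
      ((hφ.contMDiff_time (-t)).mdifferentiable (by simp) _)
  have h2 := congrArg (fun L : E →L[ℝ] E => L v) h1
  have h3 : tderiv E E (φ t ∘ φ (-t)) (φ t x) v =
    tderiv E E (φ t) (φ (-t) (φ t x)) (tderiv E E (φ (-t)) (φ t x) v) := h2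
  rw [hback] at h3
  rw [← h3, hcomp]
  unfold tderiv
  rw [mfderiv_id]
  rfl

end Flow

/-- `ℝ^{2k}` with the coordinates `(x, y)`. -/
abbrev PhaseSpace (k : ℕ) : Type := EuclideanSpace ℝ (Fin k ⊕ Fin k)

section Criterion

variable {E : Type} [NormedAddCommGroup E] [NormedSpace ℝ E] [FiniteDimensional ℝ E]
  {M : Type*} [TopologicalSpace M] [T2Space M] [ChartedSpace E M] [IsManifold 𝓘(ℝ, E) ∞ M]
  {F : Type*} [NormedAddCommGroup F] [NormedSpace ℝ F]
  {N : Type*} [TopologicalSpace N] [CompactSpace N] [ChartedSpace F N]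
  {G : Type*} [NormedAddCommGroup G] [NormedSpace ℝ G] {k : ℕ}

/-- Normal hyperbolicity of a compact invariant submanifold, in terms of functions `g` and `z` that
together are an immersion along it: the linearised flow is `e^{At} ⊕ e^{-At}` in the variable `z`,
and its growth in the variable `g` is bounded by `e^{ρ|t|}` with `ρ < A`. -/
theorem isNormallyHyperbolic_of_linear {X : ∀ x : M, TangentSpace 𝓘(ℝ, E) x} {φ : ℝ → M → M}
    (hφ : IsGlobalFlow X φ)
    (hX : ContMDiff 𝓘(ℝ, E) 𝓘(ℝ, E).tangent ∞ (fun x => (⟨x, X x⟩ : TangentBundle 𝓘(ℝ, E) M)))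
    {f : N → M} (hf : Continuous f) (hinv : ∀ t, MapsTo (φ t) (range f) (range f))
    {U : Set M} (hU : IsOpen U) (hfU : range f ⊆ U) {g : M → G}
    {z : M → PhaseSpace k} (hg : ContMDiffOn 𝓘(ℝ, E) 𝓘(ℝ, G) ∞ g U)
    (hz : ContMDiffOn 𝓘(ℝ, E) 𝓘(ℝ, PhaseSpace k) ∞ z U)
    (hinj : ∀ x ∈ range f, ∀ v : E, tderiv E G g x v = 0 →
      tderiv E (PhaseSpace k) z x v = 0 → v = 0)
    (hrange : ∀ (p : N) (v : E), tderiv E (PhaseSpace k) z (f p) v = 0 ↔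
      ∃ a : F, tderiv F E f p a = v)
    (hframe : ∀ x₀ ∈ range f, ∃ O ∈ 𝓝 x₀, ∃ s : Fin k ⊕ Fin k → ∀ x : M, TangentSpace 𝓘(ℝ, E) x,
      (∀ i, ContinuousOn (fun x => (⟨x, s i x⟩ : TangentBundle 𝓘(ℝ, E) M)) O) ∧
      ∀ x ∈ O, x ∈ range f → ∀ i, tderiv E G g x (s i x) = 0 ∧
        tderiv E (PhaseSpace k) z x (s i x) = EuclideanSpace.single i 1)
    {A ρ : ℝ} (hρ : 0 < ρ) (hρA : ρ < A)
    (hzl : ∀ x ∈ range f, ∀ (v : E) (i : Fin k),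
      tderiv E (PhaseSpace k)
        (fun y => tderiv E (PhaseSpace k) z y (X y)) x v (Sum.inl i) =
      A * tderiv E (PhaseSpace k) z x v (Sum.inl i))
    (hzr : ∀ x ∈ range f, ∀ (v : E) (i : Fin k),
      tderiv E (PhaseSpace k)
        (fun y => tderiv E (PhaseSpace k) z y (X y)) x v (Sum.inr i) =
      -A * tderiv E (PhaseSpace k) z x v (Sum.inr i))
    (hgρ : ∀ x ∈ range f, ∀ v : E,
      ‖tderiv E G (fun y => tderiv E G g y (X y)) x v‖ ≤ ρ * ‖tderiv E G g x v‖) :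
    IsNormallyHyperbolic (E' := F) X f := by
  have hφU : ∀ x ∈ range f, ∀ t, φ t x ∈ U := fun x hx t => hfU (hinv t hx)
  -- Along a trajectory in `N`, each component of `dz` on a transported vector solves the scalar
  -- equation `q' = B q`.
  have hcoord : ∀ (i : Fin k ⊕ Fin k) (B : ℝ), (∀ x ∈ range f, ∀ v : E,
      tderiv E (PhaseSpace k) (fun y => tderiv E (PhaseSpace k) z y (X y)) x v i = B * tderiv E (PhaseSpace k) z x v i) →
      ∀ x ∈ range f, ∀ (t : ℝ) (v : E), tderiv E (PhaseSpace k) z (φ t x) (tderiv E E (φ t) x v) i =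
        Real.exp (B * t) * tderiv E (PhaseSpace k) z x v i := by
    intro i B hB x hx t v
    have h1 : ∀ t, HasDerivAt (fun t => tderiv E (PhaseSpace k) z (φ t x) (tderiv E E (φ t) x v) i)
        (B * tderiv E (PhaseSpace k) z (φ t x) (tderiv E E (φ t) x v) i) t := by
      intro t
      have h2 := hφ.hasDerivAt_tderiv hX hU hz (hφU x hx t) v
      have h3 := (EuclideanSpace.proj (𝕜 := ℝ) i : PhaseSpace k →L[ℝ] ℝ).hasFDerivAt.comp_hasDerivAt t h2
      rw [← hB _ (hinv t hx)]
      exact h3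
    have h4 := eq_exp_of_hasDerivAt h1 t
    rwa [hφ.map_zero, hφ.tderiv_zero] at h4
  have hl : ∀ x ∈ range f, ∀ (t : ℝ) (v : E) (i : Fin k),
      tderiv E (PhaseSpace k) z (φ t x) (tderiv E E (φ t) x v) (Sum.inl i) =
        Real.exp (A * t) * tderiv E (PhaseSpace k) z x v (Sum.inl i) := fun x hx t v i =>
    hcoord (Sum.inl i) A (fun x hx v => hzl x hx v i) x hx t v
  have hr : ∀ x ∈ range f, ∀ (t : ℝ) (v : E) (i : Fin k),
      tderiv E (PhaseSpace k) z (φ t x) (tderiv E E (φ t) x v) (Sum.inr i) =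
        Real.exp (-A * t) * tderiv E (PhaseSpace k) z x v (Sum.inr i) := fun x hx t v i =>
    hcoord (Sum.inr i) (-A) (fun x hx v => hzr x hx v i) x hx t v
  have hgt : ∀ x ∈ range f, ∀ (t : ℝ) (v : E),
      ‖tderiv E G g (φ t x) (tderiv E E (φ t) x v)‖ ≤ Real.exp (ρ * |t|) * ‖tderiv E G g x v‖ := by
    intro x hx t v
    have h1 := norm_le_exp_of_norm_deriv_le
      (fun t => hφ.hasDerivAt_tderiv hX hU hg (hφU x hx t) v)
      (fun t => hgρ _ (hinv t hx) _) t
    rwa [hφ.map_zero, hφ.tderiv_zero] at h1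
  -- The growth estimate with initial value zero shows that the flow preserves the kernel of `dg`.
  -- With the diagonal form in `z`, this gives the invariance of `E^+` and `E^-`.
  have hg0 : ∀ x ∈ range f, ∀ (t : ℝ) (v : E), tderiv E G g x v = 0 →
      tderiv E G g (φ t x) (tderiv E E (φ t) x v) = 0 := by
    intro x hx t v hv
    have := hgt x hx t v
    rw [hv, norm_zero, mul_zero] at this
    exact norm_le_zero_iff.1 this
  have hEpm : ∀ J : Set (Fin k ⊕ Fin k), ∀ x ∈ range f, ∀ (t : ℝ) (v : E),
      v ∈ (normalSubmodule g z J x : Submodule ℝ (TangentSpace 𝓘(ℝ, E) x)) →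
      tderiv E E (φ t) x v ∈
        (normalSubmodule g z J (φ t x) : Submodule ℝ (TangentSpace 𝓘(ℝ, E) (φ t x))) := by
    intro J x hx t v hv
    rw [mem_normalSubmodule] at hv ⊢
    refine ⟨hg0 x hx t v hv.1, ?_⟩
    rintro (i | i) hi
    · rw [hl x hx, hv.2 _ hi, mul_zero]
    · rw [hr x hx, hv.2 _ hi, mul_zero]
  have hmap : ∀ J : Set (Fin k ⊕ Fin k), ∀ x ∈ range f, ∀ t : ℝ,
      (normalSubmodule (E := E) g z J x).map (mfderiv 𝓘(ℝ, E) 𝓘(ℝ, E) (φ t) x).toLinearMap =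
        normalSubmodule g z J (φ t x) := by
    intro J x hx t
    apply le_antisymm
    · rintro _ ⟨v, hv, rfl⟩
      exact hEpm J x hx t v hv
    · intro v hv
      obtain ⟨h1, h2⟩ := hφ.tderiv_neg_apply hX t x v
      have h3 := hEpm J (φ t x) (hinv t hx) (-t) v hv
      rw [h1] at h3
      exact ⟨tderiv E E (φ (-t)) (φ t x) v, h3, h2⟩
  -- The map `(g, z)` is immersive along `N`, so it can replace the metric up to a constant. On each
  -- summand of the splitting one of its two components vanishes, and the supremum norm reduces to
  -- the other.
  let Γ : M → G × PhaseSpace k := fun x => (g x, z x)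
  have hΓ : ContMDiffOn 𝓘(ℝ, E) 𝓘(ℝ, G × PhaseSpace k) ∞ Γ U := hg.prodMk_space hz
  have hΓd : ∀ x ∈ range f, ∀ v : E, tderiv E (G × PhaseSpace k) Γ x v = (tderiv E G g x v, tderiv E (PhaseSpace k) z x v) := by
    intro x hx v
    have h1 : HasMFDerivAt 𝓘(ℝ, E) 𝓘(ℝ, G × PhaseSpace k) Γ x
        ((mfderiv 𝓘(ℝ, E) 𝓘(ℝ, G) g x).prod (mfderiv 𝓘(ℝ, E) 𝓘(ℝ, PhaseSpace k) z x)) :=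
      have h2 := ((hg.contMDiffAt (hU.mem_nhds (hfU hx))).mdifferentiableAt (by simp)).hasMFDerivAt
      have h3 := ((hz.contMDiffAt (hU.mem_nhds (hfU hx))).mdifferentiableAt (by simp)).hasMFDerivAt
      ⟨h2.1.prodMk h3.1, h2.2.prodMk h3.2⟩
    exact congrArg (fun L : E →L[ℝ] G × PhaseSpace k => L v) h1.mfderiv
  have hΓinj : ∀ x ∈ range f, ∀ v, tderiv E (G × PhaseSpace k) Γ x v = 0 → v = 0 := by
    intro x hx v hv
    rw [hΓd x hx] at hv
    exact hinj x hx v (Prod.ext_iff.1 hv).1 (Prod.ext_iff.1 hv).2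
  have hdec : ∀ x ∈ range f, ∃ s : Fin k ⊕ Fin k → E,
      ∀ i, tderiv E G g x (s i) = 0 ∧ tderiv E (PhaseSpace k) z x (s i) = EuclideanSpace.single i 1 := by
    intro x hx
    obtain ⟨O, hO, s, -, hs⟩ := hframe x hx
    exact ⟨fun i => s i x, hs x (mem_of_mem_nhds hO) hx⟩
  refine ⟨φ, hφ, hinv, normalSubmodule g z (range Sum.inl), normalSubmodule g z (range Sum.inr),
    isContinuousSubbundleOn_normalSubmodule hinj hframe _ Sum.inl_injective,
    isContinuousSubbundleOn_normalSubmodule hinj hframe _ Sum.inr_injective, ?_,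
    fun x hx t => ⟨hmap _ x hx t, hmap _ x hx t⟩, ?_⟩
  · intro p
    have hx : f p ∈ range f := mem_range_self p
    constructor
    · rw [Submodule.disjoint_def]
      intro v hv hv'
      refine hinj (f p) hx v ((mem_normalSubmodule (E := E)).1 hv).1 ?_
      ext i
      rcases i with i | i
      · exact ((mem_normalSubmodule (E := E)).1 hv').2 _ (by simp)
      · exact ((mem_normalSubmodule (E := E)).1 hv).2 _ (by simp)
    · have hsum : ∀ v : TangentSpace 𝓘(ℝ, E) (f p), v ∈ (normalSubmodule g z (range Sum.inl) (f p) ⊔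
          normalSubmodule g z (range Sum.inr) (f p) :
            Submodule ℝ (TangentSpace 𝓘(ℝ, E) (f p))) → tderiv E G g (f p) v = 0 := by
        intro v hv
        obtain ⟨a, ha, b, hb, rfl⟩ := Submodule.mem_sup.1 hv
        have h1 := ((mem_normalSubmodule (E := E)).1 ha).1
        have h2 := ((mem_normalSubmodule (E := E)).1 hb).1
        have h3 : ∀ a b : E, tderiv E G g (f p) a = 0 → tderiv E G g (f p) b = 0 →
            tderiv E G g (f p) (a + b) = 0 := fun a b ha hb => by rw [map_add, ha, hb, add_zero]
        exact h3 a b h1 h2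
      constructor
      · rw [Submodule.disjoint_def]
        rintro v ⟨a, rfl⟩ hv'
        exact hinj (f p) hx _ (hsum _ hv') ((hrange p _).2 ⟨a, rfl⟩)
      · rw [codisjoint_iff, eq_top_iff]
        let P : Submodule ℝ (TangentSpace 𝓘(ℝ, E) (f p)) := (mfderiv 𝓘(ℝ, F) 𝓘(ℝ, E) f p).range ⊔
          (normalSubmodule g z (range Sum.inl) (f p) ⊔ normalSubmodule g z (range Sum.inr) (f p))
        suffices h : ∀ v : E, v ∈ P from fun v _ => h v
        intro v
        obtain ⟨s, hs⟩ := hdec (f p) hx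
        let Dg := tderiv E G g (f p)
        let Dz := tderiv E (PhaseSpace k) z (f p)
        have hsg : ∀ i, Dg (s i) = 0 := fun i => (hs i).1
        have hsz : ∀ i, Dz (s i) = EuclideanSpace.single i 1 := fun i => (hs i).2
        -- Subtracting the components along the dual frame leaves a vector with `dz = 0`, which is
        -- tangent to `N` by `hrange`.
        let vl : E := ∑ i : Fin k, Dz v (Sum.inl i) • s (Sum.inl i)
        let vr : E := ∑ i : Fin k, Dz v (Sum.inr i) • s (Sum.inr i)
        have hw : Dz (v - (vl + vr)) = 0 := by
          ext i
          rcases i with i | i <;> simp [vl, vr, map_sub, map_sum, hsz, Pi.single_apply]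
        obtain ⟨a, ha⟩ := (hrange p _).1 hw
        have h1 : vl ∈ (normalSubmodule g z (range Sum.inl) (f p) :
            Submodule ℝ (TangentSpace 𝓘(ℝ, E) (f p))) := by
          rw [mem_normalSubmodule]
          refine ⟨?_, ?_⟩
          · change Dg vl = 0
            simp [vl, map_sum, hsg]
          · rintro (i | i) hi
            · exact absurd ⟨i, rfl⟩ hi
            · change Dz vl (Sum.inr i) = 0
              simp [vl, map_sum, hsz]
        have h2 : vr ∈ (normalSubmodule g z (range Sum.inr) (f p) :
            Submodule ℝ (TangentSpace 𝓘(ℝ, E) (f p))) := by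
          rw [mem_normalSubmodule]
          refine ⟨?_, ?_⟩
          · change Dg vr = 0
            simp [vr, map_sum, hsg]
          · rintro (i | i) hi
            · change Dz vr (Sum.inl i) = 0
              simp [vr, map_sum, hsz]
            · exact absurd ⟨i, rfl⟩ hi
        have h3 : v = tderiv F E f p a + (vl + vr) := by rw [ha]; abel
        let a₁ : TangentSpace 𝓘(ℝ, E) (f p) := tderiv F E f p a
        let a₂ : TangentSpace 𝓘(ℝ, E) (f p) := vl
        let a₃ : TangentSpace 𝓘(ℝ, E) (f p) := vr
        have h4 : a₁ + (a₂ + a₃) ∈ P :=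
          Submodule.add_mem_sup ⟨a, rfl⟩ (Submodule.add_mem_sup h1 h2)
        exact (congrArg (· ∈ P) (h3 : v = a₁ + (a₂ + a₃))).mpr h4
  · intro γ
    obtain ⟨C, hC, hcmp⟩ := exists_metricNorm_comparison γ (isCompact_range hf) hU hfU hΓ hΓinj
    have hC2 : 0 < C * C := mul_pos hC hC
    let n : ∀ x : M, E → ℝ := fun x v => metricNorm γ (x := x) v
    replace hcmp : ∀ x ∈ range f, ∀ v : E, n x v ≤ C * ‖tderiv E (G × PhaseSpace k) Γ x v‖ ∧
      ‖tderiv E (G × PhaseSpace k) Γ x v‖ ≤ C * n x v := hcmp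
    let Ep (J : Set (Fin k ⊕ Fin k)) (x : M) (v : E) : Prop :=
      tderiv E G g x v = 0 ∧ ∀ j ∉ J, tderiv E (PhaseSpace k) z x v j = 0
    -- The metric is compared with the norm of `dΓ` at both ends of the trajectory; each comparison
    -- costs a factor `C`.
    refine ⟨ρ, A, A, C * C, hρ, hρA, hρA, hC2, ?_, ?_, ?_⟩
    · rintro p t v ⟨a, rfl⟩
      have hx : f p ∈ range f := mem_range_self p
      let w : E := tderiv F E f p a
      have hz0 : tderiv E (PhaseSpace k) z (f p) w = 0 := (hrange p _).2 ⟨a, rfl⟩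
      have hzt : tderiv E (PhaseSpace k) z (φ t (f p)) (tderiv E E (φ t) (f p) w) = 0 := by
        ext i
        rcases i with i | i
        · rw [hl _ hx, hz0]; simp
        · rw [hr _ hx, hz0]; simp
      have h1 := (hcmp _ (hinv t hx) (tderiv E E (φ t) (f p) w)).1
      have h2 := (hcmp _ hx w).2
      rw [hΓd _ (hinv t hx), hzt, Prod.norm_mk, norm_zero, max_eq_left (norm_nonneg _)] at h1
      rw [hΓd _ hx, hz0, Prod.norm_mk, norm_zero, max_eq_left (norm_nonneg _)] at h2
      calc n (φ t (f p)) (tderiv E E (φ t) (f p) w)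
          ≤ C * ‖tderiv E G g (φ t (f p)) (tderiv E E (φ t) (f p) w)‖ := h1
        _ ≤ C * (Real.exp (ρ * |t|) * (C * n (f p) w)) :=
          mul_le_mul_of_nonneg_left ((hgt _ hx t w).trans
            (mul_le_mul_of_nonneg_left h2 (Real.exp_pos _).le)) hC.le
        _ = C * C * Real.exp (ρ * |t|) * n (f p) w := by ring
    · suffices h : ∀ x ∈ range f, ∀ t : ℝ, 0 ≤ t → ∀ v : E, Ep (range Sum.inl) x v →
          (C * C)⁻¹ * Real.exp (A * t) * n x v ≤ n (φ t x) (tderiv E E (φ t) x v) from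
        fun x hx t ht v hv => h x hx t ht v (mem_normalSubmodule.1 hv)
      rintro x hx t ht v ⟨hv1, hv2⟩
      have hzt : tderiv E (PhaseSpace k) z (φ t x) (tderiv E E (φ t) x v) =
          Real.exp (A * t) • tderiv E (PhaseSpace k) z x v := by
        ext i
        rcases i with i | i
        · rw [hl _ hx]; rfl
        · rw [hr _ hx, hv2 _ (by simp), mul_zero]
          change 0 = Real.exp (A * t) * tderiv E (PhaseSpace k) z x v (Sum.inr i)
          rw [hv2 _ (by simp), mul_zero]
      have h1 := (hcmp _ (hinv t hx) (tderiv E E (φ t) x v)).2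
      have h2 := (hcmp _ hx v).1
      rw [hΓd _ (hinv t hx), hg0 x hx t v hv1, hzt, Prod.norm_mk, norm_zero,
        max_eq_right (norm_nonneg _), norm_smul, Real.norm_of_nonneg (Real.exp_pos _).le] at h1
      rw [hΓd _ hx, hv1, Prod.norm_mk, norm_zero, max_eq_right (norm_nonneg _)] at h2
      rw [mul_assoc, inv_mul_le_iff₀ hC2]
      calc Real.exp (A * t) * n x v
          ≤ Real.exp (A * t) * (C * ‖tderiv E (PhaseSpace k) z x v‖) :=
            mul_le_mul_of_nonneg_left h2 (Real.exp_pos _).le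
        _ = C * (Real.exp (A * t) * ‖tderiv E (PhaseSpace k) z x v‖) := by ring
        _ ≤ C * (C * n (φ t x) (tderiv E E (φ t) x v)) :=
          mul_le_mul_of_nonneg_left h1 hC.le
        _ = C * C * n (φ t x) (tderiv E E (φ t) x v) := by ring
    · suffices h : ∀ x ∈ range f, ∀ t : ℝ, 0 ≤ t → ∀ v : E, Ep (range Sum.inr) x v →
          n (φ t x) (tderiv E E (φ t) x v) ≤ C * C * Real.exp (-(A * t)) * n x v from
        fun x hx t ht v hv => h x hx t ht v (mem_normalSubmodule.1 hv)
      rintro x hx t ht v ⟨hv1, hv2⟩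
      have hzt : tderiv E (PhaseSpace k) z (φ t x) (tderiv E E (φ t) x v) =
          Real.exp (-(A * t)) • tderiv E (PhaseSpace k) z x v := by
        ext i
        rcases i with i | i
        · rw [hl _ hx, hv2 _ (by simp), mul_zero]
          change 0 = Real.exp (-(A * t)) * tderiv E (PhaseSpace k) z x v (Sum.inl i)
          rw [hv2 _ (by simp), mul_zero]
        · rw [hr _ hx, neg_mul]; rfl
      have h1 := (hcmp _ (hinv t hx) (tderiv E E (φ t) x v)).1
      have h2 := (hcmp _ hx v).2
      rw [hΓd _ (hinv t hx), hg0 x hx t v hv1, hzt, Prod.norm_mk, norm_zero,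
        max_eq_right (norm_nonneg _), norm_smul, Real.norm_of_nonneg (Real.exp_pos _).le] at h1
      rw [hΓd _ hx, hv1, Prod.norm_mk, norm_zero, max_eq_right (norm_nonneg _)] at h2
      calc n (φ t x) (tderiv E E (φ t) x v)
          ≤ C * (Real.exp (-(A * t)) * ‖tderiv E (PhaseSpace k) z x v‖) := h1
        _ ≤ C * (Real.exp (-(A * t)) * (C * n x v)) :=
          mul_le_mul_of_nonneg_left (mul_le_mul_of_nonneg_left h2 (Real.exp_pos _).le) hC.le
        _ = C * C * Real.exp (-(A * t)) * n x v := by ring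

end Criterion


/-! ### Small saddle Hamiltonians on `ℝ^{2k}` -/

section Saddle

variable {k : ℕ}

/-- The bilinear form of the quadratic form `2 ∑ x_i y_i`. -/
noncomputable def saddle (k : ℕ) : PhaseSpace k →L[ℝ] PhaseSpace k →L[ℝ] ℝ :=
  ∑ i : Fin k,
    ((EuclideanSpace.proj (Sum.inl i) : PhaseSpace k →L[ℝ] ℝ).smulRight
      (EuclideanSpace.proj (Sum.inr i) : PhaseSpace k →L[ℝ] ℝ) +
    (EuclideanSpace.proj (Sum.inr i) : PhaseSpace k →L[ℝ] ℝ).smulRight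
      (EuclideanSpace.proj (Sum.inl i) : PhaseSpace k →L[ℝ] ℝ))

theorem saddle_apply (u v : PhaseSpace k) :
    saddle k u v = ∑ i : Fin k, (u (.inl i) * v (.inr i) + u (.inr i) * v (.inl i)) := by
  simp [saddle]

theorem saddle_symm (u v : PhaseSpace k) : saddle k u v = saddle k v u := by
  simp only [saddle_apply]
  exact Finset.sum_congr rfl fun i _ => by ring

/-- The bilinear form of `∑ dx_i ∧ dy_i`. -/
noncomputable def stdBilin (k : ℕ) : PhaseSpace k →L[ℝ] PhaseSpace k →L[ℝ] ℝ :=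
  altBilin (PhaseSpace k) (∑ i : Fin k, wedgeTwo (E := PhaseSpace k)
    (EuclideanSpace.proj (Sum.inl i)) (EuclideanSpace.proj (Sum.inr i)))

theorem stdBilin_apply (u v : PhaseSpace k) :
    stdBilin k u v = ∑ i : Fin k, (u (.inl i) * v (.inr i) - v (.inl i) * u (.inr i)) := by
  rw [stdBilin, altBilin_apply, ContinuousAlternatingMap.sum_apply]
  exact Finset.sum_congr rfl fun i _ => wedgeTwo_apply _ _ _ _

theorem stdBilin_single_inr (u : PhaseSpace k) (i : Fin k) :
    stdBilin k u (EuclideanSpace.single (.inr i) 1) = u (.inl i) := by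
  rw [stdBilin_apply, Finset.sum_eq_single i]
  · simp
  · intro j _ hj; simp [hj]
  · simp

theorem stdBilin_single_inl (u : PhaseSpace k) (i : Fin k) :
    stdBilin k u (EuclideanSpace.single (.inl i) 1) = - u (.inr i) := by
  rw [stdBilin_apply, Finset.sum_eq_single i]
  · simp
  · intro j _ hj; simp [hj]
  · simp

theorem saddle_single_inr (u : PhaseSpace k) (i : Fin k) :
    saddle k u (EuclideanSpace.single (.inr i) 1) = u (.inl i) := by
  rw [saddle_apply, Finset.sum_eq_single i]
  · simp
  · intro j _ hj; simp [hj]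
  · simp

theorem saddle_single_inl (u : PhaseSpace k) (i : Fin k) :
    saddle k u (EuclideanSpace.single (.inl i) 1) = u (.inr i) := by
  rw [saddle_apply, Finset.sum_eq_single i]
  · simp
  · intro j _ hj; simp [hj]
  · simp

theorem eq_zero_of_stdBilin_eq_zero {u : PhaseSpace k} (h : stdBilin k u = 0) : u = 0 := by
  ext j
  rcases j with i | i
  · rw [← stdBilin_single_inr, h]; rfl
  · have := stdBilin_single_inl u i
    rw [h] at this
    simpa using this.symm

/-- The Hamiltonian equations of `A ∑ x_i y_i`. -/
theorem hamilton_saddle {A : ℝ} {u v : PhaseSpace k}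
    (h : ∀ w, stdBilin k v w = (A • saddle k) u w) (i : Fin k) :
    v (.inl i) = A * u (.inl i) ∧ v (.inr i) = -A * u (.inr i) := by
  constructor
  · rw [← stdBilin_single_inr, h, ← saddle_single_inr u i]; rfl
  · have h1 := h (EuclideanSpace.single (.inl i) 1)
    rw [stdBilin_single_inl] at h1
    have h2 : (A • saddle k) u (EuclideanSpace.single (.inl i) 1) = A * u (.inr i) := by
      rw [← saddle_single_inl u i]; rfl
    rw [h2] at h1
    linarith

theorem hasFDerivAt_saddle (A : ℝ) (z : PhaseSpace k) :
    HasFDerivAt (fun z => A / 2 * saddle k z z) ((A • saddle k) z) z := by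
  have h1 : HasFDerivAt (fun z => saddle k z z) _ z :=
    (saddle k).hasFDerivAt.clm_apply (hasFDerivAt_id z)
  refine (h1.const_mul (A / 2)).congr_fderiv ?_
  ext v
  simp [saddle_symm v z]
  ring

/-- There are `C^1`-small Hamiltonians with small support that are equal to `A ∑ x_i y_i` near the
origin. -/
theorem exists_small_saddle (k : ℕ) (A : ℝ) {s ε : ℝ} (hs : 0 < s) (hε : 0 < ε) :
    ∃ h : PhaseSpace k → ℝ, ContDiff ℝ ∞ h ∧ (∀ z, z ∉ Metric.closedBall 0 s → h z = 0) ∧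
      (∀ z, |h z| < ε) ∧ (∀ z, ‖fderiv ℝ h z‖ < ε) ∧ h 0 = 0 ∧
      ∀ᶠ z in 𝓝 0, HasFDerivAt h ((A • saddle k) z) z := by
  let χ : ContDiffBump (0 : PhaseSpace k) := ⟨1 / 2, 1, by norm_num, by norm_num⟩
  let h₁ : PhaseSpace k → ℝ := fun z => χ z * (A / 2 * saddle k z z)
  have hquad : ContDiff ℝ ∞ fun z : PhaseSpace k => A / 2 * saddle k z z :=
    contDiff_const.mul ((saddle k).contDiff.clm_apply contDiff_id)
  have h₁s : ContDiff ℝ ∞ h₁ := χ.contDiff.mul hquad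
  have h₁c : HasCompactSupport h₁ := χ.hasCompactSupport.mul_right
  have hd : ContDiff ℝ ∞ (fderiv ℝ h₁) := h₁s.fderiv_right (by simp)
  obtain ⟨C₁, hC₁⟩ := h₁c.exists_bound_of_continuous h₁s.continuous
  obtain ⟨C₂, hC₂⟩ := (h₁c.fderiv (𝕜 := ℝ)).exists_bound_of_continuous hd.continuous
  have hC₁0 : 0 ≤ C₁ := (norm_nonneg _).trans (hC₁ 0)
  have hC₂0 : 0 ≤ C₂ := (norm_nonneg _).trans (hC₂ 0)
  -- The function sought is `r² h₁(z / r)`. Its values are at most `r² C₁ ≤ r C₁` because `r ≤ 1`,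
  -- and its derivative is at most `r C₂`. The last condition covers both, with the summand `1`
  -- making the bounds strict, while `r ≤ s` takes care of the support.
  obtain ⟨r, hr0, hrs, hr1, hrC⟩ : ∃ r : ℝ, 0 < r ∧ r ≤ s ∧ r ≤ 1 ∧ r * (C₁ + C₂ + 1) ≤ ε := by
    refine ⟨min s (min 1 (ε / (C₁ + C₂ + 1))), by positivity, min_le_left _ _,
      (min_le_right _ _).trans (min_le_left _ _), ?_⟩
    rw [← le_div_iff₀ (by positivity)]
    exact (min_le_right _ _).trans (min_le_right _ _)
  have hder : ∀ z, HasFDerivAt (fun z => r ^ 2 * h₁ (r⁻¹ • z)) (r • fderiv ℝ h₁ (r⁻¹ • z)) z := by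
    intro z
    have h2 : HasFDerivAt (fun z : PhaseSpace k => r⁻¹ • z)
        (r⁻¹ • ContinuousLinearMap.id ℝ (PhaseSpace k)) z := (hasFDerivAt_id z).const_smul r⁻¹
    have h3 := ((h₁s.differentiable (by simp) (r⁻¹ • z)).hasFDerivAt.comp z h2).const_mul (r ^ 2)
    refine h3.congr_fderiv ?_
    ext v
    simp
    field_simp
  -- A quadratic form is unchanged by this rescaling, so the prescribed Hessian survives for every
  -- `r`.
  have heq : ∀ z ∈ Metric.ball (0 : PhaseSpace k) (r / 2),
      r ^ 2 * h₁ (r⁻¹ • z) = A / 2 * saddle k z z := by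
    intro z hz
    have h1 : χ (r⁻¹ • z) = 1 := by
      apply χ.one_of_mem_closedBall
      rw [mem_ball_zero_iff] at hz
      rw [mem_closedBall_zero_iff, norm_smul, norm_inv, Real.norm_of_nonneg hr0.le]
      rw [inv_mul_le_iff₀ hr0]
      change ‖z‖ ≤ r * (1 / 2)
      linarith
    simp only [h₁, h1, map_smul, smul_apply, smul_eq_mul]
    field_simp
  refine ⟨fun z => r ^ 2 * h₁ (r⁻¹ • z), ?_, ?_, ?_, ?_, ?_, ?_⟩
  · exact contDiff_const.mul (h₁s.comp (contDiff_const_smul _))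
  · intro z hz
    have : χ (r⁻¹ • z) = 0 := by
      apply χ.zero_of_le_dist
      rw [mem_closedBall_zero_iff, not_le] at hz
      rw [dist_zero_right, norm_smul, norm_inv, Real.norm_of_nonneg hr0.le]
      change 1 ≤ _
      rw [le_inv_mul_iff₀ hr0]
      linarith
    simp only [h₁, this, zero_mul, mul_zero]
  · intro z
    rw [abs_mul, abs_of_nonneg (sq_nonneg r)]
    have h1 : |h₁ (r⁻¹ • z)| ≤ C₁ := hC₁ _
    have h2 : r ^ 2 ≤ r := by nlinarith
    calc r ^ 2 * |h₁ (r⁻¹ • z)| ≤ r * C₁ := mul_le_mul h2 h1 (abs_nonneg _) hr0.le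
      _ < r * (C₁ + C₂ + 1) := mul_lt_mul_of_pos_left (by linarith) hr0
      _ ≤ ε := hrC
  · intro z
    rw [(hder z).fderiv, norm_smul, Real.norm_of_nonneg hr0.le]
    calc r * ‖fderiv ℝ h₁ (r⁻¹ • z)‖ ≤ r * C₂ := mul_le_mul_of_nonneg_left (hC₂ _) hr0.le
      _ < r * (C₁ + C₂ + 1) := mul_lt_mul_of_pos_left (by linarith) hr0
      _ ≤ ε := hrC
  · refine (heq 0 (Metric.mem_ball_self (by positivity))).trans ?_
    simp
  · filter_upwards [Metric.isOpen_ball.mem_nhds (Metric.mem_ball_self (x := (0 : PhaseSpace k))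
      (half_pos hr0))] with z hz
    refine (hasFDerivAt_saddle A z).congr_of_eventuallyEq ?_
    filter_upwards [Metric.isOpen_ball.mem_nhds hz] with w hw
    exact heq w hw

end Saddle


/-! ### The coordinates of a split tubular neighbourhood -/

section TDeriv

variable {E : Type*} [NormedAddCommGroup E] [NormedSpace ℝ E]
  {E' : Type*} [NormedAddCommGroup E'] [NormedSpace ℝ E']
  {E'' : Type*} [NormedAddCommGroup E''] [NormedSpace ℝ E'']
  {M : Type*} [TopologicalSpace M] [ChartedSpace E M]
  {M' : Type*} [TopologicalSpace M'] [ChartedSpace E' M']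
  {M'' : Type*} [TopologicalSpace M''] [ChartedSpace E'' M'']

theorem tderiv_comp_apply {g : M' → M''} {f : M → M'} {x : M}
    (hg : MDifferentiableAt 𝓘(ℝ, E') 𝓘(ℝ, E'') g (f x))
    (hf : MDifferentiableAt 𝓘(ℝ, E) 𝓘(ℝ, E') f x) (v : E) :
    tderiv E E'' (fun y => g (f y)) x v = tderiv E' E'' g (f x) (tderiv E E' f x v) :=
  congrArg (fun L : E →L[ℝ] E'' => L v) (mfderiv_comp x hg hf)

theorem tderiv_congr {g f : M → M'} {x : M} (h : g =ᶠ[𝓝 x] f) :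
    tderiv E E' g x = tderiv E E' f x := h.mfderiv_eq

theorem tderiv_eq_of_hasFDerivAt {g : E → E'} {L : E →L[ℝ] E'} {x : E} (h : HasFDerivAt g L x) :
    tderiv E E' g x = L := by
  unfold tderiv
  rw [mfderiv_eq_fderiv, h.fderiv]

end TDeriv

section Tube

variable {EN : Type} [NormedAddCommGroup EN] [NormedSpace ℝ EN] [FiniteDimensional ℝ EN]
  {EM : Type} [NormedAddCommGroup EM] [NormedSpace ℝ EM] [FiniteDimensional ℝ EM]
  {EW : Type} [NormedAddCommGroup EW] [NormedSpace ℝ EW] [FiniteDimensional ℝ EW]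
  {N : Type*} [TopologicalSpace N] [ChartedSpace EN N]
  {M : Type*} [TopologicalSpace M] [ChartedSpace EM M]
  {W : Type*} [TopologicalSpace W] [ChartedSpace EW W]
  {k : ℕ}

/-- A hypersurface `e : M → W` of a symplectic manifold and a submanifold `f : N → M` with a trivial
tubular neighbourhood on which the induced two-form splits. -/
structure SplitTube (EM : Type) [NormedAddCommGroup EM] [NormedSpace ℝ EM] [ChartedSpace EM M]
    (Ω : DiffForm 𝓘(ℝ, EW) W 2) (e : M → W) (f : N → M)
    (σ : DiffForm 𝓘(ℝ, EN) N 2) (δ : ℝ) (Ψ : OpenPartialHomeomorph (N × PhaseSpace k) M) :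
    Prop where
  symplectic : Ω.IsSymplectic
  isEmbedding : IsEmbedding e
  contMDiff : ContMDiff 𝓘(ℝ, EM) 𝓘(ℝ, EW) ∞ e
  injective_tderiv : ∀ x, Function.Injective (tderiv EM EW e x)
  hamiltonian : σ.IsHamiltonian
  pos : 0 < δ
  source_eq : Ψ.source = univ ×ˢ Metric.ball 0 δ
  smooth : ContMDiffOn (𝓘(ℝ, EN).prod 𝓘(ℝ, PhaseSpace k)) 𝓘(ℝ, EM) ∞ Ψ Ψ.source
  symm_smooth : ContMDiffOn 𝓘(ℝ, EM) (𝓘(ℝ, EN).prod 𝓘(ℝ, PhaseSpace k)) ∞ Ψ.symm Ψ.target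
  map_base : ∀ p, Ψ (p, 0) = f p
  split : ∀ q ∈ Ψ.source,
    DiffForm.pullback (𝓘(ℝ, EN).prod 𝓘(ℝ, PhaseSpace k)) 𝓘(ℝ, EM) Ψ
        (DiffForm.pullback 𝓘(ℝ, EM) 𝓘(ℝ, EW) e Ω) q =
      DiffForm.pullback (𝓘(ℝ, EN).prod 𝓘(ℝ, PhaseSpace k)) 𝓘(ℝ, EN) Prod.fst σ q +
      DiffForm.pullback (𝓘(ℝ, EN).prod 𝓘(ℝ, PhaseSpace k)) 𝓘(ℝ, PhaseSpace k) Prod.snd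
        (stdForm k) q

/-- The parametrization of the tube obtained from a chart of `N`. -/
noncomputable def tubeChart (EN : Type) [NormedAddCommGroup EN] [NormedSpace ℝ EN]
    [ChartedSpace EN N] (Ψ : OpenPartialHomeomorph (N × PhaseSpace k) M) (p : N) :
    OpenPartialHomeomorph (EN × PhaseSpace k) M :=
  ((chartAt EN p).symm.prod (OpenPartialHomeomorph.refl _)).trans Ψ

variable {Ω : DiffForm 𝓘(ℝ, EW) W 2} {e : M → W} {f : N → M} {σ : DiffForm 𝓘(ℝ, EN) N 2} {δ : ℝ}
  {Ψ : OpenPartialHomeomorph (N × PhaseSpace k) M}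

theorem tubeChart_apply (p : N) (w : EN × PhaseSpace k) :
    tubeChart EN Ψ p w = Ψ ((chartAt EN p).symm w.1, w.2) := rfl

theorem SplitTube.mem_source (h : SplitTube EM Ω e f σ δ Ψ) {q : N × PhaseSpace k} :
    q ∈ Ψ.source ↔ q.2 ∈ Metric.ball (0 : PhaseSpace k) δ := by
  rw [h.source_eq]; simp

theorem SplitTube.mem_tubeChart_source (h : SplitTube EM Ω e f σ δ Ψ) {p : N}
    {w : EN × PhaseSpace k} : w ∈ (tubeChart EN Ψ p).source ↔
      w.1 ∈ (chartAt EN p).target ∧ w.2 ∈ Metric.ball (0 : PhaseSpace k) δ := by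
  rw [tubeChart, OpenPartialHomeomorph.trans_source, mem_inter_iff, mem_preimage, h.mem_source]
  simp

theorem SplitTube.zero_mem (h : SplitTube EM Ω e f σ δ Ψ) (p : N) : (p, 0) ∈ Ψ.source :=
  h.mem_source.2 (Metric.mem_ball_self h.pos)

theorem SplitTube.mem_target (h : SplitTube EM Ω e f σ δ Ψ) (p : N) : f p ∈ Ψ.target := by
  rw [← h.map_base]
  exact Ψ.map_source (h.zero_mem p)

theorem SplitTube.symm_apply (h : SplitTube EM Ω e f σ δ Ψ) (p : N) : Ψ.symm (f p) = (p, 0) := by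
  rw [← h.map_base]
  exact Ψ.left_inv (h.zero_mem p)

theorem SplitTube.base_mem_source (h : SplitTube EM Ω e f σ δ Ψ) (p : N) :
    (chartAt EN p p, 0) ∈ (tubeChart EN Ψ p).source :=
  h.mem_tubeChart_source.2 ⟨mem_chart_target EN p, Metric.mem_ball_self h.pos⟩

theorem SplitTube.tubeChart_base (h : SplitTube EM Ω e f σ δ Ψ) (p : N) :
    tubeChart EN Ψ p (chartAt EN p p, 0) = f p := by
  rw [tubeChart_apply, (chartAt EN p).left_inv (mem_chart_source EN p), h.map_base]

theorem SplitTube.symm_tubeChart (h : SplitTube EM Ω e f σ δ Ψ) {p : N} {w : EN × PhaseSpace k}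
    (hw : w ∈ (tubeChart EN Ψ p).source) :
    Ψ.symm (tubeChart EN Ψ p w) = ((chartAt EN p).symm w.1, w.2) := by
  rw [tubeChart_apply]
  exact Ψ.left_inv (h.mem_source.2 (h.mem_tubeChart_source.1 hw).2)

theorem SplitTube.tubeChart_mem_target (h : SplitTube EM Ω e f σ δ Ψ) {p : N} {w : EN × PhaseSpace k}
    (hw : w ∈ (tubeChart EN Ψ p).source) : tubeChart EN Ψ p w ∈ Ψ.target :=
  Ψ.map_source (h.mem_source.2 (h.mem_tubeChart_source.1 hw).2)

/-- Every point of the tube is in the range of a parametrization. -/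
theorem SplitTube.exists_tubeChart_eq (h : SplitTube EM Ω e f σ δ Ψ) {x : M} (hx : x ∈ Ψ.target) :
    (chartAt EN (Ψ.symm x).1 (Ψ.symm x).1, (Ψ.symm x).2) ∈ (tubeChart EN Ψ (Ψ.symm x).1).source ∧
      tubeChart EN Ψ (Ψ.symm x).1 (chartAt EN (Ψ.symm x).1 (Ψ.symm x).1, (Ψ.symm x).2) = x := by
  constructor
  · exact h.mem_tubeChart_source.2 ⟨mem_chart_target EN _, h.mem_source.1 (Ψ.map_target hx)⟩
  · rw [tubeChart_apply, (chartAt EN _).left_inv (mem_chart_source EN _)]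
    exact Ψ.right_inv hx

variable [IsManifold 𝓘(ℝ, EN) ∞ N]

theorem contMDiffOn_tubeChart_aux (p : N) :
    ContMDiffOn 𝓘(ℝ, EN × PhaseSpace k) (𝓘(ℝ, EN).prod 𝓘(ℝ, PhaseSpace k)) ∞
      (fun w : EN × PhaseSpace k => ((chartAt EN p).symm w.1, w.2))
      (Prod.fst ⁻¹' (chartAt EN p).target) := by
  have h1 : ContMDiffOn 𝓘(ℝ, EN) 𝓘(ℝ, EN) ∞ (chartAt EN p).symm (chartAt EN p).target :=
    contMDiffOn_symm_of_mem_maximalAtlas (IsManifold.chart_mem_maximalAtlas p)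
  exact (h1.comp (contDiff_fst.contMDiff.contMDiffOn) (fun _ h => h)).prodMk
    contDiff_snd.contMDiff.contMDiffOn

theorem SplitTube.contMDiffOn_tubeChart (h : SplitTube EM Ω e f σ δ Ψ) (p : N) :
    ContMDiffOn 𝓘(ℝ, EN × PhaseSpace k) 𝓘(ℝ, EM) ∞ (tubeChart EN Ψ p) (tubeChart EN Ψ p).source :=
  h.smooth.comp ((contMDiffOn_tubeChart_aux p).mono
    fun _ hw => (h.mem_tubeChart_source.1 hw).1)
    fun _ hw => h.mem_source.2 (h.mem_tubeChart_source.1 hw).2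

theorem SplitTube.contMDiffOn_symm_fst (h : SplitTube EM Ω e f σ δ Ψ) :
    ContMDiffOn 𝓘(ℝ, EM) 𝓘(ℝ, EN) ∞ (fun x => (Ψ.symm x).1) Ψ.target :=
  contMDiff_fst.comp_contMDiffOn h.symm_smooth

theorem SplitTube.contMDiffOn_symm_snd (h : SplitTube EM Ω e f σ δ Ψ) :
    ContMDiffOn 𝓘(ℝ, EM) 𝓘(ℝ, PhaseSpace k) ∞ (fun x => (Ψ.symm x).2) Ψ.target :=
  contMDiff_snd.comp_contMDiffOn h.symm_smooth

theorem SplitTube.contMDiffOn_tubeChart_symm (h : SplitTube EM Ω e f σ δ Ψ) (p : N) :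
    ContMDiffOn 𝓘(ℝ, EM) 𝓘(ℝ, EN × PhaseSpace k) ∞ (tubeChart EN Ψ p).symm (tubeChart EN Ψ p).target := by
  have h1 : ContMDiffOn 𝓘(ℝ, EN) 𝓘(ℝ, EN) ∞ (chartAt EN p) (chartAt EN p).source :=
    contMDiffOn_of_mem_maximalAtlas (IsManifold.chart_mem_maximalAtlas p)
  have hsub : (tubeChart EN Ψ p).target ⊆ Ψ.target := fun x hx => hx.1
  have h2 : ∀ x ∈ (tubeChart EN Ψ p).target, (Ψ.symm x).1 ∈ (chartAt EN p).source := by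
    intro x hx
    exact hx.2.1
  exact (h1.comp (h.contMDiffOn_symm_fst.mono hsub) h2).prodMk_space
    (h.contMDiffOn_symm_snd.mono hsub)

variable [IsManifold 𝓘(ℝ, EM) ∞ M] [IsManifold 𝓘(ℝ, EW) ∞ W]

theorem SplitTube.bijective_tderiv_tubeChart (h : SplitTube EM Ω e f σ δ Ψ) {p : N}
    {w : EN × PhaseSpace k} (hw : w ∈ (tubeChart EN Ψ p).source) :
    Function.Bijective (tderiv (EN × PhaseSpace k) EM (tubeChart EN Ψ p) w) :=
  bijective_mfderiv_of_smooth (h.contMDiffOn_tubeChart p) (h.contMDiffOn_tubeChart_symm p) hw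

/-- The splitting of the induced form in the coordinates of the tube. -/
theorem SplitTube.split_tubeChart (h : SplitTube EM Ω e f σ δ Ψ) {p : N} {w : EN × PhaseSpace k}
    (hw : w ∈ (tubeChart EN Ψ p).source) (a a' : EN) (ζ ζ' : PhaseSpace k) :
    Ω.bilin (e (tubeChart EN Ψ p w))
        (tderiv (EN × PhaseSpace k) EW (fun w => e (tubeChart EN Ψ p w)) w (a, ζ))
        (tderiv (EN × PhaseSpace k) EW (fun w => e (tubeChart EN Ψ p w)) w (a', ζ')) =
      σ.bilin ((chartAt EN p).symm w.1) (tderiv EN EN (chartAt EN p).symm w.1 a)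
        (tderiv EN EN (chartAt EN p).symm w.1 a') + stdBilin k ζ ζ' := by
  have hw' := h.mem_tubeChart_source.1 hw
  set q : N × PhaseSpace k := ((chartAt EN p).symm w.1, w.2) with hq
  have hqs : q ∈ Ψ.source := h.mem_source.2 hw'.2
  have hs : MDifferentiableAt 𝓘(ℝ, EN) 𝓘(ℝ, EN) (chartAt EN p).symm w.1 :=
    (contMDiffAt_symm_of_mem_maximalAtlas (IsManifold.chart_mem_maximalAtlas (n := ∞) p)
      hw'.1).mdifferentiableAt (by simp)
  have hfst : HasMFDerivAt 𝓘(ℝ, EN × PhaseSpace k) 𝓘(ℝ, EN)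
      (fun w : EN × PhaseSpace k => (chartAt EN p).symm w.1) w
      ((tderiv EN EN (chartAt EN p).symm w.1).comp (ContinuousLinearMap.fst ℝ EN (PhaseSpace k))) :=
    hs.hasMFDerivAt.comp w (hasFDerivAt_fst (𝕜 := ℝ) (p := w)).hasMFDerivAt
  have hι : HasMFDerivAt 𝓘(ℝ, EN × PhaseSpace k) (𝓘(ℝ, EN).prod 𝓘(ℝ, PhaseSpace k))
      (fun w : EN × PhaseSpace k => ((chartAt EN p).symm w.1, w.2)) w
      (((tderiv EN EN (chartAt EN p).symm w.1).comp
        (ContinuousLinearMap.fst ℝ EN (PhaseSpace k))).prod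
          (ContinuousLinearMap.snd ℝ EN (PhaseSpace k))) :=
    hfst.prodMk (hasFDerivAt_snd (𝕜 := ℝ) (p := w)).hasMFDerivAt
  have hΨ : HasMFDerivAt (𝓘(ℝ, EN).prod 𝓘(ℝ, PhaseSpace k)) 𝓘(ℝ, EM) Ψ q
      (mfderiv (𝓘(ℝ, EN).prod 𝓘(ℝ, PhaseSpace k)) 𝓘(ℝ, EM) Ψ q) :=
    ((h.smooth.contMDiffAt (Ψ.open_source.mem_nhds hqs)).mdifferentiableAt (by simp)).hasMFDerivAt
  have he : HasMFDerivAt 𝓘(ℝ, EM) 𝓘(ℝ, EW) e (Ψ q) (mfderiv 𝓘(ℝ, EM) 𝓘(ℝ, EW) e (Ψ q)) :=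
    (h.contMDiff.contMDiffAt.mdifferentiableAt (by simp)).hasMFDerivAt
  have hcomp := (he.comp q hΨ).comp w hι
  have hd : ∀ b : EN, ∀ z : PhaseSpace k,
      tderiv (EN × PhaseSpace k) EW (fun w => e (tubeChart EN Ψ p w)) w (b, z) =
      mfderiv 𝓘(ℝ, EM) 𝓘(ℝ, EW) e (Ψ q) (mfderiv (𝓘(ℝ, EN).prod 𝓘(ℝ, PhaseSpace k)) 𝓘(ℝ, EM) Ψ q
        ((tderiv EN EN (chartAt EN p).symm w.1 b, z) : EN × PhaseSpace k)) := fun b z =>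
    congrArg (fun L : (EN × PhaseSpace k) →L[ℝ] EW => L (b, z)) hcomp.mfderiv
  rw [hd, hd]
  have hsp := congrArg (fun A : (EN × PhaseSpace k) [⋀^Fin 2]→L[ℝ] ℝ =>
    altBilin (EN × PhaseSpace k) A (tderiv EN EN (chartAt EN p).symm w.1 a, ζ)
      (tderiv EN EN (chartAt EN p).symm w.1 a', ζ')) (h.split q hqs)
  have hfst' : mfderiv (𝓘(ℝ, EN).prod 𝓘(ℝ, PhaseSpace k)) 𝓘(ℝ, EN) Prod.fst q =
      ContinuousLinearMap.fst ℝ EN (PhaseSpace k) := mfderiv_fst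
  have hsnd' : mfderiv (𝓘(ℝ, EN).prod 𝓘(ℝ, PhaseSpace k)) 𝓘(ℝ, PhaseSpace k) Prod.snd q =
      ContinuousLinearMap.snd ℝ EN (PhaseSpace k) := mfderiv_snd
  have hR1 := σ.altBilin_pull (I := 𝓘(ℝ, EN).prod 𝓘(ℝ, PhaseSpace k)) Prod.fst q
    (tderiv EN EN (chartAt EN p).symm w.1 a, ζ) (tderiv EN EN (chartAt EN p).symm w.1 a', ζ')
  rw [hfst'] at hR1
  have hR2 := (stdForm k).altBilin_pull (I := 𝓘(ℝ, EN).prod 𝓘(ℝ, PhaseSpace k)) Prod.snd q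
    (tderiv EN EN (chartAt EN p).symm w.1 a, ζ) (tderiv EN EN (chartAt EN p).symm w.1 a', ζ')
  rw [hsnd'] at hR2
  have hL := DiffForm.altBilin_pull (I := 𝓘(ℝ, EN).prod 𝓘(ℝ, PhaseSpace k)) Ψ
    (DiffForm.pullback 𝓘(ℝ, EM) 𝓘(ℝ, EW) e Ω) q
    (tderiv EN EN (chartAt EN p).symm w.1 a, ζ) (tderiv EN EN (chartAt EN p).symm w.1 a', ζ')
  have hL2 := fun x y => Ω.altBilin_pull (I := 𝓘(ℝ, EM)) e (Ψ q) x y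
  refine Eq.trans ?_ (hsp.trans ((congrArg₂ (· + ·) hR1 hR2).trans rfl))
  exact (hL.trans (hL2 _ _)).symm

end Tube


/-! ### Pushing a hypersurface along a flow -/

section FlowDerivative

variable {E : Type*} [NormedAddCommGroup E] [NormedSpace ℝ E]
  {W : Type*} [TopologicalSpace W] [ChartedSpace E W] [IsManifold 𝓘(ℝ, E) ∞ W]
  {E' : Type*} [NormedAddCommGroup E'] [NormedSpace ℝ E']
  {M : Type*} [TopologicalSpace M] [ChartedSpace E' M]
  {V : ∀ x : W, TangentSpace 𝓘(ℝ, E) x} {θ : ℝ → W → W}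

/-- The value of a vector field, as a vector of the model space. -/
def modelVec (V : ∀ x : W, TangentSpace 𝓘(ℝ, E) x) (x : W) : E := V x

theorem IsGlobalFlow.contMDiffAt_apply (hθ : IsGlobalFlow V θ) {τ : M → ℝ} {α : M → W} {x : M}
    (hτ : ContMDiffAt 𝓘(ℝ, E') 𝓘(ℝ, ℝ) ∞ τ x) (hα : ContMDiffAt 𝓘(ℝ, E') 𝓘(ℝ, E) ∞ α x) :
    ContMDiffAt 𝓘(ℝ, E') 𝓘(ℝ, E) ∞ (fun y => θ (τ y) (α y)) x :=
  hθ.smooth.contMDiffAt.comp x (hτ.prodMk hα)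

/-- The derivative of `x ↦ θ (τ x) (α x)`. -/
theorem IsGlobalFlow.tderiv_apply (hθ : IsGlobalFlow V θ) {τ : M → ℝ} {α : M → W} {x : M}
    (hτ : ContMDiffAt 𝓘(ℝ, E') 𝓘(ℝ, ℝ) ∞ τ x) (hα : ContMDiffAt 𝓘(ℝ, E') 𝓘(ℝ, E) ∞ α x) (v : E') :
    tderiv E' E (fun y => θ (τ y) (α y)) x v =
      tderiv E E (θ (τ x)) (α x) (tderiv E' E α x v) +
        (tderiv E' ℝ τ x v) • modelVec V (θ (τ x) (α x)) := by
  have hd : MDifferentiableAt (𝓘(ℝ, ℝ).prod 𝓘(ℝ, E)) 𝓘(ℝ, E) (fun q : ℝ × W => θ q.1 q.2)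
      (τ x, α x) := hθ.smooth.contMDiffAt.mdifferentiableAt (by simp)
  have hp : HasMFDerivAt 𝓘(ℝ, E') (𝓘(ℝ, ℝ).prod 𝓘(ℝ, E)) (fun y => (τ y, α y)) x
      ((tderiv E' ℝ τ x).prod (tderiv E' E α x)) :=
    (hτ.mdifferentiableAt (by simp)).hasMFDerivAt.prodMk
      (hα.mdifferentiableAt (by simp)).hasMFDerivAt
  have h1 := (hd.hasMFDerivAt.comp x hp).mfderiv
  have h2 := mfderiv_prod_eq_add_apply (p := (τ x, α x))
    (v := ((tderiv E' ℝ τ x v, tderiv E' E α x v) : ℝ × E)) hd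
  have h3 : mfderiv 𝓘(ℝ, ℝ) 𝓘(ℝ, E) (fun t => θ t (α x)) (τ x) = _ :=
    (hθ.integral (α x) (τ x)).mfderiv
  have h4 := (congrArg (fun L : E' →L[ℝ] E => L v) h1).trans h2
  have h5 : (mfderiv 𝓘(ℝ, ℝ) 𝓘(ℝ, E) (fun t => θ t (α x)) (τ x) : ℝ →L[ℝ] E)
      (tderiv E' ℝ τ x v) = (tderiv E' ℝ τ x v) • modelVec V (θ (τ x) (α x)) :=
    congrArg (fun L : ℝ →L[ℝ] E => L (tderiv E' ℝ τ x v)) h3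
  refine h4.trans ?_
  rw [add_comm]
  exact congrArg₂ (fun a b : E => a + b) rfl h5

theorem IsGlobalFlow.tderiv_time_zero (hθ : IsGlobalFlow V θ) (x : W) :
    tderiv E E (θ 0) x = ContinuousLinearMap.id ℝ E := by
  have h : θ 0 = id := funext hθ.map_zero
  unfold tderiv
  rw [h]
  exact mfderiv_id

end FlowDerivative

section LocalInjectivity

variable {E : Type*} [NormedAddCommGroup E] [NormedSpace ℝ E] [FiniteDimensional ℝ E]
  {W : Type*} [TopologicalSpace W] [ChartedSpace E W] [IsManifold 𝓘(ℝ, E) ∞ W]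
  {Y : Type*} [NormedAddCommGroup Y] [NormedSpace ℝ Y] [FiniteDimensional ℝ Y]

/-- The inverse function theorem for parametrizations of a manifold. -/
theorem ContMDiffOn.exists_mem_nhds_injOn (hdim : Module.finrank ℝ Y = Module.finrank ℝ E)
    {g : Y → W} {U : Set Y} (hU : IsOpen U) (hg : ContMDiffOn 𝓘(ℝ, Y) 𝓘(ℝ, E) ∞ g U) {y₀ : Y}
    (hy₀ : y₀ ∈ U) (hinj : Function.Injective (tderiv Y E g y₀)) :
    ∃ O ∈ 𝓝 y₀, InjOn g O ∧ ∀ y ∈ O, Function.Injective (tderiv Y E g y) := by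
  have : CompleteSpace E := FiniteDimensional.complete ℝ E
  have : CompleteSpace Y := FiniteDimensional.complete ℝ Y
  set ψ := chartAt E (g y₀)
  have hψ : ψ ∈ IsManifold.maximalAtlas 𝓘(ℝ, E) ∞ W := IsManifold.chart_mem_maximalAtlas _
  have hV : IsOpen (U ∩ g ⁻¹' ψ.source) := hg.continuousOn.isOpen_inter_preimage hU ψ.open_source
  have hyV : y₀ ∈ U ∩ g ⁻¹' ψ.source := ⟨hy₀, mem_chart_source E (g y₀)⟩
  have hG : ContDiffOn ℝ ∞ (ψ ∘ g) (U ∩ g ⁻¹' ψ.source) :=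
    ((contMDiffOn_of_mem_maximalAtlas hψ).comp (hg.mono inter_subset_left)
      fun y hy => hy.2).contDiffOn
  have hchain : ∀ y ∈ U ∩ g ⁻¹' ψ.source, ∀ v, fderiv ℝ (ψ ∘ g) y v =
      tderiv E E ψ (g y) (tderiv Y E g y v) := by
    intro y hy v
    rw [← tderiv_comp_apply (E := Y) (E' := E) (E'' := E)
      ((contMDiffAt_of_mem_maximalAtlas hψ hy.2).mdifferentiableAt (by simp))
      ((hg.contMDiffAt (hU.mem_nhds hy.1)).mdifferentiableAt (by simp))]
    unfold tderiv
    rw [mfderiv_eq_fderiv]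
    rfl
  have hψb : Function.Injective (tderiv E E ψ (g y₀)) :=
    ((mdifferentiable_of_mem_atlas (I := 𝓘(ℝ, E)) (chart_mem_atlas E (g y₀))).mfderiv_bijective
      (mem_chart_source E (g y₀))).1
  have hGi : Function.Injective (fderiv ℝ (ψ ∘ g) y₀) := by
    intro a b hab
    rw [hchain y₀ hyV, hchain y₀ hyV] at hab
    exact hinj (hψb hab)
  let T₀ : Y ≃L[ℝ] E := (LinearEquiv.ofInjectiveOfFinrankEq (fderiv ℝ (ψ ∘ g) y₀).toLinearMap hGi
    hdim).toContinuousLinearEquiv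
  have hT₀ : HasFDerivAt (ψ ∘ g) (T₀ : Y →L[ℝ] E) y₀ := by
    have h1 := ((hG.contDiffAt (hV.mem_nhds hyV)).differentiableAt (by simp)).hasFDerivAt
    refine h1.congr_fderiv ?_
    ext v
    rfl
  obtain ⟨T, hT1, hT2, hT3, hT4, hT5⟩ := hG.exists_smooth_openPartialHomeomorph hV hyV hT₀
  refine ⟨T.source, T.open_source.mem_nhds hT1, ?_, ?_⟩
  · intro a ha b hb hab
    refine T.injOn ha hb ?_
    rw [hT3, hT3, Function.comp_apply, Function.comp_apply, hab]
  · intro y hy a b hab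
    have h1 : Function.Injective (fderiv ℝ T y) := by
      have h2 := (bijective_mfderiv_of_smooth (κ := T) hT4.contMDiffOn hT5.contMDiffOn hy).1
      rwa [mfderiv_eq_fderiv] at h2
    apply h1
    have h3 : (T : Y → E) = ψ ∘ g := funext hT3
    rw [h3, hchain y (hT2 hy), hchain y (hT2 hy), hab]

end LocalInjectivity


/-! ### Flow-out coordinates of `W` near `N` -/

section FlowOut

theorem tderiv_linear {E E' : Type*} [NormedAddCommGroup E] [NormedSpace ℝ E]
    [NormedAddCommGroup E'] [NormedSpace ℝ E'] (L : E →L[ℝ] E') {g : E → E'} (hg : ∀ x, g x = L x)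
    (x v : E) : tderiv E E' g x v = L v := by
  have h : g = L := funext hg
  rw [h, tderiv_eq_of_hasFDerivAt L.hasFDerivAt]

variable {EN : Type} [NormedAddCommGroup EN] [NormedSpace ℝ EN] [FiniteDimensional ℝ EN]
  {EM : Type} [NormedAddCommGroup EM] [NormedSpace ℝ EM] [FiniteDimensional ℝ EM]
  {EW : Type} [NormedAddCommGroup EW] [NormedSpace ℝ EW] [FiniteDimensional ℝ EW]
  {N : Type*} [TopologicalSpace N] [ChartedSpace EN N] [IsManifold 𝓘(ℝ, EN) ∞ N]
  {M : Type*} [TopologicalSpace M] [ChartedSpace EM M] [IsManifold 𝓘(ℝ, EM) ∞ M]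
  {W : Type*} [TopologicalSpace W] [ChartedSpace EW W] [IsManifold 𝓘(ℝ, EW) ∞ W]
  {k : ℕ}
  {Ω : DiffForm 𝓘(ℝ, EW) W 2} {e : M → W} {f : N → M} {σ : DiffForm 𝓘(ℝ, EN) N 2} {δ : ℝ}
  {Ψ : OpenPartialHomeomorph (N × PhaseSpace k) M}
  {V : ∀ x : W, TangentSpace 𝓘(ℝ, EW) x} {θ : ℝ → W → W} {R : ∀ p : N, TangentSpace 𝓘(ℝ, EN) p}

/-- A flow on `W` transverse to `M` along `N`, and the kernel field of `σ` dual to it. -/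
structure TransverseFlow (Ω : DiffForm 𝓘(ℝ, EW) W 2) (g : N → W) (σ : DiffForm 𝓘(ℝ, EN) N 2)
    (V : ∀ x : W, TangentSpace 𝓘(ℝ, EW) x) (θ : ℝ → W → W)
    (R : ∀ p : N, TangentSpace 𝓘(ℝ, EN) p) : Prop where
  flow : IsGlobalFlow V θ
  smooth : ContMDiff 𝓘(ℝ, EN) 𝓘(ℝ, EN).tangent ∞
    (fun p => (⟨p, R p⟩ : TangentBundle 𝓘(ℝ, EN) N))
  ker : ∀ p, σ.bilin p (modelVec R p) = 0
  pair : ∀ p, Ω.bilin (g p) (modelVec V (g p)) (tderiv EN EW g p (modelVec R p)) = 1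

/-- The map `(u, z, t) ↦ θ_t(e(κ(u, z)))`. -/
def flowOut (θ : ℝ → W → W) (e : M → W) (κ : EN × PhaseSpace k → M)
    (y : EN × PhaseSpace k × ℝ) : W := θ y.2.2 (e (κ (y.1, y.2.1)))

theorem SplitTube.contMDiffAt_comp_tubeChart (h : SplitTube EM Ω e f σ δ Ψ) {p : N}
    {w : EN × PhaseSpace k} (hw : w ∈ (tubeChart EN Ψ p).source) :
    ContMDiffAt 𝓘(ℝ, EN × PhaseSpace k) 𝓘(ℝ, EW) ∞ (fun w => e (tubeChart EN Ψ p w)) w :=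
  h.contMDiff.contMDiffAt.comp w
    ((h.contMDiffOn_tubeChart p).contMDiffAt ((tubeChart EN Ψ p).open_source.mem_nhds hw))

theorem contDiff_forget_time :
    ContDiff ℝ ∞ (fun y : EN × PhaseSpace k × ℝ => (y.1, y.2.1)) := by fun_prop

theorem SplitTube.isOpen_flowOut_domain (_ : SplitTube EM Ω e f σ δ Ψ) (p : N) :
    IsOpen {y : EN × PhaseSpace k × ℝ | (y.1, y.2.1) ∈ (tubeChart EN Ψ p).source} :=
  (tubeChart EN Ψ p).open_source.preimage (contDiff_forget_time (EN := EN)).continuous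

theorem SplitTube.contMDiffOn_flowOut (h : SplitTube EM Ω e f σ δ Ψ) (hθ : IsGlobalFlow V θ)
    (p : N) : ContMDiffOn 𝓘(ℝ, EN × PhaseSpace k × ℝ) 𝓘(ℝ, EW) ∞ (flowOut θ e (tubeChart EN Ψ p))
      {y | (y.1, y.2.1) ∈ (tubeChart EN Ψ p).source} := by
  intro y hy
  have h1 : ContMDiffAt 𝓘(ℝ, EN × PhaseSpace k × ℝ) 𝓘(ℝ, EW) ∞
      (fun y : EN × PhaseSpace k × ℝ => e (tubeChart EN Ψ p (y.1, y.2.1))) y :=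
    ContMDiffAt.comp y (g := fun w => e (tubeChart EN Ψ p w)) (h.contMDiffAt_comp_tubeChart hy)
      contDiff_forget_time.contMDiff.contMDiffAt
  have h2 : ContDiff ℝ ∞ (fun y : EN × PhaseSpace k × ℝ => y.2.2) := by fun_prop
  exact (hθ.contMDiffAt_apply h2.contMDiff.contMDiffAt h1).contMDiffWithinAt

theorem SplitTube.tderiv_flowOut (h : SplitTube EM Ω e f σ δ Ψ) (hθ : IsGlobalFlow V θ) {p : N}
    {y : EN × PhaseSpace k × ℝ} (hy : (y.1, y.2.1) ∈ (tubeChart EN Ψ p).source) (a : EN)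
    (ζ : PhaseSpace k) (c : ℝ) :
    tderiv (EN × PhaseSpace k × ℝ) EW (flowOut θ e (tubeChart EN Ψ p)) y (a, ζ, c) =
      tderiv EW EW (θ y.2.2) (e (tubeChart EN Ψ p (y.1, y.2.1)))
        (tderiv (EN × PhaseSpace k) EW (fun w => e (tubeChart EN Ψ p w)) (y.1, y.2.1) (a, ζ)) +
      c • modelVec V (flowOut θ e (tubeChart EN Ψ p) y) := by
  have h1 : ContMDiffAt 𝓘(ℝ, EN × PhaseSpace k × ℝ) 𝓘(ℝ, EW) ∞
      (fun y : EN × PhaseSpace k × ℝ => e (tubeChart EN Ψ p (y.1, y.2.1))) y :=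
    ContMDiffAt.comp y (g := fun w => e (tubeChart EN Ψ p w)) (h.contMDiffAt_comp_tubeChart hy)
      contDiff_forget_time.contMDiff.contMDiffAt
  have h2 : ContDiff ℝ ∞ (fun y : EN × PhaseSpace k × ℝ => y.2.2) := by fun_prop
  have h3 := hθ.tderiv_apply h2.contMDiff.contMDiffAt h1 (a, ζ, c)
  have h4 : tderiv (EN × PhaseSpace k × ℝ) ℝ (fun y => y.2.2) y (a, ζ, c) = c := by
    exact tderiv_linear ((ContinuousLinearMap.snd ℝ (PhaseSpace k) ℝ).comp
      (ContinuousLinearMap.snd ℝ EN (PhaseSpace k × ℝ))) (fun _ => rfl) y _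
  have h5 : tderiv (EN × PhaseSpace k × ℝ) (EN × PhaseSpace k) (fun y => (y.1, y.2.1)) y
      (a, ζ, c) = (a, ζ) := by
    exact tderiv_linear ((ContinuousLinearMap.fst ℝ EN (PhaseSpace k × ℝ)).prod
      ((ContinuousLinearMap.fst ℝ (PhaseSpace k) ℝ).comp
      (ContinuousLinearMap.snd ℝ EN (PhaseSpace k × ℝ)))) (fun _ => rfl) y _
  have h6 := tderiv_comp_apply (E := EN × PhaseSpace k × ℝ) (E' := EN × PhaseSpace k) (E'' := EW)
    (g := fun w => e (tubeChart EN Ψ p w)) (f := fun y : EN × PhaseSpace k × ℝ => (y.1, y.2.1))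
    (x := y) ((h.contMDiffAt_comp_tubeChart hy).mdifferentiableAt (by simp))
    (contDiff_forget_time.contMDiff.contMDiffAt.mdifferentiableAt (by simp)) (a, ζ, c)
  rw [h4, h6, h5] at h3
  exact h3

theorem SplitTube.tderiv_flowOut_zero (h : SplitTube EM Ω e f σ δ Ψ) (hθ : IsGlobalFlow V θ) {p : N}
    {u : EN} {z : PhaseSpace k} (hy : (u, z) ∈ (tubeChart EN Ψ p).source) (a : EN)
    (ζ : PhaseSpace k) (c : ℝ) :
    tderiv (EN × PhaseSpace k × ℝ) EW (flowOut θ e (tubeChart EN Ψ p)) (u, z, 0) (a, ζ, c) =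
      tderiv (EN × PhaseSpace k) EW (fun w => e (tubeChart EN Ψ p w)) (u, z) (a, ζ) +
      c • modelVec V (e (tubeChart EN Ψ p (u, z))) := by
  have h1 := h.tderiv_flowOut hθ (y := (u, z, 0)) hy a ζ c
  rw [hθ.tderiv_time_zero] at h1
  have h2 : flowOut θ e (tubeChart EN Ψ p) (u, z, 0) = e (tubeChart EN Ψ p (u, z)) :=
    hθ.map_zero _
  rw [h2] at h1
  exact h1

/-- Along `N`, the derivative of the parametrization in the directions of `N`. -/
theorem SplitTube.tderiv_comp_tubeChart_zero (h : SplitTube EM Ω e f σ δ Ψ)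
    (hf : ContMDiff 𝓘(ℝ, EN) 𝓘(ℝ, EM) ∞ f) {p : N}
    {u : EN} (hu : u ∈ (chartAt EN p).target) (a : EN) :
    tderiv (EN × PhaseSpace k) EW (fun w => e (tubeChart EN Ψ p w)) (u, 0) (a, 0) =
      tderiv EN EW (fun p => e (f p)) ((chartAt EN p).symm u)
        (tderiv EN EN (chartAt EN p).symm u a) := by
  have hs : ContMDiffAt 𝓘(ℝ, EN) 𝓘(ℝ, EN) ∞ (chartAt EN p).symm u :=
    contMDiffAt_symm_of_mem_maximalAtlas (IsManifold.chart_mem_maximalAtlas (n := ∞) p) hu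
  have hmem : (u, (0 : PhaseSpace k)) ∈ (tubeChart EN Ψ p).source :=
    h.mem_tubeChart_source.2 ⟨hu, Metric.mem_ball_self h.pos⟩
  have hι : ContDiff ℝ ∞ (fun u : EN => (u, (0 : PhaseSpace k))) := by fun_prop
  rw [← tderiv_comp_apply (E := EN) (E' := EN) (E'' := EW)
    (g := fun p => e (f p)) ((h.contMDiff.comp hf).contMDiffAt.mdifferentiableAt (by simp))
    (hs.mdifferentiableAt (by simp))]
  have h5 : tderiv EN (EN × PhaseSpace k) (fun u => (u, (0 : PhaseSpace k))) u a = (a, 0) := by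
    exact tderiv_linear (ContinuousLinearMap.inl ℝ EN (PhaseSpace k)) (fun _ => rfl) u a
  rw [← h5, ← tderiv_comp_apply (E := EN) (E' := EN × PhaseSpace k) (E'' := EW)
    (g := fun w => e (tubeChart EN Ψ p w)) (f := fun u : EN => (u, (0 : PhaseSpace k)))
    ((h.contMDiffAt_comp_tubeChart hmem).mdifferentiableAt (by simp))
    (hι.contMDiff.contMDiffAt.mdifferentiableAt (by simp))]
  congr 2
  funext u
  rw [tubeChart_apply, h.map_base]

theorem SplitTube.injective_tderiv_comp_tubeChart (h : SplitTube EM Ω e f σ δ Ψ) {p : N}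
    {w : EN × PhaseSpace k} (hw : w ∈ (tubeChart EN Ψ p).source) :
    Function.Injective (tderiv (EN × PhaseSpace k) EW (fun w => e (tubeChart EN Ψ p w)) w) := by
  intro a b hab
  rw [tderiv_comp_apply (E' := EM) (h.contMDiff.contMDiffAt.mdifferentiableAt (by simp))
      (((h.contMDiffOn_tubeChart p).contMDiffAt
        ((tubeChart EN Ψ p).open_source.mem_nhds hw)).mdifferentiableAt (by simp)),
    tderiv_comp_apply (E' := EM) (h.contMDiff.contMDiffAt.mdifferentiableAt (by simp))
      (((h.contMDiffOn_tubeChart p).contMDiffAt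
        ((tubeChart EN Ψ p).open_source.mem_nhds hw)).mdifferentiableAt (by simp))] at hab
  exact (h.bijective_tderiv_tubeChart hw).1 (h.injective_tderiv _ hab)

theorem bijective_tderiv_chart_symm {p : N} {u : EN} (hu : u ∈ (chartAt EN p).target) :
    Function.Bijective (tderiv EN EN (chartAt EN p).symm u) := by
  have h1 : ContMDiffOn 𝓘(ℝ, EN) 𝓘(ℝ, EN) ∞ (chartAt EN p).symm (chartAt EN p).target :=
    contMDiffOn_symm_of_mem_maximalAtlas (IsManifold.chart_mem_maximalAtlas p)
  have h2 : ContMDiffOn 𝓘(ℝ, EN) 𝓘(ℝ, EN) ∞ (chartAt EN p) (chartAt EN p).source :=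
    contMDiffOn_of_mem_maximalAtlas (IsManifold.chart_mem_maximalAtlas p)
  exact bijective_mfderiv_of_smooth (κ := (chartAt EN p).symm) h1 h2 hu

theorem SplitTube.bilin_flowOut_kernel (h : SplitTube EM Ω e f σ δ Ψ)
    (hf : ContMDiff 𝓘(ℝ, EN) 𝓘(ℝ, EM) ∞ f) (ht : TransverseFlow Ω (fun p => e (f p)) σ V θ R)
    {p : N} {u : EN} (hu : u ∈ (chartAt EN p).target) {r : EN}
    (hr : tderiv EN EN (chartAt EN p).symm u r = modelVec R ((chartAt EN p).symm u)) :
    Ω.bilin (e (f ((chartAt EN p).symm u))) (modelVec V (e (f ((chartAt EN p).symm u))))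
      (tderiv (EN × PhaseSpace k) EW (fun w => e (tubeChart EN Ψ p w)) (u, 0) (r, 0)) = 1 := by
  rw [h.tderiv_comp_tubeChart_zero hf hu, hr]
  exact ht.pair _

/-- A kernel vector `(a, ζ, c)` is detected by pairing its image with that of `R`. At points of `N`
the field `R` is in the kernel of `e^* Ω`, so only `c Ω(V, R) = c` survives and `c = 0`; the rest is
the injectivity of the derivative of `e` along the tube. -/
theorem SplitTube.injective_tderiv_flowOut (h : SplitTube EM Ω e f σ δ Ψ)
    (hf : ContMDiff 𝓘(ℝ, EN) 𝓘(ℝ, EM) ∞ f) (ht : TransverseFlow Ω (fun p => e (f p)) σ V θ R)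
    (p : N) :
    Function.Injective (tderiv (EN × PhaseSpace k × ℝ) EW (flowOut θ e (tubeChart EN Ψ p))
      (chartAt EN p p, 0, 0)) := by
  have hu : chartAt EN p p ∈ (chartAt EN p).target := mem_chart_target EN p
  have hmem := h.base_mem_source p
  obtain ⟨r, hr⟩ := (bijective_tderiv_chart_symm hu).2 (modelVec R ((chartAt EN p).symm _))
  rw [injective_iff_map_eq_zero]
  rintro ⟨a, ζ, c⟩ h0
  rw [h.tderiv_flowOut_zero ht.flow hmem] at h0
  have hfp : tubeChart EN Ψ p (chartAt EN p p, 0) = f ((chartAt EN p).symm (chartAt EN p p)) := by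
    rw [tubeChart_apply, h.map_base]
  have h1 := h.bilin_flowOut_kernel hf ht hu hr
  have h2 := h.split_tubeChart hmem a r ζ 0
  have h3 : σ.bilin ((chartAt EN p).symm (chartAt EN p p))
      (tderiv EN EN (chartAt EN p).symm (chartAt EN p p) a)
      (tderiv EN EN (chartAt EN p).symm (chartAt EN p p) r) = 0 := by
    rw [σ.bilin_swap, hr, ht.ker]; simp
  rw [h3, map_zero, add_zero] at h2
  rw [← hfp] at h1
  have h4 := congrArg (fun x => Ω.bilin (e (tubeChart EN Ψ p (chartAt EN p p, 0))) x
    (tderiv (EN × PhaseSpace k) EW (fun w => e (tubeChart EN Ψ p w)) (chartAt EN p p, 0)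
      (r, 0))) h0
  simp only [map_add, add_apply, map_smul, smul_apply, h1, h2, map_zero, zero_apply] at h4
  have hc : c = 0 := by simpa using h4
  subst hc
  rw [zero_smul, add_zero] at h0
  have h5 := (injective_iff_map_eq_zero _).1 (h.injective_tderiv_comp_tubeChart hmem) _ h0
  rw [Prod.mk_eq_zero] at h5
  rw [h5.1, h5.2]
  rfl

end FlowOut


/-! ### The perturbed hypersurface is embedded -/

section Perturb

variable {EN : Type} [NormedAddCommGroup EN] [NormedSpace ℝ EN] [FiniteDimensional ℝ EN]
  {EM : Type} [NormedAddCommGroup EM] [NormedSpace ℝ EM] [FiniteDimensional ℝ EM]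
  {EW : Type} [NormedAddCommGroup EW] [NormedSpace ℝ EW] [FiniteDimensional ℝ EW]
  {N : Type*} [TopologicalSpace N] [ChartedSpace EN N]
  {M : Type*} [TopologicalSpace M] [ChartedSpace EM M]
  {W : Type*} [TopologicalSpace W] [ChartedSpace EW W]
  {k : ℕ}
  {Ω : DiffForm 𝓘(ℝ, EW) W 2} {e : M → W} {f : N → M} {σ : DiffForm 𝓘(ℝ, EN) N 2} {δ : ℝ}
  {Ψ : OpenPartialHomeomorph (N × PhaseSpace k) M}
  {V : ∀ x : W, TangentSpace 𝓘(ℝ, EW) x} {θ : ℝ → W → W} {R : ∀ p : N, TangentSpace 𝓘(ℝ, EN) p}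

open Classical in
/-- The function on `M` given by a function `h` of the normal coordinates of the tube. -/
noncomputable def tubeFun (Ψ : OpenPartialHomeomorph (N × PhaseSpace k) M)
    (h : PhaseSpace k → ℝ) (x : M) : ℝ := if x ∈ Ψ.target then h (Ψ.symm x).2 else 0

/-- The map `e` pushed along the flow `θ` by the function `h` of the normal coordinates. -/
noncomputable def perturb (Ψ : OpenPartialHomeomorph (N × PhaseSpace k) M) (θ : ℝ → W → W)
    (e : M → W) (h : PhaseSpace k → ℝ) (x : M) : W := θ (tubeFun Ψ h x) (e x)

/-- The closed tube of radius `s`. -/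
def closedTube (Ψ : OpenPartialHomeomorph (N × PhaseSpace k) M) (s : ℝ) : Set M :=
  Ψ '' (univ ×ˢ Metric.closedBall 0 s)

/-- The open tube of radius `s`. -/
def openTube (Ψ : OpenPartialHomeomorph (N × PhaseSpace k) M) (s : ℝ) : Set M :=
  Ψ '' (univ ×ˢ Metric.ball 0 s)

theorem tubeFun_of_mem {h : PhaseSpace k → ℝ} {x : M} (hx : x ∈ Ψ.target) :
    tubeFun Ψ h x = h (Ψ.symm x).2 := if_pos hx

theorem SplitTube.isCompact_closedTube [CompactSpace N] (hT : SplitTube EM Ω e f σ δ Ψ) {s : ℝ}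
    (hs : s < δ) : IsCompact (closedTube Ψ s) := by
  refine (isCompact_univ.prod (isCompact_closedBall _ _)).image_of_continuousOn
    (Ψ.continuousOn.mono ?_)
  rintro ⟨p, z⟩ ⟨-, hz⟩
  exact hT.mem_source.2 (Metric.closedBall_subset_ball hs hz)

theorem SplitTube.isOpen_openTube (hT : SplitTube EM Ω e f σ δ Ψ) {s : ℝ} (hs : s ≤ δ) :
    IsOpen (openTube Ψ s) := by
  refine Ψ.isOpen_image_of_subset_source (isOpen_univ.prod Metric.isOpen_ball) ?_
  rintro ⟨p, z⟩ ⟨-, hz⟩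
  exact hT.mem_source.2 (Metric.ball_subset_ball hs hz)

theorem SplitTube.closedTube_subset_openTube (_ : SplitTube EM Ω e f σ δ Ψ) {s t : ℝ} (hst : s < t) :
    closedTube Ψ s ⊆ openTube Ψ t :=
  image_mono (prod_mono le_rfl (Metric.closedBall_subset_ball hst))

theorem openTube_subset_closedTube {s : ℝ} : openTube Ψ s ⊆ closedTube Ψ s :=
  image_mono (prod_mono le_rfl Metric.ball_subset_closedBall)

theorem SplitTube.closedTube_subset_target (hT : SplitTube EM Ω e f σ δ Ψ) {s : ℝ} (hs : s < δ) :
    closedTube Ψ s ⊆ Ψ.target := by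
  rintro _ ⟨⟨p, z⟩, ⟨-, hz⟩, rfl⟩
  exact Ψ.map_source (hT.mem_source.2 (Metric.closedBall_subset_ball hs hz))

theorem tubeFun_of_notMem {h : PhaseSpace k → ℝ} {s : ℝ}
    (h0 : ∀ z ∉ Metric.closedBall (0 : PhaseSpace k) s, h z = 0) {x : M}
    (hx : x ∉ closedTube Ψ s) : tubeFun Ψ h x = 0 := by
  by_cases hxt : x ∈ Ψ.target
  · rw [tubeFun_of_mem hxt]
    refine h0 _ fun hz => hx ⟨Ψ.symm x, ⟨mem_univ _, hz⟩, Ψ.right_inv hxt⟩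
  · exact if_neg hxt

theorem abs_tubeFun_lt {h : PhaseSpace k → ℝ} {ε : ℝ} (hε : 0 < ε) (hh : ∀ z, |h z| < ε) (x : M) :
    |tubeFun Ψ h x| < ε := by
  unfold tubeFun
  split_ifs
  · exact hh _
  · rwa [abs_zero]

theorem SplitTube.tubeFun_tubeChart (hT : SplitTube EM Ω e f σ δ Ψ) {h : PhaseSpace k → ℝ} {p : N}
    {w : EN × PhaseSpace k} (hw : w ∈ (tubeChart EN Ψ p).source) :
    tubeFun Ψ h (tubeChart EN Ψ p w) = h w.2 := by
  rw [tubeFun_of_mem (hT.tubeChart_mem_target hw), hT.symm_tubeChart hw]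

theorem SplitTube.perturb_tubeChart (hT : SplitTube EM Ω e f σ δ Ψ) {h : PhaseSpace k → ℝ} {p : N}
    {w : EN × PhaseSpace k} (hw : w ∈ (tubeChart EN Ψ p).source) :
    perturb Ψ θ e h (tubeChart EN Ψ p w) =
      flowOut θ e (tubeChart EN Ψ p) (w.1, w.2, h w.2) := by
  rw [perturb, hT.tubeFun_tubeChart hw]
  rfl

theorem perturb_of_notMem {h : PhaseSpace k → ℝ} {s : ℝ} (hθ : ∀ x, θ 0 x = x)
    (h0 : ∀ z ∉ Metric.closedBall (0 : PhaseSpace k) s, h z = 0) {x : M}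
    (hx : x ∉ closedTube Ψ s) : perturb Ψ θ e h x = e x := by
  rw [perturb, tubeFun_of_notMem h0 hx, hθ]

theorem SplitTube.perturb_base (hT : SplitTube EM Ω e f σ δ Ψ) {h : PhaseSpace k → ℝ}
    (hθ : ∀ x, θ 0 x = x) (h0 : h 0 = 0) (p : N) : perturb Ψ θ e h (f p) = e (f p) := by
  rw [perturb, tubeFun_of_mem (hT.mem_target p), hT.symm_apply, h0, hθ]

variable [IsManifold 𝓘(ℝ, EN) ∞ N] [IsManifold 𝓘(ℝ, EM) ∞ M] [IsManifold 𝓘(ℝ, EW) ∞ W]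
  [CompactSpace N] [T2Space M]

theorem SplitTube.contMDiff_tubeFun (hT : SplitTube EM Ω e f σ δ Ψ) {h : PhaseSpace k → ℝ} {s : ℝ}
    (hs : s < δ) (hh : ContDiff ℝ ∞ h)
    (h0 : ∀ z ∉ Metric.closedBall (0 : PhaseSpace k) s, h z = 0) :
    ContMDiff 𝓘(ℝ, EM) 𝓘(ℝ, ℝ) ∞ (tubeFun Ψ h) := by
  intro x
  by_cases hx : x ∈ Ψ.target
  · have h1 : ContMDiffAt 𝓘(ℝ, EM) 𝓘(ℝ, ℝ) ∞ (fun x => h (Ψ.symm x).2) x :=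
      hh.contMDiff.contMDiffAt.comp x
        (hT.contMDiffOn_symm_snd.contMDiffAt (Ψ.open_target.mem_nhds hx))
    refine h1.congr_of_eventuallyEq ?_
    filter_upwards [Ψ.open_target.mem_nhds hx] with y hy
    exact tubeFun_of_mem hy
  · have h1 : ContMDiffAt 𝓘(ℝ, EM) 𝓘(ℝ, ℝ) ∞ (fun _ : M => (0 : ℝ)) x := contMDiffAt_const
    refine h1.congr_of_eventuallyEq ?_
    filter_upwards [(hT.isCompact_closedTube hs).isClosed.isOpen_compl.mem_nhds
      fun hx' => hx (hT.closedTube_subset_target hs hx')] with y hy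
    exact tubeFun_of_notMem h0 hy

theorem SplitTube.contMDiff_perturb (hT : SplitTube EM Ω e f σ δ Ψ) (hθ : IsGlobalFlow V θ)
    {h : PhaseSpace k → ℝ} {s : ℝ} (hs : s < δ) (hh : ContDiff ℝ ∞ h)
    (h0 : ∀ z ∉ Metric.closedBall (0 : PhaseSpace k) s, h z = 0) :
    ContMDiff 𝓘(ℝ, EM) 𝓘(ℝ, EW) ∞ (perturb Ψ θ e h) := fun _ =>
  hθ.contMDiffAt_apply (hT.contMDiff_tubeFun hs hh h0).contMDiffAt hT.contMDiff.contMDiffAt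

/-- The flow-out of the hypersurface is an injective immersion near `N`. -/
theorem SplitTube.exists_injOn_flow [T2Space W] (hT : SplitTube EM Ω e f σ δ Ψ)
    (hf : ContMDiff 𝓘(ℝ, EN) 𝓘(ℝ, EM) ∞ f) (ht : TransverseFlow Ω (fun p => e (f p)) σ V θ R)
    (hdim : Module.finrank ℝ EM + 1 = Module.finrank ℝ EW) :
    ∃ s > 0, s < δ ∧ ∃ ε > 0,
      InjOn (fun q : M × ℝ => θ q.2 (e q.1)) (closedTube Ψ s ×ˢ Metric.ball 0 ε) ∧
      ∀ x ∈ closedTube Ψ s, ∀ t ∈ Metric.ball (0 : ℝ) ε, ∀ (v : EM) (c : ℝ),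
        tderiv EW EW (θ t) (e x) (tderiv EM EW e x v) + c • modelVec V (θ t (e x)) = 0 → v = 0 := by
  have hYdim : N → Module.finrank ℝ (EN × PhaseSpace k × ℝ) = Module.finrank ℝ EW := by
    intro p
    have h1 := (LinearEquiv.ofBijective
      (tderiv (EN × PhaseSpace k) EM (tubeChart EN Ψ p) (chartAt EN p p, 0)).toLinearMap
      (hT.bijective_tderiv_tubeChart (hT.base_mem_source p))).finrank_eq
    rw [Module.finrank_prod] at h1
    rw [Module.finrank_prod, Module.finrank_prod, Module.finrank_self, ← add_assoc, h1, hdim]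
  have hFc : Continuous (fun q : M × ℝ => θ q.2 (e q.1)) :=
    ht.flow.smooth.continuous.comp (continuous_snd.prodMk (hT.contMDiff.continuous.comp
      continuous_fst))
  have hloc : ∀ p : N, ∃ O ∈ 𝓝 (chartAt EN p p, (0 : PhaseSpace k), (0 : ℝ)),
      InjOn (flowOut θ e (tubeChart EN Ψ p)) O ∧ ∀ y ∈ O, Function.Injective
        (tderiv (EN × PhaseSpace k × ℝ) EW (flowOut θ e (tubeChart EN Ψ p)) y) := fun p =>
    (hT.contMDiffOn_flowOut ht.flow p).exists_mem_nhds_injOn (hYdim p)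
      (hT.isOpen_flowOut_domain p) (hT.base_mem_source p)
      (hT.injective_tderiv_flowOut hf ht p)
  -- the inverse of `(u, z, t) ↦ (κ (u, z), t)`
  have hback : ∀ p : N, Tendsto (fun q : M × ℝ => (((tubeChart EN Ψ p).symm q.1).1,
      ((tubeChart EN Ψ p).symm q.1).2, q.2)) (𝓝 (f p, 0))
      (𝓝 (chartAt EN p p, (0 : PhaseSpace k), (0 : ℝ))) := by
    intro p
    have h1 : ContinuousAt (tubeChart EN Ψ p).symm (f p) := by
      rw [← hT.tubeChart_base p]
      exact (tubeChart EN Ψ p).continuousAt_symm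
        ((tubeChart EN Ψ p).map_source (hT.base_mem_source p))
    have h2 : (tubeChart EN Ψ p).symm (f p) = (chartAt EN p p, 0) := by
      rw [← hT.tubeChart_base p]
      exact (tubeChart EN Ψ p).left_inv (hT.base_mem_source p)
    have h3 : ContinuousAt (fun q : M × ℝ => (tubeChart EN Ψ p).symm q.1) (f p, 0) :=
      ContinuousAt.comp (g := (tubeChart EN Ψ p).symm) h1 continuousAt_fst
    have h4 := (h3.fst.prodMk (h3.snd.prodMk (continuousAt_snd (p := (f p, (0 : ℝ)))))).tendsto
    simpa only [h2] using h4
  have hsrc : ∀ p : N, ∀ᶠ q : M × ℝ in 𝓝 (f p, 0), q.1 ∈ (tubeChart EN Ψ p).target := by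
    intro p
    refine continuousAt_fst ((tubeChart EN Ψ p).open_target.mem_nhds ?_)
    have := (tubeChart EN Ψ p).map_source (hT.base_mem_source p)
    rwa [hT.tubeChart_base p] at this
  have hinj₀ : InjOn (fun q : M × ℝ => θ q.2 (e q.1)) (range f ×ˢ {0}) := by
    rintro ⟨x, t⟩ ⟨-, ht0⟩ ⟨y, t'⟩ ⟨-, ht0'⟩ hxy
    obtain rfl : t = 0 := ht0
    obtain rfl : t' = 0 := ht0'
    simp only [ht.flow.map_zero] at hxy
    rw [hT.isEmbedding.injective hxy]
  have hcomp : IsCompact (range f ×ˢ ({0} : Set ℝ)) :=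
    (isCompact_range hf.continuous).prod isCompact_singleton
  -- A continuous map that is injective on a compact set and locally injective at its points is
  -- injective on a neighbourhood of it. The compact set here is `N × {0}`, where the map is the
  -- embedding `e`.
  obtain ⟨T, hTn, hTinj⟩ := hinj₀.exists_mem_nhdsSet hcomp (fun _ _ => hFc.continuousAt) (by
    rintro ⟨_, t⟩ ⟨⟨p, rfl⟩, ht0⟩
    obtain rfl : t = 0 := ht0
    obtain ⟨O, hO, hOinj, -⟩ := hloc p
    refine ⟨_, inter_mem (hback p hO) (hsrc p), ?_⟩
    rintro ⟨x, t⟩ ⟨hx1, hx2⟩ ⟨y, t'⟩ ⟨hy1, hy2⟩ hxy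
    have h1 := hOinj hx1 hy1 (by
      simp only [flowOut, Prod.mk.eta]
      rw [(tubeChart EN Ψ p).right_inv hx2, (tubeChart EN Ψ p).right_inv hy2]
      exact hxy)
    simp only [Prod.mk.injEq] at h1
    have h2 : (tubeChart EN Ψ p).symm x = (tubeChart EN Ψ p).symm y := Prod.ext h1.1 h1.2.1
    exact Prod.ext ((tubeChart EN Ψ p).symm.injOn hx2 hy2 h2) h1.2.2)
  have hder : ∀ p : N, ∀ᶠ q : M × ℝ in 𝓝 (f p, 0), ∀ (v : EM) (c : ℝ),
      tderiv EW EW (θ q.2) (e q.1) (tderiv EM EW e q.1 v) + c • modelVec V (θ q.2 (e q.1)) = 0 →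
        v = 0 := by
    intro p
    obtain ⟨O, hO, -, hOd⟩ := hloc p
    filter_upwards [hback p hO, hsrc p] with q hq1 hq2 v c h0
    have hw := (tubeChart EN Ψ p).map_target hq2
    have hqx : tubeChart EN Ψ p ((tubeChart EN Ψ p).symm q.1) = q.1 :=
      (tubeChart EN Ψ p).right_inv hq2
    obtain ⟨⟨a, ζ⟩, haζ⟩ := (hT.bijective_tderiv_tubeChart hw).2 v
    have h1 := hT.tderiv_flowOut ht.flow (y := (((tubeChart EN Ψ p).symm q.1).1,
      ((tubeChart EN Ψ p).symm q.1).2, q.2)) hw a ζ c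
    simp only [Prod.mk.eta, flowOut] at h1
    rw [tderiv_comp_apply (E' := EM) (hT.contMDiff.contMDiffAt.mdifferentiableAt (by simp))
      (((hT.contMDiffOn_tubeChart p).contMDiffAt
        ((tubeChart EN Ψ p).open_source.mem_nhds hw)).mdifferentiableAt (by simp)), haζ, hqx,
        h0] at h1
    have h2 := (injective_iff_map_eq_zero _).1 (hOd _ hq1) _ h1
    simp only [Prod.mk_eq_zero] at h2
    rw [← haζ, h2.1, h2.2.1]
    exact map_zero _
  have hΨc : ∀ p : N, Tendsto (fun q : (PhaseSpace k × ℝ) × N => (Ψ (q.2, q.1.1), q.1.2))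
      (𝓝 ((0, 0), p)) (𝓝 (f p, 0)) := by
    intro p
    have h1 : ContinuousAt Ψ (p, 0) := Ψ.continuousAt (hT.zero_mem p)
    have h2 : ContinuousAt (fun q : (PhaseSpace k × ℝ) × N => (q.2, q.1.1)) ((0, 0), p) := by
      fun_prop
    have h3 : ContinuousAt (fun q : (PhaseSpace k × ℝ) × N => Ψ (q.2, q.1.1)) ((0, 0), p) :=
      ContinuousAt.comp (g := Ψ) h1 h2
    have h4 : ContinuousAt (fun q : (PhaseSpace k × ℝ) × N => q.1.2) ((0, 0), p) := by
      fun_prop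
    have h5 := (h3.prodMk h4).tendsto
    rwa [hT.map_base] at h5
  -- Compactness of `N` turns the neighbourhoods of its points into a single radius for `z` and `t`.
  have hall := isCompact_univ.eventually_forall_of_forall_eventually
    (x₀ := ((0, 0) : PhaseSpace k × ℝ)) (K := (univ : Set N))
    (P := fun y p => (Ψ (p, y.1), y.2) ∈ T ∧ ∀ (v : EM) (c : ℝ),
      tderiv EW EW (θ y.2) (e (Ψ (p, y.1))) (tderiv EM EW e (Ψ (p, y.1)) v) +
        c • modelVec V (θ y.2 (e (Ψ (p, y.1)))) = 0 → v = 0) (fun p _ => by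
      have hTp : T ∈ 𝓝 (f p, (0 : ℝ)) := mem_nhdsSet_iff_forall.1 hTn _ ⟨mem_range_self p, rfl⟩
      exact (hΨc p).eventually ((eventually_mem_set.2 hTp).and (hder p)))
  obtain ⟨r, hr, hball⟩ := Metric.eventually_nhds_iff_ball.1 hall
  have hmem : ∀ z ∈ Metric.closedBall (0 : PhaseSpace k) (min r δ / 2),
      ∀ t ∈ Metric.ball (0 : ℝ) r, (z, t) ∈ Metric.ball ((0, 0) : PhaseSpace k × ℝ) r := by
    intro z hz t ht'
    rw [← ball_prod_same]
    refine ⟨Metric.closedBall_subset_ball ?_ hz, ht'⟩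
    have := min_le_left r δ
    have h0 : 0 < min r δ := lt_min hr hT.pos
    linarith
  have h0 : 0 < min r δ := lt_min hr hT.pos
  have h1 := min_le_right r δ
  -- The factor one half puts the closed tube inside the open ball of radius `r` and strictly inside
  -- the given tube.
  refine ⟨min r δ / 2, by positivity, by linarith, r, hr, ?_, ?_⟩
  · refine hTinj.mono ?_
    rintro ⟨_, t⟩ ⟨⟨⟨p, z⟩, ⟨-, hz⟩, rfl⟩, ht'⟩
    exact (hball (z, t) (hmem z hz t ht') p (mem_univ p)).1
  · rintro _ ⟨⟨p, z⟩, ⟨-, hz⟩, rfl⟩ t ht' v c hvc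
    exact (hball (z, t) (hmem z hz t ht') p (mem_univ p)).2 v c hvc

/-- Small perturbations with small support are embeddings. -/
theorem SplitTube.exists_forall_isEmbedding_perturb [T2Space W] (hT : SplitTube EM Ω e f σ δ Ψ)
    (hf : ContMDiff 𝓘(ℝ, EN) 𝓘(ℝ, EM) ∞ f) (ht : TransverseFlow Ω (fun p => e (f p)) σ V θ R)
    (hdim : Module.finrank ℝ EM + 1 = Module.finrank ℝ EW) :
    ∃ s > 0, s < δ ∧ ∃ ε > 0, ∀ h : PhaseSpace k → ℝ, ContDiff ℝ ∞ h →
      (∀ z ∉ Metric.closedBall (0 : PhaseSpace k) s, h z = 0) → (∀ z, |h z| < ε) →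
      IsSmoothEmbedding 𝓘(ℝ, EM) 𝓘(ℝ, EW) ∞ (perturb Ψ θ e h) := by
  obtain ⟨s₁, hs₁, hs₁δ, ε₁, hε₁, hinj, hder⟩ := hT.exists_injOn_flow hf ht hdim
  -- The support is kept in the tube of half the radius, so that the closed tube of radius `s₁`, on
  -- which the flow-out is injective, is a compact neighbourhood of it.
  have hs : s₁ / 2 < s₁ := half_lt_self hs₁
  have hFc : Continuous (fun q : ℝ × M => θ q.1 (e q.2)) :=
    ht.flow.smooth.continuous.comp (continuous_fst.prodMk (hT.contMDiff.continuous.comp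
      continuous_snd))
  have hSB : closedTube Ψ (s₁ / 2) ⊆ interior (closedTube Ψ s₁) :=
    (hT.closedTube_subset_openTube hs).trans
      (interior_maximal openTube_subset_closedTube (hT.isOpen_openTube hs₁δ.le))
  have hS : IsCompact (closedTube Ψ (s₁ / 2)) := hT.isCompact_closedTube (hs.trans hs₁δ)
  -- At time zero the embedding `e` keeps points of the support away from the closure of the image
  -- of a closed set not containing them. This is open in the time and, by compactness of the
  -- support, uniform.
  have haway : ∀ x ∈ closedTube Ψ (s₁ / 2), ∀ᶠ q : ℝ × M in 𝓝 (0, x),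
      θ q.1 (e q.2) ∉ closure (e '' (interior (closedTube Ψ s₁))ᶜ) := by
    intro x hx
    refine hFc.continuousAt (isClosed_closure.isOpen_compl.mem_nhds ?_)
    simp only [mem_compl_iff, ht.flow.map_zero]
    intro hcl
    have h1 : x ∈ e ⁻¹' closure (e '' (interior (closedTube Ψ s₁))ᶜ) := hcl
    rw [← hT.isEmbedding.isInducing.closure_eq_preimage_closure_image,
      isOpen_interior.isClosed_compl.closure_eq] at h1
    exact h1 (hSB hx)
  obtain ⟨ε₂, hε₂, hball⟩ := Metric.eventually_nhds_iff_ball.1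
    (hS.eventually_forall_of_forall_eventually (x₀ := (0 : ℝ))
    (P := fun t x => θ t (e x) ∉ closure (e '' (interior (closedTube Ψ s₁))ᶜ)) haway)
  refine ⟨s₁ / 2, by positivity, hs.trans hs₁δ, min ε₁ ε₂, lt_min hε₁ hε₂, fun h hh h0 hsmall => ?_⟩
  have hsm := hT.contMDiff_perturb ht.flow (hs.trans hs₁δ) hh h0
  have habs : ∀ x : M, |tubeFun Ψ h x| < min ε₁ ε₂ := abs_tubeFun_lt (lt_min hε₁ hε₂) hsmall
  have hmem₁ : ∀ x : M, tubeFun Ψ h x ∈ Metric.ball (0 : ℝ) ε₁ := fun x => by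
    rw [mem_ball_zero_iff]
    exact (habs x).trans_le (min_le_left _ _)
  have hmem₂ : ∀ x : M, tubeFun Ψ h x ∈ Metric.ball (0 : ℝ) ε₂ := fun x => by
    rw [mem_ball_zero_iff]
    exact (habs x).trans_le (min_le_right _ _)
  refine ⟨hsm.isImmersion_of_injective_mfderiv (F := ℝ) (by rw [Module.finrank_self, hdim]) ?_, ?_⟩
  · intro x
    change Function.Injective (tderiv EM EW (perturb Ψ θ e h) x)
    by_cases hx : x ∈ closedTube Ψ s₁
    · rw [injective_iff_map_eq_zero]
      intro v hv
      have h1 := ht.flow.tderiv_apply (hT.contMDiff_tubeFun (hs.trans hs₁δ) hh h0).contMDiffAt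
        (hT.contMDiff.contMDiffAt (x := x)) v
      exact hder x hx _ (hmem₁ x) v _ (h1.symm.trans hv)
    · have h1 : perturb Ψ θ e h =ᶠ[𝓝 x] e := by
        filter_upwards [hS.isClosed.isOpen_compl.mem_nhds
          fun hx' => hx (interior_subset (hSB hx'))] with y hy
        exact perturb_of_notMem ht.flow.map_zero h0 hy
      rw [tderiv_congr h1]
      exact hT.injective_tderiv x
  · refine hT.isEmbedding.of_eqOn_compl hsm.continuous (hT.isCompact_closedTube hs₁δ) hSB ?_
      (fun x hx => perturb_of_notMem ht.flow.map_zero h0 hx)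
      (fun x hx => hball _ (hmem₂ x) x hx)
    intro x hx y hy hxy
    have := hinj (x₁ := (x, tubeFun Ψ h x)) (x₂ := (y, tubeFun Ψ h y)) ⟨hx, hmem₁ x⟩ ⟨hy, hmem₁ y⟩
      hxy
    exact (Prod.mk.inj this).1

end Perturb


/-! ### The perturbed hypersurface is `C^1`-close to the original one -/

section Close

variable {EN : Type} [NormedAddCommGroup EN] [NormedSpace ℝ EN] [FiniteDimensional ℝ EN]
  {EM : Type} [NormedAddCommGroup EM] [NormedSpace ℝ EM] [FiniteDimensional ℝ EM]
  {EW : Type} [NormedAddCommGroup EW] [NormedSpace ℝ EW] [FiniteDimensional ℝ EW]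
  {N : Type*} [TopologicalSpace N] [ChartedSpace EN N]
  {M : Type*} [TopologicalSpace M] [ChartedSpace EM M]
  {W : Type*} [TopologicalSpace W] [ChartedSpace EW W]
  {k : ℕ}
  {Ω : DiffForm 𝓘(ℝ, EW) W 2} {e : M → W} {f : N → M} {σ : DiffForm 𝓘(ℝ, EN) N 2} {δ : ℝ}
  {Ψ : OpenPartialHomeomorph (N × PhaseSpace k) M}
  {V : ∀ x : W, TangentSpace 𝓘(ℝ, EW) x} {θ : ℝ → W → W}

/-- A function of `(y, t)`, evaluated along the graph of a `C^1`-small function `h ∘ ζ`, is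
`C^1`-close to its restriction to `t = 0`. -/
theorem eventually_c1_close {Z : Type*} [NormedAddCommGroup Z] [NormedSpace ℝ Z]
    {Φ : EM × ℝ → EW} {ζ : EM → Z} {y₀ : EM} (hΦ : ContDiffAt ℝ ∞ Φ (y₀, 0))
    (hζ : ContDiffAt ℝ ∞ ζ y₀) {ε : ℝ} (hε : 0 < ε) :
    ∃ r > 0, ∀ᶠ y in 𝓝 y₀, ∀ h : Z → ℝ, Differentiable ℝ h → (∀ z, |h z| < r) →
      (∀ z, ‖fderiv ℝ h z‖ < r) → ‖Φ (y, h (ζ y)) - Φ (y, 0)‖ < ε ∧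
      ‖fderiv ℝ (fun y => Φ (y, h (ζ y))) y - fderiv ℝ (fun y => Φ (y, 0)) y‖ < ε := by
  -- The derivative of `y ↦ Φ (y, h (ζ y))` depends on `h` only through its value and its derivative
  -- at `ζ y`. With these as independent variables, closeness is continuity of `Φ` and `Λ` at `(y₀,
  -- 0, 0)`, so `r` does not depend on `h`.
  let Λ : EM × ℝ × (Z →L[ℝ] ℝ) → EM →L[ℝ] EW := fun q =>
    (fderiv ℝ Φ (q.1, q.2.1)).comp
      ((ContinuousLinearMap.id ℝ EM).prod (q.2.2.comp (fderiv ℝ ζ q.1)))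
  have hι : Continuous (fun q : EM × ℝ × (Z →L[ℝ] ℝ) => (q.1, q.2.1)) := by fun_prop
  have hι0 : Continuous (fun q : EM × ℝ × (Z →L[ℝ] ℝ) => (q.1, (0 : ℝ), (0 : Z →L[ℝ] ℝ))) := by
    fun_prop
  have hι1 : Continuous (fun q : EM × ℝ × (Z →L[ℝ] ℝ) => (q.1, (0 : ℝ))) := by fun_prop
  have hdΦ : ContinuousAt (fderiv ℝ Φ) (y₀, 0) :=
    (hΦ.fderiv_right (m := ∞) (by simp)).continuousAt
  have hdζ : ContinuousAt (fderiv ℝ ζ) y₀ := (hζ.fderiv_right (m := ∞) (by simp)).continuousAt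
  have hΛ : ContinuousAt Λ (y₀, 0, 0) := by
    have h1 : ContinuousAt (fun q : EM × ℝ × (Z →L[ℝ] ℝ) => fderiv ℝ Φ (q.1, q.2.1)) (y₀, 0, 0) :=
      ContinuousAt.comp (g := fderiv ℝ Φ) hdΦ hι.continuousAt
    have h2 : ContinuousAt (fun q : EM × ℝ × (Z →L[ℝ] ℝ) => fderiv ℝ ζ q.1) (y₀, 0, 0) :=
      ContinuousAt.comp (g := fderiv ℝ ζ) hdζ continuousAt_fst
    have h3 : ContinuousAt (fun q : EM × ℝ × (Z →L[ℝ] ℝ) => q.2.2) (y₀, 0, 0) := by fun_prop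
    have h4 := h3.clm_comp h2
    have h5 : ContinuousAt (fun q : EM × ℝ × (Z →L[ℝ] ℝ) =>
        (ContinuousLinearMap.id ℝ EM).prod (q.2.2.comp (fderiv ℝ ζ q.1))) (y₀, 0, 0) :=
      (ContinuousLinearMap.prodₗᵢ (R := ℝ) (𝕜 := ℝ) (E := EM) (F := EM) (G := ℝ)
        ).continuous.continuousAt.comp (continuousAt_const.prodMk h4)
    exact h1.clm_comp h5
  have hΛ0 : ContinuousAt (fun q : EM × ℝ × (Z →L[ℝ] ℝ) => Λ (q.1, 0, 0)) (y₀, 0, 0) :=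
    ContinuousAt.comp (g := Λ) hΛ hι0.continuousAt
  have hΦ1 : ContinuousAt (fun q : EM × ℝ × (Z →L[ℝ] ℝ) => Φ (q.1, q.2.1)) (y₀, 0, 0) :=
    ContinuousAt.comp (g := Φ) hΦ.continuousAt hι.continuousAt
  have hΦ0 : ContinuousAt (fun q : EM × ℝ × (Z →L[ℝ] ℝ) => Φ (q.1, 0)) (y₀, 0, 0) :=
    ContinuousAt.comp (g := Φ) hΦ.continuousAt hι1.continuousAt
  have hdiff : ∀ᶠ q in 𝓝 ((y₀, 0) : EM × ℝ), DifferentiableAt ℝ Φ q := by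
    obtain ⟨U, hU, hU'⟩ := hΦ.contDiffOn (m := 1) (by norm_cast) (by simp)
    filter_upwards [eventually_mem_nhds_iff.2 hU] with q hq
    exact (hU'.contDiffAt hq).differentiableAt (by simp)
  have hdiffζ : ∀ᶠ y in 𝓝 y₀, DifferentiableAt ℝ ζ y := by
    obtain ⟨U, hU, hU'⟩ := hζ.contDiffOn (m := 1) (by norm_cast) (by simp)
    filter_upwards [eventually_mem_nhds_iff.2 hU] with q hq
    exact (hU'.contDiffAt hq).differentiableAt (by simp)
  have hev : ∀ᶠ q in 𝓝 ((y₀, 0, 0) : EM × ℝ × (Z →L[ℝ] ℝ)),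
      ‖Φ (q.1, q.2.1) - Φ (q.1, 0)‖ < ε ∧ ‖Λ q - Λ (q.1, 0, 0)‖ < ε ∧
      DifferentiableAt ℝ Φ (q.1, q.2.1) ∧ DifferentiableAt ℝ Φ (q.1, 0) ∧
      DifferentiableAt ℝ ζ q.1 := by
    refine (((hΦ1.sub hΦ0).norm.eventually_lt continuousAt_const ?_).and
      (((hΛ.sub hΛ0).norm.eventually_lt continuousAt_const ?_).and
      ((hι.continuousAt.eventually hdiff).and ((hι1.continuousAt.eventually hdiff).and
      (continuousAt_fst.eventually hdiffζ)))))
    · simpa using hε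
    · simpa using hε
  rw [nhds_prod_eq] at hev
  obtain ⟨A, hA, B, hB, hAB⟩ := eventually_prod_iff.1 hev
  obtain ⟨r, hr, hball⟩ := Metric.eventually_nhds_iff_ball.1 hB
  refine ⟨r, hr, ?_⟩
  filter_upwards [hA] with y hy h hh h1 h2
  have hq := hAB hy (hball (h (ζ y), fderiv ℝ h (ζ y)) (by
    change (h (ζ y), fderiv ℝ h (ζ y)) ∈ Metric.ball ((0 : ℝ), (0 : Z →L[ℝ] ℝ)) r
    rw [← ball_prod_same]
    exact ⟨by rw [mem_ball_zero_iff]; exact h1 _, by rw [mem_ball_zero_iff]; exact h2 _⟩))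
  obtain ⟨q1, q2, q3, q4, q5⟩ := hq
  refine ⟨q1, ?_⟩
  have e1 : HasFDerivAt (fun y => Φ (y, h (ζ y))) (Λ (y, h (ζ y), fderiv ℝ h (ζ y))) y :=
    HasFDerivAt.comp (g := Φ) y q3.hasFDerivAt ((hasFDerivAt_id y).prodMk
      (HasFDerivAt.comp (g := h) y (hh _).hasFDerivAt q5.hasFDerivAt))
  have e2 : HasFDerivAt (fun y => Φ (y, (0 : ℝ))) (Λ (y, 0, 0)) y := by
    have := HasFDerivAt.comp (g := Φ) (f := fun y => (y, (0 : ℝ))) y q4.hasFDerivAt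
      ((hasFDerivAt_id y).prodMk (hasFDerivAt_const (0 : ℝ) y))
    refine this.congr_fderiv ?_
    simp only [Λ, ContinuousLinearMap.zero_comp]
  rw [e1.fderiv, e2.fderiv]
  exact q2

variable [IsManifold 𝓘(ℝ, EN) ∞ N] [IsManifold 𝓘(ℝ, EM) ∞ M] [IsManifold 𝓘(ℝ, EW) ∞ W]
  [CompactSpace N] [T2Space M]

/-- Membership in a basic `C^1` neighbourhood, at one point. -/
def C1NhdData.MemAt (D : C1NhdData (E := EM) (E' := EW) e) (g : M → W) (i : ℕ) (x : M) : Prop :=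
  g x ∈ (D.ψ i).source ∧ ‖D.ψ i (g x) - D.ψ i (e x)‖ < D.ε i ∧
    ‖fderiv ℝ (D.ψ i ∘ g ∘ (D.φ i).symm) (D.φ i x) -
      fderiv ℝ (D.ψ i ∘ e ∘ (D.φ i).symm) (D.φ i x)‖ < D.ε i

theorem C1NhdData.memAt_of_eventuallyEq (D : C1NhdData (E := EM) (E' := EW) e) {g : M → W} {i : ℕ}
    {x : M} (hx : x ∈ D.K i) (h : g =ᶠ[𝓝 x] e) : D.MemAt g i x := by
  have hxs := D.K_subset i hx
  refine ⟨?_, ?_, ?_⟩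
  · rw [h.eq_of_nhds]; exact D.mapsTo i hx
  · rw [h.eq_of_nhds, sub_self, norm_zero]; exact D.ε_pos i
  · have h1 : Tendsto (D.φ i).symm (𝓝 (D.φ i x)) (𝓝 x) := (D.φ i).tendsto_symm hxs
    have h2 : D.ψ i ∘ g ∘ (D.φ i).symm =ᶠ[𝓝 (D.φ i x)] D.ψ i ∘ e ∘ (D.φ i).symm := by
      filter_upwards [h1.eventually h] with y hy
      simp only [Function.comp_apply, hy]
    rw [h2.fderiv_eq, sub_self, norm_zero]
    exact D.ε_pos i

/-- In charts the perturbation is `Φ (y, h (ζ y))`, where `Φ (y, t)` is the point of `e` at `y`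
moved for time `t` and `ζ` gives the normal coordinates. So `eventually_c1_close` applies, with a
bound that is uniform in `h`. -/
theorem SplitTube.exists_memAt_nhds (hT : SplitTube EM Ω e f σ δ Ψ) (hθ : IsGlobalFlow V θ)
    (D : C1NhdData (E := EM) (E' := EW) e) (i : ℕ) {x₀ : M} (hx₀ : x₀ ∈ D.K i)
    (hx₀t : x₀ ∈ Ψ.target) :
    ∃ r > 0, ∀ᶠ x in 𝓝 x₀, ∀ h : PhaseSpace k → ℝ, ContDiff ℝ ∞ h → (∀ z, |h z| < r) →
      (∀ z, ‖fderiv ℝ h z‖ < r) → D.MemAt (perturb Ψ θ e h) i x := by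
  set φ := D.φ i
  set ψ := D.ψ i
  have hxs : x₀ ∈ φ.source := D.K_subset i hx₀
  have hFs : ContMDiff (𝓘(ℝ, EM).prod 𝓘(ℝ, ℝ)) 𝓘(ℝ, EW) ∞ (fun q : M × ℝ => θ q.2 (e q.1)) :=
    hθ.smooth.comp (contMDiff_snd.prodMk (hT.contMDiff.comp contMDiff_fst))
  have hφs : ContMDiffAt 𝓘(ℝ, EM) 𝓘(ℝ, EM) ∞ φ.symm (φ x₀) :=
    contMDiffAt_symm_of_mem_maximalAtlas (D.φ_mem i) (φ.map_source hxs)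
  have hl : φ.symm (φ x₀) = x₀ := φ.left_inv hxs
  have hψx : θ 0 (e (φ.symm (φ x₀))) ∈ ψ.source := by
    rw [hθ.map_zero, hl]; exact D.mapsTo i hx₀
  have hΦ : ContDiffAt ℝ ∞ (fun q : EM × ℝ => ψ (θ q.2 (e (φ.symm q.1)))) (φ x₀, 0) := by
    have h1 : ContMDiffAt 𝓘(ℝ, EM × ℝ) 𝓘(ℝ, EM) ∞ (fun q : EM × ℝ => φ.symm q.1) (φ x₀, 0) :=
      ContMDiffAt.comp (g := φ.symm) _ hφs contDiff_fst.contMDiff.contMDiffAt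
    have h2 := hθ.contMDiffAt_apply (M := EM × ℝ) (τ := fun q : EM × ℝ => q.2)
      (α := fun q : EM × ℝ => e (φ.symm q.1)) (x := (φ x₀, 0))
      contDiff_snd.contMDiff.contMDiffAt (ContMDiffAt.comp (g := e) _ hT.contMDiff.contMDiffAt h1)
    exact (ContMDiffAt.comp (g := ψ) (φ x₀, 0) (contMDiffAt_of_mem_maximalAtlas (D.ψ_mem i) hψx)
      h2).contDiffAt
  have hζ : ContDiffAt ℝ ∞ (fun y => (Ψ.symm (φ.symm y)).2) (φ x₀) := by
    have h1 : ContMDiffAt 𝓘(ℝ, EM) 𝓘(ℝ, PhaseSpace k) ∞ (fun x => (Ψ.symm x).2) (φ.symm (φ x₀)) :=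
      hT.contMDiffOn_symm_snd.contMDiffAt (Ψ.open_target.mem_nhds (by rw [hl]; exact hx₀t))
    exact (ContMDiffAt.comp (g := fun x => (Ψ.symm x).2) _ h1 hφs).contDiffAt
  obtain ⟨r, hr, hev⟩ := eventually_c1_close hΦ hζ (D.ε_pos i)
  have hsrc : ∀ᶠ q : M × ℝ in 𝓝 (x₀, 0), θ q.2 (e q.1) ∈ ψ.source := by
    refine hFs.continuous.continuousAt (ψ.open_source.mem_nhds ?_)
    simpa only [hl] using hψx
  rw [nhds_prod_eq] at hsrc
  obtain ⟨A, hA, B, hB, hAB⟩ := eventually_prod_iff.1 hsrc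
  obtain ⟨r', hr', hball⟩ := Metric.eventually_nhds_iff_ball.1 hB
  refine ⟨min r r', lt_min hr hr', ?_⟩
  have htend : Tendsto φ (𝓝 x₀) (𝓝 (φ x₀)) := φ.continuousAt hxs
  filter_upwards [hA, htend.eventually hev, φ.open_source.mem_nhds hxs,
    Ψ.open_target.mem_nhds hx₀t] with x hxA hx hxφ hxt h hh h1 h2
  have habs : |tubeFun Ψ h x| < min r r' := abs_tubeFun_lt (lt_min hr hr') h1 x
  have hy := hx h (hh.differentiable (by simp)) (fun z => (h1 z).trans_le (min_le_left _ _))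
    (fun z => (h2 z).trans_le (min_le_left _ _))
  have hlx : φ.symm (φ x) = x := φ.left_inv hxφ
  refine ⟨?_, ?_, ?_⟩
  · refine hAB hxA (hball (tubeFun Ψ h x) ?_)
    rw [mem_ball_zero_iff]
    exact habs.trans_le (min_le_right _ _)
  · have := hy.1
    rw [hlx, hθ.map_zero] at this
    rw [perturb, tubeFun_of_mem hxt]
    exact this
  · have hsx : Tendsto φ.symm (𝓝 (φ x)) (𝓝 x) := φ.tendsto_symm hxφ
    have e1 : ψ ∘ perturb Ψ θ e h ∘ φ.symm =ᶠ[𝓝 (φ x)]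
        fun y => ψ (θ (h (Ψ.symm (φ.symm y)).2) (e (φ.symm y))) := by
      filter_upwards [hsx (Ψ.open_target.mem_nhds hxt)] with y hyt
      simp only [Function.comp_apply]
      rw [perturb, tubeFun_of_mem hyt]
    have e2 : ψ ∘ e ∘ φ.symm = fun y => ψ (θ 0 (e (φ.symm y))) := by
      funext y
      rw [hθ.map_zero]
      rfl
    change ‖fderiv ℝ (ψ ∘ perturb Ψ θ e h ∘ φ.symm) (φ x) - fderiv ℝ (ψ ∘ e ∘ φ.symm) (φ x)‖ < _
    rw [e1.fderiv_eq, e2]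
    exact hy.2

/-- Perturbations by `C^1`-small functions are small in the strong `C^1` topology. -/
theorem SplitTube.exists_forall_mem_perturb (hT : SplitTube EM Ω e f σ δ Ψ)
    (hθ : IsGlobalFlow V θ) (D : C1NhdData (E := EM) (E' := EW) e) {s : ℝ} (hs : s < δ) :
    ∃ r > 0, ∀ h : PhaseSpace k → ℝ, ContDiff ℝ ∞ h →
      (∀ z ∉ Metric.closedBall (0 : PhaseSpace k) s, h z = 0) → (∀ z, |h z| < r) →
      (∀ z, ‖fderiv ℝ h z‖ < r) → D.Mem (perturb Ψ θ e h) := by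
  have hS := hT.isCompact_closedTube hs
  have hoff : ∀ (h : PhaseSpace k → ℝ), (∀ z ∉ Metric.closedBall (0 : PhaseSpace k) s, h z = 0) →
      ∀ i, ∀ x ∈ D.K i, x ∉ closedTube Ψ s → D.MemAt (perturb Ψ θ e h) i x := by
    intro h h0 i x hx hxS
    refine D.memAt_of_eventuallyEq hx ?_
    filter_upwards [hS.isClosed.isOpen_compl.mem_nhds hxS] with y hy
    exact perturb_of_notMem hθ.map_zero h0 hy
  have hi : ∀ i, ∃ r > 0, ∀ x ∈ D.K i, ∀ h : PhaseSpace k → ℝ, ContDiff ℝ ∞ h →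
      (∀ z ∉ Metric.closedBall (0 : PhaseSpace k) s, h z = 0) → (∀ z, |h z| < r) →
      (∀ z, ‖fderiv ℝ h z‖ < r) → D.MemAt (perturb Ψ θ e h) i x := by
    intro i
    -- Membership in `K i` is repeated as a premise because the induction over compact sets passes
    -- to neighbourhoods that may leave `K i`.
    suffices ∃ r > 0, ∀ x ∈ D.K i, x ∈ D.K i → ∀ h : PhaseSpace k → ℝ, ContDiff ℝ ∞ h →
        (∀ z ∉ Metric.closedBall (0 : PhaseSpace k) s, h z = 0) → (∀ z, |h z| < r) →
        (∀ z, ‖fderiv ℝ h z‖ < r) → D.MemAt (perturb Ψ θ e h) i x by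
      obtain ⟨r, hr, h⟩ := this
      exact ⟨r, hr, fun x hx => h x hx hx⟩
    refine (D.isCompact_K i).induction_on (p := fun A => ∃ r > 0, ∀ x ∈ A, x ∈ D.K i →
      ∀ h : PhaseSpace k → ℝ, ContDiff ℝ ∞ h →
        (∀ z ∉ Metric.closedBall (0 : PhaseSpace k) s, h z = 0) → (∀ z, |h z| < r) →
        (∀ z, ‖fderiv ℝ h z‖ < r) → D.MemAt (perturb Ψ θ e h) i x) ?_ ?_ ?_ ?_
    · exact ⟨1, one_pos, fun x hx => hx.elim⟩
    · rintro A B hAB ⟨r, hr, h⟩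
      exact ⟨r, hr, fun x hx => h x (hAB hx)⟩
    · rintro A B ⟨r, hr, hA⟩ ⟨r', hr', hB⟩
      refine ⟨min r r', lt_min hr hr', ?_⟩
      rintro x (hx | hx) hxK h hh h0 h1 h2
      · exact hA x hx hxK h hh h0 (fun z => (h1 z).trans_le (min_le_left _ _))
          (fun z => (h2 z).trans_le (min_le_left _ _))
      · exact hB x hx hxK h hh h0 (fun z => (h1 z).trans_le (min_le_right _ _))
          (fun z => (h2 z).trans_le (min_le_right _ _))
    · intro x hx
      by_cases hxS : x ∈ closedTube Ψ s
      · obtain ⟨r, hr, hev⟩ := hT.exists_memAt_nhds hθ D i hx (hT.closedTube_subset_target hs hxS)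
        exact ⟨_, mem_nhdsWithin_of_mem_nhds hev, r, hr,
          fun y hy _ h hh _ h1 h2 => hy h hh h1 h2⟩
      · exact ⟨_, mem_nhdsWithin_of_mem_nhds (hS.isClosed.isOpen_compl.mem_nhds hxS), 1, one_pos,
          fun y hy hyK h _ h0 _ _ => hoff h h0 i y hyK hy⟩
  choose r hr hmem using hi
  -- Off the compact tube the perturbation equals `e`. By local finiteness only finitely many `K i`
  -- meet the tube, so finitely many tolerances `r i` have to be respected.
  have hfin := D.locallyFinite_K.finite_nonempty_inter_compact hS
  have hev : ∀ᶠ t in 𝓝[>] (0 : ℝ), ∀ i ∈ {i | (D.K i ∩ closedTube Ψ s).Nonempty}, t < r i :=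
    (eventually_all_finite hfin).2 fun i _ => mem_nhdsWithin_of_mem_nhds (Iio_mem_nhds (hr i))
  obtain ⟨t, ht1, ht0⟩ := (hev.and self_mem_nhdsWithin).exists
  refine ⟨t, ht0, fun h hh h0 h1 h2 i => ?_⟩
  have key : ∀ x ∈ D.K i, D.MemAt (perturb Ψ θ e h) i x := by
    intro x hx
    by_cases hxS : x ∈ closedTube Ψ s
    · have hti : t < r i := ht1 i ⟨x, hx, hxS⟩
      exact hmem i x hx h hh h0 (fun z => (h1 z).trans hti) (fun z => (h2 z).trans hti)
    · exact hoff h h0 i x hx hxS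
  exact ⟨fun x hx => (key x hx).1, fun x hx => (key x hx).2⟩

end Close


/-! ### The kernel field of a Hamiltonian structure -/

section KernelFieldOfForm

variable {EN : Type*} [NormedAddCommGroup EN] [NormedSpace ℝ EN] [FiniteDimensional ℝ EN]
  {N : Type*} [TopologicalSpace N] [ChartedSpace EN N] [IsManifold 𝓘(ℝ, EN) ∞ N]
  {σ : DiffForm 𝓘(ℝ, EN) N 2}

/-- A Hamiltonian structure has a smooth kernel field on which a given framing is one. -/
theorem DiffForm.IsHamiltonian.exists_kernel_field (hσ : σ.IsHamiltonian) {ν : N → EN →L[ℝ] ℝ}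
    (hν : ∀ p, ContDiffAt ℝ ∞ (fun u => (ν ((chartAt EN p).symm u)).comp
      (tderiv EN EN (chartAt EN p).symm u)) (chartAt EN p p))
    (hνσ : ∀ p v, σ.bilin p v = 0 → ν p v = 0 → v = 0) :
    ∃ R : ∀ p : N, TangentSpace 𝓘(ℝ, EN) p, ContMDiff 𝓘(ℝ, EN) 𝓘(ℝ, EN).tangent ∞
      (fun p => (⟨p, R p⟩ : TangentBundle 𝓘(ℝ, EN) N)) ∧
      ∀ p, σ.bilin p (modelVec R p) = 0 ∧ ν p (modelVec R p) = 1 := by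
  have hinj : ∀ p, Function.Injective (framedMap (σ.bilin p) (ν p)) := fun p =>
    framedMap_injective _ (σ.bilin_self p) _ (hνσ p)
  refine ⟨fun p => ContinuousLinearMap.inverse (framedMap (σ.bilin p) (ν p)) (ν p), ?_, ?_⟩
  · intro p
    set φ := chartAt EN p
    have hφ : φ ∈ IsManifold.maximalAtlas 𝓘(ℝ, EN) ∞ N := IsManifold.chart_mem_maximalAtlas p
    have h1 : ContMDiffOn 𝓘(ℝ, EN) 𝓘(ℝ, EN) ∞ φ.symm φ.target :=
      contMDiffOn_symm_of_mem_maximalAtlas hφ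
    have h2 : ContMDiffOn 𝓘(ℝ, EN) 𝓘(ℝ, EN) ∞ φ φ.source := contMDiffOn_of_mem_maximalAtlas hφ
    have hp : φ p ∈ φ.target := mem_chart_target EN p
    have hl : φ.symm (φ p) = p := φ.left_inv (mem_chart_source EN p)
    have hB := (hσ.smooth.contDiffOn_altBilin_pull φ.open_target h1).contDiffAt
      (φ.open_target.mem_nhds hp)
    have hBapp : ∀ u v v', altBilin EN (DiffForm.pull 𝓘(ℝ, EN) 𝓘(ℝ, EN) φ.symm σ u) v v' =
        σ.bilin (φ.symm u) (tderiv EN EN φ.symm u v) (tderiv EN EN φ.symm u v') := fun u v v' =>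
      DiffForm.altBilin_pull _ σ u v v'
    have h3 := (contMDiffAt_kernel_field (κ := φ.symm) h1 h2 hp (β := fun p => σ.bilin p) (ν := ν)
      hB (hν p) (Eventually.of_forall fun u v v' => hBapp u v v')
      (Eventually.of_forall fun u v => rfl) hσ.exists_ne_zero ?_).2
    · rwa [hl] at h3
    · refine (injective_framedMap_of_comp (A := tderiv EN EN φ.symm (φ p))
        (bijective_mfderiv_of_smooth (κ := φ.symm) h1 h2 hp) (hBapp _) (fun _ => rfl)).2 (hinj _)
  · intro p
    obtain ⟨v, hv, hv1⟩ := exists_kernel_vector (σ.bilin p) (ν p) (hinj p) (hσ.exists_ne_zero p)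
    have h := kernel_vector_eq_inverse (σ.bilin p) (ν p) (hinj p) hv hv1
    change σ.bilin p (ContinuousLinearMap.inverse (framedMap (σ.bilin p) (ν p)) (ν p)) = 0 ∧
      ν p (ContinuousLinearMap.inverse (framedMap (σ.bilin p) (ν p)) (ν p)) = 1
    rw [← h]
    exact ⟨hv, hv1⟩

/-- The linear form of a one-form at a point. -/
noncomputable def DiffForm.lin (μ : DiffForm 𝓘(ℝ, EN) N 1) (p : N) : EN →L[ℝ] ℝ := altLin EN (μ p)

theorem DiffForm.IsSmooth.contDiffAt_lin {μ : DiffForm 𝓘(ℝ, EN) N 1} (hμ : μ.IsSmooth) (p : N) :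
    ContDiffAt ℝ ∞ (fun u => (μ.lin ((chartAt EN p).symm u)).comp
      (tderiv EN EN (chartAt EN p).symm u)) (chartAt EN p p) := by
  have h1 : ContMDiffOn 𝓘(ℝ, EN) 𝓘(ℝ, EN) ∞ (chartAt EN p).symm (chartAt EN p).target :=
    contMDiffOn_symm_of_mem_maximalAtlas (IsManifold.chart_mem_maximalAtlas p)
  refine ((hμ.contDiffOn_altLin_pull (chartAt EN p).open_target h1).contDiffAt
    ((chartAt EN p).open_target.mem_nhds (mem_chart_target EN p))).congr_of_eventuallyEq ?_
  refine Eventually.of_forall fun u => ?_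
  ext a
  exact (altLin_comp (E := EN) (F := EN) (μ ((chartAt EN p).symm u))
    (mfderiv 𝓘(ℝ, EN) 𝓘(ℝ, EN) (chartAt EN p).symm u) a).symm

end KernelFieldOfForm

/-! ### The symplectic form in flow-out coordinates and the choice of the transverse flow -/

section TubeForm

variable {EN : Type} [NormedAddCommGroup EN] [NormedSpace ℝ EN] [FiniteDimensional ℝ EN]
  {EM : Type} [NormedAddCommGroup EM] [NormedSpace ℝ EM] [FiniteDimensional ℝ EM]
  {EW : Type} [NormedAddCommGroup EW] [NormedSpace ℝ EW] [FiniteDimensional ℝ EW]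
  {N : Type*} [TopologicalSpace N] [ChartedSpace EN N] [IsManifold 𝓘(ℝ, EN) ∞ N]
  {M : Type*} [TopologicalSpace M] [ChartedSpace EM M] [IsManifold 𝓘(ℝ, EM) ∞ M]
  {W : Type*} [TopologicalSpace W] [ChartedSpace EW W] [IsManifold 𝓘(ℝ, EW) ∞ W]
  {k : ℕ}
  {Ω : DiffForm 𝓘(ℝ, EW) W 2} {e : M → W} {f : N → M} {σ : DiffForm 𝓘(ℝ, EN) N 2} {δ : ℝ}
  {Ψ : OpenPartialHomeomorph (N × PhaseSpace k) M}
  {V : ∀ x : W, TangentSpace 𝓘(ℝ, EW) x} {θ : ℝ → W → W} {R : ∀ p : N, TangentSpace 𝓘(ℝ, EN) p}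

/-- The pullback of `Ω` by the flow-out of the hypersurface, in the coordinates of the tube. -/
noncomputable def tubeForm (Ω : DiffForm 𝓘(ℝ, EW) W 2) (e : M → W) (θ : ℝ → W → W)
    (κ : EN × PhaseSpace k → M) (y : EN × PhaseSpace k × ℝ) :
    (EN × PhaseSpace k × ℝ) →L[ℝ] (EN × PhaseSpace k × ℝ) →L[ℝ] ℝ :=
  altBilin (EN × PhaseSpace k × ℝ)
    (DiffForm.pull 𝓘(ℝ, EN × PhaseSpace k × ℝ) 𝓘(ℝ, EW) (flowOut θ e κ) Ω y)

theorem tubeForm_apply (κ : EN × PhaseSpace k → M) (y v v' : EN × PhaseSpace k × ℝ) :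
    tubeForm Ω e θ κ y v v' = Ω.bilin (flowOut θ e κ y)
      (tderiv (EN × PhaseSpace k × ℝ) EW (flowOut θ e κ) y v)
      (tderiv (EN × PhaseSpace k × ℝ) EW (flowOut θ e κ) y v') :=
  DiffForm.altBilin_pull _ Ω y v v'

theorem tubeForm_swap (κ : EN × PhaseSpace k → M) (y v v' : EN × PhaseSpace k × ℝ) :
    tubeForm Ω e θ κ y v v' = - tubeForm Ω e θ κ y v' v := altBilin_swap _ _ _

theorem SplitTube.contDiffAt_tubeForm (hT : SplitTube EM Ω e f σ δ Ψ) (hθ : IsGlobalFlow V θ)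
    {p : N} {y : EN × PhaseSpace k × ℝ} (hy : (y.1, y.2.1) ∈ (tubeChart EN Ψ p).source) :
    ContDiffAt ℝ ∞ (tubeForm Ω e θ (tubeChart EN Ψ p)) y :=
  (hT.symplectic.smooth.contDiffOn_altBilin_pull (hT.isOpen_flowOut_domain p)
    (hT.contMDiffOn_flowOut hθ p)).contDiffAt ((hT.isOpen_flowOut_domain p).mem_nhds hy)

theorem SplitTube.tubeForm_split (hT : SplitTube EM Ω e f σ δ Ψ) (hθ : IsGlobalFlow V θ)
    {p : N} {u : EN} {z : PhaseSpace k} (hy : (u, z) ∈ (tubeChart EN Ψ p).source) (a a' : EN)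
    (ζ ζ' : PhaseSpace k) :
    tubeForm Ω e θ (tubeChart EN Ψ p) (u, z, 0) (a, ζ, 0) (a', ζ', 0) =
      σ.bilin ((chartAt EN p).symm u) (tderiv EN EN (chartAt EN p).symm u a)
        (tderiv EN EN (chartAt EN p).symm u a') + stdBilin k ζ ζ' := by
  rw [tubeForm_apply, hT.tderiv_flowOut_zero hθ hy, hT.tderiv_flowOut_zero hθ hy, zero_smul,
    add_zero, add_zero]
  have h1 : flowOut θ e (tubeChart EN Ψ p) (u, z, 0) = e (tubeChart EN Ψ p (u, z)) :=
    hθ.map_zero _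
  rw [h1]
  exact hT.split_tubeChart hy _ _ _ _

/-- The one-form `Ω(V, ·)` along a map `g`. -/
noncomputable def dualForm (Ω : DiffForm 𝓘(ℝ, EW) W 2) (V : ∀ x : W, TangentSpace 𝓘(ℝ, EW) x)
    (g : N → W) (p : N) : EN →L[ℝ] ℝ :=
  (Ω.bilin (g p) (modelVec V (g p))).comp (tderiv EN EW g p)

/-- At `t = 0` the time derivative of the flow-out is `V`. Besides giving the pairing of the time
direction with `R`, this identity is the source of the smoothness of the one-form `Ω(V, ·)` on `N`.
-/
theorem SplitTube.tubeForm_time (hT : SplitTube EM Ω e f σ δ Ψ) (hθ : IsGlobalFlow V θ)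
    (hf : ContMDiff 𝓘(ℝ, EN) 𝓘(ℝ, EM) ∞ f) {p : N} {u : EN} (hu : u ∈ (chartAt EN p).target)
    (a : EN) :
    tubeForm Ω e θ (tubeChart EN Ψ p) (u, 0, 0) (0, 0, 1) (a, 0, 0) =
      dualForm Ω V (fun p => e (f p)) ((chartAt EN p).symm u)
        (tderiv EN EN (chartAt EN p).symm u a) := by
  have hy : (u, (0 : PhaseSpace k)) ∈ (tubeChart EN Ψ p).source :=
    hT.mem_tubeChart_source.2 ⟨hu, Metric.mem_ball_self hT.pos⟩
  rw [tubeForm_apply, hT.tderiv_flowOut_zero hθ hy, hT.tderiv_flowOut_zero hθ hy, zero_smul,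
    add_zero, one_smul, hT.tderiv_comp_tubeChart_zero hf hu]
  have h1 : flowOut θ e (tubeChart EN Ψ p) (u, 0, 0) = e (tubeChart EN Ψ p (u, 0)) :=
    hθ.map_zero _
  rw [h1, map_zero, map_zero, zero_add, hT.tderiv_comp_tubeChart_zero hf hu, tubeChart_apply,
    hT.map_base]
  rfl

/-- The one-form `Ω(V, ·)` in a chart. -/
noncomputable def dualFormInChart (Ω : DiffForm 𝓘(ℝ, EW) W 2) (e : M → W) (θ : ℝ → W → W)
    (κ : EN × PhaseSpace k → M) (u : EN) : EN →L[ℝ] ℝ :=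
  (tubeForm Ω e θ κ (u, 0, 0) (0, 0, 1)).comp (ContinuousLinearMap.inl ℝ EN (PhaseSpace k × ℝ))

theorem SplitTube.contDiffAt_dualFormInChart (hT : SplitTube EM Ω e f σ δ Ψ)
    (hθ : IsGlobalFlow V θ) {p : N} {u : EN} (hu : u ∈ (chartAt EN p).target) :
    ContDiffAt ℝ ∞ (dualFormInChart Ω e θ (tubeChart EN Ψ p)) u := by
  have hy : (u, (0 : PhaseSpace k)) ∈ (tubeChart EN Ψ p).source :=
    hT.mem_tubeChart_source.2 ⟨hu, Metric.mem_ball_self hT.pos⟩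
  have hι : ContDiff ℝ ∞ (fun u : EN => (u, (0 : PhaseSpace k), (0 : ℝ))) := by fun_prop
  have h1 : ContDiffAt ℝ ∞ (fun u => tubeForm Ω e θ (tubeChart EN Ψ p) (u, 0, 0)) u :=
    ContDiffAt.comp (g := tubeForm Ω e θ (tubeChart EN Ψ p)) u
      (hT.contDiffAt_tubeForm hθ (y := (u, 0, 0)) hy) hι.contDiffAt
  exact (h1.clm_apply contDiffAt_const).clm_comp contDiffAt_const

theorem SplitTube.contDiffAt_dualForm (hT : SplitTube EM Ω e f σ δ Ψ)
    (hθ : IsGlobalFlow V θ) (hf : ContMDiff 𝓘(ℝ, EN) 𝓘(ℝ, EM) ∞ f) (p : N) :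
    ContDiffAt ℝ ∞ (fun u => (dualForm Ω V (fun p => e (f p)) ((chartAt EN p).symm u)).comp
      (tderiv EN EN (chartAt EN p).symm u)) (chartAt EN p p) := by
  have hu : chartAt EN p p ∈ (chartAt EN p).target := mem_chart_target EN p
  refine (hT.contDiffAt_dualFormInChart hθ hu).congr_of_eventuallyEq ?_
  filter_upwards [(chartAt EN p).open_target.mem_nhds hu] with u hu
  ext a
  exact (hT.tubeForm_time hθ hf hu a).symm

/-- Existence of a transverse flow and of its dual kernel field. -/
theorem SplitTube.exists_transverseFlow [CompactSpace N] [T2Space W] [SecondCountableTopology W]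
    (hT : SplitTube EM Ω e f σ δ Ψ) (hf : ContMDiff 𝓘(ℝ, EN) 𝓘(ℝ, EM) ∞ f) (hfe : IsEmbedding f)
    (hfi : ∀ p, Function.Injective (tderiv EN EM f p)) (hσ : σ.HasFraming) :
    ∃ V θ R, TransverseFlow Ω (fun p => e (f p)) σ V θ R ∧
      ∀ p v, σ.bilin p v = 0 → dualForm Ω V (fun p => e (f p)) p v = 0 → v = 0 := by
  obtain ⟨μ, hμ, hμσ⟩ := hσ
  have hμσ' : ∀ p v, σ.bilin p v = 0 → μ.lin p v = 0 → v = 0 := by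
    intro p v h1 h2
    by_contra hv
    exact hμσ p v (DiffForm.mem_ker_iff (E := EN).2 h1) hv h2
  -- The kernel field normalised by the given framing only orients the kernel lines: it tells `V` to
  -- which side it should point.
  obtain ⟨R₀, hR₀, hR₀'⟩ := hT.hamiltonian.exists_kernel_field hμ.contDiffAt_lin hμσ'
  have hg : ContMDiff 𝓘(ℝ, EN) 𝓘(ℝ, EW) ∞ (fun p => e (f p)) := hT.contMDiff.comp hf
  have hgi : ∀ p, Function.Injective (tderiv EN EW (fun p => e (f p)) p) := by
    intro p a b hab
    rw [tderiv_comp_apply (E' := EM) (hT.contMDiff.contMDiffAt.mdifferentiableAt (by simp))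
      (hf.contMDiffAt.mdifferentiableAt (by simp)),
      tderiv_comp_apply (E' := EM) (hT.contMDiff.contMDiffAt.mdifferentiableAt (by simp))
      (hf.contMDiffAt.mdifferentiableAt (by simp))] at hab
    exact hfi p (hT.injective_tderiv _ hab)
  have hR₀0 : ∀ p, R₀ p ≠ 0 := by
    intro p h0
    have h1 := (hR₀' p).2
    have h2 : modelVec R₀ p = 0 := h0
    rw [h2, map_zero] at h1
    exact zero_ne_one h1
  obtain ⟨V, K, hK, hVK, hV, hpos⟩ := Ω.exists_transverse_field hT.symplectic.smooth
    hT.symplectic.nondegenerate hg (hT.isEmbedding.comp hfe) hgi hR₀ hR₀0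
  obtain ⟨θ, hθ⟩ := exists_isGlobalFlow_of_isCompact hV hK hVK
  -- A kernel vector of `σ` is a multiple of `R₀`, on which `Ω(V, ·)` is positive. So `Ω(V, ·)` is
  -- itself a framing.
  have hdual : ∀ p v, σ.bilin p v = 0 → dualForm Ω V (fun p => e (f p)) p v = 0 → v = 0 := by
    intro p v h1 h2
    have hinj := framedMap_injective _ (σ.bilin_self p) _ (hμσ' p)
    have h3 := kernel_eq_span _ _ hinj (hR₀' p).1 (hR₀' p).2 h1
    have h4 : 0 < dualForm Ω V (fun p => e (f p)) p (modelVec R₀ p) := hpos p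
    rw [h3, map_smul, smul_eq_mul, mul_eq_zero, or_iff_left h4.ne'] at h2
    rw [h3, h2, zero_smul]
  -- The kernel field is normalised anew, by this second framing, so that it pairs to exactly one
  -- with `V`.
  obtain ⟨R, hR, hR'⟩ := hT.hamiltonian.exists_kernel_field (hT.contDiffAt_dualForm hθ hf) hdual
  exact ⟨V, θ, R, ⟨hθ, hR, fun p => (hR' p).1, fun p => (hR' p).2⟩, hdual⟩

end TubeForm


/-! ### Bounds for derivatives on a compact manifold -/

section Growth

variable {E : Type} [NormedAddCommGroup E] [NormedSpace ℝ E] [FiniteDimensional ℝ E]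
  {N : Type*} [TopologicalSpace N] [ChartedSpace E N] [IsManifold 𝓘(ℝ, E) ∞ N]
  {H : Type*} [NormedAddCommGroup H] [NormedSpace ℝ H]
  {H' : Type*} [NormedAddCommGroup H'] [NormedSpace ℝ H']

theorem fderiv_comp_chart_symm {F : N → H} (hF : ContMDiff 𝓘(ℝ, E) 𝓘(ℝ, H) ∞ F) {p : N} {u : E}
    (hu : u ∈ (chartAt E p).target) (v : E) :
    fderiv ℝ (fun u => F ((chartAt E p).symm u)) u v =
      tderiv E H F ((chartAt E p).symm u) (tderiv E E (chartAt E p).symm u v) := by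
  have hs : ContMDiffAt 𝓘(ℝ, E) 𝓘(ℝ, E) ∞ (chartAt E p).symm u :=
    contMDiffAt_symm_of_mem_maximalAtlas (IsManifold.chart_mem_maximalAtlas (n := ∞) p) hu
  rw [← tderiv_comp_apply (hF.contMDiffAt.mdifferentiableAt (by simp))
    (hs.mdifferentiableAt (by simp))]
  unfold tderiv
  rw [mfderiv_eq_fderiv]

theorem contDiffAt_comp_chart_symm {F : N → H} (hF : ContMDiff 𝓘(ℝ, E) 𝓘(ℝ, H) ∞ F) {p : N} {u : E}
    (hu : u ∈ (chartAt E p).target) : ContDiffAt ℝ ∞ (fun u => F ((chartAt E p).symm u)) u :=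
  (ContMDiffAt.comp (g := F) u hF.contMDiffAt
    (contMDiffAt_symm_of_mem_maximalAtlas (IsManifold.chart_mem_maximalAtlas (n := ∞) p)
      hu)).contDiffAt

/-- On a compact manifold, the derivative of a smooth map is controlled by that of an immersion. -/
theorem exists_norm_tderiv_le [CompactSpace N] {F : N → H} {G : N → H'}
    (hF : ContMDiff 𝓘(ℝ, E) 𝓘(ℝ, H) ∞ F) (hG : ContMDiff 𝓘(ℝ, E) 𝓘(ℝ, H') ∞ G)
    (hGi : ∀ p, Function.Injective (tderiv E H' G p)) :
    ∃ ρ > 0, ∀ p v, ‖tderiv E H F p v‖ ≤ ρ * ‖tderiv E H' G p v‖ := by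
  suffices ∃ ρ > 0, ∀ p ∈ (univ : Set N), ∀ v, ‖tderiv E H F p v‖ ≤ ρ * ‖tderiv E H' G p v‖ by
    obtain ⟨ρ, hρ, h⟩ := this
    exact ⟨ρ, hρ, fun p => h p (mem_univ p)⟩
  refine isCompact_univ.induction_on (p := fun A => ∃ ρ > 0, ∀ p ∈ A, ∀ v,
    ‖tderiv E H F p v‖ ≤ ρ * ‖tderiv E H' G p v‖) ⟨1, one_pos, fun p hp => hp.elim⟩ ?_ ?_ ?_
  · rintro A B hAB ⟨r, hr, h⟩
    exact ⟨r, hr, fun x hx => h x (hAB hx)⟩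
  · rintro A B ⟨r, hr, hA⟩ ⟨r', hr', hB⟩
    refine ⟨max r r', lt_max_of_lt_left hr, ?_⟩
    rintro x (hx | hx) v
    · exact (hA x hx v).trans (mul_le_mul_of_nonneg_right (le_max_left _ _) (norm_nonneg _))
    · exact (hB x hx v).trans (mul_le_mul_of_nonneg_right (le_max_right _ _) (norm_nonneg _))
  · intro p _
    have hp : chartAt E p p ∈ (chartAt E p).target := mem_chart_target E p
    have hdF : ContinuousAt (fderiv ℝ fun u => F ((chartAt E p).symm u)) (chartAt E p p) :=
      ((contDiffAt_comp_chart_symm hF hp).fderiv_right (m := ∞) (by simp)).continuousAt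
    have hdG : ContinuousAt (fderiv ℝ fun u => G ((chartAt E p).symm u)) (chartAt E p p) :=
      ((contDiffAt_comp_chart_symm hG hp).fderiv_right (m := ∞) (by simp)).continuousAt
    obtain ⟨C, hC, hev⟩ := eventually_le_of_homogeneous (w₀ := chartAt E p p)
      (a := fun q : E × E => ‖fderiv ℝ (fun u => F ((chartAt E p).symm u)) q.1 q.2‖)
      (b := fun q : E × E => ‖fderiv ℝ (fun u => G ((chartAt E p).symm u)) q.1 q.2‖)
      (fun v => ((ContinuousAt.comp (g := fderiv ℝ fun u => F ((chartAt E p).symm u))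
        (x := (chartAt E p p, v)) hdF continuousAt_fst).clm_apply continuousAt_snd).norm)
      (fun v => ((ContinuousAt.comp (g := fderiv ℝ fun u => G ((chartAt E p).symm u))
        (x := (chartAt E p p, v)) hdG continuousAt_fst).clm_apply continuousAt_snd).norm)
      (fun w v c => by rw [map_smul, norm_smul, Real.norm_eq_abs])
      (fun w v c => by rw [map_smul, norm_smul, Real.norm_eq_abs])
      (fun v hv => by
        rw [norm_pos_iff]
        intro h0
        apply hv
        rw [fderiv_comp_chart_symm hG hp] at h0
        exact (injective_iff_map_eq_zero _).1 (bijective_tderiv_chart_symm hp).1 _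
          ((injective_iff_map_eq_zero _).1 (hGi _) _ h0))
    have hp' : p ∈ (chartAt E p).source := mem_chart_source E p
    refine ⟨_, mem_nhdsWithin_of_mem_nhds (inter_mem ((chartAt E p).continuousAt hp' hev)
      ((chartAt E p).open_source.mem_nhds hp')), C, hC, ?_⟩
    rintro q ⟨hq1, hq2⟩ v
    have hqt := (chartAt E p).map_source hq2
    obtain ⟨w, rfl⟩ := (bijective_tderiv_chart_symm hqt).2 v
    have h1 := hq1 w
    simp only at h1
    rw [fderiv_comp_chart_symm hF hqt, fderiv_comp_chart_symm hG hqt,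
      (chartAt E p).left_inv hq2] at h1
    exact h1

end Growth


/-! ### The characteristic field of the perturbed hypersurface -/

section CharField

variable {EN : Type} [NormedAddCommGroup EN] [NormedSpace ℝ EN] [FiniteDimensional ℝ EN]
  {EM : Type} [NormedAddCommGroup EM] [NormedSpace ℝ EM] [FiniteDimensional ℝ EM]
  {EW : Type} [NormedAddCommGroup EW] [NormedSpace ℝ EW] [FiniteDimensional ℝ EW]
  {N : Type*} [TopologicalSpace N] [ChartedSpace EN N] [IsManifold 𝓘(ℝ, EN) ∞ N]
  {M : Type*} [TopologicalSpace M] [ChartedSpace EM M] [IsManifold 𝓘(ℝ, EM) ∞ M]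
  {W : Type*} [TopologicalSpace W] [ChartedSpace EW W] [IsManifold 𝓘(ℝ, EW) ∞ W]
  {k : ℕ}
  {Ω : DiffForm 𝓘(ℝ, EW) W 2} {e : M → W} {f : N → M} {σ : DiffForm 𝓘(ℝ, EN) N 2} {δ : ℝ}
  {Ψ : OpenPartialHomeomorph (N × PhaseSpace k) M}
  {V : ∀ x : W, TangentSpace 𝓘(ℝ, EW) x} {θ : ℝ → W → W} {R : ∀ p : N, TangentSpace 𝓘(ℝ, EN) p}
  {h : PhaseSpace k → ℝ} {A : ℝ}

/-- The data of a perturbation of the hypersurface along a transverse flow by a function of the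
normal coordinates that is equal to `A ∑ x_i y_i` near the origin. -/
structure SaddlePerturbation (EM : Type) [NormedAddCommGroup EM] [NormedSpace ℝ EM]
    [ChartedSpace EM M] (Ω : DiffForm 𝓘(ℝ, EW) W 2) (e : M → W) (f : N → M)
    (σ : DiffForm 𝓘(ℝ, EN) N 2) (δ : ℝ) (Ψ : OpenPartialHomeomorph (N × PhaseSpace k) M)
    (V : ∀ x : W, TangentSpace 𝓘(ℝ, EW) x) (θ : ℝ → W → W)
    (R : ∀ p : N, TangentSpace 𝓘(ℝ, EN) p) (h : PhaseSpace k → ℝ) (A : ℝ) : Prop where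
  tube : SplitTube EM Ω e f σ δ Ψ
  base_smooth : ContMDiff 𝓘(ℝ, EN) 𝓘(ℝ, EM) ∞ f
  transverse : TransverseFlow Ω (fun p => e (f p)) σ V θ R
  framing : ∀ p v, σ.bilin p v = 0 → dualForm Ω V (fun p => e (f p)) p v = 0 → v = 0
  smooth : ContDiff ℝ ∞ h
  support : ∃ s < δ, ∀ z ∉ Metric.closedBall (0 : PhaseSpace k) s, h z = 0
  apply_zero : h 0 = 0
  eventually_hasFDerivAt : ∀ᶠ z in 𝓝 0, HasFDerivAt h ((A • saddle k) z) z

/-- The derivative of `(u, z) ↦ (u, z, h z)`. -/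
noncomputable def graphDeriv (h : PhaseSpace k → ℝ) (w : EN × PhaseSpace k) :
    (EN × PhaseSpace k) →L[ℝ] (EN × PhaseSpace k × ℝ) :=
  (ContinuousLinearMap.fst ℝ EN (PhaseSpace k)).prod
    ((ContinuousLinearMap.snd ℝ EN (PhaseSpace k)).prod
      ((fderiv ℝ h w.2).comp (ContinuousLinearMap.snd ℝ EN (PhaseSpace k))))

theorem graphDeriv_apply (w : EN × PhaseSpace k) (a : EN) (ζ : PhaseSpace k) :
    graphDeriv h w (a, ζ) = (a, ζ, fderiv ℝ h w.2 ζ) := rfl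

/-- The pullback of `Ω` by the perturbed hypersurface, in the coordinates of the tube. -/
noncomputable def graphForm (Ω : DiffForm 𝓘(ℝ, EW) W 2) (e : M → W) (θ : ℝ → W → W)
    (κ : EN × PhaseSpace k → M) (h : PhaseSpace k → ℝ) (w : EN × PhaseSpace k) :
    (EN × PhaseSpace k) →L[ℝ] (EN × PhaseSpace k) →L[ℝ] ℝ :=
  (tubeForm Ω e θ κ (w.1, w.2, h w.2)).bilinearComp (graphDeriv h w) (graphDeriv h w)

theorem graphForm_apply (κ : EN × PhaseSpace k → M) (w v v' : EN × PhaseSpace k) :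
    graphForm Ω e θ κ h w v v' =
      tubeForm Ω e θ κ (w.1, w.2, h w.2) (graphDeriv h w v) (graphDeriv h w v') := rfl

theorem graphForm_self (κ : EN × PhaseSpace k → M) (w v : EN × PhaseSpace k) :
    graphForm Ω e θ κ h w v v = 0 := by
  have h1 := tubeForm_swap (Ω := Ω) (e := e) (θ := θ) κ (w.1, w.2, h w.2) (graphDeriv h w v)
    (graphDeriv h w v)
  rw [graphForm_apply]
  linarith

/-- The one-form `Ω(V, ·)` on `N`, pulled back to the coordinates of the tube. -/
noncomputable def graphDual (Ω : DiffForm 𝓘(ℝ, EW) W 2) (e : M → W) (θ : ℝ → W → W)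
    (κ : EN × PhaseSpace k → M) (w : EN × PhaseSpace k) : (EN × PhaseSpace k) →L[ℝ] ℝ :=
  (dualFormInChart Ω e θ κ w.1).comp (ContinuousLinearMap.fst ℝ EN (PhaseSpace k))

/-- The characteristic field in the coordinates of the tube. -/
noncomputable def graphField (Ω : DiffForm 𝓘(ℝ, EW) W 2) (e : M → W) (θ : ℝ → W → W)
    (κ : EN × PhaseSpace k → M) (h : PhaseSpace k → ℝ) (w : EN × PhaseSpace k) :
    EN × PhaseSpace k :=
  ContinuousLinearMap.inverse (framedMap (graphForm Ω e θ κ h w) (graphDual Ω e θ κ w))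
    (graphDual Ω e θ κ w)

/-- The bilinear form of the pullback of `Ω` by `g`. -/
noncomputable def charForm (EM : Type) [NormedAddCommGroup EM] [NormedSpace ℝ EM]
    [ChartedSpace EM M] (Ω : DiffForm 𝓘(ℝ, EW) W 2) (g : M → W) (x : M) : EM →L[ℝ] EM →L[ℝ] ℝ :=
  (DiffForm.pullback 𝓘(ℝ, EM) 𝓘(ℝ, EW) g Ω).bilin x

theorem charForm_apply (g : M → W) (x : M) (v v' : EM) : charForm EM Ω g x v v' =
    Ω.bilin (g x) (tderiv EM EW g x v) (tderiv EM EW g x v') :=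
  DiffForm.altBilin_pull (I := 𝓘(ℝ, EM)) g Ω x _ _

/-- The one-form `Ω(V, ·)` on `N`, pulled back to the tube. -/
noncomputable def tubeDual (EN : Type) [NormedAddCommGroup EN]
    [NormedSpace ℝ EN] [ChartedSpace EN N] (EM : Type) [NormedAddCommGroup EM] [NormedSpace ℝ EM]
    [ChartedSpace EM M] (Ω : DiffForm 𝓘(ℝ, EW) W 2) (V : ∀ x : W, TangentSpace 𝓘(ℝ, EW) x)
    (g : N → W) (Ψ : OpenPartialHomeomorph (N × PhaseSpace k) M) (x : M) : EM →L[ℝ] ℝ :=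
  (dualForm Ω V g (Ψ.symm x).1).comp (tderiv EM EN (fun x => (Ψ.symm x).1) x)

/-- The kernel field of `g^* Ω` normalised by the form `tubeDual`. -/
noncomputable def charField (EN : Type) [NormedAddCommGroup EN]
    [NormedSpace ℝ EN] [ChartedSpace EN N] (EM : Type) [NormedAddCommGroup EM] [NormedSpace ℝ EM]
    [ChartedSpace EM M] (Ω : DiffForm 𝓘(ℝ, EW) W 2) (V : ∀ x : W, TangentSpace 𝓘(ℝ, EW) x)
    (g : N → W) (Ψ : OpenPartialHomeomorph (N × PhaseSpace k) M) (g₁ : M → W) (x : M) : EM :=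
  ContinuousLinearMap.inverse (framedMap (charForm EM Ω g₁ x) (tubeDual EN EM Ω V g Ψ x))
    (tubeDual EN EM Ω V g Ψ x)

theorem SplitTube.tderiv_symm_fst (hT : SplitTube EM Ω e f σ δ Ψ) {p : N} {w : EN × PhaseSpace k}
    (hw : w ∈ (tubeChart EN Ψ p).source) (v : EN × PhaseSpace k) :
    tderiv EM EN (fun x => (Ψ.symm x).1) (tubeChart EN Ψ p w)
      (tderiv (EN × PhaseSpace k) EM (tubeChart EN Ψ p) w v) =
      tderiv EN EN (chartAt EN p).symm w.1 v.1 := by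
  have hs : ContMDiffAt 𝓘(ℝ, EN) 𝓘(ℝ, EN) ∞ (chartAt EN p).symm w.1 :=
    contMDiffAt_symm_of_mem_maximalAtlas (IsManifold.chart_mem_maximalAtlas (n := ∞) p)
      (hT.mem_tubeChart_source.1 hw).1
  rw [← tderiv_comp_apply (g := fun x => (Ψ.symm x).1) ((hT.contMDiffOn_symm_fst.contMDiffAt
      (Ψ.open_target.mem_nhds (hT.tubeChart_mem_target hw))).mdifferentiableAt (by simp))
    (((hT.contMDiffOn_tubeChart p).contMDiffAt
      ((tubeChart EN Ψ p).open_source.mem_nhds hw)).mdifferentiableAt (by simp))]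
  have h1 : (fun w => (Ψ.symm (tubeChart EN Ψ p w)).1) =ᶠ[𝓝 w]
      fun w => (chartAt EN p).symm w.1 := by
    filter_upwards [(tubeChart EN Ψ p).open_source.mem_nhds hw] with w' hw'
    rw [hT.symm_tubeChart hw']
  rw [tderiv_congr h1, tderiv_comp_apply (E' := EN) (f := fun w : EN × PhaseSpace k => w.1)
    (hs.mdifferentiableAt (by simp)) (contDiff_fst.contMDiff.contMDiffAt.mdifferentiableAt
      (n := ∞) (by simp)),
    tderiv_linear (ContinuousLinearMap.fst ℝ EN (PhaseSpace k)) (g := fun w => w.1) (fun _ => rfl)]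
  rfl

theorem SplitTube.tderiv_symm_snd (hT : SplitTube EM Ω e f σ δ Ψ) {p : N} {w : EN × PhaseSpace k}
    (hw : w ∈ (tubeChart EN Ψ p).source) (v : EN × PhaseSpace k) :
    tderiv EM (PhaseSpace k) (fun x => (Ψ.symm x).2) (tubeChart EN Ψ p w)
      (tderiv (EN × PhaseSpace k) EM (tubeChart EN Ψ p) w v) = v.2 := by
  rw [← tderiv_comp_apply (g := fun x => (Ψ.symm x).2) ((hT.contMDiffOn_symm_snd.contMDiffAt
      (Ψ.open_target.mem_nhds (hT.tubeChart_mem_target hw))).mdifferentiableAt (by simp))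
    (((hT.contMDiffOn_tubeChart p).contMDiffAt
      ((tubeChart EN Ψ p).open_source.mem_nhds hw)).mdifferentiableAt (by simp))]
  have h1 : (fun w => (Ψ.symm (tubeChart EN Ψ p w)).2) =ᶠ[𝓝 w] fun w => w.2 := by
    filter_upwards [(tubeChart EN Ψ p).open_source.mem_nhds hw] with w' hw'
    rw [hT.symm_tubeChart hw']
  rw [tderiv_congr h1, tderiv_linear (ContinuousLinearMap.snd ℝ EN (PhaseSpace k))
    (g := fun w => w.2) (fun _ => rfl)]
  rfl

namespace SaddlePerturbation

theorem fderiv_zero (hP : SaddlePerturbation EM Ω e f σ δ Ψ V θ R h A) : fderiv ℝ h 0 = 0 := by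
  rw [hP.eventually_hasFDerivAt.self_of_nhds.fderiv, map_zero]

theorem tubeDual_tubeChart (hP : SaddlePerturbation EM Ω e f σ δ Ψ V θ R h A) {p : N}
    {w : EN × PhaseSpace k} (hw : w ∈ (tubeChart EN Ψ p).source) (v : EN × PhaseSpace k) :
    graphDual Ω e θ (tubeChart EN Ψ p) w v =
      tubeDual EN EM Ω V (fun p => e (f p)) Ψ (tubeChart EN Ψ p w)
        (tderiv (EN × PhaseSpace k) EM (tubeChart EN Ψ p) w v) := by
  have h1 := hP.tube.tubeForm_time hP.transverse.flow hP.base_smooth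
    (hP.tube.mem_tubeChart_source.1 hw).1 v.1
  have h2 := hP.tube.tderiv_symm_fst hw v
  have h3 : (Ψ.symm (tubeChart EN Ψ p w)).1 = (chartAt EN p).symm w.1 := by
    rw [hP.tube.symm_tubeChart hw]
  simp only [tubeDual, ContinuousLinearMap.comp_apply]
  rw [h2, h3]
  exact h1

theorem contDiffAt_graphForm (hP : SaddlePerturbation EM Ω e f σ δ Ψ V θ R h A) {p : N}
    {w : EN × PhaseSpace k} (hw : w ∈ (tubeChart EN Ψ p).source) :
    ContDiffAt ℝ ∞ (graphForm Ω e θ (tubeChart EN Ψ p) h) w := by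
  have hι : ContDiff ℝ ∞ (fun w : EN × PhaseSpace k => (w.1, w.2, h w.2)) :=
    contDiff_fst.prodMk (contDiff_snd.prodMk (hP.smooth.comp contDiff_snd))
  have h1 : ContDiffAt ℝ ∞ (fun w : EN × PhaseSpace k =>
      tubeForm Ω e θ (tubeChart EN Ψ p) (w.1, w.2, h w.2)) w :=
    ContDiffAt.comp (g := tubeForm Ω e θ (tubeChart EN Ψ p)) w
      (hP.tube.contDiffAt_tubeForm hP.transverse.flow (y := (w.1, w.2, h w.2)) hw) hι.contDiffAt
  have hd : ContDiff ℝ ∞ (fun w : EN × PhaseSpace k => fderiv ℝ h w.2) :=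
    (hP.smooth.fderiv_right (by simp)).comp contDiff_snd
  have h2 : ∀ v, ContDiffAt ℝ ∞ (fun w : EN × PhaseSpace k => graphDeriv h w v) w := fun v =>
    contDiffAt_const.prodMk (contDiffAt_const.prodMk (hd.contDiffAt.clm_apply contDiffAt_const))
  exact contDiffAt_clm_of_forall_apply fun u => contDiffAt_clm_of_forall_apply fun v =>
    (h1.clm_apply (h2 u)).clm_apply (h2 v)

theorem contDiffAt_graphDual (hP : SaddlePerturbation EM Ω e f σ δ Ψ V θ R h A) {p : N}
    {w : EN × PhaseSpace k} (hw : w ∈ (tubeChart EN Ψ p).source) :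
    ContDiffAt ℝ ∞ (graphDual Ω e θ (tubeChart EN Ψ p)) w := by
  have h1 : ContDiffAt ℝ ∞ (fun w : EN × PhaseSpace k =>
      dualFormInChart Ω e θ (tubeChart EN Ψ p) w.1) w :=
    ContDiffAt.comp (g := dualFormInChart Ω e θ (tubeChart EN Ψ p)) w
      (hP.tube.contDiffAt_dualFormInChart hP.transverse.flow
        (hP.tube.mem_tubeChart_source.1 hw).1) contDiff_fst.contDiffAt
  exact h1.clm_comp contDiffAt_const

/-- Along `N`, the form splits. -/
theorem graphForm_zero (hP : SaddlePerturbation EM Ω e f σ δ Ψ V θ R h A) {p : N} {u : EN}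
    (hu : u ∈ (chartAt EN p).target) (a a' : EN) (ζ ζ' : PhaseSpace k) :
    graphForm Ω e θ (tubeChart EN Ψ p) h (u, 0) (a, ζ) (a', ζ') =
      σ.bilin ((chartAt EN p).symm u) (tderiv EN EN (chartAt EN p).symm u a)
        (tderiv EN EN (chartAt EN p).symm u a') + stdBilin k ζ ζ' := by
  have hw : (u, (0 : PhaseSpace k)) ∈ (tubeChart EN Ψ p).source :=
    hP.tube.mem_tubeChart_source.2 ⟨hu, Metric.mem_ball_self hP.tube.pos⟩
  rw [graphForm_apply, graphDeriv_apply, graphDeriv_apply, hP.fderiv_zero, hP.apply_zero]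
  exact hP.tube.tubeForm_split hP.transverse.flow hw a a' ζ ζ'

theorem graphDual_zero (hP : SaddlePerturbation EM Ω e f σ δ Ψ V θ R h A) {p : N} {u : EN}
    (hu : u ∈ (chartAt EN p).target) (z : PhaseSpace k) (a : EN) (ζ : PhaseSpace k) :
    graphDual Ω e θ (tubeChart EN Ψ p) (u, z) (a, ζ) =
      dualForm Ω V (fun p => e (f p)) ((chartAt EN p).symm u)
        (tderiv EN EN (chartAt EN p).symm u a) :=
  hP.tube.tubeForm_time hP.transverse.flow hP.base_smooth hu a

/-- Over `N` the form on the graph is the direct sum of `σ` and the standard form. Nondegeneracy of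
the standard form kills the normal component of a kernel vector, and the framing kills the
tangential one. -/
theorem injective_framedMap_graph (hP : SaddlePerturbation EM Ω e f σ δ Ψ V θ R h A) {p : N} {u : EN}
    (hu : u ∈ (chartAt EN p).target) :
    Function.Injective (framedMap (graphForm Ω e θ (tubeChart EN Ψ p) h (u, 0))
      (graphDual Ω e θ (tubeChart EN Ψ p) (u, 0))) := by
  refine framedMap_injective _ (fun v => graphForm_self _ _ v) _ ?_
  rintro ⟨a, ζ⟩ h1 h2
  have hφ := bijective_tderiv_chart_symm hu
  have h3 : ∀ a' ζ', σ.bilin ((chartAt EN p).symm u) (tderiv EN EN (chartAt EN p).symm u a)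
      (tderiv EN EN (chartAt EN p).symm u a') + stdBilin k ζ ζ' = 0 := fun a' ζ' => by
    rw [← hP.graphForm_zero hu, h1]; rfl
  have hζ : ζ = 0 := by
    apply eq_zero_of_stdBilin_eq_zero
    ext ζ'
    simpa using h3 0 ζ'
  have ha : tderiv EN EN (chartAt EN p).symm u a = 0 := by
    refine hP.framing ((chartAt EN p).symm u) _ ?_ ?_
    · ext b
      obtain ⟨a', rfl⟩ := hφ.2 b
      simpa [hζ] using h3 a' 0
    · rw [← hP.graphDual_zero hu 0 a ζ, h2]
  rw [hζ, (injective_iff_map_eq_zero _).1 hφ.1 a ha]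
  rfl

/-- The vector `(r, 0)` lies in the kernel of the split form and is normalised, which determines it.
In particular the field over `N` does not depend on `h`. -/
theorem graphField_zero (hP : SaddlePerturbation EM Ω e f σ δ Ψ V θ R h A) {p : N} {u : EN}
    (hu : u ∈ (chartAt EN p).target) {r : EN}
    (hr : tderiv EN EN (chartAt EN p).symm u r = modelVec R ((chartAt EN p).symm u)) :
    graphField Ω e θ (tubeChart EN Ψ p) h (u, 0) = (r, 0) := by
  refine (kernel_vector_eq_inverse _ _ (hP.injective_framedMap_graph hu) ?_ ?_).symm
  · refine ContinuousLinearMap.ext fun v => ?_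
    obtain ⟨a', ζ'⟩ := v
    rw [hP.graphForm_zero hu, hr, hP.transverse.ker]
    simp
  · rw [hP.graphDual_zero hu, hr]
    exact hP.transverse.pair _

variable [CompactSpace N] [T2Space M]

theorem contMDiff_perturb (hP : SaddlePerturbation EM Ω e f σ δ Ψ V θ R h A) :
    ContMDiff 𝓘(ℝ, EM) 𝓘(ℝ, EW) ∞ (perturb Ψ θ e h) := by
  obtain ⟨s, hs, hsupp⟩ := hP.support
  exact hP.tube.contMDiff_perturb hP.transverse.flow hs hP.smooth hsupp

/-- In flow-out coordinates the perturbed hypersurface is the graph `t = h(z)`, so both sides are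
`Ω` evaluated on the same pair of tangent vectors. -/
theorem charForm_tubeChart (hP : SaddlePerturbation EM Ω e f σ δ Ψ V θ R h A) {p : N}
    {w : EN × PhaseSpace k} (hw : w ∈ (tubeChart EN Ψ p).source) (v v' : EN × PhaseSpace k) :
    graphForm Ω e θ (tubeChart EN Ψ p) h w v v' =
      charForm EM Ω (perturb Ψ θ e h) (tubeChart EN Ψ p w)
        (tderiv (EN × PhaseSpace k) EM (tubeChart EN Ψ p) w v)
        (tderiv (EN × PhaseSpace k) EM (tubeChart EN Ψ p) w v') := by
  have hκ : MDifferentiableAt 𝓘(ℝ, EN × PhaseSpace k) 𝓘(ℝ, EM) (tubeChart EN Ψ p) w :=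
    ((hP.tube.contMDiffOn_tubeChart p).contMDiffAt
      ((tubeChart EN Ψ p).open_source.mem_nhds hw)).mdifferentiableAt (by simp)
  have hι : HasFDerivAt (fun w : EN × PhaseSpace k => (w.1, w.2, h w.2)) (graphDeriv h w) w :=
    hasFDerivAt_fst.prodMk (hasFDerivAt_snd.prodMk (HasFDerivAt.comp (g := h) w
      ((hP.smooth.differentiable (by simp)) w.2).hasFDerivAt hasFDerivAt_snd))
  have hF : MDifferentiableAt 𝓘(ℝ, EN × PhaseSpace k × ℝ) 𝓘(ℝ, EW)
      (flowOut θ e (tubeChart EN Ψ p)) (w.1, w.2, h w.2) :=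
    ((hP.tube.contMDiffOn_flowOut hP.transverse.flow p).contMDiffAt
      ((hP.tube.isOpen_flowOut_domain p).mem_nhds (x := (w.1, w.2, h w.2)) hw)).mdifferentiableAt
        (by simp)
  have heq : (fun w => perturb Ψ θ e h (tubeChart EN Ψ p w)) =ᶠ[𝓝 w]
      fun w => flowOut θ e (tubeChart EN Ψ p) (w.1, w.2, h w.2) := by
    filter_upwards [(tubeChart EN Ψ p).open_source.mem_nhds hw] with w' hw'
    exact hP.tube.perturb_tubeChart hw'
  have key : ∀ v : EN × PhaseSpace k, tderiv EM EW (perturb Ψ θ e h) (tubeChart EN Ψ p w)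
      (tderiv (EN × PhaseSpace k) EM (tubeChart EN Ψ p) w v) =
      tderiv (EN × PhaseSpace k × ℝ) EW (flowOut θ e (tubeChart EN Ψ p)) (w.1, w.2, h w.2)
        (graphDeriv h w v) := by
    intro v
    rw [← tderiv_comp_apply (hP.contMDiff_perturb.contMDiffAt.mdifferentiableAt (by simp)) hκ,
      tderiv_congr heq, tderiv_comp_apply (f := fun w : EN × PhaseSpace k => (w.1, w.2, h w.2))
        hF hι.differentiableAt.mdifferentiableAt, tderiv_eq_of_hasFDerivAt hι]
  rw [charForm_apply, key, key, graphForm_apply, tubeForm_apply, heq.eq_of_nhds]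

/-- The characteristic field is smooth where it is defined. -/
theorem charField_tubeChart (hP : SaddlePerturbation EM Ω e f σ δ Ψ V θ R h A)
    (hodd : Odd (Module.finrank ℝ EM)) {p : N} {w : EN × PhaseSpace k}
    (hw : w ∈ (tubeChart EN Ψ p).source)
    (hinj : Function.Injective (framedMap (graphForm Ω e θ (tubeChart EN Ψ p) h w)
      (graphDual Ω e θ (tubeChart EN Ψ p) w))) :
    (∀ᶠ w in 𝓝 w, Function.Injective (framedMap
        (charForm EM Ω (perturb Ψ θ e h) (tubeChart EN Ψ p w))
        (tubeDual EN EM Ω V (fun p => e (f p)) Ψ (tubeChart EN Ψ p w))) ∧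
      charField EN EM Ω V (fun p => e (f p)) Ψ (perturb Ψ θ e h) (tubeChart EN Ψ p w) =
        tderiv (EN × PhaseSpace k) EM (tubeChart EN Ψ p) w
          (graphField Ω e θ (tubeChart EN Ψ p) h w)) ∧
    ContMDiffAt 𝓘(ℝ, EM) 𝓘(ℝ, EM).tangent ∞ (fun x => (⟨x, charField EN EM Ω V (fun p => e (f p)) Ψ
      (perturb Ψ θ e h) x⟩ : TangentBundle 𝓘(ℝ, EM) M)) (tubeChart EN Ψ p w) := by
  have hnhds := (tubeChart EN Ψ p).open_source.mem_nhds hw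
  exact contMDiffAt_kernel_field (hP.tube.contMDiffOn_tubeChart p)
    (hP.tube.contMDiffOn_tubeChart_symm p) hw (hP.contDiffAt_graphForm hw)
    (hP.contDiffAt_graphDual hw)
    (by filter_upwards [hnhds] with w' hw' v v' using hP.charForm_tubeChart hw' v v')
    (by filter_upwards [hnhds] with w' hw' v using hP.tubeDual_tubeChart hw' v)
    (fun x => exists_ne_zero_of_odd_finrank hodd _ fun v =>
      DiffForm.bilin_self (J := 𝓘(ℝ, EM)) _ x v) hinj

end SaddlePerturbation

end CharField


/-! ### The linearised characteristic flow -/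

section Linearised

theorem fderiv_prod_zero_apply {E Z H : Type*} [NormedAddCommGroup E] [NormedSpace ℝ E]
    [NormedAddCommGroup Z] [NormedSpace ℝ Z] [NormedAddCommGroup H] [NormedSpace ℝ H]
    {Θ : E × Z → H} {u₀ : E} (hΘ : DifferentiableAt ℝ Θ (u₀, 0)) {L₁ : E →L[ℝ] H} {L₂ : Z →L[ℝ] H}
    (h₁ : HasFDerivAt (fun u => Θ (u, 0)) L₁ u₀) (h₂ : HasFDerivAt (fun z => Θ (u₀, z)) L₂ 0)
    (a : E) (ζ : Z) : fderiv ℝ Θ (u₀, 0) (a, ζ) = L₁ a + L₂ ζ := by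
  have e₁ : HasFDerivAt (fun u => Θ (u, (0 : Z)))
      ((fderiv ℝ Θ (u₀, 0)).comp (ContinuousLinearMap.inl ℝ E Z)) u₀ :=
    HasFDerivAt.comp (g := Θ) u₀ hΘ.hasFDerivAt (hasFDerivAt_prodMk_left u₀ 0)
  have e₂ : HasFDerivAt (fun z => Θ (u₀, z))
      ((fderiv ℝ Θ (u₀, 0)).comp (ContinuousLinearMap.inr ℝ E Z)) 0 :=
    HasFDerivAt.comp (g := Θ) 0 hΘ.hasFDerivAt (hasFDerivAt_prodMk_right u₀ 0)
  have h3 : ((a, ζ) : E × Z) = (a, 0) + (0, ζ) := by simp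
  rw [h3, map_add, h₁.unique e₁, h₂.unique e₂]
  rfl

variable {EN : Type} [NormedAddCommGroup EN] [NormedSpace ℝ EN] [FiniteDimensional ℝ EN]
  {EM : Type} [NormedAddCommGroup EM] [NormedSpace ℝ EM] [FiniteDimensional ℝ EM]
  {EW : Type} [NormedAddCommGroup EW] [NormedSpace ℝ EW] [FiniteDimensional ℝ EW]
  {N : Type*} [TopologicalSpace N] [ChartedSpace EN N] [IsManifold 𝓘(ℝ, EN) ∞ N]
  {M : Type*} [TopologicalSpace M] [ChartedSpace EM M] [IsManifold 𝓘(ℝ, EM) ∞ M]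
  {W : Type*} [TopologicalSpace W] [ChartedSpace EW W] [IsManifold 𝓘(ℝ, EW) ∞ W]
  {k : ℕ}
  {Ω : DiffForm 𝓘(ℝ, EW) W 2} {e : M → W} {f : N → M} {σ : DiffForm 𝓘(ℝ, EN) N 2} {δ : ℝ}
  {Ψ : OpenPartialHomeomorph (N × PhaseSpace k) M}
  {V : ∀ x : W, TangentSpace 𝓘(ℝ, EW) x} {θ : ℝ → W → W} {R : ∀ p : N, TangentSpace 𝓘(ℝ, EN) p}
  {h : PhaseSpace k → ℝ} {A : ℝ}

namespace SaddlePerturbation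

theorem zero_mem_source (hP : SaddlePerturbation EM Ω e f σ δ Ψ V θ R h A) {p : N} {u : EN}
    (hu : u ∈ (chartAt EN p).target) : (u, (0 : PhaseSpace k)) ∈ (tubeChart EN Ψ p).source :=
  hP.tube.mem_tubeChart_source.2 ⟨hu, Metric.mem_ball_self hP.tube.pos⟩

theorem odd_finrank_prod (hP : SaddlePerturbation EM Ω e f σ δ Ψ V θ R h A)
    (hodd : Odd (Module.finrank ℝ EM)) (p : N) :
    Odd (Module.finrank ℝ (EN × PhaseSpace k)) := by
  rwa [(LinearEquiv.ofBijective
    (tderiv (EN × PhaseSpace k) EM (tubeChart EN Ψ p) (chartAt EN p p, 0)).toLinearMap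
    (hP.tube.bijective_tderiv_tubeChart (hP.tube.base_mem_source p))).finrank_eq]

/-- Away from `N` the form need not split, and its kernel is found differently: odd dimension makes
it nonzero, and injectivity of the framed map makes it a line on which the dual form does not
vanish. -/
theorem graphField_spec (hP : SaddlePerturbation EM Ω e f σ δ Ψ V θ R h A)
    (hodd : Odd (Module.finrank ℝ EM)) {p : N} {w : EN × PhaseSpace k}
    (hinj : Function.Injective (framedMap (graphForm Ω e θ (tubeChart EN Ψ p) h w)
      (graphDual Ω e θ (tubeChart EN Ψ p) w))) :
    graphForm Ω e θ (tubeChart EN Ψ p) h w (graphField Ω e θ (tubeChart EN Ψ p) h w) = 0 ∧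
      graphDual Ω e θ (tubeChart EN Ψ p) w (graphField Ω e θ (tubeChart EN Ψ p) h w) = 1 := by
  obtain ⟨v, hv, hv1⟩ := exists_kernel_vector _ _ hinj
    (exists_ne_zero_of_odd_finrank (hP.odd_finrank_prod hodd p) _ (graphForm_self _ w))
  have h1 := kernel_vector_eq_inverse _ _ hinj hv hv1
  unfold graphField
  rw [← h1]
  exact ⟨hv, hv1⟩

theorem contDiffAt_graphField (hP : SaddlePerturbation EM Ω e f σ δ Ψ V θ R h A) {p : N} {u : EN}
    (hu : u ∈ (chartAt EN p).target) :
    ContDiffAt ℝ ∞ (graphField Ω e θ (tubeChart EN Ψ p) h) (u, 0) :=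
  contDiffAt_kernel_vector (hP.contDiffAt_graphForm (hP.zero_mem_source hu))
    (hP.contDiffAt_graphDual (hP.zero_mem_source hu)) (hP.injective_framedMap_graph hu)

theorem eventually_injective_framedMap_graph (hP : SaddlePerturbation EM Ω e f σ δ Ψ V θ R h A)
    {p : N} {u : EN} (hu : u ∈ (chartAt EN p).target) :
    ∀ᶠ w in 𝓝 (u, (0 : PhaseSpace k)),
      Function.Injective (framedMap (graphForm Ω e θ (tubeChart EN Ψ p) h w)
        (graphDual Ω e θ (tubeChart EN Ψ p) w)) :=
  eventually_injective_framedMap (hP.contDiffAt_graphForm (hP.zero_mem_source hu)).continuousAt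
    (hP.contDiffAt_graphDual (hP.zero_mem_source hu)).continuousAt
    (hP.injective_framedMap_graph hu)

/-- The derivative of the characteristic field in the normal directions. -/
theorem fderiv_graphField (hP : SaddlePerturbation EM Ω e f σ δ Ψ V θ R h A)
    (hodd : Odd (Module.finrank ℝ EM)) {p : N} {u : EN} (hu : u ∈ (chartAt EN p).target)
    (ζ : PhaseSpace k) :
    (fderiv ℝ (graphField Ω e θ (tubeChart EN Ψ p) h) (u, 0) (0, ζ)).1 = 0 ∧
    ∀ i, (fderiv ℝ (graphField Ω e θ (tubeChart EN Ψ p) h) (u, 0) (0, ζ)).2 (Sum.inl i) =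
        A * ζ (Sum.inl i) ∧
      (fderiv ℝ (graphField Ω e θ (tubeChart EN Ψ p) h) (u, 0) (0, ζ)).2 (Sum.inr i) =
        -A * ζ (Sum.inr i) := by
  have hφ := bijective_tderiv_chart_symm hu
  obtain ⟨r, hr⟩ := hφ.2 (modelVec R ((chartAt EN p).symm u))
  have hsrc := hP.zero_mem_source hu
  have hθ := hP.transverse.flow
  let σ₀ : EN →L[ℝ] EN →L[ℝ] ℝ := (σ.bilin ((chartAt EN p).symm u)).bilinearComp
    (tderiv EN EN (chartAt EN p).symm u) (tderiv EN EN (chartAt EN p).symm u)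
  have hσ₀ : ∀ a a', σ₀ a a' = σ.bilin ((chartAt EN p).symm u)
    (tderiv EN EN (chartAt EN p).symm u a) (tderiv EN EN (chartAt EN p).symm u a') :=
    fun a a' => rfl
  have htz : Tendsto (fun z : PhaseSpace k => (u, z)) (𝓝 0) (𝓝 (u, 0)) :=
    (Continuous.prodMk_right u).tendsto 0
  have hinj := htz.eventually (hP.eventually_injective_framedMap_graph hu)
  have key := fderiv_kernel_field_of_graph (B := tubeForm Ω e θ (tubeChart EN Ψ p)) (u₀ := u)
    ((hP.tube.contDiffAt_tubeForm hθ (y := (u, 0, 0)) hsrc).differentiableAt (by simp))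
    (tubeForm_swap _ _) (σ₀ := σ₀) (τ := stdBilin k)
    (by
      filter_upwards [htz ((tubeChart EN Ψ p).open_source.mem_nhds hsrc)] with z hz a a' ζ ζ'
      exact hP.tube.tubeForm_split hθ hz a a' ζ ζ')
    (R := r)
    (by
      ext a'
      rw [hσ₀, hr, hP.transverse.ker]
      rfl)
    (by
      rw [hP.tube.tubeForm_time hθ hP.base_smooth hu, hr]
      exact hP.transverse.pair _)
    (h := h) (Q := A • saddle k) hP.apply_zero hP.eventually_hasFDerivAt
    (X := graphField Ω e θ (tubeChart EN Ψ p) h)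
    ((hP.contDiffAt_graphField hu).differentiableAt (by simp)) (hP.graphField_zero hu hr)
    (by
      filter_upwards [hinj, hP.eventually_hasFDerivAt] with z hz hz' a' ζ'
      have h1 := congrArg (fun L : (EN × PhaseSpace k) →L[ℝ] ℝ => L (a', ζ'))
        (hP.graphField_spec hodd hz).1
      have h2 : graphForm Ω e θ (tubeChart EN Ψ p) h (u, z)
        ((graphField Ω e θ (tubeChart EN Ψ p) h (u, z)).1,
          (graphField Ω e θ (tubeChart EN Ψ p) h (u, z)).2) (a', ζ') = 0 := h1
      rw [graphForm_apply, graphDeriv_apply, graphDeriv_apply, hz'.fderiv] at h2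
      exact h2)
    -- The normalising one-form is pulled back from `N`, hence the same for all `z` over a fixed
    -- `u`. This is what removes the tangential component of the derivative.
    (ν := dualFormInChart Ω e θ (tubeChart EN Ψ p) u)
    (by
      filter_upwards [hinj] with z hz
      exact (hP.graphField_spec hodd hz).2)
    (by
      intro a h1 h2
      have h3 : tderiv EN EN (chartAt EN p).symm u a = 0 := by
        refine hP.framing ((chartAt EN p).symm u) _ ?_ ?_
        · ext b
          obtain ⟨a', rfl⟩ := hφ.2 b
          rw [← hσ₀, h1]; rfl
        · rw [← hP.tube.tubeForm_time hθ hP.base_smooth hu]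
          exact h2
      exact (injective_iff_map_eq_zero _).1 hφ.1 a h3)
    ζ
  exact ⟨key.1, hamilton_saddle key.2⟩

/-- The derivative of the normal component of the characteristic field. -/
theorem fderiv_snd_graphField (hP : SaddlePerturbation EM Ω e f σ δ Ψ V θ R h A)
    (hodd : Odd (Module.finrank ℝ EM)) {p : N} {u : EN} (hu : u ∈ (chartAt EN p).target)
    (a : EN) (ζ : PhaseSpace k) (i : Fin k) :
    fderiv ℝ (fun w => (graphField Ω e θ (tubeChart EN Ψ p) h w).2) (u, 0) (a, ζ) (Sum.inl i) =
        A * ζ (Sum.inl i) ∧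
    fderiv ℝ (fun w => (graphField Ω e θ (tubeChart EN Ψ p) h w).2) (u, 0) (a, ζ) (Sum.inr i) =
        -A * ζ (Sum.inr i) := by
  have hX := (hP.contDiffAt_graphField hu).differentiableAt (by simp)
  -- The field is tangent to `N` along `N`, so its normal component vanishes there and has no
  -- derivative along `N`.
  have h1 : HasFDerivAt (fun u => (graphField Ω e θ (tubeChart EN Ψ p) h (u, 0)).2)
      (0 : EN →L[ℝ] PhaseSpace k) u := by
    refine (hasFDerivAt_const (0 : PhaseSpace k) u).congr_of_eventuallyEq ?_
    filter_upwards [(chartAt EN p).open_target.mem_nhds hu] with u' hu'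
    obtain ⟨r, hr⟩ := (bijective_tderiv_chart_symm hu').2 (modelVec R ((chartAt EN p).symm u'))
    rw [hP.graphField_zero hu' hr]
  have h2 : HasFDerivAt (fun z => (graphField Ω e θ (tubeChart EN Ψ p) h (u, z)).2)
      (((ContinuousLinearMap.snd ℝ EN (PhaseSpace k)).comp
        (fderiv ℝ (graphField Ω e θ (tubeChart EN Ψ p) h) (u, 0))).comp
          (ContinuousLinearMap.inr ℝ EN (PhaseSpace k))) 0 :=
    HasFDerivAt.comp (g := fun w => (graphField Ω e θ (tubeChart EN Ψ p) h w).2) 0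
      hX.hasFDerivAt.snd (hasFDerivAt_prodMk_right u 0)
  have h3 := fderiv_prod_zero_apply hX.snd h1 h2 a ζ
  rw [zero_apply, zero_add] at h3
  rw [h3]
  exact (hP.fderiv_graphField hodd hu ζ).2 i

/-- The derivative of the component of the characteristic field along `N`. -/
theorem fderiv_fst_graphField (hP : SaddlePerturbation EM Ω e f σ δ Ψ V θ R h A)
    (hodd : Odd (Module.finrank ℝ EM)) {H : Type*} [NormedAddCommGroup H] [NormedSpace ℝ H]
    {G : N → H} (hG : ContMDiff 𝓘(ℝ, EN) 𝓘(ℝ, H) ∞ G)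
    (hGR : ContMDiff 𝓘(ℝ, EN) 𝓘(ℝ, H) ∞ (fun p => tderiv EN H G p (modelVec R p)))
    {p : N} {u : EN} (hu : u ∈ (chartAt EN p).target) (a : EN) (ζ : PhaseSpace k) :
    DifferentiableAt ℝ (fun w : EN × PhaseSpace k => fderiv ℝ (fun u => G ((chartAt EN p).symm u))
      w.1 (graphField Ω e θ (tubeChart EN Ψ p) h w).1) (u, 0) ∧
    fderiv ℝ (fun w : EN × PhaseSpace k => fderiv ℝ (fun u => G ((chartAt EN p).symm u)) w.1
        (graphField Ω e θ (tubeChart EN Ψ p) h w).1) (u, 0) (a, ζ) =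
      tderiv EN H (fun p => tderiv EN H G p (modelVec R p)) ((chartAt EN p).symm u)
        (tderiv EN EN (chartAt EN p).symm u a) := by
  have hX := (hP.contDiffAt_graphField hu).differentiableAt (by simp)
  have hdG : DifferentiableAt ℝ (fderiv ℝ fun u => G ((chartAt EN p).symm u)) u :=
    ((contDiffAt_comp_chart_symm hG hu).fderiv_right (m := ∞) (by simp)).differentiableAt (by simp)
  have hdG' : DifferentiableAt ℝ (fun w : EN × PhaseSpace k =>
      fderiv ℝ (fun u => G ((chartAt EN p).symm u)) w.1) (u, 0) :=
    DifferentiableAt.comp (g := fderiv ℝ fun u => G ((chartAt EN p).symm u)) (u, 0) hdG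
      differentiableAt_fst
  have hd := hdG'.clm_apply hX.fst
  refine ⟨hd, ?_⟩
  -- Along `N` the function is `dG(R)`, since the field there is `R`.
  have h1 : HasFDerivAt (fun u' => fderiv ℝ (fun u => G ((chartAt EN p).symm u)) u'
      (graphField Ω e θ (tubeChart EN Ψ p) h (u', 0)).1)
      (fderiv ℝ (fun u => tderiv EN H G ((chartAt EN p).symm u)
        (modelVec R ((chartAt EN p).symm u))) u) u := by
    have h2 := ((contDiffAt_comp_chart_symm hGR hu).differentiableAt (by simp)).hasFDerivAt
    refine h2.congr_of_eventuallyEq ?_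
    filter_upwards [(chartAt EN p).open_target.mem_nhds hu] with u' hu'
    obtain ⟨r, hr⟩ := (bijective_tderiv_chart_symm hu').2 (modelVec R ((chartAt EN p).symm u'))
    rw [hP.graphField_zero hu' hr, fderiv_comp_chart_symm hG hu', hr]
  have h2 : HasFDerivAt (fun z => (graphField Ω e θ (tubeChart EN Ψ p) h (u, z)).1)
      (((ContinuousLinearMap.fst ℝ EN (PhaseSpace k)).comp
        (fderiv ℝ (graphField Ω e θ (tubeChart EN Ψ p) h) (u, 0))).comp
          (ContinuousLinearMap.inr ℝ EN (PhaseSpace k))) 0 :=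
    HasFDerivAt.comp (g := fun w => (graphField Ω e θ (tubeChart EN Ψ p) h w).1) 0
      hX.hasFDerivAt.fst (hasFDerivAt_prodMk_right u 0)
  -- The tangential component of the field has zero derivative in the normal directions, so they do
  -- not contribute.
  have h2' : HasFDerivAt (fun z => fderiv ℝ (fun u => G ((chartAt EN p).symm u)) u
      (graphField Ω e θ (tubeChart EN Ψ p) h (u, z)).1) (0 : PhaseSpace k →L[ℝ] H) 0 := by
    refine ((fderiv ℝ (fun u => G ((chartAt EN p).symm u)) u).hasFDerivAt.comp 0 h2).congr_fderiv ?_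
    refine ContinuousLinearMap.ext fun ζ => ?_
    have h5 : (fderiv ℝ (graphField Ω e θ (tubeChart EN Ψ p) h) (u, 0) (0, ζ)).1 = 0 :=
      (hP.fderiv_graphField hodd hu ζ).1
    change fderiv ℝ (fun u => G ((chartAt EN p).symm u)) u
      (fderiv ℝ (graphField Ω e θ (tubeChart EN Ψ p) h) (u, 0) (0, ζ)).1 = 0
    rw [h5, map_zero]
  have h3 := fderiv_prod_zero_apply hd h1 h2' a ζ
  rw [zero_apply, add_zero] at h3
  rw [h3]
  exact fderiv_comp_chart_symm hGR hu a

end SaddlePerturbation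

end Linearised


/-! ### Normal hyperbolicity of the perturbed characteristic foliation -/

section Hyperbolic

theorem tderiv_eq_fderiv {E E' : Type*} [NormedAddCommGroup E] [NormedSpace ℝ E]
    [NormedAddCommGroup E'] [NormedSpace ℝ E'] (g : E → E') (x : E) :
    tderiv E E' g x = fderiv ℝ g x := mfderiv_eq_fderiv

variable {EN : Type} [NormedAddCommGroup EN] [NormedSpace ℝ EN] [FiniteDimensional ℝ EN]
  {EM : Type} [NormedAddCommGroup EM] [NormedSpace ℝ EM] [FiniteDimensional ℝ EM]
  {EW : Type} [NormedAddCommGroup EW] [NormedSpace ℝ EW] [FiniteDimensional ℝ EW]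
  {N : Type*} [TopologicalSpace N] [ChartedSpace EN N] [IsManifold 𝓘(ℝ, EN) ∞ N]
  {M : Type*} [TopologicalSpace M] [ChartedSpace EM M] [IsManifold 𝓘(ℝ, EM) ∞ M]
  {W : Type*} [TopologicalSpace W] [ChartedSpace EW W] [IsManifold 𝓘(ℝ, EW) ∞ W]
  {k : ℕ}
  {Ω : DiffForm 𝓘(ℝ, EW) W 2} {e : M → W} {f : N → M} {σ : DiffForm 𝓘(ℝ, EN) N 2} {δ : ℝ}
  {Ψ : OpenPartialHomeomorph (N × PhaseSpace k) M}
  {V : ∀ x : W, TangentSpace 𝓘(ℝ, EW) x} {θ : ℝ → W → W} {R : ∀ p : N, TangentSpace 𝓘(ℝ, EN) p}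
  {h : PhaseSpace k → ℝ} {A : ℝ} {H : Type*} [NormedAddCommGroup H] [NormedSpace ℝ H] {G : N → H}

theorem SplitTube.mdifferentiableAt_tubeChart (hT : SplitTube EM Ω e f σ δ Ψ) {p : N}
    {w : EN × PhaseSpace k} (hw : w ∈ (tubeChart EN Ψ p).source) :
    MDifferentiableAt 𝓘(ℝ, EN × PhaseSpace k) 𝓘(ℝ, EM) (tubeChart EN Ψ p) w :=
  ((hT.contMDiffOn_tubeChart p).contMDiffAt
    ((tubeChart EN Ψ p).open_source.mem_nhds hw)).mdifferentiableAt (by simp)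

theorem SplitTube.tderiv_comp_symm_fst (hT : SplitTube EM Ω e f σ δ Ψ)
    (hG : ContMDiff 𝓘(ℝ, EN) 𝓘(ℝ, H) ∞ G) {p : N} {w : EN × PhaseSpace k}
    (hw : w ∈ (tubeChart EN Ψ p).source) (v : EN × PhaseSpace k) :
    tderiv EM H (fun x => G (Ψ.symm x).1) (tubeChart EN Ψ p w)
      (tderiv (EN × PhaseSpace k) EM (tubeChart EN Ψ p) w v) =
      tderiv EN H G ((chartAt EN p).symm w.1) (tderiv EN EN (chartAt EN p).symm w.1 v.1) := by
  rw [tderiv_comp_apply (E' := EN) (g := G) (hG.contMDiffAt.mdifferentiableAt (by simp))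
    ((hT.contMDiffOn_symm_fst.contMDiffAt
      (Ψ.open_target.mem_nhds (hT.tubeChart_mem_target hw))).mdifferentiableAt (by simp)),
    hT.tderiv_symm_fst hw, hT.symm_tubeChart hw]

theorem SplitTube.tderiv_base (hT : SplitTube EM Ω e f σ δ Ψ)
    (hf : ContMDiff 𝓘(ℝ, EN) 𝓘(ℝ, EM) ∞ f) {p : N} {u : EN} (hu : u ∈ (chartAt EN p).target)
    (a : EN) :
    tderiv (EN × PhaseSpace k) EM (tubeChart EN Ψ p) (u, 0) (a, 0) =
      tderiv EN EM f ((chartAt EN p).symm u) (tderiv EN EN (chartAt EN p).symm u a) := by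
  have hs : ContMDiffAt 𝓘(ℝ, EN) 𝓘(ℝ, EN) ∞ (chartAt EN p).symm u :=
    contMDiffAt_symm_of_mem_maximalAtlas (IsManifold.chart_mem_maximalAtlas (n := ∞) p) hu
  have hmem : (u, (0 : PhaseSpace k)) ∈ (tubeChart EN Ψ p).source :=
    hT.mem_tubeChart_source.2 ⟨hu, Metric.mem_ball_self hT.pos⟩
  have hι : ContDiff ℝ ∞ (fun u : EN => (u, (0 : PhaseSpace k))) := by fun_prop
  rw [← tderiv_comp_apply (E := EN) (E' := EN) (E'' := EM)
    (g := f) (hf.contMDiffAt.mdifferentiableAt (by simp)) (hs.mdifferentiableAt (by simp))]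
  have h5 : tderiv EN (EN × PhaseSpace k) (fun u => (u, (0 : PhaseSpace k))) u a = (a, 0) :=
    tderiv_linear (ContinuousLinearMap.inl ℝ EN (PhaseSpace k)) (fun _ => rfl) u a
  rw [← h5, ← tderiv_comp_apply (E := EN) (E' := EN × PhaseSpace k) (E'' := EM)
    (g := tubeChart EN Ψ p) (f := fun u : EN => (u, (0 : PhaseSpace k)))
    (hT.mdifferentiableAt_tubeChart hmem)
    (hι.contMDiff.contMDiffAt.mdifferentiableAt (by simp))]
  congr 2
  funext u
  rw [tubeChart_apply, hT.map_base]

/-- The normal frame of the tube. -/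
theorem SplitTube.exists_normal_frame (hT : SplitTube EM Ω e f σ δ Ψ)
    (hG : ContMDiff 𝓘(ℝ, EN) 𝓘(ℝ, H) ∞ G) (p : N) :
    ∃ O ∈ 𝓝 (f p), ∃ s : Fin k ⊕ Fin k → ∀ x : M, TangentSpace 𝓘(ℝ, EM) x,
      (∀ i, ContinuousOn (fun x => (⟨x, s i x⟩ : TangentBundle 𝓘(ℝ, EM) M)) O) ∧
      ∀ x ∈ O, ∀ i, tderiv EM H (fun x => G (Ψ.symm x).1) x (s i x) = 0 ∧
        tderiv EM (PhaseSpace k) (fun x => (Ψ.symm x).2) x (s i x) =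
          EuclideanSpace.single i 1 := by
  set κ := tubeChart EN Ψ p with hκ
  have hp := hT.base_mem_source p
  refine ⟨κ.target, ?_, fun i x => tderiv (EN × PhaseSpace k) EM κ (κ.symm x)
    (0, EuclideanSpace.single i 1), ?_, ?_⟩
  · rw [← hT.tubeChart_base p]
    exact κ.open_target.mem_nhds (κ.map_source hp)
  · intro i x hx
    have hw := κ.map_target hx
    have h1 := contMDiffAt_pushforward (hT.contMDiffOn_tubeChart p)
      (hT.contMDiffOn_tubeChart_symm p) hw
      (v := fun _ => ((0, EuclideanSpace.single i 1) : EN × PhaseSpace k)) contDiffAt_const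
      (X := fun x => tderiv (EN × PhaseSpace k) EM κ (κ.symm x) (0, EuclideanSpace.single i 1))
      (by
        filter_upwards [κ.open_source.mem_nhds hw] with w hw'
        rw [κ.left_inv hw']
        rfl)
    have h2 : tubeChart EN Ψ p (κ.symm x) = x := κ.right_inv hx
    rw [h2] at h1
    exact h1.continuousAt.continuousWithinAt
  · intro x hx i
    have hw := κ.map_target hx
    have h1 := hT.tderiv_comp_symm_fst hG hw ((0, EuclideanSpace.single i 1) : EN × PhaseSpace k)
    have h2 := hT.tderiv_symm_snd hw ((0, EuclideanSpace.single i 1) : EN × PhaseSpace k)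
    have h3 : tubeChart EN Ψ p (κ.symm x) = x := κ.right_inv hx
    rw [h3] at h1 h2
    refine ⟨h1.trans ?_, h2⟩
    rw [map_zero, map_zero]

namespace SaddlePerturbation

variable [CompactSpace N] [T2Space M]

/-- The coordinate condition is translated into one on `M`, independent of the chart of `N`, so that
the domain of the characteristic field can be defined globally. -/
theorem injective_framedMap_iff (hP : SaddlePerturbation EM Ω e f σ δ Ψ V θ R h A) {p : N}
    {w : EN × PhaseSpace k} (hw : w ∈ (tubeChart EN Ψ p).source) :
    Function.Injective (framedMap (graphForm Ω e θ (tubeChart EN Ψ p) h w)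
      (graphDual Ω e θ (tubeChart EN Ψ p) w)) ↔
    Function.Injective (framedMap (charForm EM Ω (perturb Ψ θ e h) (tubeChart EN Ψ p w))
        (tubeDual EN EM Ω V (fun p => e (f p)) Ψ (tubeChart EN Ψ p w))) :=
  injective_framedMap_of_comp (hP.tube.bijective_tderiv_tubeChart hw)
    (hP.charForm_tubeChart hw) (hP.tubeDual_tubeChart hw)

/-- The set where the characteristic field is defined. -/
theorem regular_set (hP : SaddlePerturbation EM Ω e f σ δ Ψ V θ R h A)
    (hodd : Odd (Module.finrank ℝ EM)) :
    ∃ O : Set M, IsOpen O ∧ range f ⊆ O ∧ ∀ x ∈ O,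
      Function.Injective (framedMap (charForm EM Ω (perturb Ψ θ e h) x)
        (tubeDual EN EM Ω V (fun p => e (f p)) Ψ x)) ∧
      ContMDiffAt 𝓘(ℝ, EM) 𝓘(ℝ, EM).tangent ∞ (fun x => (⟨x, charField EN EM Ω V
        (fun p => e (f p)) Ψ (perturb Ψ θ e h) x⟩ : TangentBundle 𝓘(ℝ, EM) M)) x := by
  refine ⟨{x | x ∈ Ψ.target ∧ Function.Injective (framedMap (charForm EM Ω (perturb Ψ θ e h) x)
        (tubeDual EN EM Ω V (fun p => e (f p)) Ψ x))}, ?_, ?_, ?_⟩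
  · rw [isOpen_iff_mem_nhds]
    rintro x ⟨hx, hinj⟩
    obtain ⟨hw, hwx⟩ := hP.tube.exists_tubeChart_eq hx
    rw [← hwx] at hinj
    have h1 := (hP.charField_tubeChart hodd hw ((hP.injective_framedMap_iff hw).2 hinj)).1
    have h2 := (tubeChart EN Ψ (Ψ.symm x).1).map_nhds_eq hw
    rw [hwx] at h2
    refine inter_mem (Ψ.open_target.mem_nhds hx) ?_
    rw [← h2]
    exact Filter.mem_map.2 (by filter_upwards [h1] with w' hw' using hw'.1)
  · rintro _ ⟨p, rfl⟩
    refine ⟨hP.tube.mem_target p, ?_⟩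
    rw [← hP.tube.tubeChart_base p]
    exact (hP.injective_framedMap_iff (hP.tube.base_mem_source p)).1
      (hP.injective_framedMap_graph (mem_chart_target EN p))
  · rintro x ⟨hx, hinj⟩
    refine ⟨hinj, ?_⟩
    obtain ⟨hw, hwx⟩ := hP.tube.exists_tubeChart_eq hx
    rw [← hwx] at hinj
    have h1 := (hP.charField_tubeChart hodd hw ((hP.injective_framedMap_iff hw).2 hinj)).2
    rwa [hwx] at h1

theorem charField_spec (_ : SaddlePerturbation EM Ω e f σ δ Ψ V θ R h A)
    (hodd : Odd (Module.finrank ℝ EM)) {x : M}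
    (hinj : Function.Injective (framedMap (charForm EM Ω (perturb Ψ θ e h) x)
        (tubeDual EN EM Ω V (fun p => e (f p)) Ψ x))) :
    charForm EM Ω (perturb Ψ θ e h) x
        (charField EN EM Ω V (fun p => e (f p)) Ψ (perturb Ψ θ e h) x) = 0 ∧
      tubeDual EN EM Ω V (fun p => e (f p)) Ψ x
        (charField EN EM Ω V (fun p => e (f p)) Ψ (perturb Ψ θ e h) x) = 1 := by
  obtain ⟨v, hv, hv1⟩ := exists_kernel_vector _ _ hinj
    (exists_ne_zero_of_odd_finrank hodd _ fun v => DiffForm.bilin_self (J := 𝓘(ℝ, EM)) _ x v)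
  have h1 := kernel_vector_eq_inverse _ _ hinj hv hv1
  unfold charField
  rw [← h1]
  exact ⟨hv, hv1⟩

/-- A field which is the characteristic field near `N`, in the coordinates of the tube. -/
theorem field_tubeChart (hP : SaddlePerturbation EM Ω e f σ δ Ψ V θ R h A)
    (hodd : Odd (Module.finrank ℝ EM)) {X : ∀ x : M, TangentSpace 𝓘(ℝ, EM) x}
    (hX : ∀ᶠ x in 𝓝ˢ (range f), modelVec X x =
      charField EN EM Ω V (fun p => e (f p)) Ψ (perturb Ψ θ e h) x) (p : N) :
    ∀ᶠ w in 𝓝 (chartAt EN p p, (0 : PhaseSpace k)), modelVec X (tubeChart EN Ψ p w) =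
      tderiv (EN × PhaseSpace k) EM (tubeChart EN Ψ p) w
        (graphField Ω e θ (tubeChart EN Ψ p) h w) := by
  have hw := hP.tube.base_mem_source p
  have h1 := (hP.charField_tubeChart hodd hw
    (hP.injective_framedMap_graph (mem_chart_target EN p))).1
  have h2 : ∀ᶠ x in 𝓝 (f p), modelVec X x =
      charField EN EM Ω V (fun p => e (f p)) Ψ (perturb Ψ θ e h) x :=
    (eventually_nhdsSet_iff_forall.1 hX) _ (mem_range_self p)
  rw [← hP.tube.tubeChart_base p, ← (tubeChart EN Ψ p).map_nhds_eq hw, eventually_map] at h2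
  filter_upwards [h1, h2] with w h3 h4
  rw [h4, h3.2]

/-- Along `N`, the characteristic field is the kernel field of `σ`. -/
theorem field_base (hP : SaddlePerturbation EM Ω e f σ δ Ψ V θ R h A)
    (hodd : Odd (Module.finrank ℝ EM)) {X : ∀ x : M, TangentSpace 𝓘(ℝ, EM) x}
    (hX : ∀ᶠ x in 𝓝ˢ (range f), modelVec X x =
      charField EN EM Ω V (fun p => e (f p)) Ψ (perturb Ψ θ e h) x) (p : N) :
    modelVec X (f p) = tderiv EN EM f p (modelVec R p) := by
  have hu : chartAt EN p p ∈ (chartAt EN p).target := mem_chart_target EN p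
  have h1 := (hP.field_tubeChart hodd hX p).self_of_nhds
  obtain ⟨r, hr⟩ := (bijective_tderiv_chart_symm hu).2 (modelVec R ((chartAt EN p).symm _))
  have hl : (chartAt EN p).symm (chartAt EN p p) = p :=
    (chartAt EN p).left_inv (mem_chart_source EN p)
  rw [hP.graphField_zero hu hr, hP.tube.tderiv_base hP.base_smooth hu, hr, hl,
    hP.tube.tubeChart_base] at h1
  exact h1

/-- The derivative of the normal component of the characteristic field along `N`. -/
theorem tderiv_normal (hP : SaddlePerturbation EM Ω e f σ δ Ψ V θ R h A)
    (hodd : Odd (Module.finrank ℝ EM)) {X : ∀ x : M, TangentSpace 𝓘(ℝ, EM) x}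
    (hXs : ContMDiff 𝓘(ℝ, EM) 𝓘(ℝ, EM).tangent ∞
      (fun x => (⟨x, X x⟩ : TangentBundle 𝓘(ℝ, EM) M)))
    (hX : ∀ᶠ x in 𝓝ˢ (range f), modelVec X x =
      charField EN EM Ω V (fun p => e (f p)) Ψ (perturb Ψ θ e h) x) (p : N) (v : EM) (i : Fin k) :
    tderiv EM (PhaseSpace k) (fun y => tderiv EM (PhaseSpace k) (fun x => (Ψ.symm x).2) y
        (modelVec X y)) (f p) v (Sum.inl i) =
      A * tderiv EM (PhaseSpace k) (fun x => (Ψ.symm x).2) (f p) v (Sum.inl i) ∧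
    tderiv EM (PhaseSpace k) (fun y => tderiv EM (PhaseSpace k) (fun x => (Ψ.symm x).2) y
        (modelVec X y)) (f p) v (Sum.inr i) =
      -A * tderiv EM (PhaseSpace k) (fun x => (Ψ.symm x).2) (f p) v (Sum.inr i) := by
  have hw := hP.tube.base_mem_source p
  have hu : chartAt EN p p ∈ (chartAt EN p).target := mem_chart_target EN p
  have hsm : ContMDiffOn 𝓘(ℝ, EM) 𝓘(ℝ, PhaseSpace k) ∞
      (fun y => tderiv EM (PhaseSpace k) (fun x => (Ψ.symm x).2) y (modelVec X y)) Ψ.target :=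
    hP.tube.contMDiffOn_symm_snd.mfderiv_apply_field Ψ.open_target hXs.contMDiffOn
  rw [← hP.tube.tubeChart_base p]
  obtain ⟨⟨a, ζ⟩, rfl⟩ := (hP.tube.bijective_tderiv_tubeChart hw).2 v
  rw [← tderiv_comp_apply (E := EN × PhaseSpace k)
    (g := fun y => tderiv EM (PhaseSpace k) (fun x => (Ψ.symm x).2) y (modelVec X y))
    ((hsm.contMDiffAt (Ψ.open_target.mem_nhds
      (hP.tube.tubeChart_mem_target hw))).mdifferentiableAt (by simp))
    (hP.tube.mdifferentiableAt_tubeChart hw), hP.tube.tderiv_symm_snd hw]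
  have heq : (fun w => tderiv EM (PhaseSpace k) (fun x => (Ψ.symm x).2) (tubeChart EN Ψ p w)
      (modelVec X (tubeChart EN Ψ p w))) =ᶠ[𝓝 (chartAt EN p p, (0 : PhaseSpace k))]
      fun w => (graphField Ω e θ (tubeChart EN Ψ p) h w).2 := by
    filter_upwards [hP.field_tubeChart hodd hX p,
      (tubeChart EN Ψ p).open_source.mem_nhds hw] with w h1 h2
    rw [h1, hP.tube.tderiv_symm_snd h2]
  rw [tderiv_congr heq, tderiv_eq_fderiv]
  exact hP.fderiv_snd_graphField hodd hu a ζ i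

/-- The derivative of the component of the characteristic field along `N`. -/
theorem tderiv_tangential (hP : SaddlePerturbation EM Ω e f σ δ Ψ V θ R h A)
    (hodd : Odd (Module.finrank ℝ EM)) {X : ∀ x : M, TangentSpace 𝓘(ℝ, EM) x}
    (hXs : ContMDiff 𝓘(ℝ, EM) 𝓘(ℝ, EM).tangent ∞
      (fun x => (⟨x, X x⟩ : TangentBundle 𝓘(ℝ, EM) M)))
    (hX : ∀ᶠ x in 𝓝ˢ (range f), modelVec X x =
      charField EN EM Ω V (fun p => e (f p)) Ψ (perturb Ψ θ e h) x)
    (hG : ContMDiff 𝓘(ℝ, EN) 𝓘(ℝ, H) ∞ G) {ρ : ℝ}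
    (hGρ : ∀ p v, ‖tderiv EN H (fun p => tderiv EN H G p (modelVec R p)) p v‖ ≤
      ρ * ‖tderiv EN H G p v‖) (p : N) (v : EM) :
    ‖tderiv EM H (fun y => tderiv EM H (fun x => G (Ψ.symm x).1) y (modelVec X y)) (f p) v‖ ≤
      ρ * ‖tderiv EM H (fun x => G (Ψ.symm x).1) (f p) v‖ := by
  have hw := hP.tube.base_mem_source p
  have hu : chartAt EN p p ∈ (chartAt EN p).target := mem_chart_target EN p
  have hgs : ContMDiffOn 𝓘(ℝ, EM) 𝓘(ℝ, H) ∞ (fun x => G (Ψ.symm x).1) Ψ.target :=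
    hG.comp_contMDiffOn hP.tube.contMDiffOn_symm_fst
  have hsm : ContMDiffOn 𝓘(ℝ, EM) 𝓘(ℝ, H) ∞
      (fun y => tderiv EM H (fun x => G (Ψ.symm x).1) y (modelVec X y)) Ψ.target :=
    hgs.mfderiv_apply_field Ψ.open_target hXs.contMDiffOn
  have hGR : ContMDiff 𝓘(ℝ, EN) 𝓘(ℝ, H) ∞ (fun p => tderiv EN H G p (modelVec R p)) := by
    rw [← contMDiffOn_univ]
    exact hG.contMDiffOn.mfderiv_apply_field isOpen_univ hP.transverse.smooth.contMDiffOn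
  rw [← hP.tube.tubeChart_base p]
  obtain ⟨⟨a, ζ⟩, rfl⟩ := (hP.tube.bijective_tderiv_tubeChart hw).2 v
  rw [← tderiv_comp_apply (E := EN × PhaseSpace k)
    (g := fun y => tderiv EM H (fun x => G (Ψ.symm x).1) y (modelVec X y))
    ((hsm.contMDiffAt (Ψ.open_target.mem_nhds
      (hP.tube.tubeChart_mem_target hw))).mdifferentiableAt (by simp))
    (hP.tube.mdifferentiableAt_tubeChart hw), hP.tube.tderiv_comp_symm_fst hG hw]
  have heq : (fun w => tderiv EM H (fun x => G (Ψ.symm x).1) (tubeChart EN Ψ p w)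
      (modelVec X (tubeChart EN Ψ p w))) =ᶠ[𝓝 (chartAt EN p p, (0 : PhaseSpace k))]
      fun w => fderiv ℝ (fun u => G ((chartAt EN p).symm u)) w.1
        (graphField Ω e θ (tubeChart EN Ψ p) h w).1 := by
    filter_upwards [hP.field_tubeChart hodd hX p,
      (tubeChart EN Ψ p).open_source.mem_nhds hw] with w h1 h2
    rw [h1, hP.tube.tderiv_comp_symm_fst hG h2,
      fderiv_comp_chart_symm hG (hP.tube.mem_tubeChart_source.1 h2).1]
  rw [tderiv_congr heq, tderiv_eq_fderiv, (hP.fderiv_fst_graphField hodd hG hGR hu a ζ).2]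
  exact hGρ _ _

/-- The flow of the characteristic field preserves `N`. -/
theorem mapsTo_range [T2Space N] (hP : SaddlePerturbation EM Ω e f σ δ Ψ V θ R h A)
    (hodd : Odd (Module.finrank ℝ EM)) {X : ∀ x : M, TangentSpace 𝓘(ℝ, EM) x}
    (hXs : ContMDiff 𝓘(ℝ, EM) 𝓘(ℝ, EM).tangent ∞
      (fun x => (⟨x, X x⟩ : TangentBundle 𝓘(ℝ, EM) M)))
    (hX : ∀ᶠ x in 𝓝ˢ (range f), modelVec X x =
      charField EN EM Ω V (fun p => e (f p)) Ψ (perturb Ψ θ e h) x) {φ : ℝ → M → M}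
    (hφ : IsGlobalFlow X φ) (t : ℝ) : MapsTo (φ t) (range f) (range f) := by
  -- On the compact manifold `N` the field `R` is complete, and `f` carries its integral curves to
  -- integral curves of `X`. Uniqueness then keeps the trajectories of `X` that start in `f(N)`
  -- inside `f(N)`.
  obtain ⟨ϑ, hϑ⟩ := exists_isGlobalFlow_of_isCompact hP.transverse.smooth isCompact_univ
    (fun x hx => (hx (mem_univ x)).elim)
  rintro _ ⟨p, rfl⟩
  have hcurve : IsMIntegralCurve (I := 𝓘(ℝ, EM)) (fun t => f (ϑ t p)) X := by
    intro t
    have h1 := ((hP.base_smooth.contMDiffAt (x := ϑ t p)).mdifferentiableAt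
      (by simp)).hasMFDerivAt.comp t (hϑ.integral p t)
    refine h1.congr_mfderiv ?_
    have h2 := hP.field_base hodd hX (ϑ t p)
    have h3 : ∀ c : ℝ, tderiv EN EM f (ϑ t p) (c • modelVec R (ϑ t p)) =
        c • modelVec X (f (ϑ t p)) := fun c => by rw [map_smul, h2]
    exact ContinuousLinearMap.ext fun c => h3 c
  have h1 := isMIntegralCurve_unique hXs (hφ.integral (f p)) hcurve (t₀ := 0)
    (by rw [hφ.map_zero, hϑ.map_zero])
  exact ⟨ϑ t p, (congrFun h1 t).symm⟩

/-- The characteristic foliation of the perturbed hypersurface is normally hyperbolic along `N`. -/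
theorem isNormallyHyperbolicForCharFoliation [T2Space N] [SecondCountableTopology M]
    (hP : SaddlePerturbation EM Ω e f σ δ Ψ V θ R h A) (hodd : Odd (Module.finrank ℝ EM))
    (hG : ContMDiff 𝓘(ℝ, EN) 𝓘(ℝ, H) ∞ G) (hGi : ∀ p, Function.Injective (tderiv EN H G p))
    {ρ : ℝ} (hρ : 0 < ρ) (hρA : ρ < A)
    (hGρ : ∀ p v, ‖tderiv EN H (fun p => tderiv EN H G p (modelVec R p)) p v‖ ≤
      ρ * ‖tderiv EN H G p v‖) :
    IsNormallyHyperbolicForCharFoliation (E' := EN)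
      (DiffForm.pullback 𝓘(ℝ, EM) 𝓘(ℝ, EW) (perturb Ψ θ e h) Ω) f := by
  have hfc : IsCompact (range f) := isCompact_range hP.base_smooth.continuous
  obtain ⟨O, hO, hfO, hreg⟩ := hP.regular_set hodd
  -- The cut-off gives a compactly supported field, hence a complete one, with values in the kernel
  -- everywhere. It equals the characteristic field on a neighbourhood of `f(N)`, so the
  -- linearisation along `f(N)` is not affected.
  obtain ⟨χ, L, hχ, hL, hLO, hχ0, hχ1⟩ := exists_smooth_cutoff (E := EM) hfc hO hfO
  let X₀ : ∀ x : M, TangentSpace 𝓘(ℝ, EM) x :=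
    fun x => charField EN EM Ω V (fun p => e (f p)) Ψ (perturb Ψ θ e h) x
  let X : ∀ x : M, TangentSpace 𝓘(ℝ, EM) x := fun x => χ x • X₀ x
  have hXs : ContMDiff 𝓘(ℝ, EM) 𝓘(ℝ, EM).tangent ∞
      (fun x => (⟨x, X x⟩ : TangentBundle 𝓘(ℝ, EM) M)) :=
    contMDiff_smul_of_cutoff (X := X₀) hχ hL hLO hχ0 fun x hx => (hreg x hx).2
  have hXm : ∀ x, modelVec X x =
      χ x • charField EN EM Ω V (fun p => e (f p)) Ψ (perturb Ψ θ e h) x := fun x => rfl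
  have hX1 : ∀ᶠ x in 𝓝ˢ (range f), modelVec X x =
      charField EN EM Ω V (fun p => e (f p)) Ψ (perturb Ψ θ e h) x := by
    filter_upwards [hχ1] with x hx
    rw [hXm, hx, one_smul]
  have hker : ∀ x, charForm EM Ω (perturb Ψ θ e h) x (modelVec X x) = 0 := by
    intro x
    rw [hXm]
    by_cases hx : x ∈ L
    · rw [map_smul, (hP.charField_spec hodd (hreg x (hLO hx)).1).1, smul_zero]
    · rw [hχ0 x hx, zero_smul, map_zero]
  obtain ⟨φ, hφ⟩ := exists_isGlobalFlow_of_isCompact hXs hL (fun x hx => by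
    change χ x • X₀ x = 0
    rw [hχ0 x hx]
    exact zero_smul ℝ (X₀ x))
  have hbase : ∀ p, tubeChart EN Ψ p (chartAt EN p p, 0) = f p := hP.tube.tubeChart_base
  refine ⟨X, hXs, fun x => DiffForm.mem_ker_iff (E := EM).2 (hker x), ?_, ?_⟩
  · obtain ⟨T, hTo, hfT, hT1⟩ := mem_nhdsSet_iff_exists.1 hX1
    refine ⟨T ∩ O, hTo.inter hO, subset_inter hfT hfO, ?_⟩
    rintro x ⟨hxT, hxO⟩
    have hspec := hP.charField_spec hodd (hreg x hxO).1
    have hxe : modelVec X x =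
      charField EN EM Ω V (fun p => e (f p)) Ψ (perturb Ψ θ e h) x := hT1 hxT
    rw [← hxe] at hspec
    refine ⟨?_, le_antisymm ?_ ?_⟩
    · intro h0
      have h1 : modelVec X x = 0 := h0
      have h2 := hspec.2
      rw [h1, map_zero] at h2
      exact zero_ne_one h2
    · rw [Submodule.span_singleton_le_iff_mem]
      exact DiffForm.mem_ker_iff (E := EM).2 (hker x)
    · intro v hv
      have h1 : charForm EM Ω (perturb Ψ θ e h) x v = 0 := DiffForm.mem_ker_iff (E := EM).1 hv
      -- The coefficient is the value of the normalising one-form on `v`.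
      exact Submodule.mem_span_singleton.2 ⟨_,
        (kernel_eq_span _ _ (hreg x hxO).1 hspec.1 hspec.2 h1).symm⟩
  · refine isNormallyHyperbolic_of_linear (F := EN) hφ hXs hP.base_smooth.continuous
      (hP.mapsTo_range hodd hXs hX1 hφ) Ψ.open_target ?_
      (g := fun x => G (Ψ.symm x).1) (z := fun x => (Ψ.symm x).2)
      (hG.comp_contMDiffOn hP.tube.contMDiffOn_symm_fst) hP.tube.contMDiffOn_symm_snd ?_ ?_ ?_
      hρ hρA ?_ ?_ ?_
    · rintro _ ⟨p, rfl⟩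
      exact hP.tube.mem_target p
    · rintro _ ⟨p, rfl⟩ v h1 h2
      have hw := hP.tube.base_mem_source p
      have hu : chartAt EN p p ∈ (chartAt EN p).target := mem_chart_target EN p
      rw [← hbase p] at h1 h2
      obtain ⟨⟨a, ζ⟩, rfl⟩ := (hP.tube.bijective_tderiv_tubeChart hw).2 v
      rw [hP.tube.tderiv_comp_symm_fst hG hw] at h1
      rw [hP.tube.tderiv_symm_snd hw] at h2
      have h3 : a = 0 := (injective_iff_map_eq_zero _).1 (bijective_tderiv_chart_symm hu).1 a
        ((injective_iff_map_eq_zero _).1 (hGi _) _ h1)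
      have h4 : ζ = 0 := h2
      rw [h3, h4]
      exact map_zero _
    · intro p v
      have hw := hP.tube.base_mem_source p
      have hu : chartAt EN p p ∈ (chartAt EN p).target := mem_chart_target EN p
      have hl : (chartAt EN p).symm (chartAt EN p p) = p :=
        (chartAt EN p).left_inv (mem_chart_source EN p)
      obtain ⟨⟨a, ζ⟩, rfl⟩ := (hP.tube.bijective_tderiv_tubeChart hw).2 v
      have h1 := hP.tube.tderiv_symm_snd hw (a, ζ)
      rw [hbase p] at h1
      rw [h1]
      constructor
      · intro h2
        obtain rfl : ζ = 0 := h2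
        have h4 := hP.tube.tderiv_base hP.base_smooth hu a
        rw [hl] at h4
        exact ⟨_, h4.symm⟩
      · rintro ⟨b, hb⟩
        obtain ⟨a', rfl⟩ := (bijective_tderiv_chart_symm hu).2 b
        have h4 := hP.tube.tderiv_base hP.base_smooth hu a'
        rw [hl, hb] at h4
        exact (congrArg Prod.snd ((hP.tube.bijective_tderiv_tubeChart hw).1 h4)).symm
    · rintro _ ⟨p, rfl⟩
      obtain ⟨O', hO', s, hs, hs'⟩ := hP.tube.exists_normal_frame hG p
      exact ⟨O', hO', s, hs, fun x hx _ => hs' x hx⟩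
    · rintro _ ⟨p, rfl⟩ v i
      exact (hP.tderiv_normal hodd hXs hX1 p v i).1
    · rintro _ ⟨p, rfl⟩ v i
      exact (hP.tderiv_normal hodd hXs hX1 p v i).2
    · rintro _ ⟨p, rfl⟩ v
      exact hP.tderiv_tangential hodd hXs hX1 hG hGρ p v

end SaddlePerturbation

end Hyperbolic


/-! ### The main theorem -/

section Main

variable {EN : Type} [NormedAddCommGroup EN] [NormedSpace ℝ EN] [FiniteDimensional ℝ EN]
  {EM : Type} [NormedAddCommGroup EM] [NormedSpace ℝ EM] [FiniteDimensional ℝ EM]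
  {EW : Type} [NormedAddCommGroup EW] [NormedSpace ℝ EW] [FiniteDimensional ℝ EW]
  {N : Type*} [TopologicalSpace N] [ChartedSpace EN N] [IsManifold 𝓘(ℝ, EN) ∞ N]
  {M : Type*} [TopologicalSpace M] [ChartedSpace EM M] [IsManifold 𝓘(ℝ, EM) ∞ M]
  {W : Type*} [TopologicalSpace W] [ChartedSpace EW W] [IsManifold 𝓘(ℝ, EW) ∞ W]
  {k : ℕ}
  {Ω : DiffForm 𝓘(ℝ, EW) W 2} {e : M → W} {f : N → M} {σ : DiffForm 𝓘(ℝ, EN) N 2} {δ : ℝ}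
  {Ψ : OpenPartialHomeomorph (N × PhaseSpace k) M}

theorem DiffForm.ext_bilin {σ τ : DiffForm 𝓘(ℝ, EN) N 2}
    (h : ∀ p (v w : EN), σ.bilin p v w = τ.bilin p v w) : σ = τ := by
  funext p
  refine ContinuousAlternatingMap.ext fun u => ?_
  have hu : u = ![u 0, u 1] := by
    ext i
    fin_cases i <;> rfl
  rw [hu]
  exact h p (u 0) (u 1)

/-- The submanifold inherits its Hamiltonian structure from the symplectic manifold. -/
theorem SplitTube.pullback_base (hT : SplitTube EM Ω e f σ δ Ψ)
    (hf : ContMDiff 𝓘(ℝ, EN) 𝓘(ℝ, EM) ∞ f) :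
    DiffForm.pullback 𝓘(ℝ, EN) 𝓘(ℝ, EW) (fun p => e (f p)) Ω = σ := by
  refine DiffForm.ext_bilin fun p v w => ?_
  have hu : chartAt EN p p ∈ (chartAt EN p).target := mem_chart_target EN p
  have hl : (chartAt EN p).symm (chartAt EN p p) = p :=
    (chartAt EN p).left_inv (mem_chart_source EN p)
  obtain ⟨a, rfl⟩ := (bijective_tderiv_chart_symm hu).2 v
  obtain ⟨a', rfl⟩ := (bijective_tderiv_chart_symm hu).2 w
  have h1 := hT.split_tubeChart (hT.base_mem_source p) a a' 0 0
  rw [hT.tderiv_comp_tubeChart_zero hf hu, hT.tderiv_comp_tubeChart_zero hf hu,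
    hT.tubeChart_base, hl, map_zero, add_zero] at h1
  rw [← h1]
  exact altBilin_comp (E := EW) (F := EN) _ _ _ _

/-- The order of the choices matters. The transverse flow and the kernel field `R` come first and
determine the tangential growth rate `ρ`, which no later choice affects. The tube radius and the two
smallness conditions come next, and `h`, with prescribed Hessian, comes last. -/
theorem SplitTube.exists_perturbation [CompactSpace N] [T2Space N] [T2Space M]
    [SecondCountableTopology M] [T2Space W] [SecondCountableTopology W]
    (hT : SplitTube EM Ω e f σ δ Ψ) (hf : ContMDiff 𝓘(ℝ, EN) 𝓘(ℝ, EM) ∞ f) (hfe : IsEmbedding f)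
    (hfi : ∀ p, Function.Injective (tderiv EN EM f p)) (hσ : σ.HasFraming)
    (hodd : Odd (Module.finrank ℝ EM)) (hdim : Module.finrank ℝ EM + 1 = Module.finrank ℝ EW)
    (D : C1NhdData (E := EM) (E' := EW) e) :
    ∃ e₁ : M → W, IsSmoothEmbedding 𝓘(ℝ, EM) 𝓘(ℝ, EW) ∞ e₁ ∧ D.Mem e₁ ∧
      DiffForm.pullback 𝓘(ℝ, EN) 𝓘(ℝ, EW) (e₁ ∘ f) Ω = σ ∧
      IsNormallyHyperbolicForCharFoliation (E' := EN)
        (DiffForm.pullback 𝓘(ℝ, EM) 𝓘(ℝ, EW) e₁ Ω) f := by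
  obtain ⟨V, θ, R, ht, hframe⟩ := hT.exists_transverseFlow hf hfe hfi hσ
  -- An immersion into a Euclidean space provides a global way to measure tangent vectors of `N`:
  -- the growth of the flow of `R` is read off from the derivative of `dG(R)`, compared with `dG`.
  obtain ⟨n, G, hG, -, hGi⟩ := exists_embedding_euclidean_of_compact (I := 𝓘(ℝ, EN)) (M := N)
  have hGR : ContMDiff 𝓘(ℝ, EN) 𝓘(ℝ, EuclideanSpace ℝ (Fin n)) ∞
      (fun p => tderiv EN (EuclideanSpace ℝ (Fin n)) G p (modelVec R p)) := by
    rw [← contMDiffOn_univ]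
    exact hG.contMDiffOn.mfderiv_apply_field isOpen_univ ht.smooth.contMDiffOn
  obtain ⟨ρ, hρ, hGρ⟩ := exists_norm_tderiv_le hGR hG hGi
  obtain ⟨s, hs, hsδ, ε, hε, hemb⟩ := hT.exists_forall_isEmbedding_perturb hf ht hdim
  obtain ⟨r, hr, hmem⟩ := hT.exists_forall_mem_perturb ht.flow D hsδ
  -- Any expansion rate larger than `ρ` would do. The smallness is the stronger of the one needed
  -- for an embedding and the one imposed by the neighbourhood `D`.
  obtain ⟨h, hh, hsupp, hlt, hlt', h0, hsad⟩ :=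
    exists_small_saddle k (ρ + 1) hs (lt_min hε hr)
  have hP : SaddlePerturbation EM Ω e f σ δ Ψ V θ R h (ρ + 1) :=
    ⟨hT, hf, ht, hframe, hh, ⟨s, hsδ, hsupp⟩, h0, hsad⟩
  refine ⟨perturb Ψ θ e h, hemb h hh hsupp fun z => (hlt z).trans_le (min_le_left _ _),
    hmem h hh hsupp (fun z => (hlt z).trans_le (min_le_right _ _))
      fun z => (hlt' z).trans_le (min_le_right _ _), ?_,
    hP.isNormallyHyperbolicForCharFoliation hodd hG hGi hρ (lt_add_one ρ) hGρ⟩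
  rw [show perturb Ψ θ e h ∘ f = fun p => e (f p) from
    funext (hT.perturb_base ht.flow.map_zero h0)]
  exact hT.pullback_base hf

end Main

theorem proposition3p7 (m k : ℕ)
    -- the symplectic manifold `W`, the hypersurface `M`, the compact submanifold `N`
    {W : Type*} [TopologicalSpace W] [T2Space W] [SecondCountableTopology W]
    [ChartedSpace (EuclideanSpace ℝ (Fin (2 * (m + k + 1)))) W]
    [IsManifold (𝓡 (2 * (m + k + 1))) ∞ W]
    {M : Type*} [TopologicalSpace M] [T2Space M] [SecondCountableTopology M]
    [ChartedSpace (EuclideanSpace ℝ (Fin (2 * (m + k) + 1))) M]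
    [IsManifold (𝓡 (2 * (m + k) + 1)) ∞ M]
    {N : Type*} [TopologicalSpace N] [T2Space N] [CompactSpace N]
    [ChartedSpace (EuclideanSpace ℝ (Fin (2 * m + 1))) N]
    [IsManifold (𝓡 (2 * m + 1)) ∞ N]
    (Ω : DiffForm (𝓡 (2 * (m + k + 1))) W 2) (hΩ : Ω.IsSymplectic)
    (e : M → W)
    (he : IsSmoothEmbedding (𝓡 (2 * (m + k) + 1)) (𝓡 (2 * (m + k + 1))) ∞ e)
    (f : N → M) (hf : IsSmoothEmbedding (𝓡 (2 * m + 1)) (𝓡 (2 * (m + k) + 1)) ∞ f)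
    (σ : DiffForm (𝓡 (2 * m + 1)) N 2) (hσ : σ.IsHamiltonian) (hσ_framing : σ.HasFraming)
    -- the trivial tubular neighbourhood: a diffeomorphism `Ψ` of `N × D^{2k}` onto an open set
    (δ : ℝ) (hδ : 0 < δ)
    (Ψ : OpenPartialHomeomorph (N × EuclideanSpace ℝ (Fin k ⊕ Fin k)) M)
    (hΨ_source : Ψ.source = univ ×ˢ Metric.ball 0 δ)
    (hΨ_smooth : ContMDiffOn ((𝓡 (2 * m + 1)).prod 𝓘(ℝ, EuclideanSpace ℝ (Fin k ⊕ Fin k)))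
      (𝓡 (2 * (m + k) + 1)) ∞ Ψ Ψ.source)
    (hΨ_symm_smooth : ContMDiffOn (𝓡 (2 * (m + k) + 1))
      ((𝓡 (2 * m + 1)).prod 𝓘(ℝ, EuclideanSpace ℝ (Fin k ⊕ Fin k))) ∞ Ψ.symm Ψ.target)
    (hΨ_zero : ∀ p : N, Ψ (p, 0) = f p)
    -- `Ψ^* e^* Ω = σ + ∑ dx_i ∧ dy_i`
    (hsplit : ∀ q ∈ Ψ.source,
      DiffForm.pullback ((𝓡 (2 * m + 1)).prod 𝓘(ℝ, EuclideanSpace ℝ (Fin k ⊕ Fin k)))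
          (𝓡 (2 * (m + k) + 1)) Ψ
          (DiffForm.pullback (𝓡 (2 * (m + k) + 1)) (𝓡 (2 * (m + k + 1))) e Ω) q =
        DiffForm.pullback ((𝓡 (2 * m + 1)).prod 𝓘(ℝ, EuclideanSpace ℝ (Fin k ⊕ Fin k)))
          (𝓡 (2 * m + 1)) Prod.fst σ q +
        DiffForm.pullback ((𝓡 (2 * m + 1)).prod 𝓘(ℝ, EuclideanSpace ℝ (Fin k ⊕ Fin k)))
          𝓘(ℝ, EuclideanSpace ℝ (Fin k ⊕ Fin k)) Prod.snd (stdForm k) q)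
    -- an arbitrary basic neighbourhood of `e` in the strong `C^1` topology
    (D : C1NhdData (E := EuclideanSpace ℝ (Fin (2 * (m + k) + 1)))
      (E' := EuclideanSpace ℝ (Fin (2 * (m + k + 1)))) e) :
    ∃ e₁ : M → W,
      IsSmoothEmbedding (𝓡 (2 * (m + k) + 1)) (𝓡 (2 * (m + k + 1))) ∞ e₁ ∧
      D.Mem e₁ ∧
      DiffForm.pullback (𝓡 (2 * m + 1)) (𝓡 (2 * (m + k + 1))) (e₁ ∘ f) Ω = σ ∧
      IsNormallyHyperbolicForCharFoliation
        (E' := EuclideanSpace ℝ (Fin (2 * m + 1)))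
        (DiffForm.pullback (𝓡 (2 * (m + k) + 1)) (𝓡 (2 * (m + k + 1))) e₁ Ω) f := by
  have hT : SplitTube (EuclideanSpace ℝ (Fin (2 * (m + k) + 1))) Ω e f σ δ Ψ :=
    ⟨hΩ, he.isEmbedding, he.contMDiff, fun x => IsImmersion.injective_mfderiv he.isImmersion x,
      hσ, hδ, hΨ_source, hΨ_smooth, hΨ_symm_smooth, hΨ_zero, hsplit⟩
  refine hT.exists_perturbation hf.contMDiff hf.isEmbedding
    (fun p => IsImmersion.injective_mfderiv hf.isImmersion p) hσ_framing ?_ ?_ D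
  · rw [finrank_euclideanSpace_fin]
    exact odd_two_mul_add_one _
  · rw [finrank_euclideanSpace_fin, finrank_euclideanSpace_fin]
    ring
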